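/- **Setting.** Let $N,M\ge 1$. Agents $k=1,\dots,N$ have twice-differentiable costs $J_k:\mathbb R^M\to\mathbb R$ such that the Hessian of $J^{\rm glob}=\sum_k J_k$ lies between $\nu_d I_M$ and $\delta_d I_M$ for some $0<\nu_d\le\delta_d$, and each $J_k$ is strongly convex ($\nabla^2J_k\ge\nu_k I_M$ with $\nu_k>0$) with global minimizer at the common point $w^o$. Put $H_k=\nabla_w^2J_k(w^o)$. The agents run the asynchronous diffusion strategy, for $i\ge 0$, $$\boldsymbol\psi_{k,i}=\boldsymbol w_{k,i-1}-\boldsymbol\mu_k(i)\,\widehat{\nabla J}_{k,i}(\boldsymbol w_{k,i-1}),\qquad \boldsymbol w_{k,i}=\sum_{\ell}\boldsymbol a_{\ell k}(i)\,\boldsymbol\psi_{\ell,i},$$ with random approximate gradients. Put $\widetilde{\boldsymbol w}_{k,i}=w^o-\boldsymbol w_{k,i}$, let $\widetilde{\boldsymbol w}_i$ be the stacked vector of the $\widetilde{\boldsymbol w}_{k,i}$, let $\boldsymbol s_{k,i}(w)=\widehat{\nabla J}_{k,i}(w)-\nabla J_k(w)$, and let $\mathcal F_{i-1}$ be generated by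 all iterates $\boldsymbol w_{\ell,j}$, $j\le i-1$. **Assumptions.** (a) *Asynchronous model.* The step-sizes $\boldsymbol\mu_k(i)$ are nonnegative and bounded, with time-invariant means $\bar\mu_k>0$ and covariances $c_{\mu,k\ell}$; put $\sigma^2_{\mu,k}=c_{\mu,kk}$. The matrices $\boldsymbol A_i=[\boldsymbol a_{\ell k}(i)]$ have nonnegative entries and columns summing to one, with time-invariant mean $\bar A$ and $C_A=\mathbb E[(\boldsymbol A_i-\bar A)\otimes(\boldsymbol A_i-\bar A)]$. At every time $i$, the step-sizes $(\boldsymbol\mu_k(i))_k$, the matrix $\boldsymbol A_i$, and the collection of all iterates up to time $i-1$, all approximate gradients evaluated at them up to time $i$, and all earlier step-sizes and combination matrices, are mutually independent. The matrix $\bar A\otimes\bar A+C_A=\mathbb E(\boldsymbol A_i\otimes\boldsymbol A_i)$ is primitive; $\bar p$ and $p_c$ are the Perron vectors (entries summing to one) of $\bar A$ and of $\bar A\otimes\bar A+C_A$, and $p_{c,kk}$ denotes the entry of $p_c$ at the index pair $(k,k)$. (b) *Gradient noise.* Almost surely, $\mathbb E[\boldsymbol s_{k,i}(\boldsymbol w_{k,i-1})|\mathcal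 F_{i-1}]=0$, $\mathbb E[\boldsymbol s_{k,i}(\boldsymbol w_{k,i-1})\boldsymbol s_{\ell,i}(\boldsymbol w_{\ell,i-1})^{\sf T}|\mathcal F_{i-1}]=0$ for $k\ne\ell$, $\mathbb E[\|\boldsymbol s_{k,i}(\boldsymbol w_{k,i-1})\|^2|\mathcal F_{i-1}]\le\beta_k^2\|\widetilde{\boldsymbol w}_{k,i-1}\|^2+\sigma_{s,k}^2$, and $\mathbb E[\boldsymbol s_{k,i}(w^o)\boldsymbol s_{k,i}(w^o)^{\sf T}|\mathcal F_{i-1}]\to R_{s,k}$, a constant matrix. (c) *Smoothness.* For $\|\delta w\|\le r$ (with $r>0$ and $1\le\kappa\le2$): $\|\nabla^2J_k(w^o+\delta w)-\nabla^2J_k(w^o)\|\le\tau_{k,d}\|\delta w\|$ and, for $R_{s,k,i}(w)=\mathbb E[\boldsymbol s_{k,i}(w)\boldsymbol s_{k,i}(w)^{\sf T}|\mathcal F_{i-1}]$ and every $\mathcal F_{i-1}$-measurable $\delta w$, $\|R_{s,k,i}(w^o+\delta w)-R_{s,k,i}(w^o)\|\le\tau_{k,s}\|\delta w\|^\kappa$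 almost surely. (d) *Fourth-order moments.* With $\mu_{x,\max}=\max_k(\bar\mu_k+\sigma_{\mu,k}^2/\bar\mu_k)$: the initial iterates and the noises $\boldsymbol s_{k,i}(\boldsymbol w_{k,i-1})$ have finite fourth moments, $\mathbb E[\|\boldsymbol s_{k,i}(\boldsymbol w_{k,i-1})\|^4|\mathcal F_{i-1}]\le\beta_{4,k}\|\widetilde{\boldsymbol w}_{k,i-1}\|^4+\sigma_{4,k}$ almost surely, and $\mathbb E\,\boldsymbol\mu_k(i)^4\le c\,\bar\mu_k\,\mu_{x,\max}^2$ (which holds, for instance, when $\boldsymbol\mu_k(i)\le c'\mu_{x,\max}$ with a fixed $c'$, and $\mu_{x,\max}\le1$). **Claim.** There are $\mu_o>0$ and $K$, depending only on $N$, $M$, the costs, $\bar A$, $C_A$ and the constants in (b)–(d), such that the following holds whenever $\mu_{x,\max}<\mu_o$. Put $$\mathcal E=\tfrac12\operatorname{Tr}\Big[\Big(\sum_{k}\bar\mu_k\bar p_kH_k\Big)^{-1}\Big(\sum_{k}(\bar\mu_k^2+\sigma_{\mu,k}^2)\,p_{c,kk}\,R_{s,k}\Big)\Big].$$ 1. All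 mean-square errors $\mathbb E\|\widetilde{\boldsymbol w}_{k,i}\|^2$ are finite; for all large $i$ they satisfy $|\mathbb E\|\widetilde{\boldsymbol w}_{k,i}\|^2-\mathcal E|\le K\mu_{x,\max}^{3/2}$; and with $\mathrm{MSD}_k=\limsup_i\mathbb E\|\widetilde{\boldsymbol w}_{k,i}\|^2$ and $\mathrm{MSD}_{\rm av}=\frac1N\sum_k\mathrm{MSD}_k$, each of $|\mathrm{MSD}_k-\mathcal E|$, $|\mathrm{MSD}_{\rm av}-\mathcal E|$ and $|\mathrm{MSD}_k-\mathrm{MSD}_{\rm av}|$ is at most $K\mu_{x,\max}^{3/2}$. 2. Let $\boldsymbol B_i=(\boldsymbol A_i^{\sf T}\otimes I_M)\,(I_{NM}-\mathrm{diag}\{\boldsymbol\mu_k(i)H_k\})$. The matrix $F=\mathbb E[\boldsymbol B_i\otimes\boldsymbol B_i]$ does not depend on $i$, and its spectral radius $\alpha$ satisfies $0\le\alpha<1$. The second moments $z_i=\mathbb E[\widetilde{\boldsymbol w}_i\otimes\widetilde{\boldsymbol w}_i]$ approach a steady-state value at the rate $\alpha$ in the following sense: there is a vector $z_\infty$, for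 which the trace of the $k$-th $M\times M$ diagonal block of the corresponding $NM\times NM$ matrix is within $K\mu_{x,\max}^{3/2}$ of $\mathcal E$ for every $k$, such that for all large $i$ every entry of $z_{i}-z_\infty-F(z_{i-1}-z_\infty)$ is at most $K\mu_{x,\max}^{5/2}$ in absolute value. Moreover $$\Big|\alpha-\Big(1-2\lambda_{\min}\Big(\sum_k\bar\mu_k\bar p_kH_k\Big)\Big)\Big|\le K\,\mu_{x,\max}^{1+1/N^2}.$$ -/

import Mathlib

open MeasureTheory ProbabilityTheory Filter Topology
open scoped Kronecker Matrix

namespace AsyncDiffusion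

noncomputable section

/-- The parameter space `ℝ^M` with its Euclidean norm. -/
abbrev Vec (M : ℕ) : Type := EuclideanSpace ℝ (Fin M)

/-! ### Costs -/

/-- The Hessian `∇² f (w)`, as the derivative of the gradient. -/
def hess {M : ℕ} (f : Vec M → ℝ) (w : Vec M) : Vec M →L[ℝ] Vec M :=
  fderiv ℝ (gradient f) w

/-- The Hessian as an `M × M` matrix. -/
def hessMatrix {M : ℕ} (f : Vec M → ℝ) (w : Vec M) : Matrix (Fin M) (Fin M) ℝ :=
  Matrix.of fun a b => hess f w (EuclideanSpace.single b 1) a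

/-- `f` is twice differentiable. -/
def TwiceDifferentiable {M : ℕ} (f : Vec M → ℝ) : Prop :=
  Differentiable ℝ f ∧ Differentiable ℝ (gradient f)

/-- The aggregate cost `J^glob = ∑ₖ Jₖ`. -/
def aggregateCost {N M : ℕ} (J : Fin N → Vec M → ℝ) : Vec M → ℝ := fun w => ∑ k, J k w

/-- Conditions on the costs: all costs are twice differentiable, the Hessian of the aggregate cost
is between `ν I > 0` and `δ I`, every individual cost is strongly convex, and all of them have their
global minimizer at `wo`. -/
structure CostConditions {N M : ℕ} (J : Fin N → Vec M → ℝ) (wo : Vec M) : Prop where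
  twiceDiff : ∀ k, TwiceDifferentiable (J k)
  aggregate : ∃ ν δ : ℝ, 0 < ν ∧ ν ≤ δ ∧ ∀ w v : Vec M,
    ν * ‖v‖ ^ 2 ≤ inner ℝ v (hess (aggregateCost J) w v) ∧
    inner ℝ v (hess (aggregateCost J) w v) ≤ δ * ‖v‖ ^ 2
  stronglyConvex : ∀ k, ∃ ν : ℝ, 0 < ν ∧ ∀ w v : Vec M,
    ν * ‖v‖ ^ 2 ≤ inner ℝ v (hess (J k) w v)
  minimizer : ∀ k w, J k wo ≤ J k w

/-- The Hessians of the individual costs are Lipschitz at `wo`, on the ball of radius `r`. -/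
def HessianSmoothness {N M : ℕ} (J : Fin N → Vec M → ℝ) (wo : Vec M)
    (r : ℝ) (τ : Fin N → ℝ) : Prop :=
  ∀ k (δw : Vec M), ‖δw‖ ≤ r → ‖hess (J k) (wo + δw) - hess (J k) wo‖ ≤ τ k * ‖δw‖

/-! ### The algorithm -/

/-- The random quantities of a network of `N` agents. The iterate `w_{k,i-1}`, which is available
before the update at time `i ≥ 0`, is `w i k`, so that `w 0 k` is the initial condition `w_{k,-1}`.
`step i k` is the random step-size `μ_k(i)`, `comb i` is the random combination matrix
`A_i = [a_{ℓk}(i)]`, and `gradHat i k x` is the approximate gradient vector that agent `k` has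
available at time `i` at the point `x`. -/
structure Network (N M : ℕ) (Ω : Type*) where
  w : ℕ → Fin N → Ω → Vec M
  step : ℕ → Fin N → Ω → ℝ
  comb : ℕ → Ω → Matrix (Fin N) (Fin N) ℝ
  gradHat : ℕ → Fin N → Vec M → Ω → Vec M

namespace Network

variable {N M : ℕ} {Ω : Type*}

/-- The asynchronous adapt-then-combine diffusion strategy
`ψ_{k,i} = w_{k,i-1} - μ_k(i) ∇̂J_k(w_{k,i-1})`, `w_{k,i} = ∑_ℓ a_{ℓk}(i) ψ_{ℓ,i}`
(coefficients outside of the current neighborhood are zero), driven by random variables. -/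
structure IsATCDiffusion [MeasurableSpace Ω] (X : Network N M Ω) : Prop where
  recursion : ∀ i k ω, X.w (i + 1) k ω =
    ∑ l, X.comb i ω l k • (X.w i l ω - X.step i l ω • X.gradHat i l (X.w i l ω) ω)
  measurable_init : ∀ k, Measurable (X.w 0 k)
  measurable_step : ∀ i k, Measurable (X.step i k)
  measurable_comb : ∀ i l k, Measurable fun ω => X.comb i ω l k
  measurable_gradHat : ∀ i k, Measurable fun q : Vec M × Ω => X.gradHat i k q.1 q.2

/-- The σ-algebra `F_{i-1}` generated by the iterates of all agents up to time `i - 1`. -/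
abbrev past (X : Network N M Ω) (i : ℕ) : MeasurableSpace Ω :=
  ⨆ j ≤ i, ⨆ k, MeasurableSpace.comap (X.w j k) inferInstance

/-- The σ-algebra generated by the step-sizes of all agents at time `i`. -/
abbrev stepAlg (X : Network N M Ω) (i : ℕ) : MeasurableSpace Ω :=
  ⨆ k, MeasurableSpace.comap (X.step i k) inferInstance

/-- The σ-algebra generated by all combination coefficients at time `i`. -/
abbrev combAlg (X : Network N M Ω) (i : ℕ) : MeasurableSpace Ω :=
  ⨆ l, ⨆ k, MeasurableSpace.comap (fun ω => X.comb i ω l k) inferInstance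

/-- The σ-algebra of all other random variables that have entered the algorithm when `μ(i)` and
`A_i` are used: the iterates up to time `i - 1`, the approximate gradients evaluated up to time `i`,
and the step-sizes and combination coefficients before time `i`. -/
abbrev history (X : Network N M Ω) (i : ℕ) : MeasurableSpace Ω :=
  X.past i ⊔
  (⨆ j ≤ i, ⨆ k, MeasurableSpace.comap (fun ω => X.gradHat j k (X.w j k ω) ω) inferInstance) ⊔
  (⨆ j < i, X.stepAlg j ⊔ X.combAlg j)

/-- The asynchronous network model. Step-sizes are nonnegative and bounded, with means `mbar k > 0`
and covariances `cmu k l` that do not depend on time; combination matrices are left-stochastic with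
nonnegative entries, with mean `Abar` and Kronecker-covariance `CA` that do not depend on time.
At every time the step-sizes and the combination coefficients are independent of each other and of
everything that entered the algorithm before (so they are also independent over time). Dependence
across agents at the same time is allowed. -/
structure IsAsyncModel [MeasurableSpace Ω] (X : Network N M Ω) (P : Measure Ω)
    (Abar : Matrix (Fin N) (Fin N) ℝ) (CA : Matrix (Fin N × Fin N) (Fin N × Fin N) ℝ)
    (mbar : Fin N → ℝ) (cmu : Fin N → Fin N → ℝ) : Prop where
  step_bounded : ∃ mub : ℝ, ∀ i k, ∀ᵐ ω ∂P, X.step i k ω ∈ Set.Icc 0 mub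
  mbar_pos : ∀ k, 0 < mbar k
  step_mean : ∀ i k, ∫ ω, X.step i k ω ∂P = mbar k
  step_cov : ∀ i k l, ∫ ω, (X.step i k ω - mbar k) * (X.step i l ω - mbar l) ∂P = cmu k l
  comb_nonneg : ∀ i l k, ∀ᵐ ω ∂P, 0 ≤ X.comb i ω l k
  comb_sum : ∀ i k, ∀ᵐ ω ∂P, ∑ l, X.comb i ω l k = 1
  comb_mean : ∀ i l k, ∫ ω, X.comb i ω l k ∂P = Abar l k
  comb_cov : ∀ i p q,
    ∫ ω, ((X.comb i ω - Abar) ⊗ₖ (X.comb i ω - Abar)) p q ∂P = CA p q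
  indep : ∀ i, iIndep ![X.stepAlg i, X.combAlg i, X.history i] P

/-- The error vector `w̃_{k,i-1} = w^o - w_{k,i-1}`. -/
def err (X : Network N M Ω) (wo : Vec M) (i : ℕ) (k : Fin N) (ω : Ω) : Vec M := wo - X.w i k ω

/-- The gradient noise `s_{k,i}(x) = ∇̂J_k(x) - ∇J_k(x)`. -/
def noise (X : Network N M Ω) (J : Fin N → Vec M → ℝ) (i : ℕ) (k : Fin N) (x : Vec M) (ω : Ω) :
    Vec M :=
  X.gradHat i k x ω - gradient (J k) x

/-- The `(a, b)` entry of the conditional noise covariance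
`R_{s,k,i}(x) = E[s_{k,i}(x) s_{k,i}(x)ᵀ | F_{i-1}]`, at an argument `x` that may itself be random
(such as `w_{k,i-1}`). -/
def condCov [MeasurableSpace Ω] (X : Network N M Ω) (P : Measure Ω) (J : Fin N → Vec M → ℝ)
    (i : ℕ) (k : Fin N) (x : Ω → Vec M) (a b : Fin M) : Ω → ℝ :=
  P[fun ω => X.noise J i k (x ω) ω a * X.noise J i k (x ω) ω b | X.past i]

/-- Conditions on the gradient noise: unbiased, uncorrelated across agents, with conditional
variance at most `β2 k ‖w̃‖² + σ2 k`, and with limiting covariance matrices `Rs k` at `wo`. -/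
structure NoiseConditions [MeasurableSpace Ω] (X : Network N M Ω) (P : Measure Ω)
    (J : Fin N → Vec M → ℝ) (wo : Vec M) (β2 σ2 : Fin N → ℝ)
    (Rs : Fin N → Matrix (Fin M) (Fin M) ℝ) : Prop where
  memLp : ∀ i k, MemLp (fun ω => X.noise J i k (X.w i k ω) ω) 2 P
  unbiased : ∀ i k, P[fun ω => X.noise J i k (X.w i k ω) ω | X.past i] =ᵐ[P] 0
  uncorrelated : ∀ i k l, k ≠ l → ∀ a b,
    P[fun ω => X.noise J i k (X.w i k ω) ω a * X.noise J i l (X.w i l ω) ω b | X.past i] =ᵐ[P] 0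
  variance : ∀ i k, ∀ᵐ ω ∂P,
    (P[fun ω => ‖X.noise J i k (X.w i k ω) ω‖ ^ 2 | X.past i]) ω
      ≤ β2 k * ‖X.err wo i k ω‖ ^ 2 + σ2 k
  memLp_wo : ∀ i k, MemLp (X.noise J i k wo) 2 P
  limit_cov : ∀ k a b, ∀ᵐ ω ∂P,
    Tendsto (fun i => X.condCov P J i k (fun _ => wo) a b ω) atTop (𝓝 (Rs k a b))

/-- The conditional noise covariances satisfy
`‖R_{s,k,i}(wo + δw) - R_{s,k,i}(wo)‖ ≤ τ k ‖δw‖^κ` for `‖δw‖ ≤ r`. As `R_{s,k,i}` is a conditional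
expectation given `F_{i-1}`, the perturbation `δw` is any `F_{i-1}`-measurable one.
The inequality is imposed on the entries (in any matrix norm it is the same up to the constant). -/
def NoiseSmoothness [MeasurableSpace Ω] (X : Network N M Ω) (P : Measure Ω)
    (J : Fin N → Vec M → ℝ) (wo : Vec M) (r κ : ℝ) (τ : Fin N → ℝ) : Prop :=
  ∀ i k (δw : Ω → Vec M), Measurable[X.past i] δw → (∀ ω, ‖δw ω‖ ≤ r) →
    MemLp (fun ω => X.noise J i k (wo + δw ω) ω) 2 P ∧
    ∀ a b, ∀ᵐ ω ∂P,
      |X.condCov P J i k (fun ω => wo + δw ω) a b ω - X.condCov P J i k (fun _ => wo) a b ω|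
        ≤ τ k * ‖δw ω‖ ^ κ

/-- `μ_{x,max} = max_k (μ̄_k + σ²_{μ,k} / μ̄_k)`. -/
def muMax (mbar : Fin N → ℝ) (cmu : Fin N → Fin N → ℝ) : ℝ :=
  ⨆ k, (mbar k + cmu k k / mbar k)

/-- Fourth-order moment conditions on the initial conditions, the gradient noise and the
step-sizes. -/
structure FourthMomentConditions [MeasurableSpace Ω] (X : Network N M Ω) (P : Measure Ω)
    (J : Fin N → Vec M → ℝ) (wo : Vec M) (β4 σ4 : Fin N → ℝ) (c : ℝ)
    (mbar : Fin N → ℝ) (cmu : Fin N → Fin N → ℝ) : Prop where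
  init : ∀ k, MemLp (X.w 0 k) 4 P
  memLp : ∀ i k, MemLp (fun ω => X.noise J i k (X.w i k ω) ω) 4 P
  noise_bound : ∀ i k, ∀ᵐ ω ∂P,
    (P[fun ω => ‖X.noise J i k (X.w i k ω) ω‖ ^ 4 | X.past i]) ω
      ≤ β4 k * ‖X.err wo i k ω‖ ^ 4 + σ4 k
  step_bound : ∀ i k, ∫ ω, X.step i k ω ^ 4 ∂P ≤ c * mbar k * muMax mbar cmu ^ 2

/-! ### Performance -/

/-- The mean-square error `E ‖w̃_{k,i-1}‖²`. -/
def mse [MeasurableSpace Ω] (X : Network N M Ω) (P : Measure Ω) (wo : Vec M) (k : Fin N) (i : ℕ) :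
    ℝ :=
  ∫ ω, ‖X.err wo i k ω‖ ^ 2 ∂P

/-- The mean-square deviation of agent `k` (with `limsup`, as the limit need not exist). -/
def msd [MeasurableSpace Ω] (X : Network N M Ω) (P : Measure Ω) (wo : Vec M) (k : Fin N) : ℝ :=
  limsup (X.mse P wo k) atTop

/-- The network-average mean-square deviation. -/
def msdAv [MeasurableSpace Ω] (X : Network N M Ω) (P : Measure Ω) (wo : Vec M) : ℝ :=
  (1 / (N : ℝ)) * ∑ k, X.msd P wo k

/-- The vectorized second-moment matrix `E[w̃_{i-1} ⊗ w̃_{i-1}]` of the network error vector. -/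
def errMoment [MeasurableSpace Ω] (X : Network N M Ω) (P : Measure Ω) (wo : Vec M) (i : ℕ) :
    (Fin N × Fin M) × (Fin N × Fin M) → ℝ :=
  fun p => ∫ ω, X.err wo i p.1.1 ω p.1.2 * X.err wo i p.2.1 ω p.2.2 ∂P

/-- The coefficient matrix `B_i = (A_i ⊗ I)ᵀ (I - diag{μ_k(i) H_k})` of the long-term model of the
network error vector, in which the Hessians are frozen at their values `H_k` at `wo`. -/
def transition (X : Network N M Ω) (H : Fin N → Matrix (Fin M) (Fin M) ℝ) (i : ℕ) (ω : Ω) :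
    Matrix (Fin N × Fin M) (Fin N × Fin M) ℝ :=
  (X.comb i ω ⊗ₖ (1 : Matrix (Fin M) (Fin M) ℝ))ᵀ *
    (1 - Matrix.of fun p q => if p.1 = q.1 then X.step i p.1 ω * H p.1 p.2 q.2 else 0)

/-- The matrix `F_i = E[B_i ⊗ B_i]`, which propagates second moments in the long-term model. -/
def msTransition [MeasurableSpace Ω] (X : Network N M Ω) (P : Measure Ω)
    (H : Fin N → Matrix (Fin M) (Fin M) ℝ) (i : ℕ) :
    Matrix ((Fin N × Fin M) × (Fin N × Fin M)) ((Fin N × Fin M) × (Fin N × Fin M)) ℝ :=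
  Matrix.of fun p q => ∫ ω, (X.transition H i ω ⊗ₖ X.transition H i ω) p q ∂P

end Network

/-- `p` is the Perron vector of the primitive left-stochastic matrix `A`:
`A p = p`, and the entries of `p` add up to one. -/
def IsPerronVector {n : Type*} [Fintype n] (A : Matrix n n ℝ) (p : n → ℝ) : Prop :=
  A *ᵥ p = p ∧ ∑ k, p k = 1

/-- The smallest eigenvalue of a symmetric matrix. -/
def lambdaMin {M : ℕ} (S : Matrix (Fin M) (Fin M) ℝ) : ℝ := sInf (spectrum ℝ S)

/-- `∑ₖ μ̄_k p̄_k H_k`. -/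
def meanHessian {N M : ℕ} (mbar pbar : Fin N → ℝ) (H : Fin N → Matrix (Fin M) (Fin M) ℝ) :
    Matrix (Fin M) (Fin M) ℝ :=
  ∑ k, (mbar k * pbar k) • H k

/-- `½ Tr[(∑ₖ μ̄_k p̄_k H_k)⁻¹ (∑ₖ (μ̄_k² + σ²_{μ,k}) p_{c,kk} R_{s,k})]`. -/
def msdExpr {N M : ℕ} (mbar : Fin N → ℝ) (cmu : Fin N → Fin N → ℝ) (pbar : Fin N → ℝ)
    (pc : Fin N × Fin N → ℝ) (H Rs : Fin N → Matrix (Fin M) (Fin M) ℝ) : ℝ :=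
  (1 / 2) * ((meanHessian mbar pbar H)⁻¹ *
    ∑ k, ((mbar k ^ 2 + cmu k k) * pc (k, k)) • Rs k).trace

/-- The convergence rate of the mean-square error towards steady state is `α`, in a regime with
step-size parameter `m` and constant `K`: second moments of the long-term model are propagated by
a matrix `F` (the same at all times) with spectral radius `α ∈ [0, 1)`, and there is a steady-state
value `zinf`, whose diagonal blocks have traces within `K m^{3/2}` of `level`, such that for large
`i` the second moments of the actual network error satisfy
`z_{i+1} - zinf = F (z_i - zinf) + O(m^{5/2})`. -/
def HasConvergenceRate {N M : ℕ} {Ω : Type*} [MeasurableSpace Ω] (X : Network N M Ω)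
    (P : Measure Ω) (wo : Vec M) (H : Fin N → Matrix (Fin M) (Fin M) ℝ) (level m K α : ℝ) : Prop :=
  ∃ (F : Matrix ((Fin N × Fin M) × (Fin N × Fin M)) ((Fin N × Fin M) × (Fin N × Fin M)) ℝ)
    (zinf : (Fin N × Fin M) × (Fin N × Fin M) → ℝ),
    (∀ i, X.msTransition P H i = F) ∧
    0 ≤ α ∧ α < 1 ∧
    spectralRadius ℂ (F.map (fun x : ℝ => (x : ℂ))) = ENNReal.ofReal α ∧
    (∀ k, |∑ a, zinf ((k, a), (k, a)) - level| ≤ K * m ^ (3 / 2 : ℝ)) ∧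
    ∀ᶠ i in atTop, ∀ p,
      |X.errMoment P wo (i + 1) p - zinf p - (F *ᵥ (X.errMoment P wo i - zinf)) p|
        ≤ K * m ^ (5 / 2 : ℝ)

end

end AsyncDiffusion

namespace AsyncDiffusion

set_option linter.unusedSectionVars false

/-! ### Column-stochastic matrices with a positive power -/

section Stochastic

variable {ι : Type*} [Fintype ι] [DecidableEq ι]

/-! Write `x k = wo - w k` for the error of agent `k`, `m` for `muMax`, `η` for the sum of the mean
step-sizes, `Q` for `Abar ⊗ₖ Abar + CA`. The errors obey `x' = Aᵀ (x + μ (g x + s))`, where the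
drift `g l x = ∇J_l (wo - x)` vanishes at `0` and equals `-H l x` up to a quadratic error. There are
two time scales. Disagreement between agents is damped at a rate independent of the step-sizes,
while the average with weights `pbar` contracts only at a rate of order `η`. Since some step-sizes
may be far smaller than others, `η` is the natural unit: every perturbation is shown to carry a
factor `η`, which cancels against the contraction rate.

Disagreement: as `Q` is column-stochastic with a positive power, `v - Q v = L` is solvable for the
kernel `L` of the total squared disagreement, and the form of `v` is a Lyapunov function for the
combination step (`CombMoments.exists_lyapunov`).

Fourth moments: a weighted sum of the fourth moment of the average, a mixed moment and a fourth
moment of the disagreement contracts by `1 - ν₀ η` and is driven by `B η m²`, so `E ‖x‖⁴ = O(m²)`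
eventually (`exists_fourth_moment_bound`). Third moments are then `O(m^{3/2})`, so replacing the
costs by quadratic ones changes the recursion of second moments by `O(η m^{3/2})` only
(`abs_second_moment_le`), and the noise covariances end up within `O(√m)` of `Rs`
(`exists_noise_covariance_bound`).

Second moments: they satisfy `z' = F z + drive + O(η m^{3/2})` with `F = momentMatrix`. An
approximate fixed point is `S + T`, where `S`, repeated in every block, solves the Lyapunov equation
`Hh S + S Hh = R` for the mean Hessian `Hh`, whose trace is the claimed level, and `T = O(m²)` is a
correction (`exists_steady_state`). The powers of `F` decay like `ρ₁ⁿ` with `1 - ρ₁` at least a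
multiple of `η` (`exists_geometric_bounds`), so the accumulated error is `O(m^{3/2})`.

Rate: the same bound limits the spectral radius from above. From below, an indefinite quadratic form
equal to one at a consensus vector along the lowest eigenvector is expanded by a factor at least `ρ`
at each step, and Gelfand's formula turns both estimates into `α = 1 - 2 λ_min + O(η m)`. This is
`O(m²)`, hence stronger than the claimed exponent. -/

theorem sum_mulVec_of_colSum {Q : Matrix ι ι ℝ} (hQ : ∀ q, ∑ p, Q p q = 1) (y : ι → ℝ) :
    ∑ p, (Q *ᵥ y) p = ∑ p, y p := by
  simp only [Matrix.mulVec, dotProduct]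
  rw [Finset.sum_comm]
  simp [← Finset.sum_mul, hQ]

theorem colSum_pow {Q : Matrix ι ι ℝ} (hQ : ∀ q, ∑ p, Q p q = 1) (k : ℕ) :
    ∀ q, ∑ p, (Q ^ k) p q = 1 := by
  induction k with
  | zero => intro q; simp [Matrix.one_apply]
  | succ k ih =>
    intro q
    simp only [pow_succ, Matrix.mul_apply]
    rw [Finset.sum_comm]
    simp [← Finset.sum_mul, ih, hQ]

/-- Doeblin's argument: on zero-sum vectors `Q` acts like `Q - ε`, a nonnegative matrix whose column
sums are `1 - ε * card ι`. -/
theorem l1_contraction {Q : Matrix ι ι ℝ} {ε : ℝ} (hε : ∀ p q, ε ≤ Q p q)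
    (hQ : ∀ q, ∑ p, Q p q = 1) {y : ι → ℝ} (hy : ∑ p, y p = 0) :
    ∑ p, |(Q *ᵥ y) p| ≤ (1 - ε * Fintype.card ι) * ∑ p, |y p| := by
  have h1 : ∀ p, |(Q *ᵥ y) p| ≤ ∑ q, (Q p q - ε) * |y q| := by
    intro p
    have : (Q *ᵥ y) p = ∑ q, (Q p q - ε) * y q := by
      simp only [Matrix.mulVec, dotProduct, sub_mul, Finset.sum_sub_distrib, ← Finset.mul_sum, hy]
      simp
    rw [this]
    refine (Finset.abs_sum_le_sum_abs _ _).trans (Finset.sum_le_sum fun q _ => ?_)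
    rw [abs_mul, abs_of_nonneg (sub_nonneg.2 (hε p q))]
  refine (Finset.sum_le_sum fun p _ => h1 p).trans ?_
  rw [Finset.sum_comm]
  simp only [← Finset.sum_mul, Finset.sum_sub_distrib, hQ]
  rw [← Finset.mul_sum]
  simp [mul_comm]

theorem exists_pos_le {Q : Matrix ι ι ℝ} (hQ : ∀ p q, 0 < Q p q) :
    ∃ ε > 0, ∀ p q, ε ≤ Q p q := by
  rcases isEmpty_or_nonempty ι with h | h
  · exact ⟨1, one_pos, fun p => h.elim p⟩
  · obtain ⟨x, hx⟩ := Finite.exists_min (fun x : ι × ι => Q x.1 x.2)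
    exact ⟨_, hQ x.1 x.2, fun p q => hx (p, q)⟩

theorem eq_zero_of_fixed {Q : Matrix ι ι ℝ} (hpos : ∀ p q, 0 < Q p q)
    (hQ : ∀ q, ∑ p, Q p q = 1) {y : ι → ℝ} (hy : ∑ p, y p = 0) (hfix : Q *ᵥ y = y) : y = 0 := by
  obtain ⟨ε, hε, hle⟩ := exists_pos_le hpos
  have h := l1_contraction hle hQ hy
  rw [hfix] at h
  funext q
  have hcard : (0 : ℝ) < Fintype.card ι := by
    have : Nonempty ι := ⟨q⟩
    exact_mod_cast Fintype.card_pos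
  have hs : 0 ≤ ∑ p, |y p| := Finset.sum_nonneg fun _ _ => abs_nonneg _
  have h0 : ∑ p, |y p| = 0 := by
    have : 0 < ε * Fintype.card ι := by positivity
    nlinarith
  have := (Finset.sum_eq_zero_iff_of_nonneg (fun p _ => abs_nonneg (y p))).1 h0 q (Finset.mem_univ _)
  simpa using this

theorem pow_mulVec_fixed {Q : Matrix ι ι ℝ} {y : ι → ℝ} (h : Q *ᵥ y = y) (k : ℕ) :
    (Q ^ k) *ᵥ y = y := by
  induction k with
  | zero => simp
  | succ k ih => rw [pow_succ, ← Matrix.mulVec_mulVec, h, ih]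

theorem eq_zero_of_fixed_of_pow {Q : Matrix ι ι ℝ} {k : ℕ} (hpos : ∀ p q, 0 < (Q ^ k) p q)
    (hQ : ∀ q, ∑ p, Q p q = 1) {y : ι → ℝ} (hy : ∑ p, y p = 0) (hfix : Q *ᵥ y = y) : y = 0 :=
  eq_zero_of_fixed hpos (colSum_pow hQ k) hy (pow_mulVec_fixed hfix k)

theorem tendsto_pow_mulVec_zero {Q : Matrix ι ι ℝ} (hpos : ∀ p q, 0 < Q p q)
    (hQ : ∀ q, ∑ p, Q p q = 1) {y : ι → ℝ} (hy : ∑ p, y p = 0) :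
    Tendsto (fun n : ℕ => (Q ^ n) *ᵥ y) atTop (𝓝 0) := by
  rcases isEmpty_or_nonempty ι with hι | hι
  · have : (fun n : ℕ => (Q ^ n) *ᵥ y) = fun _ => 0 := by funext n; exact Subsingleton.elim _ _
    rw [this]; exact tendsto_const_nhds
  obtain ⟨ε, hε, hle⟩ := exists_pos_le hpos
  have hcard : (0 : ℝ) < Fintype.card ι := by exact_mod_cast Fintype.card_pos
  set ρ := 1 - ε * Fintype.card ι with hρ
  have hρ1 : ρ < 1 := by
    have : 0 < ε * Fintype.card ι := by positivity
    linarith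
  have hρ0 : 0 ≤ ρ := by
    obtain ⟨q⟩ := hι
    have := hQ q
    have h2 : ∑ p : ι, ε ≤ ∑ p, Q p q := Finset.sum_le_sum fun p _ => hle p q
    simp at h2
    rw [hρ]; rw [this] at h2; linarith
  have key : ∀ n : ℕ, ∑ p, |((Q ^ n) *ᵥ y) p| ≤ ρ ^ n * ∑ p, |y p| := by
    intro n
    induction n with
    | zero => simp
    | succ n ih =>
      rw [pow_succ', ← Matrix.mulVec_mulVec]
      refine (l1_contraction hle hQ ?_).trans ?_
      · rw [sum_mulVec_of_colSum (colSum_pow hQ n), hy]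
      · rw [← hρ, pow_succ', mul_assoc]
        exact mul_le_mul_of_nonneg_left ih hρ0
  rw [tendsto_pi_nhds]
  intro p
  refine squeeze_zero_norm (a := fun n : ℕ => ρ ^ n * ∑ p, |y p|) (fun n => ?_) ?_
  · rw [Real.norm_eq_abs]
    exact (Finset.single_le_sum (f := fun p => |((Q ^ n) *ᵥ y) p|)
      (fun p _ => abs_nonneg _) (Finset.mem_univ p)).trans (key n)
  · simpa using (tendsto_pow_atTop_nhds_zero_of_lt_one hρ0 hρ1).mul_const (∑ p, |y p|)

/-- The triangle inequality gives `|y| ≤ Q |y|`, and both sides have the same sum, so `|y|` is fixed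
as well. Then `|y| - c y` is a zero-sum fixed vector, hence zero, which forces `y ≥ 0`. Positivity
of the entries of `Q` makes it strict. -/
theorem perron_pos {Q : Matrix ι ι ℝ} (hpos : ∀ p q, 0 < Q p q)
    (hQ : ∀ q, ∑ p, Q p q = 1) {y : ι → ℝ} (hy : ∑ p, y p = 1) (hfix : Q *ᵥ y = y) (p : ι) :
    0 < y p := by
  have h1 : ∀ p, |y p| ≤ (Q *ᵥ fun q => |y q|) p := by
    intro p
    conv_lhs => rw [← hfix]
    refine (Finset.abs_sum_le_sum_abs _ _).trans (Finset.sum_le_sum fun q _ => ?_)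
    rw [abs_mul, abs_of_pos (hpos p q)]
  have h2 : (Q *ᵥ fun q => |y q|) = fun q => |y q| := by
    have hs : ∑ p, ((Q *ᵥ fun q => |y q|) p - |y p|) = 0 := by
      rw [Finset.sum_sub_distrib, sum_mulVec_of_colSum hQ, sub_self]
    have := (Finset.sum_eq_zero_iff_of_nonneg (fun p _ => sub_nonneg.2 (h1 p))).1 hs
    funext p
    linarith [this p (Finset.mem_univ _)]
  set c := ∑ p, |y p| with hc
  have hc1 : 1 ≤ c := by
    rw [hc, ← hy]; exact Finset.sum_le_sum fun p _ => le_abs_self _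
  have h3 : (fun q => |y q|) - c • y = 0 := by
    refine eq_zero_of_fixed hpos hQ ?_ ?_
    · simp only [Pi.sub_apply, Pi.smul_apply, smul_eq_mul, Finset.sum_sub_distrib, ← Finset.mul_sum,
        hy, mul_one, hc, sub_self]
    · rw [Matrix.mulVec_sub, Matrix.mulVec_smul, h2, hfix]
  have h4 : ∀ q, 0 ≤ y q := by
    intro q
    have := congrFun h3 q
    simp only [Pi.sub_apply, Pi.smul_apply, smul_eq_mul, Pi.zero_apply] at this
    have h5 := abs_nonneg (y q)
    by_contra hneg
    push Not at hneg
    nlinarith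
  have h6 : ∃ q, 0 < y q := by
    by_contra hcon
    push Not at hcon
    have : ∑ p, y p ≤ 0 := Finset.sum_nonpos fun p _ => hcon p
    linarith
  obtain ⟨q, hq⟩ := h6
  rw [← hfix]
  exact Finset.sum_pos' (fun q _ => mul_nonneg (hpos p q).le (h4 q))
    ⟨q, Finset.mem_univ _, mul_pos (hpos p q) hq⟩

/-- The rank-one modification `1 - Q + p 1ᵀ` which is invertible when `p` is the Perron vector. -/
noncomputable def fundamental (Q : Matrix ι ι ℝ) (p : ι → ℝ) : Matrix ι ι ℝ :=
  1 - Q + Matrix.of fun i _ => p i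

theorem fundamental_mulVec (Q : Matrix ι ι ℝ) (p y : ι → ℝ) :
    fundamental Q p *ᵥ y = y - Q *ᵥ y + (∑ q, y q) • p := by
  rw [fundamental, Matrix.add_mulVec, Matrix.sub_mulVec, Matrix.one_mulVec]
  congr 1
  funext i
  simp [Matrix.mulVec, dotProduct, ← Finset.mul_sum, mul_comm]

/-- Summing the coordinates of a kernel equation kills `y - Q y` and leaves `∑ y = 0`. Then `y` is a
zero-sum fixed vector of `Q`, hence zero. -/
theorem isUnit_det_fundamental {Q : Matrix ι ι ℝ} {k : ℕ} (hpos : ∀ p q, 0 < (Q ^ k) p q)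
    (hQ : ∀ q, ∑ p, Q p q = 1) {p : ι → ℝ} (hp : ∑ q, p q = 1) :
    IsUnit (fundamental Q p).det := by
  rw [isUnit_iff_ne_zero]
  intro h0
  obtain ⟨y, hy0, hy⟩ := Matrix.exists_mulVec_eq_zero_iff.2 h0
  rw [fundamental_mulVec] at hy
  have hs : ∑ q, y q = 0 := by
    have := congrArg (fun f => ∑ q, f q) hy
    simp only [Pi.add_apply, Pi.sub_apply, Finset.sum_add_distrib, Finset.sum_sub_distrib,
      sum_mulVec_of_colSum hQ, Pi.smul_apply, smul_eq_mul, ← Finset.mul_sum, hp, Pi.zero_apply,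
      Finset.sum_const_zero] at this
    linarith
  rw [hs, zero_smul, add_zero, sub_eq_zero] at hy
  exact hy0 (eq_zero_of_fixed_of_pow hpos hQ hs hy.symm)

/-- Solving `v - Q v = L` for zero-sum `L`. -/
theorem exists_sub_mulVec_eq {Q : Matrix ι ι ℝ} {k : ℕ} (hpos : ∀ p q, 0 < (Q ^ k) p q)
    (hQ : ∀ q, ∑ p, Q p q = 1) {p : ι → ℝ} (hp : ∑ q, p q = 1) {L : ι → ℝ}
    (hL : ∑ q, L q = 0) : ∃ v : ι → ℝ, ∑ q, v q = 0 ∧ v - Q *ᵥ v = L := by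
  have hu := isUnit_det_fundamental hpos hQ hp
  refine ⟨(fundamental Q p)⁻¹ *ᵥ L, ?_⟩
  set v := (fundamental Q p)⁻¹ *ᵥ L
  have hv : fundamental Q p *ᵥ v = L := by
    rw [Matrix.mulVec_mulVec, Matrix.mul_nonsing_inv _ hu, Matrix.one_mulVec]
  rw [fundamental_mulVec] at hv
  have hs : ∑ q, v q = 0 := by
    have := congrArg (fun f => ∑ q, f q) hv
    simp only [Pi.add_apply, Pi.sub_apply, Finset.sum_add_distrib, Finset.sum_sub_distrib,
      sum_mulVec_of_colSum hQ, Pi.smul_apply, smul_eq_mul, ← Finset.mul_sum, hp, hL] at this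
    linarith
  refine ⟨hs, ?_⟩
  rwa [hs, zero_smul, add_zero] at hv

/-- Solving the transposed equation `T - Qᵀ T = G` when `G` is orthogonal to the Perron vector,
with a bound on the solution. -/
theorem exists_bound_sub_vecMul_eq {Q : Matrix ι ι ℝ} {k : ℕ} (hpos : ∀ p q, 0 < (Q ^ k) p q)
    (hQ : ∀ q, ∑ p, Q p q = 1) {p : ι → ℝ} (hp : ∑ q, p q = 1) (hfix : Q *ᵥ p = p) :
    ∃ C : ℝ, 0 ≤ C ∧ ∀ G : ι → ℝ, ∑ q, p q * G q = 0 → ∀ b : ℝ, (∀ q, |G q| ≤ b) →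
      ∃ T : ι → ℝ, T - T ᵥ* Q = G ∧ ∀ q, |T q| ≤ C * b := by
  have hu := isUnit_det_fundamental hpos hQ hp
  set W := (fundamental Q p)⁻¹ with hW
  refine ⟨∑ i, ∑ j, |W i j|, by positivity, fun G hG b hb => ⟨G ᵥ* W, ?_, ?_⟩⟩
  · have h1 : (G ᵥ* W) ᵥ* fundamental Q p = G := by
      rw [Matrix.vecMul_vecMul, Matrix.nonsing_inv_mul _ hu, Matrix.vecMul_one]
    have h2 : ∀ T : ι → ℝ, T ᵥ* fundamental Q p = T - T ᵥ* Q + fun _ => T ⬝ᵥ p := by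
      intro T
      rw [fundamental, Matrix.vecMul_add, Matrix.vecMul_sub, Matrix.vecMul_one]
      congr 1
    have h3 : fundamental Q p *ᵥ p = p := by
      rw [fundamental_mulVec, hfix, hp]; simp
    -- `fundamental Q p` fixes `p`, so the solution has the same pairing with `p` as `G`, namely
    -- zero. This removes the rank-one term from the equation.
    have h4 : (G ᵥ* W) ⬝ᵥ p = 0 := by
      have h5 : ((G ᵥ* W) ᵥ* fundamental Q p) ⬝ᵥ p = (G ᵥ* W) ⬝ᵥ p := by
        rw [← Matrix.dotProduct_mulVec, h3]
      rw [← h5, h1, dotProduct]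
      simpa [mul_comm] using hG
    have h6 := h2 (G ᵥ* W)
    rw [h1, h4] at h6
    conv_rhs => rw [h6]
    funext q
    simp only [Pi.add_apply, add_zero]
  · intro q
    have hb0 : 0 ≤ b := (abs_nonneg _).trans (hb q)
    calc |(G ᵥ* W) q| ≤ ∑ i, |G i * W i q| := Finset.abs_sum_le_sum_abs _ _
      _ ≤ ∑ i, (∑ j, |W i j|) * b := by
          refine Finset.sum_le_sum fun i _ => ?_
          rw [abs_mul, mul_comm]
          exact mul_le_mul (Finset.single_le_sum (f := fun j => |W i j|)
            (fun _ _ => abs_nonneg _) (Finset.mem_univ q)) (hb i) (abs_nonneg _)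
            (Finset.sum_nonneg fun _ _ => abs_nonneg _)
      _ = _ := by rw [Finset.sum_mul]

end Stochastic

/-! ### Consensus, disagreement and quadratic forms -/

section Disagreement

variable {N M : ℕ}

/-- The combination step: agent `k` receives `∑ₗ A l k • x l`. -/
noncomputable def combine (A : Matrix (Fin N) (Fin N) ℝ) (x : Fin N → Vec M) : Fin N → Vec M :=
  fun k => ∑ l, A l k • x l

/-- The weighted average of the agents. -/
noncomputable def wavg (p : Fin N → ℝ) (x : Fin N → Vec M) : Vec M := ∑ k, p k • x k

/-- The largest distance between two agents. -/
noncomputable def disp (x : Fin N → Vec M) : ℝ := ‖fun q : Fin N × Fin N => x q.1 - x q.2‖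

/-- The quadratic form `∑ v (k, l) ⟪x k, x l⟫`. -/
noncomputable def qf (v : Fin N × Fin N → ℝ) (x : Fin N → Vec M) : ℝ :=
  ∑ k, ∑ l, v (k, l) * inner ℝ (x k) (x l)

structure LeftStochastic (A : Matrix (Fin N) (Fin N) ℝ) : Prop where
  nonneg : ∀ l k, 0 ≤ A l k
  sum : ∀ k, ∑ l, A l k = 1

structure ProbVec (p : Fin N → ℝ) : Prop where
  nonneg : ∀ k, 0 ≤ p k
  sum : ∑ k, p k = 1

theorem disp_nonneg (x : Fin N → Vec M) : 0 ≤ disp x := norm_nonneg _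

theorem norm_sub_le_disp (x : Fin N → Vec M) (k l : Fin N) : ‖x k - x l‖ ≤ disp x :=
  norm_le_pi_norm (fun q : Fin N × Fin N => x q.1 - x q.2) (k, l)

theorem disp_le_two_mul_norm (x : Fin N → Vec M) : disp x ≤ 2 * ‖x‖ := by
  refine (pi_norm_le_iff_of_nonneg (by positivity)).2 fun q => (norm_sub_le _ _).trans ?_
  linarith [norm_le_pi_norm x q.1, norm_le_pi_norm x q.2]

theorem disp_add_le (x y : Fin N → Vec M) : disp (x + y) ≤ disp x + 2 * ‖y‖ := by
  have h : (fun q : Fin N × Fin N => (x + y) q.1 - (x + y) q.2)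
      = (fun q : Fin N × Fin N => x q.1 - x q.2) + fun q => y q.1 - y q.2 := by
    funext q; simp only [Pi.add_apply]; abel
  unfold disp
  rw [h]
  exact (norm_add_le _ _).trans (add_le_add le_rfl (disp_le_two_mul_norm y))

theorem norm_sum_smul_sub_le {ι : Type*} [Fintype ι] {w : ι → ℝ} (hw : ∀ i, 0 ≤ w i)
    (hs : ∑ i, w i = 1) {y : ι → Vec M} {z : Vec M} {b : ℝ} (h : ∀ i, ‖y i - z‖ ≤ b) :
    ‖∑ i, w i • y i - z‖ ≤ b := by
  have : ∑ i, w i • y i - z = ∑ i, w i • (y i - z) := by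
    simp only [smul_sub, Finset.sum_sub_distrib, ← Finset.sum_smul, hs, one_smul]
  rw [this]
  refine (norm_sum_le _ _).trans ?_
  calc ∑ i, ‖w i • (y i - z)‖ ≤ ∑ i, w i * b := Finset.sum_le_sum fun i _ => by
        rw [norm_smul, Real.norm_of_nonneg (hw i)]
        exact mul_le_mul_of_nonneg_left (h i) (hw i)
    _ = b := by rw [← Finset.sum_mul, hs, one_mul]

theorem disp_combine_le {A : Matrix (Fin N) (Fin N) ℝ} (hA : LeftStochastic A)
    (x : Fin N → Vec M) : disp (combine A x) ≤ disp x := by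
  refine (pi_norm_le_iff_of_nonneg (disp_nonneg x)).2 fun q => ?_
  refine norm_sum_smul_sub_le (fun l => hA.nonneg l q.1) (hA.sum q.1) fun l => ?_
  rw [norm_sub_rev]
  refine norm_sum_smul_sub_le (fun l => hA.nonneg l q.2) (hA.sum q.2) fun l' => ?_
  exact norm_sub_le_disp x l' l

theorem norm_combine_le {A : Matrix (Fin N) (Fin N) ℝ} (hA : LeftStochastic A)
    (x : Fin N → Vec M) : ‖combine A x‖ ≤ ‖x‖ := by
  refine (pi_norm_le_iff_of_nonneg (norm_nonneg _)).2 fun q => ?_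
  have := norm_sum_smul_sub_le (z := 0) (fun l => hA.nonneg l q) (hA.sum q) (y := x) (b := ‖x‖)
    (fun l => by simpa using norm_le_pi_norm x l)
  simpa [combine] using this

theorem norm_wavg_le {p : Fin N → ℝ} (hp : ProbVec p) (x : Fin N → Vec M) :
    ‖wavg p x‖ ≤ ‖x‖ := by
  have := norm_sum_smul_sub_le (z := 0) hp.nonneg hp.sum (y := x) (b := ‖x‖)
    (fun l => by simpa using norm_le_pi_norm x l)
  simpa [wavg] using this

theorem norm_sub_wavg_le {p : Fin N → ℝ} (hp : ProbVec p) (x : Fin N → Vec M) (k : Fin N) :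
    ‖x k - wavg p x‖ ≤ disp x := by
  rw [norm_sub_rev]
  exact norm_sum_smul_sub_le hp.nonneg hp.sum fun l => norm_sub_le_disp x l k

theorem norm_le_wavg_add_disp {p : Fin N → ℝ} (hp : ProbVec p) (x : Fin N → Vec M) :
    ‖x‖ ≤ ‖wavg p x‖ + disp x := by
  refine (pi_norm_le_iff_of_nonneg (add_nonneg (norm_nonneg _) (disp_nonneg _))).2 fun k => ?_
  have h : x k = wavg p x + (x k - wavg p x) := by abel
  rw [h]
  exact (norm_add_le _ _).trans (add_le_add le_rfl (norm_sub_wavg_le hp x k))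

theorem norm_wavg_combine_sub_le {p : Fin N → ℝ} (hp : ProbVec p)
    {A : Matrix (Fin N) (Fin N) ℝ} (hA : LeftStochastic A) (x y : Fin N → Vec M) :
    ‖wavg p (combine A (x + y)) - wavg p x‖ ≤ disp x + ‖y‖ := by
  refine norm_sum_smul_sub_le hp.nonneg hp.sum fun k => ?_
  refine norm_sum_smul_sub_le (fun l => hA.nonneg l k) (hA.sum k) fun l => ?_
  have : (x + y) l - wavg p x = (x l - wavg p x) + y l := by simp only [Pi.add_apply]; abel
  rw [this]
  exact (norm_add_le _ _).trans (add_le_add (norm_sub_wavg_le hp x l) (norm_le_pi_norm y l))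

/-! ### Quadratic forms -/

theorem qf_eq_sum_coord (v : Fin N × Fin N → ℝ) (x : Fin N → Vec M) :
    qf v x = ∑ a, ∑ k, ∑ l, v (k, l) * (x k a * x l a) := by
  simp only [qf, PiLp.inner_apply, RCLike.inner_apply, conj_trivial, Finset.mul_sum]
  symm
  rw [Finset.sum_comm]
  refine Finset.sum_congr rfl fun k _ => ?_
  rw [Finset.sum_comm]
  refine Finset.sum_congr rfl fun l _ => Finset.sum_congr rfl fun a _ => ?_
  ring

theorem qf_nonneg_of_scalar {v : Fin N × Fin N → ℝ}
    (h : ∀ t : Fin N → ℝ, 0 ≤ ∑ k, ∑ l, v (k, l) * (t k * t l)) (x : Fin N → Vec M) :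
    0 ≤ qf v x := by
  rw [qf_eq_sum_coord]
  exact Finset.sum_nonneg fun a _ => h fun k => x k a

/-- Young's inequality for a semidefinite form: expand the form at `t • x - y`, which is
nonnegative, and divide by `t`. -/
theorem qf_add_le {v : Fin N × Fin N → ℝ} (h : ∀ x : Fin N → Vec M, 0 ≤ qf v x)
    {t : ℝ} (ht : 0 < t) (x y : Fin N → Vec M) :
    qf v (x + y) ≤ (1 + t) * qf v x + (1 + 1 / t) * qf v y := by
  have h1 := h (t • x - y)
  have e1 : qf v (x + y) = qf v x + qf v y + ∑ k, ∑ l, v (k, l) * (inner ℝ (x k) (y l)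
      + inner ℝ (y k) (x l)) := by
    simp only [qf, ← Finset.sum_add_distrib, Pi.add_apply, inner_add_left, inner_add_right]
    refine Finset.sum_congr rfl fun k _ => Finset.sum_congr rfl fun l _ => ?_
    ring
  have e2 : qf v (t • x - y) = t ^ 2 * qf v x + qf v y - t * ∑ k, ∑ l, v (k, l) *
      (inner ℝ (x k) (y l) + inner ℝ (y k) (x l)) := by
    simp only [qf, Finset.mul_sum, ← Finset.sum_add_distrib, ← Finset.sum_sub_distrib,
      Pi.sub_apply, Pi.smul_apply, inner_sub_left, inner_sub_right, real_inner_smul_left,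
      real_inner_smul_right]
    refine Finset.sum_congr rfl fun k _ => Finset.sum_congr rfl fun l _ => ?_
    ring
  rw [e2] at h1
  set B := ∑ k, ∑ l, v (k, l) * (inner ℝ (x k) (y l) + inner ℝ (y k) (x l))
  rw [e1]
  have h2 : B ≤ t * qf v x + 1 / t * qf v y := by
    rw [← sub_nonneg]
    have : t * qf v x + 1 / t * qf v y - B = (t ^ 2 * qf v x + qf v y - t * B) / t := by
      field_simp
    rw [this]; positivity
  linarith

theorem abs_qf_le {v : Fin N × Fin N → ℝ} (x : Fin N → Vec M) :
    |qf v x| ≤ (∑ k, ∑ l, |v (k, l)|) * ‖x‖ ^ 2 := by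
  simp only [qf, Finset.sum_mul]
  refine (Finset.abs_sum_le_sum_abs _ _).trans (Finset.sum_le_sum fun k _ => ?_)
  refine (Finset.abs_sum_le_sum_abs _ _).trans (Finset.sum_le_sum fun l _ => ?_)
  rw [abs_mul]
  refine mul_le_mul_of_nonneg_left ((abs_real_inner_le_norm _ _).trans ?_) (abs_nonneg _)
  rw [sq]
  exact mul_le_mul (norm_le_pi_norm x k) (norm_le_pi_norm x l) (norm_nonneg _) (norm_nonneg _)

/-- With vanishing marginals the form sees only differences between agents, which is why it can be
bounded by the disagreement. -/
theorem qf_sub_const {v : Fin N × Fin N → ℝ} (h1 : ∀ k, ∑ l, v (k, l) = 0)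
    (h2 : ∀ l, ∑ k, v (k, l) = 0) (x : Fin N → Vec M) (c : Vec M) :
    qf v (fun k => x k - c) = qf v x := by
  have e : qf v (fun k => x k - c) = qf v x - (∑ k, ∑ l, v (k, l) * inner ℝ (x k) c)
      - (∑ k, ∑ l, v (k, l) * inner ℝ c (x l)) + ∑ k, ∑ l, v (k, l) * inner ℝ c c := by
    simp only [qf, ← Finset.sum_add_distrib, ← Finset.sum_sub_distrib, inner_sub_left,
      inner_sub_right]
    refine Finset.sum_congr rfl fun k _ => Finset.sum_congr rfl fun l _ => ?_
    ring
  have e1 : ∑ k, ∑ l, v (k, l) * inner ℝ (x k) c = 0 := by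
    simp [← Finset.sum_mul, h1]
  have e2 : ∑ k, ∑ l, v (k, l) * inner ℝ c (x l) = 0 := by
    rw [Finset.sum_comm]; simp [← Finset.sum_mul, h2]
  have e3 : ∑ k, ∑ l, v (k, l) * inner ℝ c c = 0 := by
    simp [← Finset.sum_mul, h1]
  rw [e, e1, e2, e3]; ring

/-- First- and second-order moments `Abar`, `Q` of a random left-stochastic matrix: the properties
that survive in expectation. -/
structure CombMoments (Abar : Matrix (Fin N) (Fin N) ℝ)
    (Q : Matrix (Fin N × Fin N) (Fin N × Fin N) ℝ) : Prop where
  colSum : ∀ k, ∑ l, Abar l k = 1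
  sum_fst : ∀ l' k k', ∑ l, Q (l, l') (k, k') = Abar l' k'
  sum_snd : ∀ l k k', ∑ l', Q (l, l') (k, k') = Abar l k
  psd : ∀ G : Fin N × Fin N → ℝ, (∀ t : Fin N → ℝ, 0 ≤ ∑ k, ∑ l, G (k, l) * (t k * t l)) →
    ∀ t : Fin N → ℝ, 0 ≤ ∑ k, ∑ l, (Q *ᵥ G) (k, l) * (t k * t l)

namespace CombMoments

variable {Abar : Matrix (Fin N) (Fin N) ℝ} {Q : Matrix (Fin N × Fin N) (Fin N × Fin N) ℝ}

theorem colSum_pair (h : CombMoments Abar Q) (q : Fin N × Fin N) : ∑ p, Q p q = 1 := by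
  rw [Fintype.sum_prod_type]
  obtain ⟨k, k'⟩ := q
  simp [h.sum_snd, h.colSum]

theorem sum_fst_pow (h : CombMoments Abar Q) (n : ℕ) :
    ∀ l' k k', ∑ l, (Q ^ n) (l, l') (k, k') = (Abar ^ n) l' k' := by
  induction n with
  | zero =>
    intro l' k k'
    simp only [pow_zero, Matrix.one_apply, Prod.mk.injEq]
    by_cases hl : l' = k' <;> simp [hl]
  | succ n ih =>
    intro l' k k'
    simp only [pow_succ, Matrix.mul_apply]
    rw [Finset.sum_comm]
    simp only [← Finset.sum_mul, Fintype.sum_prod_type, ih]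
    rw [Finset.sum_comm]
    simp [← Finset.mul_sum, h.sum_fst]

/-- Summing `Q ^ n` over one index of the pair gives `Abar ^ n`, so primitivity of `Q` alone makes
`Abar` primitive. -/
theorem pow_pos (h : CombMoments Abar Q) (hN : 0 < N) {n : ℕ} (hpos : ∀ p q, 0 < (Q ^ n) p q)
    (l k : Fin N) : 0 < (Abar ^ n) l k := by
  have : Nonempty (Fin N) := ⟨⟨0, hN⟩⟩
  rw [← h.sum_fst_pow n l k k]
  exact Finset.sum_pos (fun _ _ => hpos _ _) Finset.univ_nonempty

theorem sum_fst_mulVec (h : CombMoments Abar Q) (v : Fin N × Fin N → ℝ) (l' : Fin N) :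
    ∑ l, (Q *ᵥ v) (l, l') = (Abar *ᵥ fun k' => ∑ k, v (k, k')) l' := by
  simp only [Matrix.mulVec, dotProduct]
  rw [Finset.sum_comm]
  simp only [← Finset.sum_mul, Fintype.sum_prod_type, h.sum_fst, Finset.mul_sum]
  rw [Finset.sum_comm]

theorem sum_snd_mulVec (h : CombMoments Abar Q) (v : Fin N × Fin N → ℝ) (l : Fin N) :
    ∑ l', (Q *ᵥ v) (l, l') = (Abar *ᵥ fun k => ∑ k', v (k, k')) l := by
  simp only [Matrix.mulVec, dotProduct]
  rw [Finset.sum_comm]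
  simp only [← Finset.sum_mul, Fintype.sum_prod_type, h.sum_snd, Finset.mul_sum]

/-- Marginalization intertwines `Q` and `Abar`, so each marginal of `pc` is a fixed vector of `Abar`
with sum one. Its difference with `pbar` is a zero-sum fixed vector and must vanish. -/
theorem perron_marginals (h : CombMoments Abar Q) (hN : 0 < N) (hprim : Q.IsPrimitive)
    {pbar : Fin N → ℝ} (hpbar : IsPerronVector Abar pbar) {pc : Fin N × Fin N → ℝ}
    (hpc : IsPerronVector Q pc) :
    (∀ l, ∑ k, pc (k, l) = pbar l) ∧ (∀ k, ∑ l, pc (k, l) = pbar k) ∧ ∀ k, 0 < pbar k := by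
  obtain ⟨n, -, hn⟩ := hprim.exists_pos_pow
  have hA := h.pow_pos hN hn
  refine ⟨?_, ?_, perron_pos hA (colSum_pow h.colSum n) hpbar.2 (pow_mulVec_fixed hpbar.1 n)⟩
  · have hy := eq_zero_of_fixed_of_pow hA h.colSum (y := (fun l => ∑ k, pc (k, l)) - pbar) ?_ ?_
    · intro l
      have := congrFun hy l
      simpa [sub_eq_zero] using this
    · have h2 := hpc.2
      rw [Fintype.sum_prod_type, Finset.sum_comm] at h2
      simp [h2, hpbar.2]
    · rw [Matrix.mulVec_sub, hpbar.1]
      congr 1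
      funext l
      rw [← h.sum_fst_mulVec, hpc.1]
  · have hy := eq_zero_of_fixed_of_pow hA h.colSum (y := (fun k => ∑ l, pc (k, l)) - pbar) ?_ ?_
    · intro l
      have := congrFun hy l
      simpa [sub_eq_zero] using this
    · have h2 := hpc.2
      rw [Fintype.sum_prod_type] at h2
      simp [h2, hpbar.2]
    · rw [Matrix.mulVec_sub, hpbar.1]
      congr 1
      funext l
      rw [← h.sum_snd_mulVec, hpc.1]

/-- A quadratic form comparable to the squared disagreement which decreases on average under the
combination step. -/
theorem exists_lyapunov (h : CombMoments Abar Q) (hN : 0 < N) (hprim : Q.IsPrimitive)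
    {pc : Fin N × Fin N → ℝ} (hpc : IsPerronVector Q pc) :
    ∃ (v : Fin N × Fin N → ℝ) (C : ℝ), 1 ≤ C ∧ ∀ x : Fin N → Vec M,
      disp x ^ 2 ≤ qf v x ∧ qf v x ≤ C * disp x ^ 2 ∧ qf (Q *ᵥ v) x ≤ qf v x - disp x ^ 2 := by
  obtain ⟨n, hn0, hn⟩ := hprim.exists_pos_pow
  have hA := h.pow_pos hN hn
  -- `L` is the kernel of `∑ ‖x k - x l‖²`. Formally `v = ∑ⱼ Qʲ L`, so that the form of `v` is the
  -- total disagreement expected over all future combination steps.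
  set L : Fin N × Fin N → ℝ := fun q => 2 * N * (if q.1 = q.2 then 1 else 0) - 2 with hL
  have hL1 : ∀ k, ∑ l, L (k, l) = 0 := by
    intro k; simp [hL, Finset.sum_sub_distrib]; ring
  have hL2 : ∀ l, ∑ k, L (k, l) = 0 := by
    intro k; simp [hL, Finset.sum_sub_distrib]; ring
  obtain ⟨v, hv0, hv⟩ := exists_sub_mulVec_eq hn h.colSum_pair hpc.2 (L := L) (by
    rw [Fintype.sum_prod_type]; simp [hL1])
  -- The marginals of `L` vanish, so those of `v` are fixed by `Abar`; they have zero sum, hence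
  -- vanish too.
  have hv1 : ∀ l, ∑ k, v (k, l) = 0 := by
    have hy := eq_zero_of_fixed_of_pow hA h.colSum (y := (fun l => ∑ k, v (k, l))) ?_ ?_
    · exact fun l => congrFun hy l
    · rw [Finset.sum_comm, ← Fintype.sum_prod_type (f := v)]; exact hv0
    · funext l
      rw [← h.sum_fst_mulVec]
      have := hL2 l
      rw [← hv] at this
      simp only [Pi.sub_apply, Finset.sum_sub_distrib] at this
      linarith
  have hv2 : ∀ k, ∑ l, v (k, l) = 0 := by
    have hy := eq_zero_of_fixed_of_pow hA h.colSum (y := (fun k => ∑ l, v (k, l))) ?_ ?_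
    · exact fun l => congrFun hy l
    · rw [← Fintype.sum_prod_type (f := v)]; exact hv0
    · funext l
      rw [← h.sum_snd_mulVec]
      have := hL1 l
      rw [← hv] at this
      simp only [Pi.sub_apply, Finset.sum_sub_distrib] at this
      linarith
  have hLs : ∀ t : Fin N → ℝ, ∑ k, ∑ l, L (k, l) * (t k * t l) = ∑ k, ∑ l, (t k - t l) ^ 2 := by
    intro t
    have e : ∀ k l, L (k, l) * (t k * t l) = (2 * N * if k = l then t k * t l else 0)
        - 2 * (t k * t l) := by
      intro k l; simp only [hL]; split_ifs <;> ring
    have e2 : ∀ k l, (t k - t l) ^ 2 = t k ^ 2 + t l ^ 2 - 2 * (t k * t l) := by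
      intro k l; ring
    simp only [e, e2, Finset.sum_sub_distrib, Finset.sum_add_distrib, ← Finset.mul_sum]
    simp
    rw [← Finset.mul_sum]
    simp only [← sq]
    ring
  -- The forms of `Qʲ L` stay nonnegative under `psd`, so the form of `Qʲ v` decreases in `j`. It
  -- tends to zero along the multiples of `n`, where contraction is available, hence it is
  -- nonnegative from `j = 1` on.
  have hQv : ∀ t : Fin N → ℝ, 0 ≤ ∑ k, ∑ l, (Q *ᵥ v) (k, l) * (t k * t l) := by
    intro t
    set sf : (Fin N × Fin N → ℝ) → ℝ := fun G => ∑ k, ∑ l, G (k, l) * (t k * t l) with hsf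
    have hsub : ∀ G G', sf (G - G') = sf G - sf G' := by
      intro G G'
      simp only [hsf, Pi.sub_apply, sub_mul, Finset.sum_sub_distrib]
    have hpsd : ∀ j, 0 ≤ sf ((Q ^ j) *ᵥ L) := by
      intro j
      suffices ∀ t : Fin N → ℝ, 0 ≤ ∑ k, ∑ l, ((Q ^ j) *ᵥ L) (k, l) * (t k * t l) from this t
      induction j with
      | zero =>
        intro t
        simp only [pow_zero, Matrix.one_mulVec, hLs]
        positivity
      | succ j ih =>
        intro t
        rw [pow_succ', ← Matrix.mulVec_mulVec]
        exact h.psd _ ih t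
    have hmono : Antitone fun j : ℕ => sf ((Q ^ j) *ᵥ v) := by
      refine antitone_nat_of_succ_le fun j => ?_
      have : (Q ^ j) *ᵥ L = (Q ^ j) *ᵥ v - (Q ^ (j + 1)) *ᵥ v := by
        rw [← hv, Matrix.mulVec_sub, Matrix.mulVec_mulVec, ← pow_succ]
      have h2 := hpsd j
      rw [this, hsub] at h2
      linarith
    have htend : Tendsto (fun j : ℕ => sf (((Q ^ n) ^ j) *ᵥ v)) atTop (𝓝 (sf 0)) := by
      have hc : Continuous sf := by
        simp only [hsf]; fun_prop
      exact (hc.tendsto 0).comp (tendsto_pow_mulVec_zero hn (colSum_pow h.colSum_pair n) hv0)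
    have h0 : sf 0 = 0 := by simp [hsf]
    rw [h0] at htend
    have h1 : sf (Q *ᵥ v) = sf ((Q ^ 1) *ᵥ v) := by rw [pow_one]
    change 0 ≤ sf (Q *ᵥ v)
    rw [h1]
    refine le_of_tendsto htend ?_
    filter_upwards [eventually_ge_atTop 1] with j hj
    rw [← pow_mul]
    exact hmono (Nat.succ_le_of_lt (Nat.mul_pos hn0 hj))
  have hLx : ∀ x : Fin N → Vec M, qf L x = ∑ k, ∑ l, ‖x k - x l‖ ^ 2 := by
    intro x
    rw [qf_eq_sum_coord]
    simp only [hLs, EuclideanSpace.norm_sq_eq, Real.norm_eq_abs, sq_abs, PiLp.sub_apply]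
    rw [Finset.sum_comm]
    refine Finset.sum_congr rfl fun k _ => ?_
    rw [Finset.sum_comm]
  have hLd : ∀ x : Fin N → Vec M, disp x ^ 2 ≤ qf L x := by
    intro x
    rw [hLx]
    have h1 : disp x ≤ √(∑ k, ∑ l, ‖x k - x l‖ ^ 2) := by
      refine (pi_norm_le_iff_of_nonneg (Real.sqrt_nonneg _)).2 fun q => ?_
      refine Real.le_sqrt_of_sq_le ?_
      refine le_trans ?_ (Finset.single_le_sum (f := fun k => ∑ l, ‖x k - x l‖ ^ 2)
        (fun _ _ => Finset.sum_nonneg fun _ _ => by positivity) (Finset.mem_univ q.1))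
      exact Finset.single_le_sum (f := fun l => ‖x q.1 - x l‖ ^ 2)
        (fun _ _ => by positivity) (Finset.mem_univ q.2)
    calc disp x ^ 2 ≤ (√(∑ k, ∑ l, ‖x k - x l‖ ^ 2)) ^ 2 :=
          pow_le_pow_left₀ (disp_nonneg x) h1 2
      _ = _ := Real.sq_sqrt (by positivity)
  have hsplit : ∀ x : Fin N → Vec M, qf v x = qf (Q *ᵥ v) x + qf L x := by
    intro x
    rw [← hv]
    simp only [qf, Pi.sub_apply, sub_mul, Finset.sum_sub_distrib]
    ring
  refine ⟨v, 1 + ∑ k, ∑ l, |v (k, l)|, by linarith [show 0 ≤ ∑ k, ∑ l, |v (k, l)| by positivity],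
    fun x => ⟨?_, ?_, ?_⟩⟩
  · rw [hsplit]; linarith [hLd x, qf_nonneg_of_scalar hQv x]
  -- After subtracting the vector of one fixed agent, the norm of the network vector is at most its
  -- disagreement.
  · have e := qf_sub_const hv2 hv1 x (x ⟨0, hN⟩)
    rw [← e]
    refine (le_abs_self _).trans ((abs_qf_le _).trans ?_)
    refine mul_le_mul (by linarith) ?_ (by positivity) (by positivity)
    refine pow_le_pow_left₀ (norm_nonneg _) ?_ 2
    exact (pi_norm_le_iff_of_nonneg (disp_nonneg x)).2 fun k => norm_sub_le_disp x k _
  · linarith [hsplit x, hLd x]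

end CombMoments

end Disagreement

/-! ### Costs -/

section Costs

variable {N M : ℕ}

/-- Properties of the gradients `g l x = ∇ J_l (wo - x)` and of the Hessians `H l` at `wo`. -/
structure CostBounds (g : Fin N → Vec M → Vec M) (H : Fin N → Vec M →L[ℝ] Vec M)
    (ν δ e : ℝ) : Prop where
  nu_pos : 0 < ν
  delta_pos : 0 < δ
  e_nonneg : 0 ≤ e
  continuous : ∀ l, Continuous (g l)
  zero : ∀ l, g l 0 = 0
  lipschitz : ∀ l x y, ‖g l x - g l y‖ ≤ δ * ‖x - y‖
  monotone : ∀ l x, inner ℝ x (g l x) ≤ -(ν * ‖x‖ ^ 2)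
  linearization : ∀ l x, ‖g l x + H l x‖ ≤ e * ‖x‖ ^ 2
  symm : ∀ l x y, inner ℝ y (H l x) = inner ℝ (H l y) x
  pos : ∀ l x, ν * ‖x‖ ^ 2 ≤ inner ℝ x (H l x)
  norm_le : ∀ l x, ‖H l x‖ ≤ δ * ‖x‖

theorem fderiv_apply_eq_inner_gradient {f : Vec M → ℝ} (w v : Vec M) :
    fderiv ℝ f w v = inner ℝ (gradient f w) v := by
  rw [gradient, InnerProductSpace.toDual_symm_apply]

/-- The gradient is differentiable but not assumed continuously so. `second_derivative_symmetric`
needs only this, once the gradient is read as a derivative through the inner product. -/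
theorem hess_symm {f : Vec M → ℝ} (hf : TwiceDifferentiable f) (w x y : Vec M) :
    inner ℝ y (hess f w x) = inner ℝ (hess f w y) x := by
  have hb : IsBoundedBilinearMap ℝ fun p : Vec M × Vec M => inner ℝ p.1 p.2 :=
    isBoundedBilinearMap_inner
  set B := hb.toContinuousLinearMap with hB
  have hBa : ∀ a b, B a b = inner ℝ a b := fun a b => rfl
  have h1 : ∀ z, HasFDerivAt f (B (gradient f z)) z := by
    intro z
    convert! (hf.1 z).hasFDerivAt using 1
    ext v
    rw [hBa, fderiv_apply_eq_inner_gradient]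
  have h2 : HasFDerivAt (fun z => B (gradient f z)) (B.comp (hess f w)) w :=
    B.hasFDerivAt.comp w (hf.2 w).hasFDerivAt
  have h3 := second_derivative_symmetric h1 h2 x y
  rw [ContinuousLinearMap.comp_apply, ContinuousLinearMap.comp_apply, hBa, hBa] at h3
  rw [← h3, real_inner_comm]

theorem gradient_aggregateCost {J : Fin N → Vec M → ℝ} (hJ : ∀ k, Differentiable ℝ (J k))
    (w : Vec M) : gradient (aggregateCost J) w = ∑ k, gradient (J k) w := by
  unfold gradient
  rw [← map_sum]
  congr 1
  exact fderiv_fun_sum fun k _ => hJ k w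

theorem hess_aggregateCost {J : Fin N → Vec M → ℝ} (hJ : ∀ k, TwiceDifferentiable (J k))
    (w : Vec M) : hess (aggregateCost J) w = ∑ k, hess (J k) w := by
  unfold hess
  have : gradient (aggregateCost J) = fun w => ∑ k, gradient (J k) w := by
    funext w; exact gradient_aggregateCost (fun k => (hJ k).1) w
  rw [this]
  exact fderiv_fun_sum fun k _ => (hJ k).2 w

/-- Nonnegativity of the form at `x - δ⁻¹ T x`, with symmetry and the upper bound at `T x`, gives
`δ⁻¹ ‖T x‖² ≤ ⟪x, T x⟫ ≤ δ ‖x‖²`. -/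
theorem norm_apply_le_of_inner_le {T : Vec M →L[ℝ] Vec M}
    (hs : ∀ x y, inner ℝ y (T x) = inner ℝ (T y) x) (h0 : ∀ x, 0 ≤ inner ℝ x (T x)) {δ : ℝ}
    (hδ : 0 < δ) (h : ∀ x, inner ℝ x (T x) ≤ δ * ‖x‖ ^ 2) (x : Vec M) : ‖T x‖ ≤ δ * ‖x‖ := by
  have h1 := h0 (x - δ⁻¹ • T x)
  have e : inner ℝ (x - δ⁻¹ • T x) (T (x - δ⁻¹ • T x)) = inner ℝ x (T x) - 2 * δ⁻¹ * ‖T x‖ ^ 2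
      + δ⁻¹ ^ 2 * inner ℝ (T x) (T (T x)) := by
    simp only [map_sub, map_smul, inner_sub_left, inner_sub_right, real_inner_smul_left,
      real_inner_smul_right]
    rw [hs (T x) x, real_inner_self_eq_norm_sq]
    ring
  rw [e] at h1
  have h2 := h (T x)
  have h3 := h x
  have h4 : δ⁻¹ ^ 2 * inner ℝ (T x) (T (T x)) ≤ δ⁻¹ * ‖T x‖ ^ 2 := by
    calc δ⁻¹ ^ 2 * inner ℝ (T x) (T (T x)) ≤ δ⁻¹ ^ 2 * (δ * ‖T x‖ ^ 2) := by gcongr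
      _ = δ⁻¹ * ‖T x‖ ^ 2 := by field_simp
  have h5 : δ⁻¹ * ‖T x‖ ^ 2 ≤ δ * ‖x‖ ^ 2 := by linarith
  have h6 : ‖T x‖ ^ 2 ≤ (δ * ‖x‖) ^ 2 := by
    have := mul_le_mul_of_nonneg_left h5 hδ.le
    rw [← mul_assoc, mul_inv_cancel₀ hδ.ne', one_mul] at this
    linarith
  exact abs_le_of_sq_le_sq' h6 (by positivity) |>.2

/-- Each Hessian is positive and their sum is at most `δ`, so each one is at most `δ`. This global
bound extends the local linearization estimate to all of space: for `‖x‖ > r` the trivial error `2 δ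
‖x‖` is at most `(2 δ / r) ‖x‖²`, which explains the second term of `e`. -/
theorem exists_costBounds (hN : 0 < N) {J : Fin N → Vec M → ℝ} {wo : Vec M}
    (hJ : CostConditions J wo) {r : ℝ} (hr : 0 < r) {τ : Fin N → ℝ}
    (hH : HessianSmoothness J wo r τ) :
    ∃ ν δ e, CostBounds (fun l x => gradient (J l) (wo - x)) (fun l => hess (J l) wo) ν δ e := by
  have : Nonempty (Fin N) := ⟨⟨0, hN⟩⟩
  choose ν' hν'0 hν' using hJ.stronglyConvex
  obtain ⟨k0, hk0⟩ := Finite.exists_min ν'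
  obtain ⟨νa, δ, hνa, hδa, hagg⟩ := hJ.aggregate
  have hδ : 0 < δ := hνa.trans_le hδa
  set ν := ν' k0
  have hν : 0 < ν := hν'0 k0
  have hlow : ∀ k w v, ν * ‖v‖ ^ 2 ≤ inner ℝ v (hess (J k) w v) := fun k w v =>
    (mul_le_mul_of_nonneg_right (hk0 k) (by positivity)).trans (hν' k w v)
  have hup : ∀ k w v, inner ℝ v (hess (J k) w v) ≤ δ * ‖v‖ ^ 2 := by
    intro k w v
    refine le_trans ?_ (hagg w v).2
    rw [hess_aggregateCost hJ.twiceDiff, sum_apply, inner_sum]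
    exact Finset.single_le_sum (f := fun k => inner ℝ v (hess (J k) w v))
      (fun k _ => (by positivity : 0 ≤ ν * ‖v‖ ^ 2).trans (hlow k w v)) (Finset.mem_univ k)
  have hnorm : ∀ k w x, ‖hess (J k) w x‖ ≤ δ * ‖x‖ := fun k w =>
    norm_apply_le_of_inner_le (fun x y => hess_symm (hJ.twiceDiff k) w x y)
      (fun x => (by positivity : 0 ≤ ν * ‖x‖ ^ 2).trans (hlow k w x)) hδ (hup k w)
  have hnorm' : ∀ k w, ‖hess (J k) w‖ ≤ δ := fun k w =>
    ContinuousLinearMap.opNorm_le_bound _ hδ.le (hnorm k w)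
  have hg0 : ∀ l, gradient (J l) wo = 0 := by
    intro l
    have : IsLocalMin (J l) wo := Eventually.of_forall (hJ.minimizer l)
    rw [gradient, this.fderiv_eq_zero, map_zero]
  have hgd : ∀ l x, HasFDerivAt (fun x => gradient (J l) (wo - x)) (-hess (J l) (wo - x)) x := by
    intro l x
    have h1 : HasFDerivAt (fun x : Vec M => wo - x) (-ContinuousLinearMap.id ℝ (Vec M)) x :=
      (hasFDerivAt_id x).const_sub wo
    have h2 := ((hJ.twiceDiff l).2 (wo - x)).hasFDerivAt.comp x h1
    convert! h2 using 1
    ext v; simp [hess]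
  have hlip : ∀ l x y, ‖gradient (J l) (wo - x) - gradient (J l) (wo - y)‖ ≤ δ * ‖x - y‖ := by
    intro l x y
    refine Convex.norm_image_sub_le_of_norm_hasFDerivWithin_le (s := Set.univ)
      (f := fun x => gradient (J l) (wo - x)) (fun z _ => (hgd l z).hasFDerivWithinAt) (fun z _ => ?_)
      convex_univ (Set.mem_univ y) (Set.mem_univ x)
    rw [norm_neg]; exact hnorm' l _
  set e := (∑ k, |τ k|) + 2 * δ / r with he
  have he0 : 0 ≤ e := by positivity
  refine ⟨ν, δ, e, hν, hδ, he0, ?_, ?_, hlip, ?_, ?_, ?_, ?_, ?_⟩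
  · exact fun l => (hJ.twiceDiff l).2.continuous.comp (continuous_const.sub continuous_id)
  · intro l; simp [hg0]
  · intro l x
    have hd : ∀ t : ℝ, HasDerivAt (fun t : ℝ => inner ℝ x (gradient (J l) (wo - t • x)))
        (inner ℝ x (-hess (J l) (wo - t • x) x)) t := by
      intro t
      have h1 : HasDerivAt (fun t : ℝ => t • x) x t := by
        simpa using (hasDerivAt_id t).smul_const x
      have h2 := (hgd l (t • x)).comp_hasDerivAt t h1
      exact (hasDerivAt_const t x).inner ℝ h2 |>.congr_deriv (by simp)
    -- The mean value theorem along the segment from `0` to `x`: the pairing of `x` with the drift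
    -- equals minus a Hessian form at an intermediate point.
    obtain ⟨c, -, hc⟩ := exists_hasDerivAt_eq_slope
      (fun t : ℝ => inner ℝ x (gradient (J l) (wo - t • x))) _ (zero_lt_one' ℝ)
      (fun t _ => (hd t).continuousAt.continuousWithinAt) (fun t _ => hd t)
    simp only [one_smul, zero_smul, sub_zero, hg0, inner_zero_right, div_one, inner_neg_right] at hc
    rw [← hc]
    exact neg_le_neg (hlow l _ x)
  · intro l x
    rcases le_or_gt ‖x‖ r with hxr | hxr
    · have hτ : 0 ≤ ∑ k, |τ k| := by positivity
      have h1 : ‖(gradient (J l) (wo - x) + hess (J l) wo x)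
          - (gradient (J l) (wo - 0) + hess (J l) wo 0)‖ ≤ (|τ l| * ‖x‖) * ‖x - 0‖ := by
        refine Convex.norm_image_sub_le_of_norm_hasFDerivWithin_le (s := Metric.closedBall 0 ‖x‖)
          (f := fun x => gradient (J l) (wo - x) + hess (J l) wo x)
          (f' := fun z => -hess (J l) (wo - z) + hess (J l) wo)
          (fun z _ => ((hgd l z).add (hess (J l) wo).hasFDerivAt).hasFDerivWithinAt)
          (fun z hz => ?_) (convex_closedBall _ _) (by simp) (by simp)
        have hz' : ‖z‖ ≤ ‖x‖ := by simpa using hz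
        have h2 := hH l (-z) (by rw [norm_neg]; exact hz'.trans hxr)
        rw [← sub_eq_add_neg, norm_neg] at h2
        rw [neg_add_eq_sub, norm_sub_rev]
        refine h2.trans ?_
        exact mul_le_mul (le_abs_self _) hz' (norm_nonneg _) (abs_nonneg _)
      simp only [sub_zero, hg0, map_zero, add_zero] at h1
      refine h1.trans ?_
      rw [mul_assoc, ← sq]
      refine mul_le_mul_of_nonneg_right ?_ (by positivity)
      have h3 := Finset.single_le_sum (f := fun k => |τ k|) (fun _ _ => abs_nonneg _)
        (Finset.mem_univ l)
      have : 0 ≤ 2 * δ / r := by positivity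
      linarith
    · have h1 := hlip l x 0
      simp only [sub_zero, hg0] at h1
      have h2 := hnorm l wo x
      refine (norm_add_le _ _).trans ?_
      have h3 : 2 * δ * ‖x‖ ≤ 2 * δ / r * ‖x‖ ^ 2 := by
        have : 2 * δ / r * ‖x‖ ^ 2 = 2 * δ * ‖x‖ * (‖x‖ / r) := by ring
        rw [this]
        refine le_mul_of_one_le_right (by positivity) ?_
        rw [le_div_iff₀ hr]; linarith
      have h4 : 2 * δ / r * ‖x‖ ^ 2 ≤ e * ‖x‖ ^ 2 := by
        refine mul_le_mul_of_nonneg_right ?_ (by positivity)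
        rw [he]; linarith [show 0 ≤ ∑ k, |τ k| by positivity]
      linarith
  · exact fun l x y => hess_symm (hJ.twiceDiff l) wo x y
  · exact fun l x => hlow l wo x
  · exact fun l x => hnorm l wo x

end Costs

/-! ### One step of the algorithm -/

section OneStepSection

variable {N M : ℕ} {Ω : Type*}

theorem integral_mul_of_indep {mΩ : MeasurableSpace Ω} {P : Measure Ω} {m₁ m₂ : MeasurableSpace Ω}
    (h₁ : m₁ ≤ mΩ) (h₂ : m₂ ≤ mΩ) (h : Indep m₁ m₂ P) {f g : Ω → ℝ} (hf : Measurable[m₁] f)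
    (hg : Measurable[m₂] g) : ∫ ω, f ω * g ω ∂P = (∫ ω, f ω ∂P) * ∫ ω, g ω ∂P := by
  have hfg : IndepFun f g P := by
    rw [IndepFun_iff_Indep]
    exact indep_of_indep_of_le h hf.comap_le hg.comap_le
  exact hfg.integral_fun_mul_eq_mul_integral (hf.mono h₁ le_rfl).aestronglyMeasurable
    (hg.mono h₂ le_rfl).aestronglyMeasurable

/-- The random step-sizes `μ` (measurable with respect to `S`) and the random combination matrix
`A` (measurable with respect to `C`) used at one time instant are independent of each other and of
the history `H`. -/
structure OneStep {mΩ : MeasurableSpace Ω} (P : Measure Ω) (S C H : MeasurableSpace Ω)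
    (A : Ω → Matrix (Fin N) (Fin N) ℝ) (μ : Ω → Fin N → ℝ) (Abar : Matrix (Fin N) (Fin N) ℝ)
    (Q : Matrix (Fin N × Fin N) (Fin N × Fin N) ℝ) (mbar : Fin N → ℝ)
    (m2 : Fin N → Fin N → ℝ) : Prop where
  le_step : S ≤ mΩ
  le_comb : C ≤ mΩ
  le_hist : H ≤ mΩ
  measurable_comb : ∀ l k, Measurable[C] fun ω => A ω l k
  measurable_step : ∀ k, Measurable[S] fun ω => μ ω k
  indep_comb : Indep C (S ⊔ H) P
  indep_step : Indep S H P
  stoch : ∀ᵐ ω ∂P, LeftStochastic (A ω)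
  mean_comb : ∀ l k, ∫ ω, A ω l k ∂P = Abar l k
  mean_comb_mul : ∀ l k l' k', ∫ ω, A ω l k * A ω l' k' ∂P = Q (l, l') (k, k')
  step_bdd : ∃ b, 0 ≤ b ∧ ∀ᵐ ω ∂P, ∀ k, 0 ≤ μ ω k ∧ μ ω k ≤ b
  mean_step : ∀ k, ∫ ω, μ ω k ∂P = mbar k
  mean_step_mul : ∀ k l, ∫ ω, μ ω k * μ ω l ∂P = m2 k l

/-- The vector `(μ_l • h_l)_l`. -/
noncomputable def scale (μ : Fin N → ℝ) (h : Fin N → Vec M) : Fin N → Vec M := fun l => μ l • h l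

theorem norm_scale_sq_le (μ : Fin N → ℝ) (h : Fin N → Vec M) :
    ‖scale μ h‖ ^ 2 ≤ ∑ l, μ l ^ 2 * ‖h l‖ ^ 2 := by
  have h1 : ‖scale μ h‖ ≤ √(∑ l, μ l ^ 2 * ‖h l‖ ^ 2) := by
    refine (pi_norm_le_iff_of_nonneg (Real.sqrt_nonneg _)).2 fun l => Real.le_sqrt_of_sq_le ?_
    refine le_trans (le_of_eq ?_) (Finset.single_le_sum (f := fun l => μ l ^ 2 * ‖h l‖ ^ 2)
        (fun _ _ => by positivity) (Finset.mem_univ l))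
    simp only [scale, norm_smul, Real.norm_eq_abs, mul_pow, sq_abs]
  calc _ ≤ (√(∑ l, μ l ^ 2 * ‖h l‖ ^ 2)) ^ 2 := pow_le_pow_left₀ (norm_nonneg _) h1 2
    _ = _ := Real.sq_sqrt (Finset.sum_nonneg fun _ _ => by positivity)

theorem norm_scale_pow_four_le (μ : Fin N → ℝ) (h : Fin N → Vec M) :
    ‖scale μ h‖ ^ 4 ≤ ∑ l, μ l ^ 4 * ‖h l‖ ^ 4 := by
  have hs : 0 ≤ ∑ l, μ l ^ 4 * ‖h l‖ ^ 4 := Finset.sum_nonneg fun _ _ => by positivity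
  have h1 : ‖scale μ h‖ ≤ √(√(∑ l, μ l ^ 4 * ‖h l‖ ^ 4)) := by
    refine (pi_norm_le_iff_of_nonneg (Real.sqrt_nonneg _)).2 fun l => Real.le_sqrt_of_sq_le
      (Real.le_sqrt_of_sq_le ?_)
    refine le_trans (le_of_eq ?_) (Finset.single_le_sum (f := fun l => μ l ^ 4 * ‖h l‖ ^ 4)
        (fun _ _ => by positivity) (Finset.mem_univ l))
    simp only [scale, norm_smul, Real.norm_eq_abs, mul_pow, ← pow_mul]
    norm_num
    left
    exact Even.pow_abs (by decide) _
  calc _ ≤ (√(√(∑ l, μ l ^ 4 * ‖h l‖ ^ 4))) ^ 4 := pow_le_pow_left₀ (norm_nonneg _) h1 4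
    _ = ((√(√(∑ l, μ l ^ 4 * ‖h l‖ ^ 4))) ^ 2) ^ 2 := by ring
    _ = _ := by rw [Real.sq_sqrt (Real.sqrt_nonneg _), Real.sq_sqrt hs]

theorem norm_scale_le {μ : Fin N → ℝ} {b : ℝ} (hb : 0 ≤ b) (hμ : ∀ k, 0 ≤ μ k ∧ μ k ≤ b)
    (h : Fin N → Vec M) : ‖scale μ h‖ ≤ b * ‖h‖ := by
  refine (pi_norm_le_iff_of_nonneg (by positivity)).2 fun l => ?_
  rw [scale, norm_smul, Real.norm_of_nonneg (hμ l).1]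
  exact mul_le_mul (hμ l).2 (norm_le_pi_norm h l) (norm_nonneg _) hb

namespace OneStep

variable {S C H : MeasurableSpace Ω} {mΩ : MeasurableSpace Ω} {P : Measure Ω}
  [IsProbabilityMeasure P]
  {A : Ω → Matrix (Fin N) (Fin N) ℝ} {μ : Ω → Fin N → ℝ} {Abar : Matrix (Fin N) (Fin N) ℝ}
  {Q : Matrix (Fin N × Fin N) (Fin N × Fin N) ℝ} {mbar : Fin N → ℝ} {m2 : Fin N → Fin N → ℝ}

section basic

variable (O : OneStep P S C H A μ Abar Q mbar m2)
include O

theorem le_sup : S ⊔ H ≤ mΩ := sup_le O.le_step O.le_hist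

theorem comb_le_one : ∀ᵐ ω ∂P, ∀ l k, |A ω l k| ≤ 1 := by
  filter_upwards [O.stoch] with ω hω l k
  rw [abs_of_nonneg (hω.nonneg l k), ← hω.sum k]
  exact Finset.single_le_sum (f := fun l => A ω l k) (fun l _ => hω.nonneg l k) (Finset.mem_univ l)

theorem measurable_comb' (l k : Fin N) : Measurable fun ω => A ω l k :=
  (O.measurable_comb l k).mono O.le_comb le_rfl

theorem measurable_step' (k : Fin N) : Measurable fun ω => μ ω k :=
  (O.measurable_step k).mono O.le_step le_rfl

theorem integrable_comb_mul {φ : Ω → ℝ} (hφ : Integrable φ P) (l k : Fin N) :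
    Integrable (fun ω => A ω l k * φ ω) P := by
  refine hφ.bdd_mul (c := 1) (O.measurable_comb' l k).aestronglyMeasurable ?_
  filter_upwards [O.comb_le_one] with ω h using h l k

theorem integral_comb_mul {φ : Ω → ℝ} (hφ : Measurable[S ⊔ H] φ) (l k : Fin N) :
    ∫ ω, A ω l k * φ ω ∂P = Abar l k * ∫ ω, φ ω ∂P := by
  rw [integral_mul_of_indep O.le_comb O.le_sup O.indep_comb (O.measurable_comb l k) hφ, O.mean_comb]

theorem integral_comb_comb_mul {φ : Ω → ℝ} (hφ : Measurable[S ⊔ H] φ) (l k l' k' : Fin N) :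
    ∫ ω, A ω l k * A ω l' k' * φ ω ∂P = Q (l, l') (k, k') * ∫ ω, φ ω ∂P := by
  have h : Measurable[C] fun ω => A ω l k * A ω l' k' :=
    (O.measurable_comb l k).mul (O.measurable_comb l' k')
  rw [integral_mul_of_indep O.le_comb O.le_sup O.indep_comb h hφ, O.mean_comb_mul]

theorem integrable_comb_comb_mul {φ : Ω → ℝ} (hφ : Integrable φ P) (l k l' k' : Fin N) :
    Integrable (fun ω => A ω l k * A ω l' k' * φ ω) P := by
  simp only [mul_assoc]
  exact O.integrable_comb_mul (O.integrable_comb_mul hφ _ _) _ _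

theorem integrable_step_mul {φ : Ω → ℝ} (hφ : Integrable φ P) (k : Fin N) :
    Integrable (fun ω => μ ω k * φ ω) P := by
  obtain ⟨b, hb, h⟩ := O.step_bdd
  refine hφ.bdd_mul (c := b) (O.measurable_step' k).aestronglyMeasurable ?_
  filter_upwards [h] with ω h
  rw [Real.norm_of_nonneg (h k).1]; exact (h k).2

theorem integral_step_mul {φ : Ω → ℝ} (hφ : Measurable[H] φ) (k : Fin N) :
    ∫ ω, μ ω k * φ ω ∂P = mbar k * ∫ ω, φ ω ∂P := by
  rw [integral_mul_of_indep O.le_step O.le_hist O.indep_step (O.measurable_step k) hφ, O.mean_step]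

theorem integral_step_step_mul {φ : Ω → ℝ} (hφ : Measurable[H] φ) (k l : Fin N) :
    ∫ ω, μ ω k * μ ω l * φ ω ∂P = m2 k l * ∫ ω, φ ω ∂P := by
  have h : Measurable[S] fun ω => μ ω k * μ ω l := (O.measurable_step k).mul (O.measurable_step l)
  rw [integral_mul_of_indep O.le_step O.le_hist O.indep_step h hφ, O.mean_step_mul]

theorem integral_step_pow_mul {φ : Ω → ℝ} (hφ : Measurable[H] φ) (k : Fin N) (n : ℕ) :
    ∫ ω, μ ω k ^ n * φ ω ∂P = (∫ ω, μ ω k ^ n ∂P) * ∫ ω, φ ω ∂P :=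
  integral_mul_of_indep O.le_step O.le_hist O.indep_step ((O.measurable_step k).pow_const n) hφ

theorem integrable_step_pow_mul {φ : Ω → ℝ} (hφ : Integrable φ P) (k : Fin N) (n : ℕ) :
    Integrable (fun ω => μ ω k ^ n * φ ω) P := by
  induction n with
  | zero => simpa using hφ
  | succ n ih =>
    have := O.integrable_step_mul ih k
    refine this.congr (Eventually.of_forall fun ω => ?_)
    simp only; ring

end basic

theorem measurable_scale {m : MeasurableSpace Ω} {μ : Ω → Fin N → ℝ} (hμ : ∀ k, Measurable[m] fun ω => μ ω k)
    {h : Ω → Fin N → Vec M} (hh : Measurable[m] h) : Measurable[m] fun ω => scale (μ ω) (h ω) := by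
  refine measurable_pi_lambda _ fun l => ?_
  exact (hμ l).smul ((measurable_pi_apply l).comp hh)

section basic2

variable (O : OneStep P S C H A μ Abar Q mbar m2)
include O

theorem measurable_state {x h : Ω → Fin N → Vec M} (hx : Measurable[H] x) (hh : Measurable[H] h) :
    Measurable[S ⊔ H] fun ω => x ω + scale (μ ω) (h ω) :=
  (hx.mono le_sup_right le_rfl).add
    (measurable_scale (m := S ⊔ H) (fun k => (O.measurable_step k).mono le_sup_left le_rfl)
      (hh.mono le_sup_right le_rfl))

theorem measurable_combine {z : Ω → Fin N → Vec M} (hz : Measurable z) :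
    Measurable fun ω => combine (A ω) (z ω) := by
  refine measurable_pi_lambda _ fun k => ?_
  exact Finset.measurable_sum _ fun l _ =>
    (O.measurable_comb' l k).smul ((measurable_pi_apply l).comp hz)

/-- Mean of the combined vector, tested against a function of the past. -/
theorem integral_inner_wavg {x h : Ω → Fin N → Vec M} (hx : Measurable[H] x) (hh : Measurable[H] h)
    {f : Ω → Vec M} (hf : Measurable[H] f)
    (hfx : ∀ l, Integrable (fun ω => inner ℝ (f ω) (x ω l)) P)
    (hfh : ∀ l, Integrable (fun ω => inner ℝ (f ω) (h ω l)) P)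
    {p : Fin N → ℝ} (hp : Abar *ᵥ p = p) :
    Integrable (fun ω => inner ℝ (f ω) (wavg p (combine (A ω) (x ω + scale (μ ω) (h ω))))) P ∧
    ∫ ω, inner ℝ (f ω) (wavg p (combine (A ω) (x ω + scale (μ ω) (h ω)))) ∂P
      = ∫ ω, inner ℝ (f ω) (wavg p (x ω)) ∂P
        + ∑ l, p l * mbar l * ∫ ω, inner ℝ (f ω) (h ω l) ∂P := by
  have hmx : ∀ l, Measurable[H] fun ω => inner ℝ (f ω) (x ω l) := fun l =>
    hf.inner ((measurable_pi_apply l).comp hx)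
  have hmh : ∀ l, Measurable[H] fun ω => inner ℝ (f ω) (h ω l) := fun l =>
    hf.inner ((measurable_pi_apply l).comp hh)
  set φ : Fin N → Ω → ℝ := fun l ω => inner ℝ (f ω) (x ω l) + μ ω l * inner ℝ (f ω) (h ω l) with hφ
  have hφi : ∀ l, Integrable (φ l) P := fun l => (hfx l).add (O.integrable_step_mul (hfh l) l)
  have hφm : ∀ l, Measurable[S ⊔ H] (φ l) := fun l =>
    ((hmx l).mono le_sup_right le_rfl).add
      (((O.measurable_step l).mono le_sup_left le_rfl).mul ((hmh l).mono le_sup_right le_rfl))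
  have e : ∀ ω, inner ℝ (f ω) (wavg p (combine (A ω) (x ω + scale (μ ω) (h ω))))
      = ∑ k, ∑ l, p k * (A ω l k * φ l ω) := by
    intro ω
    simp only [wavg, combine, inner_sum, real_inner_smul_right, hφ, Pi.add_apply, scale,
      inner_add_right, Finset.mul_sum]
  have hi : ∀ k l, Integrable (fun ω => p k * (A ω l k * φ l ω)) P := fun k l =>
    (O.integrable_comb_mul (hφi l) l k).const_mul _
  simp only [e]
  refine ⟨integrable_finsetSum _ fun k _ => integrable_finsetSum _ fun l _ => hi k l, ?_⟩
  rw [integral_finsetSum _ fun k _ => integrable_finsetSum _ fun l _ => hi k l]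
  have e2 : ∀ k, ∫ ω, ∑ l, p k * (A ω l k * φ l ω) ∂P
      = ∑ l, p k * (Abar l k * ∫ ω, φ l ω ∂P) := by
    intro k
    rw [integral_finsetSum _ fun l _ => hi k l]
    refine Finset.sum_congr rfl fun l _ => ?_
    rw [integral_const_mul, O.integral_comb_mul (hφm l)]
  have e3 : ∀ l, ∫ ω, φ l ω ∂P = ∫ ω, inner ℝ (f ω) (x ω l) ∂P
      + mbar l * ∫ ω, inner ℝ (f ω) (h ω l) ∂P := by
    intro l
    rw [integral_add (hfx l) (O.integrable_step_mul (hfh l) l), O.integral_step_mul (hmh l)]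
  have e4 : ∀ ω, inner ℝ (f ω) (wavg p (x ω)) = ∑ l, p l * inner ℝ (f ω) (x ω l) := by
    intro ω
    simp only [wavg, inner_sum, real_inner_smul_right]
  simp only [e2, e4]
  rw [integral_finsetSum _ fun l _ => (hfx l).const_mul _, Finset.sum_comm, ← Finset.sum_add_distrib]
  refine Finset.sum_congr rfl fun l _ => ?_
  rw [integral_const_mul]
  -- `p` is fixed by `Abar`, so in the mean the combination step does not alter the weighted
  -- average, although an individual combination matrix does.
  have : ∑ k, p k * (Abar l k * ∫ ω, φ l ω ∂P) = p l * ∫ ω, φ l ω ∂P := by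
    have h1 := congrFun hp l
    simp only [Matrix.mulVec, dotProduct] at h1
    rw [← h1, Finset.sum_mul]
    refine Finset.sum_congr rfl fun k _ => ?_
    ring
  rw [this, e3]; ring

/-- Mean of a quadratic form of the combined vector. -/
theorem integral_mul_qf_combine {z : Ω → Fin N → Vec M} (hz : Measurable[S ⊔ H] z)
    {φ : Ω → ℝ} (hφ : Measurable[S ⊔ H] φ)
    (hi : ∀ k l, Integrable (fun ω => φ ω * inner ℝ (z ω k) (z ω l)) P) (v : Fin N × Fin N → ℝ) :
    Integrable (fun ω => φ ω * qf v (combine (A ω) (z ω))) P ∧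
    ∫ ω, φ ω * qf v (combine (A ω) (z ω)) ∂P = ∫ ω, φ ω * qf (Q *ᵥ v) (z ω) ∂P := by
  have hm : ∀ k l, Measurable[S ⊔ H] fun ω => φ ω * inner ℝ (z ω k) (z ω l) := fun k l =>
    hφ.mul (((measurable_pi_apply k).comp hz).inner ((measurable_pi_apply l).comp hz))
  have e : ∀ ω, φ ω * qf v (combine (A ω) (z ω)) = ∑ k, ∑ k', ∑ l, ∑ l',
      v (k, k') * (A ω l k * A ω l' k' * (φ ω * inner ℝ (z ω l) (z ω l'))) := by
    intro ω
    simp only [qf, combine, sum_inner, inner_sum, real_inner_smul_left, real_inner_smul_right,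
      Finset.mul_sum]
    refine Finset.sum_congr rfl fun k _ => Finset.sum_congr rfl fun k' _ => ?_
    rw [Finset.sum_comm]
    refine Finset.sum_congr rfl fun l _ => Finset.sum_congr rfl fun l' _ => ?_
    ring
  have hi2 : ∀ k k' l l', Integrable (fun ω => v (k, k') *
      (A ω l k * A ω l' k' * (φ ω * inner ℝ (z ω l) (z ω l')))) P := fun k k' l l' =>
    (O.integrable_comb_comb_mul (hi l l') _ _ _ _).const_mul _
  simp only [e]
  refine ⟨integrable_finsetSum _ fun k _ => integrable_finsetSum _ fun k' _ =>
    integrable_finsetSum _ fun l _ => integrable_finsetSum _ fun l' _ => hi2 k k' l l', ?_⟩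
  rw [integral_finsetSum _ fun k _ => integrable_finsetSum _ fun k' _ =>
    integrable_finsetSum _ fun l _ => integrable_finsetSum _ fun l' _ => hi2 k k' l l']
  have e1 : ∀ k, ∫ ω, ∑ k', ∑ l, ∑ l',
      v (k, k') * (A ω l k * A ω l' k' * (φ ω * inner ℝ (z ω l) (z ω l'))) ∂P
      = ∑ k', ∑ l, ∑ l', v (k, k') * (Q (l, l') (k, k') *
        ∫ ω, φ ω * inner ℝ (z ω l) (z ω l') ∂P) := by
    intro k
    rw [integral_finsetSum _ fun k' _ =>
      integrable_finsetSum _ fun l _ => integrable_finsetSum _ fun l' _ => hi2 k k' l l']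
    refine Finset.sum_congr rfl fun k' _ => ?_
    rw [integral_finsetSum _ fun l _ => integrable_finsetSum _ fun l' _ => hi2 k k' l l']
    refine Finset.sum_congr rfl fun l _ => ?_
    rw [integral_finsetSum _ fun l' _ => hi2 k k' l l']
    refine Finset.sum_congr rfl fun l' _ => ?_
    rw [integral_const_mul, O.integral_comb_comb_mul (hm l l')]
  have e2 : ∀ ω, φ ω * qf (Q *ᵥ v) (z ω) = ∑ l, ∑ l', (Q *ᵥ v) (l, l') *
      (φ ω * inner ℝ (z ω l) (z ω l')) := by
    intro ω
    simp only [qf, Finset.mul_sum]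
    refine Finset.sum_congr rfl fun k _ => Finset.sum_congr rfl fun k' _ => ?_
    ring
  simp only [e1, e2]
  rw [integral_finsetSum _ fun l _ => integrable_finsetSum _ fun l' _ => (hi l l').const_mul _]
  have e3 : ∀ l, ∫ ω, ∑ l', (Q *ᵥ v) (l, l') * (φ ω * inner ℝ (z ω l) (z ω l')) ∂P
      = ∑ l', ∑ k, ∑ k', v (k, k') * (Q (l, l') (k, k') *
        ∫ ω, φ ω * inner ℝ (z ω l) (z ω l') ∂P) := by
    intro l
    rw [integral_finsetSum _ fun l' _ => (hi l l').const_mul _]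
    refine Finset.sum_congr rfl fun l' _ => ?_
    rw [integral_const_mul, Matrix.mulVec, dotProduct, Fintype.sum_prod_type, Finset.sum_mul]
    refine Finset.sum_congr rfl fun k _ => ?_
    rw [Finset.sum_mul]
    refine Finset.sum_congr rfl fun k' _ => ?_
    ring
  simp only [e3]
  have e4 : ∀ F : Fin N → Fin N → Fin N → Fin N → ℝ, ∑ k, ∑ k', ∑ l, ∑ l', F k k' l l'
      = ∑ l, ∑ l', ∑ k, ∑ k', F k k' l l' := by
    intro F
    simp only [← Fintype.sum_prod_type']
    exact Fintype.sum_equiv ⟨fun x => (x.2.2.1, x.2.2.2, x.1, x.2.1),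
      fun x => (x.2.2.1, x.2.2.2, x.1, x.2.1), fun _ => rfl, fun _ => rfl⟩ _ _ fun _ => rfl
  exact e4 _

/-- Mean of a product of coordinates of two combined vectors. -/
theorem integral_combine_mul_combine {z z' : Ω → Fin N → Vec M} (hz : Measurable[S ⊔ H] z)
    (hz' : Measurable[S ⊔ H] z') (k k' : Fin N) (a a' : Fin M)
    (hi : ∀ l l', Integrable (fun ω => z ω l a * z' ω l' a') P) :
    Integrable (fun ω => combine (A ω) (z ω) k a * combine (A ω) (z' ω) k' a') P ∧
    ∫ ω, combine (A ω) (z ω) k a * combine (A ω) (z' ω) k' a' ∂P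
      = ∑ l, ∑ l', Q (l, l') (k, k') * ∫ ω, z ω l a * z' ω l' a' ∂P := by
  have hc : ∀ (l : Fin N) (a : Fin M), Measurable fun x : Fin N → Vec M => x l a := fun l a => by
    fun_prop
  have hm : ∀ l l', Measurable[S ⊔ H] fun ω => z ω l a * z' ω l' a' := fun l l' =>
    ((hc l a).comp hz).mul ((hc l' a').comp hz')
  have e : ∀ ω, combine (A ω) (z ω) k a * combine (A ω) (z' ω) k' a'
      = ∑ l, ∑ l', A ω l k * A ω l' k' * (z ω l a * z' ω l' a') := by
    intro ω
    have e1 : ∀ (A : Matrix (Fin N) (Fin N) ℝ) (x : Fin N → Vec M) k a,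
        combine A x k a = ∑ l, A l k * x l a := by
      intro A x k a
      simp [combine]
    rw [e1, e1, Finset.sum_mul_sum]
    refine Finset.sum_congr rfl fun k _ => Finset.sum_congr rfl fun k' _ => ?_
    ring
  have hi2 : ∀ l l', Integrable (fun ω => A ω l k * A ω l' k' * (z ω l a * z' ω l' a')) P :=
    fun l l' => O.integrable_comb_comb_mul (hi l l') _ _ _ _
  simp only [e]
  refine ⟨integrable_finsetSum _ fun l _ => integrable_finsetSum _ fun l' _ => hi2 l l', ?_⟩
  rw [integral_finsetSum _ fun l _ => integrable_finsetSum _ fun l' _ => hi2 l l']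
  refine Finset.sum_congr rfl fun l _ => ?_
  rw [integral_finsetSum _ fun l' _ => hi2 l l']
  refine Finset.sum_congr rfl fun l' _ => ?_
  rw [O.integral_comb_comb_mul (hm l l')]

end basic2

end OneStep

end OneStepSection

/-! ### Fourth-order moments after one step -/

section Pathwise

variable {N M : ℕ}

/-- The quadratic form of `v` is comparable to the squared disagreement and decreases on average
when the combination matrix has the second-order moments `Q`. -/
structure IsLyapunov (M : ℕ) (Q : Matrix (Fin N × Fin N) (Fin N × Fin N) ℝ)
    (v : Fin N × Fin N → ℝ) (c : ℝ) : Prop where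
  one_le : 1 ≤ c
  lower : ∀ x : Fin N → Vec M, disp x ^ 2 ≤ qf v x
  upper : ∀ x : Fin N → Vec M, qf v x ≤ c * disp x ^ 2
  decrease : ∀ x : Fin N → Vec M, qf (Q *ᵥ v) x ≤ qf v x - disp x ^ 2

theorem continuous_disp : Continuous (disp : (Fin N → Vec M) → ℝ) := by
  unfold disp; fun_prop

theorem continuous_qf (v : Fin N × Fin N → ℝ) : Continuous (qf v : (Fin N → Vec M) → ℝ) := by
  unfold qf; fun_prop

theorem continuous_wavg (p : Fin N → ℝ) : Continuous (wavg p : (Fin N → Vec M) → Vec M) := by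
  unfold wavg; fun_prop

namespace IsLyapunov

variable {Q : Matrix (Fin N × Fin N) (Fin N × Fin N) ℝ} {v : Fin N × Fin N → ℝ} {c : ℝ}

theorem qf_nonneg (h : IsLyapunov M Q v c) (x : Fin N → Vec M) : 0 ≤ qf v x :=
  (sq_nonneg _).trans (h.lower x)

/-- The contraction factor in the estimates below is `1 - θ`, with this `θ`. -/
noncomputable def rate (c : ℝ) : ℝ := 1 / (4 * c)

theorem rate_pos (h : IsLyapunov M Q v c) : 0 < rate c := by
  have := h.one_le
  unfold rate; positivity

theorem rate_le (h : IsLyapunov M Q v c) : rate c ≤ 1 / 4 := by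
  have := h.one_le
  unfold rate
  apply one_div_le_one_div_of_le <;> linarith

theorem mul_rate (h : IsLyapunov M Q v c) : c * rate c = 1 / 4 := by
  have := h.one_le
  unfold rate; field_simp

/-- Since `4 c θ = 1` for `θ = rate c`, the drop by `disp ^ 2` is at least a fraction `4 θ` of the
form. Young's inequality with parameter `θ` separates `y` and costs one `θ`, leaving `1 - 3 θ`. -/
theorem qf_step_le (h : IsLyapunov M Q v c) (x y : Fin N → Vec M) :
    qf (Q *ᵥ v) (x + y) ≤ (1 - 3 * rate c) * qf v x + (1 + 1 / rate c) * (4 * c) * ‖y‖ ^ 2 := by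
  have hθ := h.rate_pos
  have hθ4 := h.rate_le
  have hc := h.mul_rate
  set θ := rate c
  have h1 := h.decrease (x + y)
  have h2 : 4 * θ * qf v (x + y) ≤ disp (x + y) ^ 2 := by
    have := mul_le_mul_of_nonneg_left (h.upper (x + y)) (by positivity : 0 ≤ 4 * θ)
    nlinarith
  have h3 := qf_add_le (fun x => h.qf_nonneg x) hθ x y
  have h4 : qf v y ≤ 4 * c * ‖y‖ ^ 2 := by
    refine (h.upper y).trans ?_
    have h5 := disp_le_two_mul_norm y
    have h6 : disp y ^ 2 ≤ (2 * ‖y‖) ^ 2 := pow_le_pow_left₀ (disp_nonneg y) h5 2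
    have := h.one_le
    nlinarith
  have h0 := h.qf_nonneg x
  calc qf (Q *ᵥ v) (x + y) ≤ (1 - 4 * θ) * qf v (x + y) := by linarith
    _ ≤ (1 - 4 * θ) * ((1 + θ) * qf v x + (1 + 1 / θ) * qf v y) :=
        mul_le_mul_of_nonneg_left h3 (by linarith)
    _ = (1 - 3 * θ - 4 * θ ^ 2) * qf v x + (1 - 4 * θ) * ((1 + 1 / θ) * qf v y) := by ring
    _ ≤ (1 - 3 * θ) * qf v x + 1 * ((1 + 1 / θ) * (4 * c * ‖y‖ ^ 2)) := by
        refine add_le_add (mul_le_mul_of_nonneg_right (by nlinarith) h0) ?_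
        refine mul_le_mul (by linarith) (by gcongr) ?_ zero_le_one
        have := h.qf_nonneg y
        positivity
    _ = _ := by ring

end IsLyapunov

/-- The term linear in `ξ` is kept exact, because its expectation supplies the contraction. All
other terms are estimated by Cauchy–Schwarz. -/
theorem norm_pow_four_add_le (u ξ : Vec M) :
    ‖u + ξ‖ ^ 4 ≤ ‖u‖ ^ 4 + 4 * ‖u‖ ^ 2 * inner ℝ u ξ + 8 * ‖u‖ ^ 2 * ‖ξ‖ ^ 2 + 3 * ‖ξ‖ ^ 4 := by
  have h1 : ‖u + ξ‖ ^ 2 = ‖u‖ ^ 2 + 2 * inner ℝ u ξ + ‖ξ‖ ^ 2 := norm_add_sq_real u ξ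
  have h2 : ‖u + ξ‖ ^ 4 = (‖u‖ ^ 2 + 2 * inner ℝ u ξ + ‖ξ‖ ^ 2) ^ 2 := by rw [← h1]; ring
  have h3 := abs_le.1 (abs_real_inner_le_norm u ξ)
  have h4 : (inner ℝ u ξ : ℝ) ^ 2 ≤ ‖u‖ ^ 2 * ‖ξ‖ ^ 2 := by
    rw [← mul_pow]; exact sq_le_sq' h3.1 h3.2
  have h5 : 4 * inner ℝ u ξ * ‖ξ‖ ^ 2 ≤ 2 * ‖u‖ ^ 2 * ‖ξ‖ ^ 2 + 2 * ‖ξ‖ ^ 4 := by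
    have h6 : inner ℝ u ξ * ‖ξ‖ ^ 2 ≤ ‖u‖ * ‖ξ‖ * ‖ξ‖ ^ 2 :=
      mul_le_mul_of_nonneg_right h3.2 (by positivity)
    nlinarith [mul_nonneg (sq_nonneg (‖u‖ - ‖ξ‖)) (sq_nonneg ‖ξ‖)]
  rw [h2]
  nlinarith

/-- A single combination matrix does not preserve the weighted average, but all combined vectors lie
within `disp x + ‖y‖` of the old average `u`. The fourth-power expansion is applied to that
deviation. -/
theorem norm_wavg_combine_pow_four_le {p : Fin N → ℝ} (hp : ProbVec p)
    {A : Matrix (Fin N) (Fin N) ℝ} (hA : LeftStochastic A) (x y : Fin N → Vec M) :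
    ‖wavg p (combine A (x + y))‖ ^ 4 ≤ ‖wavg p x‖ ^ 4
      + 4 * (‖wavg p x‖ ^ 2 * inner ℝ (wavg p x) (wavg p (combine A (x + y)))
        - ‖wavg p x‖ ^ 2 * inner ℝ (wavg p x) (wavg p x))
      + (16 * (‖wavg p x‖ ^ 2 * disp x ^ 2) + 16 * (‖wavg p x‖ ^ 2 * ‖y‖ ^ 2)
        + 24 * disp x ^ 4 + 24 * ‖y‖ ^ 4) := by
  set u := wavg p x
  set ξ := wavg p (combine A (x + y)) - u with hξ
  have e : wavg p (combine A (x + y)) = u + ξ := by rw [hξ]; abel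
  have h1 := norm_pow_four_add_le u ξ
  have h2 : ‖ξ‖ ≤ disp x + ‖y‖ := norm_wavg_combine_sub_le hp hA x y
  have h3 : ‖ξ‖ ^ 2 ≤ 2 * disp x ^ 2 + 2 * ‖y‖ ^ 2 := by
    have := pow_le_pow_left₀ (norm_nonneg ξ) h2 2
    nlinarith [sq_nonneg (disp x - ‖y‖)]
  have h4 : ‖ξ‖ ^ 4 ≤ 8 * disp x ^ 4 + 8 * ‖y‖ ^ 4 := by
    have : ‖ξ‖ ^ 4 = (‖ξ‖ ^ 2) ^ 2 := by ring
    rw [this]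
    have := pow_le_pow_left₀ (sq_nonneg ‖ξ‖) h3 2
    nlinarith [sq_nonneg (disp x ^ 2 - ‖y‖ ^ 2)]
  rw [e]
  simp only [inner_add_right]
  have h5 : ‖u‖ ^ 2 * ‖ξ‖ ^ 2 ≤ ‖u‖ ^ 2 * (2 * disp x ^ 2 + 2 * ‖y‖ ^ 2) :=
    mul_le_mul_of_nonneg_left h3 (by positivity)
  linarith

/-- Only the average is replaced by its old value here. The form after the combination is kept, so
that the expectation over the combination matrix can afterwards turn `v` into `Q *ᵥ v`. -/
theorem norm_wavg_combine_sq_mul_qf_le {p : Fin N → ℝ} (hp : ProbVec p)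
    {A : Matrix (Fin N) (Fin N) ℝ} (hA : LeftStochastic A)
    {Q : Matrix (Fin N × Fin N) (Fin N × Fin N) ℝ} {v : Fin N × Fin N → ℝ} {c : ℝ}
    (h : IsLyapunov M Q v c) (x y : Fin N → Vec M) :
    ‖wavg p (combine A (x + y))‖ ^ 2 * qf v (combine A (x + y)) ≤
      (1 + IsLyapunov.rate c) * (‖wavg p x‖ ^ 2 * qf v (combine A (x + y)))
        + (1 + 1 / IsLyapunov.rate c) * (26 * c) * (disp x ^ 4 + ‖y‖ ^ 4) := by
  have hθ := h.rate_pos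
  set θ := IsLyapunov.rate c
  set u := wavg p x
  set ξ := wavg p (combine A (x + y)) - u with hξ
  have e : wavg p (combine A (x + y)) = u + ξ := by rw [hξ]; abel
  have h2 : ‖ξ‖ ≤ disp x + ‖y‖ := norm_wavg_combine_sub_le hp hA x y
  have h3 : ‖ξ‖ ^ 2 ≤ 2 * disp x ^ 2 + 2 * ‖y‖ ^ 2 := by
    have := pow_le_pow_left₀ (norm_nonneg ξ) h2 2
    nlinarith [sq_nonneg (disp x - ‖y‖)]
  have h4 : ‖u + ξ‖ ^ 2 ≤ (1 + θ) * ‖u‖ ^ 2 + (1 + 1 / θ) * ‖ξ‖ ^ 2 := by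
    have h5 : ‖u + ξ‖ ^ 2 ≤ (‖u‖ + ‖ξ‖) ^ 2 := pow_le_pow_left₀ (norm_nonneg _) (norm_add_le u ξ) 2
    have h6 : 2 * ‖u‖ * ‖ξ‖ ≤ θ * ‖u‖ ^ 2 + 1 / θ * ‖ξ‖ ^ 2 := by
      rw [← sub_nonneg]
      have : θ * ‖u‖ ^ 2 + 1 / θ * ‖ξ‖ ^ 2 - 2 * ‖u‖ * ‖ξ‖ = (θ * ‖u‖ - ‖ξ‖) ^ 2 / θ := by
        field_simp; ring
      rw [this]; positivity
    nlinarith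
  have hd : disp (combine A (x + y)) ≤ disp x + 2 * ‖y‖ :=
    (disp_combine_le hA _).trans (disp_add_le x y)
  have hc0 : 0 ≤ c := by linarith [h.one_le]
  have h7 : qf v (combine A (x + y)) ≤ c * (2 * disp x ^ 2 + 8 * ‖y‖ ^ 2) := by
    refine (h.upper _).trans (mul_le_mul_of_nonneg_left ?_ hc0)
    have := pow_le_pow_left₀ (disp_nonneg _) hd 2
    nlinarith [sq_nonneg (disp x - 2 * ‖y‖)]
  have h0 := h.qf_nonneg (combine A (x + y))
  set W := qf v (combine A (x + y))
  rw [e]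
  have h8 : ‖ξ‖ ^ 2 * W ≤ (26 * c) * (disp x ^ 4 + ‖y‖ ^ 4) := by
    calc ‖ξ‖ ^ 2 * W ≤ (2 * disp x ^ 2 + 2 * ‖y‖ ^ 2) * (c * (2 * disp x ^ 2 + 8 * ‖y‖ ^ 2)) :=
          mul_le_mul h3 h7 h0 (by positivity)
      _ = c * (4 * disp x ^ 4 + 20 * (disp x ^ 2 * ‖y‖ ^ 2) + 16 * ‖y‖ ^ 4) := by ring
      _ ≤ c * (26 * (disp x ^ 4 + ‖y‖ ^ 4)) := by
          refine mul_le_mul_of_nonneg_left ?_ hc0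
          nlinarith [sq_nonneg (disp x ^ 2 - ‖y‖ ^ 2), sq_nonneg (disp x ^ 2)]
      _ = _ := by ring
  calc ‖u + ξ‖ ^ 2 * W ≤ ((1 + θ) * ‖u‖ ^ 2 + (1 + 1 / θ) * ‖ξ‖ ^ 2) * W :=
        mul_le_mul_of_nonneg_right h4 h0
    _ = (1 + θ) * (‖u‖ ^ 2 * W) + (1 + 1 / θ) * (‖ξ‖ ^ 2 * W) := by ring
    _ ≤ (1 + θ) * (‖u‖ ^ 2 * W) + (1 + 1 / θ) * ((26 * c) * (disp x ^ 4 + ‖y‖ ^ 4)) := by gcongr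
    _ = _ := by ring

/-- Multiplying the contraction `1 - 3 θ` of the form by a growth `1 + θ` of the squared
disagreement leaves `1 - 2 θ`. The cross terms `κ D² Y²` are absorbed by another `θ D⁴ ≤ θ D² V` and
a multiple of `Y⁴`. -/
theorem disp_sq_mul_qf_le {Q : Matrix (Fin N × Fin N) (Fin N × Fin N) ℝ}
    {v : Fin N × Fin N → ℝ} {c : ℝ} (h : IsLyapunov M Q v c) :
    ∃ K : ℝ, 0 ≤ K ∧ ∀ x y : Fin N → Vec M, disp (x + y) ^ 2 * qf (Q *ᵥ v) (x + y) ≤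
      (1 - IsLyapunov.rate c) * (disp x ^ 2 * qf v x) + K * ‖y‖ ^ 4 := by
  have hθ := h.rate_pos
  have hθ4 := h.rate_le
  set θ := IsLyapunov.rate c with hθdef
  have hc0 : 0 ≤ c := by linarith [h.one_le]
  set K1 := (1 + 1 / θ) * (4 * c) with hK1
  have hK10 : 0 ≤ K1 := by positivity
  set κ := (1 + 1 / θ) * 4 * c + (1 + θ) * K1 with hκ
  have hκ0 : 0 ≤ κ := by positivity
  refine ⟨κ ^ 2 / (4 * θ) + (1 + 1 / θ) * 4 * K1, by positivity, fun x y => ?_⟩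
  set D := disp x
  set Y := ‖y‖
  have h1 := h.qf_step_le x y
  rw [← hθdef, ← hK1] at h1
  have h2 : disp (x + y) ^ 2 ≤ (1 + θ) * D ^ 2 + (1 + 1 / θ) * (4 * Y ^ 2) := by
    have h5 := pow_le_pow_left₀ (disp_nonneg _) (disp_add_le x y) 2
    have h6 : 4 * D * Y ≤ θ * D ^ 2 + 1 / θ * (4 * Y ^ 2) := by
      rw [← sub_nonneg]
      have : θ * D ^ 2 + 1 / θ * (4 * Y ^ 2) - 4 * D * Y = (θ * D - 2 * Y) ^ 2 / θ := by
        field_simp; ring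
      rw [this]; positivity
    nlinarith
  have hV := h.qf_nonneg x
  have hV1 := h.upper x
  have hV2 := h.lower x
  set V := qf v x
  have hfac : 0 ≤ (1 - 3 * θ) * V + K1 * Y ^ 2 := by
    have : 0 ≤ 1 - 3 * θ := by linarith
    positivity
  have h3 : κ * (D ^ 2 * Y ^ 2) ≤ θ * D ^ 4 + κ ^ 2 / (4 * θ) * Y ^ 4 := by
    rw [← sub_nonneg]
    have : θ * D ^ 4 + κ ^ 2 / (4 * θ) * Y ^ 4 - κ * (D ^ 2 * Y ^ 2)
        = (2 * θ * D ^ 2 - κ * Y ^ 2) ^ 2 / (4 * θ) := by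
      field_simp; ring
    rw [this]; positivity
  have h4 : D ^ 4 ≤ D ^ 2 * V := by
    have : D ^ 4 = D ^ 2 * D ^ 2 := by ring
    rw [this]; exact mul_le_mul_of_nonneg_left hV2 (sq_nonneg _)
  have h5 : Y ^ 2 * V ≤ c * (D ^ 2 * Y ^ 2) := by
    have := mul_le_mul_of_nonneg_left hV1 (sq_nonneg Y)
    linarith
  have h6 : 0 ≤ D ^ 2 * V := by positivity
  calc disp (x + y) ^ 2 * qf (Q *ᵥ v) (x + y)
      ≤ disp (x + y) ^ 2 * ((1 - 3 * θ) * V + K1 * Y ^ 2) :=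
        mul_le_mul_of_nonneg_left h1 (sq_nonneg _)
    _ ≤ ((1 + θ) * D ^ 2 + (1 + 1 / θ) * (4 * Y ^ 2)) * ((1 - 3 * θ) * V + K1 * Y ^ 2) :=
        mul_le_mul_of_nonneg_right h2 hfac
    _ = (1 - 2 * θ - 3 * θ ^ 2) * (D ^ 2 * V) + (1 + 1 / θ) * 4 * ((1 - 3 * θ) * (Y ^ 2 * V))
        + (1 + θ) * K1 * (D ^ 2 * Y ^ 2) + (1 + 1 / θ) * 4 * K1 * Y ^ 4 := by ring
    _ ≤ (1 - 2 * θ) * (D ^ 2 * V) + (1 + 1 / θ) * 4 * (1 * (c * (D ^ 2 * Y ^ 2)))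
        + (1 + θ) * K1 * (D ^ 2 * Y ^ 2) + (1 + 1 / θ) * 4 * K1 * Y ^ 4 := by
        have e1 : (1 - 2 * θ - 3 * θ ^ 2) * (D ^ 2 * V) ≤ (1 - 2 * θ) * (D ^ 2 * V) :=
          mul_le_mul_of_nonneg_right (by nlinarith) h6
        have e2 : (1 - 3 * θ) * (Y ^ 2 * V) ≤ 1 * (c * (D ^ 2 * Y ^ 2)) :=
          mul_le_mul (by linarith) h5 (by positivity) zero_le_one
        have e3 := mul_le_mul_of_nonneg_left e2 (by positivity : 0 ≤ (1 + 1 / θ) * 4)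
        linarith
    _ = (1 - 2 * θ) * (D ^ 2 * V) + κ * (D ^ 2 * Y ^ 2) + (1 + 1 / θ) * 4 * K1 * Y ^ 4 := by
        rw [hκ]; ring
    _ ≤ (1 - 2 * θ) * (D ^ 2 * V) + (θ * (D ^ 2 * V) + κ ^ 2 / (4 * θ) * Y ^ 4)
        + (1 + 1 / θ) * 4 * K1 * Y ^ 4 := by
        gcongr
        refine h3.trans ?_
        gcongr
    _ = _ := by ring

end Pathwise

/-! ### Fourth-order moments in expectation: one step of a general recursion -/

section FourthMoments

variable {N M : ℕ} {Ω : Type*}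

/-- `f` is integrable with integral `c`. -/
def HasInt {mΩ : MeasurableSpace Ω} (P : Measure Ω) (f : Ω → ℝ) (c : ℝ) : Prop :=
  Integrable f P ∧ ∫ ω, f ω ∂P = c

namespace HasInt

variable {mΩ : MeasurableSpace Ω} {P : Measure Ω} {f g : Ω → ℝ} {a b : ℝ}

theorem of_integrable (hf : Integrable f P) : HasInt P f (∫ ω, f ω ∂P) := ⟨hf, rfl⟩

theorem add (hf : HasInt P f a) (hg : HasInt P g b) : HasInt P (fun ω => f ω + g ω) (a + b) :=
  ⟨hf.1.add hg.1, by rw [integral_add hf.1 hg.1, hf.2, hg.2]⟩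

theorem sub (hf : HasInt P f a) (hg : HasInt P g b) : HasInt P (fun ω => f ω - g ω) (a - b) :=
  ⟨hf.1.sub hg.1, by rw [integral_sub hf.1 hg.1, hf.2, hg.2]⟩

theorem const_mul (r : ℝ) (hf : HasInt P f a) : HasInt P (fun ω => r * f ω) (r * a) :=
  ⟨hf.1.const_mul r, by rw [integral_const_mul, hf.2]⟩

theorem mono_ae (hf : HasInt P f a) (hg : HasInt P g b) (h : ∀ᵐ ω ∂P, f ω ≤ g ω) : a ≤ b := by
  rw [← hf.2, ← hg.2]; exact integral_mono_ae hf.1 hg.1 h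

theorem sum {ι : Type*} [Fintype ι] {f : ι → Ω → ℝ} {a : ι → ℝ} (h : ∀ i, HasInt P (f i) (a i)) :
    HasInt P (fun ω => ∑ i, f i ω) (∑ i, a i) :=
  ⟨integrable_finsetSum _ fun i _ => (h i).1, by
    rw [integral_finsetSum _ fun i _ => (h i).1]
    exact Finset.sum_congr rfl fun i _ => (h i).2⟩

theorem congr (hf : HasInt P f a) (h : ∀ ω, g ω = f ω) : HasInt P g a := by
  have : g = f := funext h
  rwa [this]

end HasInt

theorem integrable_mul_of_le_sq {mΩ : MeasurableSpace Ω} {P : Measure Ω} {R f g : Ω → ℝ}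
    (hR : Integrable (fun ω => R ω ^ 4) P) (hf : Measurable f) (hg : Measurable g) {K L : ℝ}
    (hfR : ∀ᵐ ω ∂P, |f ω| ≤ K * R ω ^ 2) (hgR : ∀ᵐ ω ∂P, |g ω| ≤ L * R ω ^ 2) :
    Integrable (fun ω => f ω * g ω) P := by
  refine (hR.const_mul (K * L)).mono' (hf.mul hg).aestronglyMeasurable ?_
  filter_upwards [hfR, hgR] with ω h1 h2
  rw [Real.norm_eq_abs, abs_mul]
  calc |f ω| * |g ω| ≤ (K * R ω ^ 2) * (L * R ω ^ 2) :=
        mul_le_mul h1 h2 (abs_nonneg _) ((abs_nonneg _).trans h1)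
    _ = _ := by ring

theorem abs_sq_le_of_le {a K R : ℝ} (ha : 0 ≤ a) (h : a ≤ K * R) : |a ^ 2| ≤ K ^ 2 * R ^ 2 := by
  rw [abs_of_nonneg (by positivity), ← mul_pow]
  exact pow_le_pow_left₀ ha h 2

theorem integrable_pow_four_of_le {mΩ : MeasurableSpace Ω} {P : Measure Ω} {R f : Ω → ℝ}
    (hR : Integrable (fun ω => R ω ^ 4) P) (hf : Measurable f) (hf0 : ∀ ω, 0 ≤ f ω) {K : ℝ}
    (hfR : ∀ᵐ ω ∂P, f ω ≤ K * R ω) : Integrable (fun ω => f ω ^ 4) P := by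
  have h : ∀ᵐ ω ∂P, |f ω ^ 2| ≤ K ^ 2 * R ω ^ 2 := by
    filter_upwards [hfR] with ω h using abs_sq_le_of_le (hf0 ω) h
  have := integrable_mul_of_le_sq hR (hf.pow_const 2) (hf.pow_const 2) h h
  refine this.congr (Eventually.of_forall fun ω => ?_)
  simp only; ring

namespace OneStep

variable {S C H : MeasurableSpace Ω} {mΩ : MeasurableSpace Ω} {P : Measure Ω}
  [IsProbabilityMeasure P]
  {A : Ω → Matrix (Fin N) (Fin N) ℝ} {μ : Ω → Fin N → ℝ} {Abar : Matrix (Fin N) (Fin N) ℝ}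
  {Q : Matrix (Fin N × Fin N) (Fin N × Fin N) ℝ} {mbar : Fin N → ℝ} {m2 : Fin N → Fin N → ℝ}

set_option maxHeartbeats 1000000 in
/-- Effect of one step on the fourth-order moments. -/
theorem fourth_moments_step (O : OneStep P S C H A μ Abar Q mbar m2)
    {x h : Ω → Fin N → Vec M} (hx : Measurable[H] x) (hh : Measurable[H] h)
    (hx4 : Integrable (fun ω => ‖x ω‖ ^ 4) P) (hh4 : Integrable (fun ω => ‖h ω‖ ^ 4) P)
    {p : Fin N → ℝ} (hp : ProbVec p) (hpA : Abar *ᵥ p = p)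
    {v : Fin N × Fin N → ℝ} {c K : ℝ} (hv : IsLyapunov M Q v c)
    (hK : ∀ x y : Fin N → Vec M, disp (x + y) ^ 2 * qf (Q *ᵥ v) (x + y) ≤
      (1 - IsLyapunov.rate c) * (disp x ^ 2 * qf v x) + K * ‖y‖ ^ 4)
    (x' : Ω → Fin N → Vec M)
    (hx' : x' = fun ω => combine (A ω) (x ω + scale (μ ω) (h ω))) :
    ((Measurable x' ∧ Integrable (fun ω => ‖x' ω‖ ^ 4) P) ∧
    (∫ ω, ‖wavg p (x' ω)‖ ^ 4 ∂P ≤ ∫ ω, ‖wavg p (x ω)‖ ^ 4 ∂P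
      + 4 * ∑ l, p l * mbar l * ∫ ω, ‖wavg p (x ω)‖ ^ 2 * inner ℝ (wavg p (x ω)) (h ω l) ∂P
      + 16 * ∫ ω, ‖wavg p (x ω)‖ ^ 2 * qf v (x ω) ∂P
      + 16 * ∫ ω, ‖wavg p (x ω)‖ ^ 2 * ‖scale (μ ω) (h ω)‖ ^ 2 ∂P
      + 24 * ∫ ω, disp (x ω) ^ 2 * qf v (x ω) ∂P
      + 24 * ∫ ω, ‖scale (μ ω) (h ω)‖ ^ 4 ∂P)) ∧
    (∫ ω, ‖wavg p (x' ω)‖ ^ 2 * qf v (x' ω) ∂P ≤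
      (1 + IsLyapunov.rate c) * ((1 - 3 * IsLyapunov.rate c) *
          ∫ ω, ‖wavg p (x ω)‖ ^ 2 * qf v (x ω) ∂P
        + (1 + 1 / IsLyapunov.rate c) * (4 * c) *
          ∫ ω, ‖wavg p (x ω)‖ ^ 2 * ‖scale (μ ω) (h ω)‖ ^ 2 ∂P)
      + (1 + 1 / IsLyapunov.rate c) * (26 * c) *
        (∫ ω, disp (x ω) ^ 2 * qf v (x ω) ∂P + ∫ ω, ‖scale (μ ω) (h ω)‖ ^ 4 ∂P)) ∧
    (∫ ω, disp (x' ω) ^ 2 * qf v (x' ω) ∂P ≤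
      (1 - IsLyapunov.rate c) * ∫ ω, disp (x ω) ^ 2 * qf v (x ω) ∂P
        + K * ∫ ω, ‖scale (μ ω) (h ω)‖ ^ 4 ∂P) ∧
    (∫ ω, ‖wavg p (x ω)‖ ^ 2 * ‖scale (μ ω) (h ω)‖ ^ 2 ∂P ≤
      ∑ l, m2 l l * ∫ ω, ‖wavg p (x ω)‖ ^ 2 * ‖h ω l‖ ^ 2 ∂P) ∧
    (∫ ω, ‖scale (μ ω) (h ω)‖ ^ 4 ∂P ≤
      ∑ l, (∫ ω, μ ω l ^ 4 ∂P) * ∫ ω, ‖h ω l‖ ^ 4 ∂P) := by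
  obtain ⟨b, hb, hμ⟩ := O.step_bdd
  have hθ := hv.rate_pos
  have hθ4 := hv.rate_le
  set θ := IsLyapunov.rate c
  have mx : Measurable x := hx.mono O.le_hist le_rfl
  have mh : Measurable h := hh.mono O.le_hist le_rfl
  set y : Ω → Fin N → Vec M := fun ω => scale (μ ω) (h ω) with hy
  have my : Measurable y := measurable_scale O.measurable_step' mh
  have hz : Measurable[S ⊔ H] fun ω => x ω + y ω := O.measurable_state hx hh
  have mz : Measurable fun ω => x ω + y ω := mx.add my
  have mx' : Measurable x' := by rw [hx']; exact O.measurable_combine mz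
  -- Every vector below is bounded by a multiple of `R`, so every expression of degree four is
  -- dominated by a multiple of the integrable `R ^ 4`.
  set R : Ω → ℝ := fun ω => ‖x ω‖ + ‖h ω‖ with hRdef
  have hR0 : ∀ ω, 0 ≤ R ω := fun ω => by positivity
  have hR : Integrable (fun ω => R ω ^ 4) P := by
    refine ((hx4.add hh4).const_mul 8).mono' (mx.norm.add mh.norm |>.pow_const 4).aestronglyMeasurable
      (Eventually.of_forall fun ω => ?_)
    rw [Real.norm_of_nonneg (by have := hR0 ω; positivity)]
    simp only [hRdef, Pi.add_apply]
    have := norm_nonneg (x ω)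
    have := norm_nonneg (h ω)
    nlinarith [sq_nonneg (‖x ω‖ - ‖h ω‖), sq_nonneg (‖x ω‖ ^ 2 - ‖h ω‖ ^ 2),
      sq_nonneg (‖x ω‖ + ‖h ω‖), mul_nonneg (sq_nonneg (‖x ω‖ - ‖h ω‖)) (sq_nonneg (‖x ω‖ + ‖h ω‖)),
      mul_nonneg (sq_nonneg (‖x ω‖ - ‖h ω‖)) (sq_nonneg (‖x ω‖ - ‖h ω‖))]
  have cp : Continuous (wavg p : (Fin N → Vec M) → Vec M) := continuous_wavg p
  have bx : ∀ ω, ‖x ω‖ ≤ 1 * R ω := fun ω => by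
    simp only [hRdef]; linarith [norm_nonneg (h ω)]
  have bh : ∀ ω, ‖h ω‖ ≤ 1 * R ω := fun ω => by
    simp only [hRdef]; linarith [norm_nonneg (x ω)]
  have byy : ∀ᵐ ω ∂P, ‖y ω‖ ≤ b * R ω := by
    filter_upwards [hμ] with ω h1
    exact (norm_scale_le hb h1 (h ω)).trans (mul_le_mul_of_nonneg_left (by linarith [bh ω]) hb)
  have bz : ∀ᵐ ω ∂P, ‖x ω + y ω‖ ≤ (1 + b) * R ω := by
    filter_upwards [byy] with ω h1
    refine (norm_add_le _ _).trans ?_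
    linarith [bx ω]
  have bx' : ∀ᵐ ω ∂P, ‖x' ω‖ ≤ (1 + b) * R ω := by
    filter_upwards [bz, O.stoch] with ω h1 h2
    rw [hx']
    exact (norm_combine_le h2 _).trans h1
  -- second-degree quantities
  have qU : ∀ {ξ : Ω → Fin N → Vec M} {k : ℝ}, (∀ᵐ ω ∂P, ‖ξ ω‖ ≤ k * R ω) →
      ∀ᵐ ω ∂P, |‖wavg p (ξ ω)‖ ^ 2| ≤ k ^ 2 * R ω ^ 2 := by
    intro ξ k hk
    filter_upwards [hk] with ω h1
    exact abs_sq_le_of_le (norm_nonneg _) ((norm_wavg_le hp _).trans h1)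
  have qD : ∀ {ξ : Ω → Fin N → Vec M} {k : ℝ}, (∀ᵐ ω ∂P, ‖ξ ω‖ ≤ k * R ω) →
      ∀ᵐ ω ∂P, |disp (ξ ω) ^ 2| ≤ (2 * k) ^ 2 * R ω ^ 2 := by
    intro ξ k hk
    filter_upwards [hk] with ω h1
    refine abs_sq_le_of_le (disp_nonneg _) ((disp_le_two_mul_norm _).trans ?_)
    linarith
  have qV : ∀ (v : Fin N × Fin N → ℝ) {ξ : Ω → Fin N → Vec M} {k : ℝ}, (∀ᵐ ω ∂P, ‖ξ ω‖ ≤ k * R ω) →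
      ∀ᵐ ω ∂P, |qf v (ξ ω)| ≤ ((∑ i, ∑ j, |v (i, j)|) * k ^ 2) * R ω ^ 2 := by
    intro v ξ k hk
    filter_upwards [hk] with ω h1
    refine (abs_qf_le _).trans ?_
    rw [mul_assoc, ← mul_pow]
    exact mul_le_mul_of_nonneg_left (pow_le_pow_left₀ (norm_nonneg _) h1 2)
      (Finset.sum_nonneg fun _ _ => Finset.sum_nonneg fun _ _ => abs_nonneg _)
  have mU : ∀ {ξ : Ω → Fin N → Vec M}, Measurable ξ → Measurable fun ω => ‖wavg p (ξ ω)‖ ^ 2 :=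
    fun hξ => (cp.measurable.comp hξ).norm.pow_const 2
  have mD : ∀ {ξ : Ω → Fin N → Vec M}, Measurable ξ → Measurable fun ω => disp (ξ ω) ^ 2 :=
    fun hξ => (continuous_disp.measurable.comp hξ).pow_const 2
  have mV : ∀ (v : Fin N × Fin N → ℝ) {ξ : Ω → Fin N → Vec M}, Measurable ξ →
      Measurable fun ω => qf v (ξ ω) := fun v ξ hξ => (continuous_qf v).measurable.comp hξ
  have bxa : ∀ᵐ ω ∂P, ‖x ω‖ ≤ 1 * R ω := Eventually.of_forall bx
  have iUV : Integrable (fun ω => ‖wavg p (x ω)‖ ^ 2 * qf v (x ω)) P :=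
    integrable_mul_of_le_sq hR (mU mx) (mV v mx) (qU bxa) (qV v bxa)
  have iDV : Integrable (fun ω => disp (x ω) ^ 2 * qf v (x ω)) P :=
    integrable_mul_of_le_sq hR (mD mx) (mV v mx) (qD bxa) (qV v bxa)
  have iUV' : Integrable (fun ω => ‖wavg p (x' ω)‖ ^ 2 * qf v (x' ω)) P :=
    integrable_mul_of_le_sq hR (mU mx') (mV v mx') (qU bx') (qV v bx')
  have iDV' : Integrable (fun ω => disp (x' ω) ^ 2 * qf v (x' ω)) P :=
    integrable_mul_of_le_sq hR (mD mx') (mV v mx') (qD bx') (qV v bx')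
  have iUV1 : Integrable (fun ω => ‖wavg p (x ω)‖ ^ 2 * qf v (x' ω)) P :=
    integrable_mul_of_le_sq hR (mU mx) (mV v mx') (qU bxa) (qV v bx')
  have iDzV : Integrable (fun ω => disp (x ω + y ω) ^ 2 * qf v (x' ω)) P :=
    integrable_mul_of_le_sq hR (mD mz) (mV v mx') (qD bz) (qV v bx')
  have iUQ : Integrable (fun ω => ‖wavg p (x ω)‖ ^ 2 * qf (Q *ᵥ v) (x ω + y ω)) P :=
    integrable_mul_of_le_sq hR (mU mx) (mV _ mz) (qU bxa) (qV _ bz)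
  have iDQ : Integrable (fun ω => disp (x ω + y ω) ^ 2 * qf (Q *ᵥ v) (x ω + y ω)) P :=
    integrable_mul_of_le_sq hR (mD mz) (mV _ mz) (qD bz) (qV _ bz)
  have qy : ∀ᵐ ω ∂P, |‖y ω‖ ^ 2| ≤ b ^ 2 * R ω ^ 2 := by
    filter_upwards [byy] with ω h1 using abs_sq_le_of_le (norm_nonneg _) h1
  have iUy : Integrable (fun ω => ‖wavg p (x ω)‖ ^ 2 * ‖y ω‖ ^ 2) P :=
    integrable_mul_of_le_sq hR (mU mx) (my.norm.pow_const 2) (qU bxa) qy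
  have iy4 : Integrable (fun ω => ‖y ω‖ ^ 4) P :=
    integrable_pow_four_of_le hR my.norm (fun _ => norm_nonneg _) byy
  have iU4 : Integrable (fun ω => ‖wavg p (x ω)‖ ^ 4) P :=
    integrable_pow_four_of_le hR (cp.measurable.comp mx).norm (fun _ => norm_nonneg _)
      (Eventually.of_forall fun ω => (norm_wavg_le hp _).trans (bx ω))
  have iU4' : Integrable (fun ω => ‖wavg p (x' ω)‖ ^ 4) P :=
    integrable_pow_four_of_le hR (cp.measurable.comp mx').norm (fun _ => norm_nonneg _)
      (by filter_upwards [bx'] with ω h1 using (norm_wavg_le hp _).trans h1)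
  have iD4 : Integrable (fun ω => disp (x ω) ^ 4) P :=
    integrable_pow_four_of_le hR (continuous_disp.measurable.comp mx) (fun _ => disp_nonneg _)
      (Eventually.of_forall fun ω => (disp_le_two_mul_norm _).trans
        (show 2 * ‖x ω‖ ≤ 2 * R ω by linarith [bx ω]))
  have iUD : Integrable (fun ω => ‖wavg p (x ω)‖ ^ 2 * disp (x ω) ^ 2) P :=
    integrable_mul_of_le_sq hR (mU mx) (mD mx) (qU bxa) (qD bxa)
  have hD4w : ∫ ω, disp (x ω) ^ 4 ∂P ≤ ∫ ω, disp (x ω) ^ 2 * qf v (x ω) ∂P := by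
    refine integral_mono iD4 iDV fun ω => ?_
    have : disp (x ω) ^ 4 = disp (x ω) ^ 2 * disp (x ω) ^ 2 := by ring
    simp only [this]
    exact mul_le_mul_of_nonneg_left (hv.lower _) (sq_nonneg _)
  refine ⟨⟨⟨mx', ?_⟩, ?_⟩, ?_, ?_, ?_, ?_⟩
  · exact integrable_pow_four_of_le hR mx'.norm (fun _ => norm_nonneg _) bx'
  · -- fourth power of the average
    set f : Ω → Vec M := fun ω => ‖wavg p (x ω)‖ ^ 2 • wavg p (x ω) with hf
    have mcf : Measurable fun x : Fin N → Vec M => ‖wavg p x‖ ^ 2 • wavg p x := by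
      exact (cp.norm.pow 2 |>.smul cp).measurable
    have mf : Measurable[H] f := mcf.comp hx
    have mf' : Measurable f := mf.mono O.le_hist le_rfl
    have hfi : ∀ {ξ : Ω → Fin N → Vec M} (_ : Measurable ξ) {k : ℝ} (_ : ∀ᵐ ω ∂P, ‖ξ ω‖ ≤ k * R ω)
        (l : Fin N), Integrable (fun ω => inner ℝ (f ω) (ξ ω l)) P := by
      intro ξ mξ k hk l
      have : (fun ω => inner ℝ (f ω) (ξ ω l)) = fun ω => ‖wavg p (x ω)‖ ^ 2 *
          inner ℝ (wavg p (x ω)) (ξ ω l) := by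
        funext ω; simp only [hf, real_inner_smul_left]
      rw [this]
      refine integrable_mul_of_le_sq (L := 1 * k) hR (mU mx) ?_ (qU bxa) ?_
      · exact (cp.measurable.comp mx).inner ((measurable_pi_apply l).comp mξ)
      · filter_upwards [hk] with ω h1
        refine (abs_real_inner_le_norm _ _).trans ?_
        calc ‖wavg p (x ω)‖ * ‖ξ ω l‖ ≤ (1 * R ω) * (k * R ω) :=
              mul_le_mul ((norm_wavg_le hp _).trans (bx ω)) ((norm_le_pi_norm _ l).trans h1)
                (norm_nonneg _) (by linarith [hR0 ω])
          _ = _ := by ring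
    -- The linear term pairs the new average with `‖u‖² u`, a function of the history. In its mean
    -- the combination disappears and only the mean increments remain.
    obtain ⟨i1, e1⟩ := O.integral_inner_wavg hx hh mf (hfi mx bxa)
      (hfi mh (Eventually.of_forall bh)) hpA
    have e2 : ∀ ξ : Vec M, ∀ ω, inner ℝ (f ω) ξ
        = ‖wavg p (x ω)‖ ^ 2 * inner ℝ (wavg p (x ω)) ξ := by
      intro ξ ω; simp only [hf, real_inner_smul_left]
    simp only [e2] at i1 e1
    have i0 : Integrable (fun ω => ‖wavg p (x ω)‖ ^ 2 *
        inner ℝ (wavg p (x ω)) (wavg p (x ω))) P := by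
      refine iU4.congr (Eventually.of_forall fun ω => ?_)
      simp only [real_inner_self_eq_norm_sq]; ring
    have hle := (HasInt.of_integrable iU4').mono_ae
      (((HasInt.of_integrable iU4).add (((HasInt.of_integrable i1).sub
        (HasInt.of_integrable i0)).const_mul 4)).add
        (((((HasInt.of_integrable iUD).const_mul 16).add
          ((HasInt.of_integrable iUy).const_mul 16)).add
          ((HasInt.of_integrable iD4).const_mul 24)).add
          ((HasInt.of_integrable iy4).const_mul 24))) (by
        filter_upwards [O.stoch] with ω h1
        rw [hx']
        exact norm_wavg_combine_pow_four_le hp h1 (x ω) (y ω))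
    have hUD : ∫ ω, ‖wavg p (x ω)‖ ^ 2 * disp (x ω) ^ 2 ∂P
        ≤ ∫ ω, ‖wavg p (x ω)‖ ^ 2 * qf v (x ω) ∂P :=
      integral_mono iUD iUV fun ω => mul_le_mul_of_nonneg_left (hv.lower _) (sq_nonneg _)
    rw [e1] at hle
    linarith
  · have h1 := (HasInt.of_integrable iUV').mono_ae
      (((HasInt.of_integrable iUV1).const_mul (1 + θ)).add
        (((HasInt.of_integrable iD4).add (HasInt.of_integrable iy4)).const_mul
          ((1 + 1 / θ) * (26 * c)))) (by
        filter_upwards [O.stoch] with ω h1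
        rw [hx']
        exact norm_wavg_combine_sq_mul_qf_le hp h1 hv (x ω) (y ω))
    -- The weight `‖u‖²` is independent of the combination matrix, so the average over that matrix
    -- acts on the form alone.
    have e1 := (O.integral_mul_qf_combine hz (φ := fun ω => ‖wavg p (x ω)‖ ^ 2)
      (((cp.norm.pow 2).measurable.comp hx).mono le_sup_right le_rfl) (fun k l => by
        refine integrable_mul_of_le_sq (L := (1 + b) ^ 2) hR (mU mx) ?_ (qU bxa) ?_
        · exact ((measurable_pi_apply k).comp mz).inner ((measurable_pi_apply l).comp mz)
        · filter_upwards [bz] with ω h1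
          refine (abs_real_inner_le_norm _ _).trans ?_
          rw [← mul_pow, sq]
          exact mul_le_mul ((norm_le_pi_norm _ k).trans h1) ((norm_le_pi_norm _ l).trans h1)
            (norm_nonneg _) ((norm_nonneg _).trans h1)) v).2
    have e2 : ∫ ω, ‖wavg p (x ω)‖ ^ 2 * qf v (x' ω) ∂P
        = ∫ ω, ‖wavg p (x ω)‖ ^ 2 * qf (Q *ᵥ v) (x ω + y ω) ∂P := by rw [hx']; exact e1
    have h2 : ∫ ω, ‖wavg p (x ω)‖ ^ 2 * qf (Q *ᵥ v) (x ω + y ω) ∂P ≤ ∫ ω,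
        ((1 - 3 * θ) * (‖wavg p (x ω)‖ ^ 2 * qf v (x ω))
          + (1 + 1 / θ) * (4 * c) * (‖wavg p (x ω)‖ ^ 2 * ‖y ω‖ ^ 2)) ∂P := by
      refine integral_mono iUQ ((iUV.const_mul _).add (iUy.const_mul _)) fun ω => ?_
      have := mul_le_mul_of_nonneg_left (hv.qf_step_le (x ω) (y ω)) (sq_nonneg ‖wavg p (x ω)‖)
      simp only
      linarith
    rw [integral_add (iUV.const_mul _) (iUy.const_mul _), integral_const_mul,
      integral_const_mul] at h2
    rw [e2] at h1
    have hc0 : 0 ≤ (1 + 1 / θ) * (26 * c) := by have := hv.one_le; positivity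
    have h3 := mul_le_mul_of_nonneg_left h2 (by linarith : 0 ≤ 1 + θ)
    have h4 := mul_le_mul_of_nonneg_left hD4w hc0
    linarith
  -- Combining never increases the disagreement, so the first factor may be replaced by its value
  -- before the combination. This one is independent of the matrix, and the form alone is averaged.
  · have h1 : ∫ ω, disp (x' ω) ^ 2 * qf v (x' ω) ∂P
        ≤ ∫ ω, disp (x ω + y ω) ^ 2 * qf v (x' ω) ∂P := by
      refine integral_mono_ae iDV' iDzV ?_
      filter_upwards [O.stoch] with ω h1
      refine mul_le_mul_of_nonneg_right ?_ (hv.qf_nonneg _)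
      refine pow_le_pow_left₀ (disp_nonneg _) ?_ 2
      rw [hx']; exact disp_combine_le h1 _
    have e1 := (O.integral_mul_qf_combine hz (φ := fun ω => disp (x ω + y ω) ^ 2)
      ((continuous_disp.pow 2).measurable.comp hz) (fun k l => by
        refine integrable_mul_of_le_sq (L := (1 + b) ^ 2) hR (mD mz) ?_ (qD bz) ?_
        · exact ((measurable_pi_apply k).comp mz).inner ((measurable_pi_apply l).comp mz)
        · filter_upwards [bz] with ω h1
          refine (abs_real_inner_le_norm _ _).trans ?_
          rw [← mul_pow, sq]
          exact mul_le_mul ((norm_le_pi_norm _ k).trans h1) ((norm_le_pi_norm _ l).trans h1)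
            (norm_nonneg _) ((norm_nonneg _).trans h1)) v).2
    have e2 : ∫ ω, disp (x ω + y ω) ^ 2 * qf v (x' ω) ∂P
        = ∫ ω, disp (x ω + y ω) ^ 2 * qf (Q *ᵥ v) (x ω + y ω) ∂P := by rw [hx']; exact e1
    rw [e2] at h1
    refine h1.trans ?_
    rw [← integral_const_mul, ← integral_const_mul,
      ← integral_add (iDV.const_mul _) (iy4.const_mul _)]
    exact integral_mono iDQ ((iDV.const_mul _).add (iy4.const_mul _)) fun ω => hK (x ω) (y ω)
  · have iUh : ∀ l, Integrable (fun ω => ‖wavg p (x ω)‖ ^ 2 * ‖h ω l‖ ^ 2) P := fun l =>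
      integrable_mul_of_le_sq (L := 1 ^ 2) hR (mU mx)
        (((measurable_pi_apply l).comp mh).norm.pow_const 2) (qU bxa)
        (Eventually.of_forall fun ω => abs_sq_le_of_le (norm_nonneg _)
          ((norm_le_pi_norm _ l).trans (bh ω)))
    have i2 : ∀ l, Integrable (fun ω => μ ω l ^ 2 * (‖wavg p (x ω)‖ ^ 2 * ‖h ω l‖ ^ 2)) P :=
      fun l => O.integrable_step_pow_mul (iUh l) l 2
    have h1 : ∫ ω, ‖wavg p (x ω)‖ ^ 2 * ‖y ω‖ ^ 2 ∂P
        ≤ ∫ ω, ∑ l, μ ω l ^ 2 * (‖wavg p (x ω)‖ ^ 2 * ‖h ω l‖ ^ 2) ∂P := by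
      refine integral_mono iUy (integrable_finsetSum _ fun l _ => i2 l) fun ω => ?_
      have := mul_le_mul_of_nonneg_left (norm_scale_sq_le (μ ω) (h ω)) (sq_nonneg ‖wavg p (x ω)‖)
      refine this.trans (le_of_eq ?_)
      rw [Finset.mul_sum]
      exact Finset.sum_congr rfl fun l _ => by ring
    rw [integral_finsetSum _ fun l _ => i2 l] at h1
    refine h1.trans (le_of_eq (Finset.sum_congr rfl fun l _ => ?_))
    have m1 : Measurable[H] fun ω => ‖wavg p (x ω)‖ ^ 2 := (cp.norm.pow 2).measurable.comp hx
    have m3 : Measurable fun q : Fin N → Vec M => ‖q l‖ ^ 2 := by fun_prop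
    have m4 : Measurable[H] fun ω => ‖h ω l‖ ^ 2 := m3.comp hh
    have mq : Measurable[H] fun ω => ‖wavg p (x ω)‖ ^ 2 * ‖h ω l‖ ^ 2 := m1.mul m4
    rw [O.integral_step_pow_mul mq l 2]
    congr 1
    rw [← O.mean_step_mul]
    simp only [sq]
  · have ih : ∀ l, Integrable (fun ω => ‖h ω l‖ ^ 4) P := fun l =>
      integrable_pow_four_of_le hR ((measurable_pi_apply l).comp mh).norm (fun _ => norm_nonneg _)
        (Eventually.of_forall fun ω => (norm_le_pi_norm _ l).trans (bh ω))
    have i2 : ∀ l, Integrable (fun ω => μ ω l ^ 4 * ‖h ω l‖ ^ 4) P :=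
      fun l => O.integrable_step_pow_mul (ih l) l 4
    have h1 : ∫ ω, ‖y ω‖ ^ 4 ∂P ≤ ∫ ω, ∑ l, μ ω l ^ 4 * ‖h ω l‖ ^ 4 ∂P :=
      integral_mono iy4 (integrable_finsetSum _ fun l _ => i2 l) fun ω =>
        norm_scale_pow_four_le (μ ω) (h ω)
    rw [integral_finsetSum _ fun l _ => i2 l] at h1
    refine h1.trans (le_of_eq (Finset.sum_congr rfl fun l _ => ?_))
    have mm : Measurable fun q : Fin N → Vec M => ‖q l‖ ^ 4 := by fun_prop
    have mq : Measurable[H] fun ω => ‖h ω l‖ ^ 4 := mm.comp hh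
    exact O.integral_step_pow_mul mq l 4

end OneStep

end FourthMoments

/-! ### The error recursion and its fourth-order moments -/

section ErrorProcess

variable {N M : ℕ}

/-- The error recursion `x (i+1) = Aᵢᵀ (x i + μᵢ (g (x i) + s i))`, where `g` is the (deterministic)
drift and `s i` the gradient noise, together with the conditions on moments. -/
structure DiffusionProcess {Ω : Type*} {mΩ : MeasurableSpace Ω} (P : Measure Ω)
    (g : Fin N → Vec M → Vec M)
    (Abar : Matrix (Fin N) (Fin N) ℝ) (Q : Matrix (Fin N × Fin N) (Fin N × Fin N) ℝ)
    (mbar : Fin N → ℝ) (m2 : Fin N → Fin N → ℝ) (m β σ c : ℝ)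
    (F : ℕ → MeasurableSpace Ω) (A : ℕ → Ω → Matrix (Fin N) (Fin N) ℝ) (μ : ℕ → Ω → Fin N → ℝ)
    (x s : ℕ → Ω → Fin N → Vec M) : Prop where
  oneStep : ∀ i, ∃ S C H : MeasurableSpace Ω, F i ≤ H ∧ Measurable[H] (s i) ∧
    OneStep P S C H (A i) (μ i) Abar Q mbar m2
  measurable_state : ∀ i, Measurable[F i] (x i)
  recursion : ∀ i, ∀ᵐ ω ∂P, x (i + 1) ω
    = combine (A i ω) (x i ω + scale (μ i ω) (fun l => g l (x i ω l) + s i ω l))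
  init : Integrable (fun ω => ‖x 0 ω‖ ^ 4) P
  noise_integrable : ∀ i, Integrable (fun ω => ‖s i ω‖ ^ 4) P
  unbiased : ∀ i l a (f : Ω → ℝ), Measurable[F i] f → Integrable (fun ω => f ω * s i ω l a) P →
    ∫ ω, f ω * s i ω l a ∂P = 0
  uncorrelated : ∀ i k l, k ≠ l → ∀ a b, ∫ ω, s i ω k a * s i ω l b ∂P = 0
  noise_fourth : ∀ i l, ∫ ω, ‖s i ω l‖ ^ 4 ∂P ≤ β * ∫ ω, ‖x i ω l‖ ^ 4 ∂P + σ
  m_pos : 0 < m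
  mbar_pos : ∀ k, 0 < mbar k
  mbar_le : ∀ k, mbar k ≤ m
  step_sq : ∀ k, m2 k k ≤ mbar k * m
  step_fourth : ∀ i k, ∫ ω, μ i ω k ^ 4 ∂P ≤ c * mbar k * m ^ 2

/-- Here `a`, `b`, `w` stand for the fourth moment of the average, the mixed moment and the
disagreement moment. The last two contract at the fixed rate `θ`, so weights `Λ₁` and then `Λ₂` of
order `1 / θ` absorb all their couplings into `a`. Of the slow contraction `4 ν₀ η a`, one share
pays for the noise term `p2` (hence the choice `t = ν₀ / A2`), one for the part of `B η m²`
proportional to `a`, and one is kept as the rate `ν₀ η`. -/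
theorem fourth_moment_algebra {ν₀ θ C₁ K₁ K₂ K₃ K₄ K₅ : ℝ} (hν : 0 < ν₀) (hθ : 0 < θ) (hθ4 : θ ≤ 1 / 4)
    (hC₁ : 0 ≤ C₁) (hK₁ : 0 ≤ K₁) (hK₂ : 0 ≤ K₂) (hK₃ : 0 ≤ K₃) (hK₄ : 0 ≤ K₄) (hK₅ : 0 ≤ K₅) :
    ∃ Λ₁ Λ₂ B : ℝ, 1 ≤ Λ₁ ∧ 1 ≤ Λ₂ ∧ 0 < B ∧ ∀ a b w a' b' w' p2 p4 η m : ℝ, 0 ≤ a → 0 ≤ b → 0 ≤ w →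
      0 < η → η ≤ 1 → ν₀ * η ≤ θ / 4 → B * m ^ 2 ≤ ν₀ →
      a' ≤ a + 4 * (-(ν₀ * η * a) + C₁ * η * b) + 16 * b + 16 * p2 + 24 * w + 24 * p4 →
      b' ≤ (1 + θ) * ((1 - 3 * θ) * b + K₁ * p2) + K₂ * (w + p4) →
      w' ≤ (1 - θ) * w + K₃ * p4 →
      (∀ t > 0, p2 ≤ η * (t * a + m ^ 2 / (4 * t) * (K₄ * (a + w + 1)))) →
      p4 ≤ η * m ^ 2 * (K₅ * (a + w + 1)) →
      a' + Λ₁ * b' + Λ₂ * w' ≤ (1 - ν₀ * η) * (a + Λ₁ * b + Λ₂ * w) + B * η * m ^ 2 := by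
  obtain ⟨Λ₁, hΛ₁⟩ : ∃ z, z = (4 * C₁ + 16) / θ := ⟨_, rfl⟩
  have hΛ₁θ : Λ₁ * θ = 4 * C₁ + 16 := by rw [hΛ₁]; field_simp
  have hΛ₁0 : 0 < Λ₁ := by rw [hΛ₁]; positivity
  obtain ⟨Λ₂, hΛ₂⟩ : ∃ z, z = 2 * (Λ₁ * K₂ + 24) / θ := ⟨_, rfl⟩
  have hΛ₂θ : Λ₂ * θ = 2 * (Λ₁ * K₂ + 24) := by rw [hΛ₂]; field_simp
  have hΛ₂0 : 0 < Λ₂ := by rw [hΛ₂]; positivity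
  have hΛ₁1 : 1 ≤ Λ₁ := by nlinarith
  have hΛ₂1 : 1 ≤ Λ₂ := by nlinarith [mul_nonneg hΛ₁0.le hK₂]
  obtain ⟨A2, hA2⟩ : ∃ z, z = 16 + Λ₁ * (1 + θ) * K₁ := ⟨_, rfl⟩
  have hA20 : 0 < A2 := by rw [hA2]; positivity
  obtain ⟨A4, hA4⟩ : ∃ z, z = 24 + Λ₁ * K₂ + Λ₂ * K₃ := ⟨_, rfl⟩
  have hA40 : 0 < A4 := by rw [hA4]; positivity
  obtain ⟨B, hB⟩ : ∃ z, z = A2 ^ 2 * K₄ / (4 * ν₀) + A4 * K₅ + 1 := ⟨_, rfl⟩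
  have hB0 : 0 < B := by rw [hB]; positivity
  refine ⟨Λ₁, Λ₂, B, hΛ₁1, hΛ₂1, hB0, ?_⟩
  intro a b w a' b' w' p2 p4 η m ha hb hw hη hη1 hηθ hBm h1 h2 h3 h4 h5
  have h6 : A2 * p2 ≤ η * (ν₀ * a) + η * m ^ 2 * (A2 ^ 2 * K₄ / (4 * ν₀)) * (a + w + 1) := by
    have := mul_le_mul_of_nonneg_left (h4 (ν₀ / A2) (by positivity)) hA20.le
    refine this.trans (le_of_eq ?_)
    field_simp
  have h7 : A4 * p4 ≤ η * m ^ 2 * (A4 * K₅) * (a + w + 1) := by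
    have := mul_le_mul_of_nonneg_left h5 hA40.le
    linarith
  have h8 : A2 * p2 + A4 * p4 ≤ η * (ν₀ * a) + B * η * m ^ 2 * (a + w + 1) := by
    have h9 : B * η * m ^ 2 * (a + w + 1) = η * m ^ 2 * (A2 ^ 2 * K₄ / (4 * ν₀)) * (a + w + 1)
      + η * m ^ 2 * (A4 * K₅) * (a + w + 1) + η * m ^ 2 * (a + w + 1) := by rw [hB]; ring
    have : 0 ≤ η * m ^ 2 * (a + w + 1) := by positivity
    linarith
  have h10 : B * η * m ^ 2 * (a + w + 1) ≤ ν₀ * η * a + ν₀ * η * w + B * η * m ^ 2 := by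
    have h11 : B * m ^ 2 * (η * (a + w)) ≤ ν₀ * (η * (a + w)) :=
      mul_le_mul_of_nonneg_right hBm (by positivity)
    linarith only [h11]
  have hb2 := mul_le_mul_of_nonneg_left h2 hΛ₁0.le
  have hw2 := mul_le_mul_of_nonneg_left h3 hΛ₂0.le
  have hηb : C₁ * η * b ≤ C₁ * b := by
    have := mul_le_mul_of_nonneg_left hη1 (mul_nonneg hC₁ hb)
    linarith
  have e3 : 0 ≤ (Λ₁ * θ) * θ * b := by positivity
  have hwη : ν₀ * η * w ≤ θ / 4 * w := mul_le_mul_of_nonneg_right hηθ hw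
  have hwη2 : ν₀ * η * (Λ₂ * w) ≤ θ / 4 * (Λ₂ * w) :=
    mul_le_mul_of_nonneg_right hηθ (by positivity)
  have hbη2 : ν₀ * η * (Λ₁ * b) ≤ θ / 4 * (Λ₁ * b) :=
    mul_le_mul_of_nonneg_right hηθ (by positivity)
  have hww : θ / 4 * w ≤ θ / 4 * (Λ₂ * w) := by
    exact mul_le_mul_of_nonneg_left (le_mul_of_one_le_left hw hΛ₂1) (by positivity)
  have haη : 0 ≤ ν₀ * η * a := by positivity
  have hA2p : 16 * p2 + Λ₁ * (1 + θ) * K₁ * p2 = A2 * p2 := by rw [hA2]; ring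
  have hA4p : 24 * p4 + Λ₁ * K₂ * p4 + Λ₂ * K₃ * p4 = A4 * p4 := by rw [hA4]; ring
  have f1 : Λ₁ * θ * b = (4 * C₁ + 16) * b := by rw [hΛ₁θ]
  have f2 : Λ₂ * θ * w = 2 * (Λ₁ * K₂ + 24) * w := by rw [hΛ₂θ]
  have f4 : 0 ≤ Λ₁ * θ * b := by positivity
  linear_combination h1 + hb2 + hw2 + 4 * hηb + hA2p + hA4p + h8 + h10 - f1 - (1 / 2) * f2 + 3 * e3
    + hwη + hww + haη + hbη2 + (3 / 4) * f4 + hwη2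

theorem tendsto_geometric_bound {Φ : ℕ → ℝ} {κ B : ℝ} (hκ : 0 < κ) (hκ1 : κ ≤ 1) (hB : 0 < B)
    (h : ∀ i, Φ (i + 1) ≤ (1 - κ) * Φ i + κ * B) : ∀ᶠ i in atTop, Φ i ≤ 2 * B := by
  have key : ∀ i, Φ i - B ≤ (1 - κ) ^ i * (Φ 0 - B) := by
    intro i
    induction i with
    | zero => simp
    | succ i ih =>
      have := mul_le_mul_of_nonneg_left ih (by linarith : 0 ≤ 1 - κ)
      rw [pow_succ']
      linarith [h i]
  have ht : Tendsto (fun i : ℕ => (1 - κ) ^ i * (Φ 0 - B)) atTop (𝓝 0) := by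
    simpa using (tendsto_pow_atTop_nhds_zero_of_lt_one (by linarith : 0 ≤ 1 - κ)
      (by linarith)).mul_const (Φ 0 - B)
  filter_upwards [ht.eventually_lt_const hB] with i hi
  linarith [key i]

theorem abs_coord_le_norm (v : Vec M) (a : Fin M) : |v a| ≤ ‖v‖ := by
  rw [← Real.norm_eq_abs]; exact PiLp.norm_apply_le v a

namespace DiffusionProcess

universe u

variable {Ω : Type u} {mΩ : MeasurableSpace Ω} {P : Measure Ω} [IsProbabilityMeasure P]
  {g : Fin N → Vec M → Vec M} {Abar : Matrix (Fin N) (Fin N) ℝ}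
  {Q : Matrix (Fin N × Fin N) (Fin N × Fin N) ℝ} {mbar : Fin N → ℝ} {m2 : Fin N → Fin N → ℝ}
  {m β σ c : ℝ} {F : ℕ → MeasurableSpace Ω} {A : ℕ → Ω → Matrix (Fin N) (Fin N) ℝ}
  {μ : ℕ → Ω → Fin N → ℝ} {x s : ℕ → Ω → Fin N → Vec M}
  {H : Fin N → Vec M →L[ℝ] Vec M} {ν δ e : ℝ}

theorem measurable_x (D : DiffusionProcess P g Abar Q mbar m2 m β σ c F A μ x s) (i : ℕ) :
    Measurable (x i) := by
  obtain ⟨S, C, H, hF, hs, O⟩ := D.oneStep i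
  exact (D.measurable_state i).mono (hF.trans O.le_hist) le_rfl

theorem measurable_s (D : DiffusionProcess P g Abar Q mbar m2 m β σ c F A μ x s) (i : ℕ) :
    Measurable (s i) := by
  obtain ⟨S, C, H, hF, hs, O⟩ := D.oneStep i
  exact hs.mono O.le_hist le_rfl

theorem measurable_drift (hg : CostBounds g H ν δ e) :
    Measurable fun y : Fin N → Vec M => fun l => g l (y l) := by
  refine measurable_pi_lambda _ fun l => ?_
  exact (hg.continuous l).measurable.comp (measurable_pi_apply l)

theorem norm_drift_le (hg : CostBounds g H ν δ e) (y : Fin N → Vec M) :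
    ‖fun l => g l (y l)‖ ≤ δ * ‖y‖ := by
  have := hg.delta_pos
  refine (pi_norm_le_iff_of_nonneg (by positivity)).2 fun l => ?_
  have h := hg.lipschitz l (y l) 0
  rw [hg.zero, sub_zero, sub_zero] at h
  exact h.trans (mul_le_mul_of_nonneg_left (norm_le_pi_norm y l) hg.delta_pos.le)

theorem add_pow_four_le {a b : ℝ} : (a + b) ^ 4 ≤ 8 * (a ^ 4 + b ^ 4) := by
  nlinarith [sq_nonneg (a - b), sq_nonneg (a ^ 2 - b ^ 2), sq_nonneg (a + b),
    mul_nonneg (sq_nonneg (a - b)) (sq_nonneg (a + b)),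
    mul_nonneg (sq_nonneg (a - b)) (sq_nonneg (a - b))]

theorem integrable_h (D : DiffusionProcess P g Abar Q mbar m2 m β σ c F A μ x s)
    (hg : CostBounds g H ν δ e) {i : ℕ} (hx : Integrable (fun ω => ‖x i ω‖ ^ 4) P) :
    Integrable (fun ω => ‖fun l => g l (x i ω l) + s i ω l‖ ^ 4) P := by
  have mx := D.measurable_x i
  have ms := D.measurable_s i
  refine ((((hx.const_mul (δ ^ 4)).add (D.noise_integrable i))).const_mul 8).mono'
    ((((measurable_drift hg).comp mx).add ms).norm.pow_const 4).aestronglyMeasurable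
    (Eventually.of_forall fun ω => ?_)
  rw [Real.norm_of_nonneg (by positivity)]
  simp only [Pi.add_apply]
  have h1 : ‖fun l => g l (x i ω l) + s i ω l‖ ≤ δ * ‖x i ω‖ + ‖s i ω‖ :=
    (norm_add_le (fun l => g l (x i ω l)) (s i ω)).trans (add_le_add (norm_drift_le hg _) le_rfl)
  calc _ ≤ (δ * ‖x i ω‖ + ‖s i ω‖) ^ 4 := pow_le_pow_left₀ (norm_nonneg _) h1 4
    _ ≤ 8 * ((δ * ‖x i ω‖) ^ 4 + ‖s i ω‖ ^ 4) := add_pow_four_le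
    _ = _ := by ring

set_option maxHeartbeats 1000000 in
-- These are the inputs of `fourth_moment_algebra`: all moments of state and increment in terms of
-- the three Lyapunov quantities. The drift bound compares `g l (x l)` with `g l u` at the average
-- `u`: strong monotonicity gives `-ν ‖u‖²`, the Lipschitz constant gives an error `δ ‖u‖ disp`, and
-- half of the former is spent on the latter.
theorem wavg_moments_le (D : DiffusionProcess P g Abar Q mbar m2 m β σ c F A μ x s)
    (hg : CostBounds g H ν δ e) {p : Fin N → ℝ} (hp : ProbVec p)
    {v : Fin N × Fin N → ℝ} {cv : ℝ} (hv : IsLyapunov M Q v cv) (hβ : 0 ≤ β) (hσ : 0 ≤ σ)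
    {i : ℕ} (hx4 : Integrable (fun ω => ‖x i ω‖ ^ 4) P) :
    (∫ ω, ‖x i ω‖ ^ 4 ∂P ≤ 8 * (∫ ω, ‖wavg p (x i ω)‖ ^ 4 ∂P
      + ∫ ω, disp (x i ω) ^ 2 * qf v (x i ω) ∂P)) ∧
    (∀ l, ∫ ω, ‖g l (x i ω l) + s i ω l‖ ^ 4 ∂P ≤ (64 * (δ ^ 4 + β) + 8 * σ) *
      (∫ ω, ‖wavg p (x i ω)‖ ^ 4 ∂P + ∫ ω, disp (x i ω) ^ 2 * qf v (x i ω) ∂P + 1)) ∧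
    (∀ l, ∫ ω, ‖wavg p (x i ω)‖ ^ 2 * inner ℝ (wavg p (x i ω)) (g l (x i ω l) + s i ω l) ∂P
      ≤ -(ν / 2 * ∫ ω, ‖wavg p (x i ω)‖ ^ 4 ∂P)
        + δ ^ 2 / (2 * ν) * ∫ ω, ‖wavg p (x i ω)‖ ^ 2 * qf v (x i ω) ∂P) ∧
    ∀ t > 0, ∀ l, m * ∫ ω, ‖wavg p (x i ω)‖ ^ 2 * ‖g l (x i ω l) + s i ω l‖ ^ 2 ∂P
      ≤ t * ∫ ω, ‖wavg p (x i ω)‖ ^ 4 ∂P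
        + m ^ 2 / (4 * t) * ∫ ω, ‖g l (x i ω l) + s i ω l‖ ^ 4 ∂P := by
  have hν := hg.nu_pos
  have hδ := hg.delta_pos
  have mx := D.measurable_x i
  have ms := D.measurable_s i
  have hxF := D.measurable_state i
  set h : ℕ → Ω → Fin N → Vec M := fun i ω l => g l (x i ω l) + s i ω l with hh
  have hh4 : Integrable (fun ω => ‖h i ω‖ ^ 4) P := D.integrable_h hg hx4
  have mh : Measurable (h i) := ((measurable_drift hg).comp mx).add ms
  set a : ℕ → ℝ := fun i => ∫ ω, ‖wavg p (x i ω)‖ ^ 4 ∂P with ha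
  set b : ℕ → ℝ := fun i => ∫ ω, ‖wavg p (x i ω)‖ ^ 2 * qf v (x i ω) ∂P with hb
  set w : ℕ → ℝ := fun i => ∫ ω, disp (x i ω) ^ 2 * qf v (x i ω) ∂P with hw
  set K₄ := 64 * (δ ^ 4 + β) + 8 * σ with hK₄
  set R : Ω → ℝ := fun ω => ‖x i ω‖ + ‖s i ω‖ with hRdef
  have hR : Integrable (fun ω => R ω ^ 4) P := by
    refine ((hx4.add (D.noise_integrable i)).const_mul 8).mono'
      ((mx.norm.add ms.norm).pow_const 4).aestronglyMeasurable (Eventually.of_forall fun ω => ?_)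
    rw [Real.norm_of_nonneg (by positivity)]
    exact add_pow_four_le
  have bx : ∀ ω, ‖x i ω‖ ≤ 1 * R ω := fun ω => by
    simp only [hRdef]; linarith [norm_nonneg (s i ω)]
  have bs : ∀ ω, ‖s i ω‖ ≤ 1 * R ω := fun ω => by
    simp only [hRdef]; linarith [norm_nonneg (x i ω)]
  have cp : Continuous (wavg p : (Fin N → Vec M) → Vec M) := continuous_wavg p
  have bU : ∀ ω, ‖wavg p (x i ω)‖ ≤ 1 * R ω := fun ω => (norm_wavg_le hp _).trans (bx ω)
  have mU : Measurable fun ω => wavg p (x i ω) := cp.measurable.comp mx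
  have iU4 : Integrable (fun ω => ‖wavg p (x i ω)‖ ^ 4) P :=
    integrable_pow_four_of_le hR mU.norm (fun _ => norm_nonneg _) (Eventually.of_forall bU)
  have iDV : Integrable (fun ω => disp (x i ω) ^ 2 * qf v (x i ω)) P := by
    refine integrable_mul_of_le_sq (K := 2 ^ 2) (L := ∑ i, ∑ j, |v (i, j)|) hR
      ((continuous_disp.measurable.comp mx).pow_const 2)
      ((continuous_qf v).measurable.comp mx) (Eventually.of_forall fun ω => ?_)
      (Eventually.of_forall fun ω => ?_)
    · refine abs_sq_le_of_le (disp_nonneg _) ((disp_le_two_mul_norm _).trans ?_)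
      linarith [bx ω]
    · refine (abs_qf_le _).trans (mul_le_mul_of_nonneg_left ?_ (by positivity))
      exact pow_le_pow_left₀ (norm_nonneg _) (by linarith [bx ω]) 2
  have iUV : Integrable (fun ω => ‖wavg p (x i ω)‖ ^ 2 * qf v (x i ω)) P := by
    refine integrable_mul_of_le_sq (K := 1 ^ 2) (L := ∑ i, ∑ j, |v (i, j)|) hR
      (mU.norm.pow_const 2)
      ((continuous_qf v).measurable.comp mx) (Eventually.of_forall fun ω => ?_)
      (Eventually.of_forall fun ω => ?_)
    · exact abs_sq_le_of_le (norm_nonneg _) (bU ω)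
    · refine (abs_qf_le _).trans (mul_le_mul_of_nonneg_left ?_ (by positivity))
      exact pow_le_pow_left₀ (norm_nonneg _) (by linarith [bx ω]) 2
  have hxaw : ∫ ω, ‖x i ω‖ ^ 4 ∂P ≤ 8 * (a i + w i) := by
    refine (HasInt.of_integrable hx4).mono_ae (((HasInt.of_integrable iU4).add
      (HasInt.of_integrable iDV)).const_mul 8) (Eventually.of_forall fun ω => ?_)
    have h1 := pow_le_pow_left₀ (norm_nonneg _) (norm_le_wavg_add_disp hp (x i ω)) 4
    refine h1.trans (add_pow_four_le.trans ?_)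
    have h2 := mul_le_mul_of_nonneg_left (hv.lower (x i ω)) (sq_nonneg (disp (x i ω)))
    nlinarith
  have hh4l : ∀ l, Integrable (fun ω => ‖h i ω l‖ ^ 4) P := fun l =>
    integrable_pow_four_of_le hh4 ((measurable_pi_apply l).comp mh).norm (fun _ => norm_nonneg _)
      (Eventually.of_forall fun ω => (norm_le_pi_norm (h i ω) l).trans (one_mul _).ge)
  have hxl : ∀ l, Integrable (fun ω => ‖x i ω l‖ ^ 4) P := fun l =>
    integrable_pow_four_of_le hx4 ((measurable_pi_apply l).comp mx).norm (fun _ => norm_nonneg _)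
      (Eventually.of_forall fun ω => (norm_le_pi_norm (x i ω) l).trans (one_mul _).ge)
  have hsl : ∀ l, Integrable (fun ω => ‖s i ω l‖ ^ 4) P := fun l =>
    integrable_pow_four_of_le (D.noise_integrable i) ((measurable_pi_apply l).comp ms).norm
      (fun _ => norm_nonneg _)
      (Eventually.of_forall fun ω => (norm_le_pi_norm (s i ω) l).trans (one_mul _).ge)
  have hhK : ∀ l, ∫ ω, ‖h i ω l‖ ^ 4 ∂P ≤ K₄ * (a i + w i + 1) := by
    intro l
    have h1 : ∫ ω, ‖h i ω l‖ ^ 4 ∂P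
        ≤ 8 * (δ ^ 4 * ∫ ω, ‖x i ω l‖ ^ 4 ∂P + ∫ ω, ‖s i ω l‖ ^ 4 ∂P) := by
      refine (HasInt.of_integrable (hh4l l)).mono_ae ((((HasInt.of_integrable (hxl l)).const_mul
        (δ ^ 4)).add (HasInt.of_integrable (hsl l))).const_mul 8) (Eventually.of_forall fun ω => ?_)
      have h2 : ‖h i ω l‖ ≤ δ * ‖x i ω l‖ + ‖s i ω l‖ := by
        refine (norm_add_le _ _).trans (add_le_add ?_ le_rfl)
        have h := hg.lipschitz l (x i ω l) 0
        rwa [hg.zero, sub_zero, sub_zero] at h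
      calc _ ≤ (δ * ‖x i ω l‖ + ‖s i ω l‖) ^ 4 := pow_le_pow_left₀ (norm_nonneg _) h2 4
        _ ≤ 8 * ((δ * ‖x i ω l‖) ^ 4 + ‖s i ω l‖ ^ 4) := add_pow_four_le
        _ = _ := by ring
    have h3 : ∫ ω, ‖x i ω l‖ ^ 4 ∂P ≤ ∫ ω, ‖x i ω‖ ^ 4 ∂P :=
      integral_mono (hxl l) hx4 fun ω => pow_le_pow_left₀ (norm_nonneg _)
        (norm_le_pi_norm (x i ω) l) 4
    have h4 := D.noise_fourth i l
    have h5 : (δ ^ 4 + β) * ∫ ω, ‖x i ω l‖ ^ 4 ∂P ≤ (δ ^ 4 + β) * (8 * (a i + w i)) :=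
      mul_le_mul_of_nonneg_left (h3.trans hxaw) (by positivity)
    have ha0 : 0 ≤ a i := integral_nonneg fun ω => by positivity
    have hw0 : 0 ≤ w i := integral_nonneg fun ω => mul_nonneg (sq_nonneg _) (hv.qf_nonneg _)
    rw [hK₄]
    have h6 := mul_nonneg hσ (add_nonneg ha0 hw0)
    have h7 : 0 ≤ δ ^ 4 := by positivity
    linarith
  have hdrift : ∀ l, ∫ ω, ‖wavg p (x i ω)‖ ^ 2 * inner ℝ (wavg p (x i ω)) (h i ω l) ∂P
      ≤ -(ν / 2 * a i) + δ ^ 2 / (2 * ν) * b i := by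
    intro l
    have ig : Integrable (fun ω => ‖wavg p (x i ω)‖ ^ 2 *
        inner ℝ (wavg p (x i ω)) (g l (x i ω l))) P := by
      refine integrable_mul_of_le_sq (K := 1 ^ 2) (L := δ) hR (mU.norm.pow_const 2)
        (mU.inner ((hg.continuous l).measurable.comp ((measurable_pi_apply l).comp mx)))
        (Eventually.of_forall fun ω => abs_sq_le_of_le (norm_nonneg _) (bU ω))
        (Eventually.of_forall fun ω => ?_)
      refine (abs_real_inner_le_norm _ _).trans ?_
      have h := hg.lipschitz l (x i ω l) 0
      rw [hg.zero, sub_zero, sub_zero] at h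
      have h2 : ‖g l (x i ω l)‖ ≤ δ * R ω := h.trans (mul_le_mul_of_nonneg_left
        ((norm_le_pi_norm (x i ω) l).trans (by linarith [bx ω])) hδ.le)
      calc _ ≤ (1 * R ω) * (δ * R ω) := mul_le_mul (bU ω) h2 (norm_nonneg _)
            ((norm_nonneg _).trans (bU ω))
        _ = _ := by ring
    have isc : ∀ q : Fin M, Integrable (fun ω => (‖wavg p (x i ω)‖ ^ 2 * wavg p (x i ω) q)
        * s i ω l q) P := by
      intro q
      have : (fun ω => (‖wavg p (x i ω)‖ ^ 2 * wavg p (x i ω) q) * s i ω l q)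
          = fun ω => ‖wavg p (x i ω)‖ ^ 2 * (wavg p (x i ω) q * s i ω l q) := by
        funext ω; ring
      rw [this]
      have mc : ∀ q : Fin M, Measurable fun v : Vec M => v q := fun q => by fun_prop
      refine integrable_mul_of_le_sq (K := 1 ^ 2) (L := 1) hR (mU.norm.pow_const 2)
        (((mc q).comp mU).mul ((mc q).comp ((measurable_pi_apply l).comp ms)))
        (Eventually.of_forall fun ω => abs_sq_le_of_le (norm_nonneg _) (bU ω))
        (Eventually.of_forall fun ω => ?_)
      rw [abs_mul]
      calc _ ≤ (1 * R ω) * (1 * R ω) := mul_le_mul ((abs_coord_le_norm _ _).trans (bU ω))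
            ((abs_coord_le_norm _ _).trans ((norm_le_pi_norm (s i ω) l).trans (bs ω)))
            (abs_nonneg _) ((norm_nonneg _).trans (bU ω))
        _ = _ := by ring
    -- The coordinates of `‖u‖² u` are functions of the past, so unbiasedness applies coordinate by
    -- coordinate.
    have hs0 : HasInt P (fun ω => ‖wavg p (x i ω)‖ ^ 2 * inner ℝ (wavg p (x i ω)) (s i ω l)) 0 := by
      have h0 : ∀ q : Fin M, HasInt P (fun ω => (‖wavg p (x i ω)‖ ^ 2 * wavg p (x i ω) q)
          * s i ω l q) 0 := by
        intro q
        refine ⟨isc q, D.unbiased i l q _ ?_ (isc q)⟩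
        have cc : Continuous fun y : Fin N → Vec M => ‖wavg p y‖ ^ 2 * wavg p y q := by
          unfold wavg; fun_prop
        exact cc.measurable.comp hxF
      have h1 := HasInt.sum h0
      simp only [Finset.sum_const_zero] at h1
      refine h1.congr fun ω => ?_
      rw [PiLp.inner_apply, Finset.mul_sum]
      refine Finset.sum_congr rfl fun q _ => ?_
      simp only [RCLike.inner_apply, conj_trivial]; ring
    have hsum := (HasInt.of_integrable ig).add hs0
    have e1 : ∫ ω, ‖wavg p (x i ω)‖ ^ 2 * inner ℝ (wavg p (x i ω)) (h i ω l) ∂P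
        = ∫ ω, ‖wavg p (x i ω)‖ ^ 2 * inner ℝ (wavg p (x i ω)) (g l (x i ω l)) ∂P := by
      have h2 := (hsum.congr (g := fun ω => ‖wavg p (x i ω)‖ ^ 2 *
        inner ℝ (wavg p (x i ω)) (h i ω l)) fun ω => by
          simp only [hh, inner_add_right]; ring).2
      rw [h2, add_zero]
    rw [e1]
    have h3 := (HasInt.of_integrable ig).mono_ae (((HasInt.of_integrable iU4).const_mul
      (-(ν / 2))).add ((HasInt.of_integrable iUV).const_mul (δ ^ 2 / (2 * ν))))
      (Eventually.of_forall fun ω => ?_)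
    · linarith
    have h4 := hg.monotone l (wavg p (x i ω))
    have h5 := hg.lipschitz l (x i ω l) (wavg p (x i ω))
    have h6 := norm_sub_wavg_le hp (x i ω) l
    have h7 := hv.lower (x i ω)
    set u := wavg p (x i ω)
    set d := disp (x i ω)
    have hd0 : 0 ≤ d := disp_nonneg _
    have h8 : inner ℝ u (g l (x i ω l)) ≤ -(ν * ‖u‖ ^ 2) + ‖u‖ * (δ * d) := by
      have e2 : g l (x i ω l) = g l u + (g l (x i ω l) - g l u) := by abel
      rw [e2, inner_add_right]
      refine add_le_add h4 ((real_inner_le_norm _ _).trans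
        (mul_le_mul_of_nonneg_left (h5.trans ?_) (norm_nonneg _)))
      exact mul_le_mul_of_nonneg_left h6 hδ.le
    have h9 : ‖u‖ * (δ * d) ≤ ν / 2 * ‖u‖ ^ 2 + δ ^ 2 / (2 * ν) * d ^ 2 := by
      rw [← sub_nonneg]
      have : ν / 2 * ‖u‖ ^ 2 + δ ^ 2 / (2 * ν) * d ^ 2 - ‖u‖ * (δ * d)
          = (ν * ‖u‖ - δ * d) ^ 2 / (2 * ν) := by field_simp; ring
      rw [this]; positivity
    have h10 : δ ^ 2 / (2 * ν) * d ^ 2 ≤ δ ^ 2 / (2 * ν) * qf v (x i ω) :=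
      mul_le_mul_of_nonneg_left h7 (by positivity)
    have h11 : inner ℝ u (g l (x i ω l)) ≤ -(ν / 2) * ‖u‖ ^ 2
        + δ ^ 2 / (2 * ν) * qf v (x i ω) := by linarith
    have h12 := mul_le_mul_of_nonneg_left h11 (sq_nonneg ‖u‖)
    linarith
  refine ⟨hxaw, hhK, hdrift, fun t ht l => ?_⟩
  have iUh : Integrable (fun ω => ‖wavg p (x i ω)‖ ^ 2 * ‖h i ω l‖ ^ 2) P := by
    refine (((iU4.const_mul 1).add ((hh4l l).const_mul 1))).mono'
      ((mU.norm.pow_const 2).mul (((measurable_pi_apply l).comp mh).norm.pow_const 2)).aestronglyMeasurable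
      (Eventually.of_forall fun ω => ?_)
    rw [Real.norm_of_nonneg (by positivity)]
    simp only [Pi.add_apply, one_mul]
    nlinarith [sq_nonneg (‖wavg p (x i ω)‖ ^ 2 - ‖h i ω l‖ ^ 2)]
  have h1 : m * ∫ ω, ‖wavg p (x i ω)‖ ^ 2 * ‖h i ω l‖ ^ 2 ∂P
      ≤ t * a i + m ^ 2 / (4 * t) * ∫ ω, ‖h i ω l‖ ^ 4 ∂P := by
    refine ((HasInt.of_integrable iUh).const_mul m).mono_ae
      (((HasInt.of_integrable iU4).const_mul t).add
        ((HasInt.of_integrable (hh4l l)).const_mul _)) (Eventually.of_forall fun ω => ?_)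
    rw [← sub_nonneg]
    have : t * ‖wavg p (x i ω)‖ ^ 4 + m ^ 2 / (4 * t) * ‖h i ω l‖ ^ 4
        - m * (‖wavg p (x i ω)‖ ^ 2 * ‖h i ω l‖ ^ 2)
        = (2 * t * ‖wavg p (x i ω)‖ ^ 2 - m * ‖h i ω l‖ ^ 2) ^ 2 / (4 * t) := by
      field_simp; ring
    rw [this]; positivity
  exact h1

set_option maxHeartbeats 1000000 in
/-- Fourth-order moments of the errors are finite, and eventually at most `K m²`. -/
theorem exists_fourth_moment_bound (hN : 0 < N) (hg : CostBounds g H ν δ e)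
    {p : Fin N → ℝ} (hp : ProbVec p) (hppos : ∀ k, 0 < p k) (hpA : Abar *ᵥ p = p)
    {v : Fin N × Fin N → ℝ} {cv : ℝ} (hv : IsLyapunov M Q v cv) (hβ : 0 ≤ β) (hσ : 0 ≤ σ)
    (hc : 0 ≤ c) : ∃ K μ₁ : ℝ, 0 < K ∧ 0 < μ₁ ∧ ∀ {Ω : Type u} {mΩ : MeasurableSpace Ω} {P : Measure Ω}
      [IsProbabilityMeasure P] {mbar : Fin N → ℝ} {m2 : Fin N → Fin N → ℝ} {m : ℝ}
      {F : ℕ → MeasurableSpace Ω} {A : ℕ → Ω → Matrix (Fin N) (Fin N) ℝ}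
      {μ : ℕ → Ω → Fin N → ℝ} {x s : ℕ → Ω → Fin N → Vec M},
      DiffusionProcess P g Abar Q mbar m2 m β σ c F A μ x s → m < μ₁ →
      (∀ i, Integrable (fun ω => ‖x i ω‖ ^ 4) P) ∧
      ∀ᶠ i in atTop, ∫ ω, ‖x i ω‖ ^ 4 ∂P ≤ K * m ^ 2 := by
  have hNn : Nonempty (Fin N) := ⟨⟨0, hN⟩⟩
  obtain ⟨k0, hk0⟩ := Finite.exists_min p
  set ε := p k0
  have hε : 0 < ε := hppos k0
  have hν := hg.nu_pos
  have hδ := hg.delta_pos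
  have hθ := hv.rate_pos
  have hθ4 := hv.rate_le
  have hcv := hv.one_le
  obtain ⟨K₃, hK₃, hdq⟩ := disp_sq_mul_qf_le hv
  set θ := IsLyapunov.rate cv with hθdef
  set K₄ := 64 * (δ ^ 4 + β) + 8 * σ with hK₄
  have hK₄0 : 0 ≤ K₄ := by positivity
  obtain ⟨Λ₁, Λ₂, B, hΛ₁, hΛ₂, hB, key⟩ := fourth_moment_algebra (ν₀ := ν / 2 * ε) (θ := θ)
    (C₁ := δ ^ 2 / (2 * ν)) (K₁ := (1 + 1 / θ) * (4 * cv)) (K₂ := (1 + 1 / θ) * (26 * cv)) (K₃ := K₃)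
    (K₄ := K₄) (K₅ := c * K₄) (by positivity) hθ hθ4 (by positivity) (by positivity) (by positivity)
    hK₃ hK₄0 (by positivity)
  set ν₀ := ν / 2 * ε with hν₀
  have hν₀0 : 0 < ν₀ := by positivity
  have hNpos : (0 : ℝ) < N := by exact_mod_cast hN
  -- In the constant, `8` comes from the fourth power of a sum of two terms and `2` from waiting
  -- until the transient is below the stationary level. As `η ≤ N m`, the thresholds ensure `η ≤ 1`,
  -- `ν₀ η ≤ θ / 4` and `B m² ≤ ν₀`.
  refine ⟨8 * (2 * (B / ν₀)), min (1 / N) (min (θ / 4 / (ν₀ * N)) (min 1 (ν₀ / B))), by positivity,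
    by positivity, ?_⟩
  intro Ω mΩ P _ mbar m2 m F A μ x s D hm
  have hm0 := D.m_pos
  set η := ∑ k, mbar k with hη
  have hη0 : 0 < η := Finset.sum_pos (fun k _ => D.mbar_pos k) Finset.univ_nonempty
  have hηN : η ≤ N * m := by
    calc η ≤ ∑ _k : Fin N, m := Finset.sum_le_sum fun k _ => D.mbar_le k
      _ = N * m := by simp
  have hm1 : m < 1 / N := hm.trans_le (min_le_left _ _)
  have hm2 : m < θ / 4 / (ν₀ * N) :=
    hm.trans_le ((min_le_right _ _).trans (min_le_left _ _))
  have hm3 : m < 1 := hm.trans_le ((min_le_right _ _).trans ((min_le_right _ _).trans (min_le_left _ _)))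
  have hm4 : m < ν₀ / B :=
    hm.trans_le ((min_le_right _ _).trans ((min_le_right _ _).trans (min_le_right _ _)))
  have hη1 : η ≤ 1 := by
    rw [lt_div_iff₀ hNpos] at hm1
    linarith
  have hηθ : ν₀ * η ≤ θ / 4 := by
    rw [lt_div_iff₀ (by positivity)] at hm2
    have := mul_le_mul_of_nonneg_left hηN hν₀0.le
    linarith
  have hBm : B * m ^ 2 ≤ ν₀ := by
    rw [lt_div_iff₀ hB] at hm4
    have : m ^ 2 ≤ m := by nlinarith
    nlinarith
  set h : ℕ → Ω → Fin N → Vec M := fun i ω l => g l (x i ω l) + s i ω l with hh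
  set a : ℕ → ℝ := fun i => ∫ ω, ‖wavg p (x i ω)‖ ^ 4 ∂P with ha
  set b : ℕ → ℝ := fun i => ∫ ω, ‖wavg p (x i ω)‖ ^ 2 * qf v (x i ω) ∂P with hb
  set w : ℕ → ℝ := fun i => ∫ ω, disp (x i ω) ^ 2 * qf v (x i ω) ∂P with hw
  have main : ∀ i, Integrable (fun ω => ‖x i ω‖ ^ 4) P →
      Integrable (fun ω => ‖x (i + 1) ω‖ ^ 4) P ∧
      (∫ ω, ‖x i ω‖ ^ 4 ∂P ≤ 8 * (a i + w i)) ∧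
      a (i + 1) + Λ₁ * b (i + 1) + Λ₂ * w (i + 1)
        ≤ (1 - ν₀ * η) * (a i + Λ₁ * b i + Λ₂ * w i) + B * η * m ^ 2 := by
    intro i hx4
    obtain ⟨S, C, H', hF, hs, O⟩ := D.oneStep i
    have hxF := D.measurable_state i
    have hxH : Measurable[H'] (x i) := hxF.mono hF le_rfl
    have hhH : Measurable[H'] (h i) := by
      have h1 : Measurable[H'] fun ω => fun l => g l (x i ω l) := (measurable_drift hg).comp hxH
      exact h1.add hs
    have hh4 : Integrable (fun ω => ‖h i ω‖ ^ 4) P := D.integrable_h hg hx4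
    set x' : Ω → Fin N → Vec M :=
      fun ω => combine (A i ω) (x i ω + scale (μ i ω) (h i ω)) with hx'
    have hae : ∀ᵐ ω ∂P, x (i + 1) ω = x' ω := D.recursion i
    obtain ⟨⟨⟨mx', ix'⟩, ha1⟩, hb1, hw1, hp2, hp4⟩ := O.fourth_moments_step hxH hhH hx4 hh4 hp hpA hv
      hdq x' rfl
    have ea : a (i + 1) = ∫ ω, ‖wavg p (x' ω)‖ ^ 4 ∂P :=
      integral_congr_ae (by filter_upwards [hae] with ω h1; simp only [h1])
    have eb : b (i + 1) = ∫ ω, ‖wavg p (x' ω)‖ ^ 2 * qf v (x' ω) ∂P :=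
      integral_congr_ae (by filter_upwards [hae] with ω h1; simp only [h1])
    have ew : w (i + 1) = ∫ ω, disp (x' ω) ^ 2 * qf v (x' ω) ∂P :=
      integral_congr_ae (by filter_upwards [hae] with ω h1; simp only [h1])
    obtain ⟨hxaw, hhK, hdrift, hUh⟩ := D.wavg_moments_le hg hp hv hβ hσ hx4
    have ha0 : 0 ≤ a i := integral_nonneg fun ω => by positivity
    have hb0 : 0 ≤ b i := integral_nonneg fun ω => mul_nonneg (sq_nonneg _) (hv.qf_nonneg _)
    have hw0 : 0 ≤ w i := integral_nonneg fun ω => mul_nonneg (sq_nonneg _) (hv.qf_nonneg _)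
    have hgd : ∑ l, p l * mbar l *
        ∫ ω, ‖wavg p (x i ω)‖ ^ 2 * inner ℝ (wavg p (x i ω)) (h i ω l) ∂P
        ≤ -(ν₀ * η * a i) + δ ^ 2 / (2 * ν) * η * b i := by
      have h1 : ∀ l, p l * mbar l *
          ∫ ω, ‖wavg p (x i ω)‖ ^ 2 * inner ℝ (wavg p (x i ω)) (h i ω l) ∂P
          ≤ mbar l * (-(ν₀ * a i) + δ ^ 2 / (2 * ν) * b i) := by
        intro l
        have hpl : p l ≤ 1 := by
          rw [← hp.sum]
          exact Finset.single_le_sum (f := p) (fun k _ => hp.nonneg k) (Finset.mem_univ l)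
        have hpε : ε ≤ p l := hk0 l
        have hml := D.mbar_pos l
        have h2 := mul_le_mul_of_nonneg_left (hdrift l) (mul_nonneg (hp.nonneg l) hml.le)
        refine h2.trans ?_
        have h3 : p l * (-(ν / 2 * a i) + δ ^ 2 / (2 * ν) * b i)
            ≤ -(ν₀ * a i) + δ ^ 2 / (2 * ν) * b i := by
          have e1 : ν₀ * a i ≤ p l * (ν / 2 * a i) := by
            rw [hν₀]
            have := mul_le_mul_of_nonneg_right hpε (by positivity : 0 ≤ ν / 2 * a i)
            linarith
          have e2 : p l * (δ ^ 2 / (2 * ν) * b i) ≤ 1 * (δ ^ 2 / (2 * ν) * b i) :=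
            mul_le_mul_of_nonneg_right hpl (by positivity)
          linarith
        have := mul_le_mul_of_nonneg_left h3 hml.le
        linarith
      refine (Finset.sum_le_sum fun l _ => h1 l).trans (le_of_eq ?_)
      rw [← Finset.sum_mul, ← hη]; ring
    have hP2 : ∀ t > 0, ∫ ω, ‖wavg p (x i ω)‖ ^ 2 * ‖scale (μ i ω) (h i ω)‖ ^ 2 ∂P
        ≤ η * (t * a i + m ^ 2 / (4 * t) * (K₄ * (a i + w i + 1))) := by
      intro t ht
      refine hp2.trans ?_
      rw [hη, Finset.sum_mul]
      refine Finset.sum_le_sum fun l _ => ?_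
      have h1 := hUh t ht l
      have hI0 : 0 ≤ ∫ ω, ‖wavg p (x i ω)‖ ^ 2 * ‖h i ω l‖ ^ 2 ∂P :=
        integral_nonneg fun ω => by positivity
      have h2 := mul_le_mul_of_nonneg_right (D.step_sq l) hI0
      have h3 : m ^ 2 / (4 * t) * ∫ ω, ‖h i ω l‖ ^ 4 ∂P ≤ m ^ 2 / (4 * t) * (K₄ * (a i + w i + 1)) :=
        mul_le_mul_of_nonneg_left (hhK l) (by positivity)
      have h4 := mul_le_mul_of_nonneg_left (h1.trans (add_le_add le_rfl h3)) (D.mbar_pos l).le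
      linarith
    have hP4 : ∫ ω, ‖scale (μ i ω) (h i ω)‖ ^ 4 ∂P ≤ η * m ^ 2 * (c * K₄ * (a i + w i + 1)) := by
      refine hp4.trans ?_
      have e1 : η * m ^ 2 * (c * K₄ * (a i + w i + 1))
          = ∑ l, (c * mbar l * m ^ 2) * (K₄ * (a i + w i + 1)) := by
        rw [← Finset.sum_mul, ← Finset.sum_mul, ← Finset.mul_sum, ← hη]; ring
      rw [e1]
      refine Finset.sum_le_sum fun l _ => ?_
      refine mul_le_mul (D.step_fourth i l) (hhK l) (integral_nonneg fun ω => by positivity) ?_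
      have := D.mbar_pos l
      positivity
    refine ⟨ix'.congr (by filter_upwards [hae] with ω h1; rw [h1]), hxaw, ?_⟩
    refine key (a i) (b i) (w i) _ _ _ _ _ η m ha0 hb0 hw0 hη0 hη1 hηθ hBm ?_ ?_ ?_ hP2 hP4
    · rw [ea]; linarith
    · rw [eb]; exact hb1
    · rw [ew]; exact hw1
  have hint : ∀ i, Integrable (fun ω => ‖x i ω‖ ^ 4) P := by
    intro i
    induction i with
    | zero => exact D.init
    | succ i ih => exact (main i ih).1
  refine ⟨hint, ?_⟩
  -- The forcing `B η m²` is divided by the contraction `ν₀ η`: the bound is of order `m²` however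
  -- small `η` is compared with `m`.
  have hev := tendsto_geometric_bound (Φ := fun i => a i + Λ₁ * b i + Λ₂ * w i) (κ := ν₀ * η)
    (B := B / ν₀ * m ^ 2) (by positivity) (by linarith) (by positivity) (fun i => by
      refine ((main i (hint i)).2.2).trans (le_of_eq ?_)
      field_simp)
  filter_upwards [hev] with i hi
  have h1 := (main i (hint i)).2.1
  have hb0 : 0 ≤ b i := integral_nonneg fun ω => mul_nonneg (sq_nonneg _) (hv.qf_nonneg _)
  have hw0 : 0 ≤ w i := integral_nonneg fun ω => mul_nonneg (sq_nonneg _) (hv.qf_nonneg _)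
  have h2 : w i ≤ Λ₂ * w i := by nlinarith
  have h3 : 0 ≤ Λ₁ * b i := by positivity
  calc _ ≤ 8 * (a i + w i) := h1
    _ ≤ 8 * (a i + Λ₁ * b i + Λ₂ * w i) := by linarith
    _ ≤ 8 * (2 * (B / ν₀ * m ^ 2)) := by linarith
    _ = _ := by ring

end DiffusionProcess

end ErrorProcess

/-! ### Second-order moments -/

section SecondMoments

variable {N M : ℕ} {Ω : Type*}

/-- Pairs of coordinates of the network vector. -/
abbrev Idx (N M : ℕ) : Type := (Fin N × Fin M) × (Fin N × Fin M)

/-- The matrix of a linear map. -/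
noncomputable def opMatrix (T : Vec M →L[ℝ] Vec M) : Matrix (Fin M) (Fin M) ℝ :=
  Matrix.of fun a b => T (EuclideanSpace.single b 1) a

theorem apply_coord (T : Vec M →L[ℝ] Vec M) (x : Vec M) (a : Fin M) :
    T x a = ∑ c, opMatrix T a c * x c := by
  have hx : x = ∑ c, x c • (EuclideanSpace.single c (1 : ℝ) : Vec M) := by
    ext b
    simp [Finset.sum_apply, Pi.single_apply]
  conv_lhs => rw [hx]
  rw [map_sum]
  simp only [map_smul, WithLp.ofLp_sum, WithLp.ofLp_smul, Finset.sum_apply, Pi.smul_apply,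
    smul_eq_mul, opMatrix, Matrix.of_apply]
  exact Finset.sum_congr rfl fun c _ => mul_comm _ _

/-- The matrix which propagates second-order moments in the long-term model. -/
noncomputable def momentMatrix (Q : Matrix (Fin N × Fin N) (Fin N × Fin N) ℝ) (mbar : Fin N → ℝ)
    (m2 : Fin N → Fin N → ℝ) (H : Fin N → Vec M →L[ℝ] Vec M) : Matrix (Idx N M) (Idx N M) ℝ :=
  Matrix.of fun p q => Q (q.1.1, q.2.1) (p.1.1, p.2.1) *
    ((1 : Matrix (Fin M) (Fin M) ℝ) p.1.2 q.1.2 * (1 : Matrix (Fin M) (Fin M) ℝ) p.2.2 q.2.2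
      - mbar q.1.1 * (opMatrix (H q.1.1) p.1.2 q.1.2 * (1 : Matrix (Fin M) (Fin M) ℝ) p.2.2 q.2.2)
      - mbar q.2.1 * ((1 : Matrix (Fin M) (Fin M) ℝ) p.1.2 q.1.2 * opMatrix (H q.2.1) p.2.2 q.2.2)
      + m2 q.1.1 q.2.1 * (opMatrix (H q.1.1) p.1.2 q.1.2 * opMatrix (H q.2.1) p.2.2 q.2.2))

theorem momentMatrix_mulVec (Q : Matrix (Fin N × Fin N) (Fin N × Fin N) ℝ) (mbar : Fin N → ℝ)
    (m2 : Fin N → Fin N → ℝ) (H : Fin N → Vec M →L[ℝ] Vec M) (z : Idx N M → ℝ)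
    (k k' : Fin N) (a b : Fin M) :
    (momentMatrix Q mbar m2 H *ᵥ z) ((k, a), (k', b)) = ∑ l, ∑ l', Q (l, l') (k, k') *
      (z ((l, a), (l', b)) - mbar l * ∑ c, opMatrix (H l) a c * z ((l, c), (l', b))
        - mbar l' * ∑ d, opMatrix (H l') b d * z ((l, a), (l', d))
        + m2 l l' * ∑ c, ∑ d, opMatrix (H l) a c * opMatrix (H l') b d * z ((l, c), (l', d))) := by
  simp only [momentMatrix, Matrix.mulVec, dotProduct, Fintype.sum_prod_type, Matrix.of_apply]
  refine Finset.sum_congr rfl fun l _ => ?_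
  rw [Finset.sum_comm]
  refine Finset.sum_congr rfl fun l' _ => ?_
  have e : ∀ c d : Fin M, Q (l, l') (k, k') *
      ((1 : Matrix (Fin M) (Fin M) ℝ) a c * (1 : Matrix (Fin M) (Fin M) ℝ) b d
      - mbar l * (opMatrix (H l) a c * (1 : Matrix (Fin M) (Fin M) ℝ) b d)
      - mbar l' * ((1 : Matrix (Fin M) (Fin M) ℝ) a c * opMatrix (H l') b d)
      + m2 l l' * (opMatrix (H l) a c * opMatrix (H l') b d)) * z ((l, c), (l', d))
    = Q (l, l') (k, k') * ((1 : Matrix (Fin M) (Fin M) ℝ) a c *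
        ((1 : Matrix (Fin M) (Fin M) ℝ) b d * z ((l, c), (l', d)))
      - mbar l * (opMatrix (H l) a c * ((1 : Matrix (Fin M) (Fin M) ℝ) b d * z ((l, c), (l', d))))
      - mbar l' * ((1 : Matrix (Fin M) (Fin M) ℝ) a c * (opMatrix (H l') b d * z ((l, c), (l', d))))
      + m2 l l' * (opMatrix (H l) a c * opMatrix (H l') b d * z ((l, c), (l', d)))) := by
    intro c d; ring
  have h1 : ∀ (i : Fin M) (f : Fin M → ℝ), ∑ j, (1 : Matrix (Fin M) (Fin M) ℝ) i j * f j = f i := by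
    intro i f; simp [Matrix.one_apply]
  simp only [e]
  have h2 : ∀ f : Fin M → Fin M → ℝ,
      ∑ i, ∑ j, (1 : Matrix (Fin M) (Fin M) ℝ) a i * f i j = ∑ j, f a j := by
    intro f; simp only [← Finset.mul_sum, h1]
  have h3 : ∀ f : Fin M → Fin M → ℝ,
      ∑ i, ∑ j, f i j * ((1 : Matrix (Fin M) (Fin M) ℝ) b j * z ((l, i), (l', j)))
        = ∑ i, ∑ j, (1 : Matrix (Fin M) (Fin M) ℝ) b j * (f i j * z ((l, i), (l', j))) := by
    intro f
    exact Finset.sum_congr rfl fun i _ => Finset.sum_congr rfl fun j _ => by ring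
  calc ∑ c, ∑ d, Q (l, l') (k, k') * ((1 : Matrix (Fin M) (Fin M) ℝ) a c *
        ((1 : Matrix (Fin M) (Fin M) ℝ) b d * z ((l, c), (l', d)))
      - mbar l * (opMatrix (H l) a c * ((1 : Matrix (Fin M) (Fin M) ℝ) b d * z ((l, c), (l', d))))
      - mbar l' * ((1 : Matrix (Fin M) (Fin M) ℝ) a c * (opMatrix (H l') b d * z ((l, c), (l', d))))
      + m2 l l' * (opMatrix (H l) a c * opMatrix (H l') b d * z ((l, c), (l', d))))
      = Q (l, l') (k, k') * (∑ c, ∑ d, (1 : Matrix (Fin M) (Fin M) ℝ) a c *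
        ((1 : Matrix (Fin M) (Fin M) ℝ) b d * z ((l, c), (l', d)))
      - mbar l * ∑ c, ∑ d, opMatrix (H l) a c * ((1 : Matrix (Fin M) (Fin M) ℝ) b d * z ((l, c), (l', d)))
      - mbar l' * ∑ c, ∑ d, (1 : Matrix (Fin M) (Fin M) ℝ) a c * (opMatrix (H l') b d * z ((l, c), (l', d)))
      + m2 l l' * ∑ c, ∑ d, opMatrix (H l) a c * opMatrix (H l') b d * z ((l, c), (l', d))) := by
        simp only [Finset.mul_sum, ← Finset.sum_sub_distrib, ← Finset.sum_add_distrib]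
    _ = _ := by
        rw [h2, h2, h1, h3]
        simp only [h1]

/-- The outer product of two network vectors. -/
noncomputable def tens (x y : Fin N → Vec M) : Idx N M → ℝ :=
  fun p => x p.1.1 p.1.2 * y p.2.1 p.2.2

theorem integrable_mul_of_le {mΩ : MeasurableSpace Ω} {P : Measure Ω} [IsProbabilityMeasure P]
    {R f g : Ω → ℝ} (hR : Integrable (fun ω => R ω ^ 4) P) (hf : Measurable f) (hg : Measurable g)
    {K L : ℝ} (hK : 0 ≤ K) (hL : 0 ≤ L) (hfR : ∀ ω, |f ω| ≤ K * R ω) (hgR : ∀ ω, |g ω| ≤ L * R ω) :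
    Integrable (fun ω => f ω * g ω) P := by
  refine ((hR.add (integrable_const 1)).const_mul (K * L)).mono' (hf.mul hg).aestronglyMeasurable
    (Eventually.of_forall fun ω => ?_)
  rw [Real.norm_eq_abs, abs_mul]
  simp only [Pi.add_apply]
  calc |f ω| * |g ω| ≤ (K * R ω) * (L * R ω) :=
        mul_le_mul (hfR ω) (hgR ω) (abs_nonneg _) ((abs_nonneg _).trans (hfR ω))
    _ = K * L * R ω ^ 2 := by ring
    _ ≤ K * L * (R ω ^ 4 + 1) := mul_le_mul_of_nonneg_left
      (by nlinarith [sq_nonneg (R ω ^ 2 - 1)]) (by positivity)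

theorem measurable_coord (l : Fin N) (a : Fin M) : Measurable fun x : Fin N → Vec M => x l a := by
  fun_prop

theorem abs_coord_le (x : Fin N → Vec M) (l : Fin N) (a : Fin M) : |x l a| ≤ ‖x‖ :=
  (abs_coord_le_norm _ _).trans (norm_le_pi_norm x l)

namespace OneStep

variable {S C H : MeasurableSpace Ω} {mΩ : MeasurableSpace Ω} {P : Measure Ω}
  [IsProbabilityMeasure P]
  {A : Ω → Matrix (Fin N) (Fin N) ℝ} {μ : Ω → Fin N → ℝ} {Abar : Matrix (Fin N) (Fin N) ℝ}
  {Q : Matrix (Fin N × Fin N) (Fin N × Fin N) ℝ} {mbar : Fin N → ℝ} {m2 : Fin N → Fin N → ℝ}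

/-- Second-order moments of the vector after one step. -/
theorem second_moments_step (O : OneStep P S C H A μ Abar Q mbar m2) {x h y g : Ω → Fin N → Vec M}
    (hx : Measurable[H] x) (hh : Measurable[H] h) (hy : Measurable[H] y) (hg : Measurable[H] g)
    {R : Ω → ℝ} (hR : Integrable (fun ω => R ω ^ 4) P) {L : ℝ} (hL : 0 ≤ L)
    (bx : ∀ ω, ‖x ω‖ ≤ L * R ω) (bh : ∀ ω, ‖h ω‖ ≤ L * R ω) (bY : ∀ ω, ‖y ω‖ ≤ L * R ω)
    (bg : ∀ ω, ‖g ω‖ ≤ L * R ω) (k k' : Fin N) (a b : Fin M) :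
    HasInt P (fun ω => combine (A ω) (x ω + scale (μ ω) (h ω)) k a *
        combine (A ω) (y ω + scale (μ ω) (g ω)) k' b)
      (∑ l, ∑ l', Q (l, l') (k, k') * (∫ ω, x ω l a * y ω l' b ∂P
        + mbar l * ∫ ω, h ω l a * y ω l' b ∂P + mbar l' * ∫ ω, x ω l a * g ω l' b ∂P
        + m2 l l' * ∫ ω, h ω l a * g ω l' b ∂P)) := by
  have meas : ∀ {f : Ω → Fin N → Vec M}, Measurable[H] f → ∀ l a, Measurable[H] fun ω => f ω l a :=
    fun hf l a => (measurable_coord l a).comp hf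
  have int : ∀ {f f' : Ω → Fin N → Vec M}, Measurable[H] f → Measurable[H] f' →
      (∀ ω, ‖f ω‖ ≤ L * R ω) → (∀ ω, ‖f' ω‖ ≤ L * R ω) → ∀ l a l' b,
      Integrable (fun ω => f ω l a * f' ω l' b) P := by
    intro f f' hf hf' bf bf' l a l' b
    exact integrable_mul_of_le hR ((meas hf l a).mono O.le_hist le_rfl)
      ((meas hf' l' b).mono O.le_hist le_rfl) hL hL (fun ω => (abs_coord_le _ _ _).trans (bf ω))
      (fun ω => (abs_coord_le _ _ _).trans (bf' ω))
  have prod : ∀ {f f' : Ω → Fin N → Vec M}, Measurable[H] f → Measurable[H] f' → ∀ l a l' b,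
      Measurable[H] (fun ω => f ω l a * f' ω l' b) := by
    intro f f' hf hf' l a l' b
    exact (meas hf l a).mul (meas hf' l' b)
  have key : ∀ l l', HasInt P (fun ω => (x ω + scale (μ ω) (h ω)) l a *
        (y ω + scale (μ ω) (g ω)) l' b)
      (∫ ω, x ω l a * y ω l' b ∂P
        + mbar l * ∫ ω, h ω l a * y ω l' b ∂P + mbar l' * ∫ ω, x ω l a * g ω l' b ∂P
        + m2 l l' * ∫ ω, h ω l a * g ω l' b ∂P) := by
    intro l l'
    have i1 := HasInt.of_integrable (int hx hy bx bY l a l' b)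
    have i2 : HasInt P (fun ω => μ ω l * (h ω l a * y ω l' b)) _ :=
      ⟨O.integrable_step_mul (int hh hy bh bY l a l' b) l,
        O.integral_step_mul (prod hh hy l a l' b) l⟩
    have i3 : HasInt P (fun ω => μ ω l' * (x ω l a * g ω l' b)) _ :=
      ⟨O.integrable_step_mul (int hx hg bx bg l a l' b) l',
        O.integral_step_mul (prod hx hg l a l' b) l'⟩
    have i4 : HasInt P (fun ω => μ ω l * μ ω l' * (h ω l a * g ω l' b)) _ :=
      ⟨by
        have := O.integrable_step_mul (O.integrable_step_mul (int hh hg bh bg l a l' b) l') l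
        simpa only [mul_assoc] using this,
        O.integral_step_step_mul (prod hh hg l a l' b) l l'⟩
    refine (((i1.add i2).add i3).add i4).congr fun ω => ?_
    simp only [Pi.add_apply, scale, PiLp.add_apply, PiLp.smul_apply, smul_eq_mul]
    ring
  have h1 := O.integral_combine_mul_combine (O.measurable_state hx hh) (O.measurable_state hy hg)
    k k' a b (fun l l' => (key l l').1)
  refine ⟨h1.1, h1.2.trans ?_⟩
  refine Finset.sum_congr rfl fun l _ => Finset.sum_congr rfl fun l' _ => ?_
  rw [(key l l').2]

/-- Expectation of `2 |μₖ μₗ| ≤ μₖ² + μₗ²`, so correlations between the step-sizes of different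
agents need no separate assumption. -/
theorem abs_m2_le (O : OneStep P S C H A μ Abar Q mbar m2) (k l : Fin N) :
    |m2 k l| ≤ (m2 k k + m2 l l) / 2 := by
  have i : ∀ k l, HasInt P (fun ω => μ ω k * μ ω l) (m2 k l) := by
    intro k l
    refine ⟨?_, O.mean_step_mul k l⟩
    have := O.integrable_step_mul (O.integrable_step_mul (integrable_const (1 : ℝ)) l) k
    simpa only [mul_one] using this
  have h1 := (i k l).mono_ae (((i k k).add (i l l)).const_mul (1 / 2))
    (Eventually.of_forall fun ω => by nlinarith [sq_nonneg (μ ω k - μ ω l)])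
  have h2 := ((i k l).const_mul (-1)).mono_ae (((i k k).add (i l l)).const_mul (1 / 2))
    (Eventually.of_forall fun ω => by nlinarith [sq_nonneg (μ ω k + μ ω l)])
  rw [abs_le]; constructor <;> linarith

end OneStep

/-- The driving term of the recursion of second-order moments. -/
noncomputable def drive (Q : Matrix (Fin N × Fin N) (Fin N × Fin N) ℝ) (m2 : Fin N → Fin N → ℝ)
    (Rs : Fin N → Matrix (Fin M) (Fin M) ℝ) : Idx N M → ℝ :=
  fun p => ∑ l, Q (l, l) (p.1.1, p.2.1) * (m2 l l * Rs l p.1.2 p.2.2)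

/-- The sum of the absolute values of the entries of a matrix. -/
noncomputable def absSum {ι : Type*} [Fintype ι] (Q : Matrix ι ι ℝ) : ℝ := ∑ p, ∑ q, |Q p q|

theorem absSum_nonneg {ι : Type*} [Fintype ι] (Q : Matrix ι ι ℝ) : 0 ≤ absSum Q :=
  Finset.sum_nonneg fun _ _ => Finset.sum_nonneg fun _ _ => abs_nonneg _

theorem sum_abs_le_absSum {ι : Type*} [Fintype ι] (Q : Matrix ι ι ℝ) (q : ι) :
    ∑ p, |Q p q| ≤ absSum Q :=
  Finset.sum_le_sum fun p _ =>
    Finset.single_le_sum (f := fun q => |Q p q|) (fun _ _ => abs_nonneg _) (Finset.mem_univ q)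

namespace DiffusionProcess

variable {mΩ : MeasurableSpace Ω} {P : Measure Ω} [IsProbabilityMeasure P]
  {g : Fin N → Vec M → Vec M} {Abar : Matrix (Fin N) (Fin N) ℝ}
  {Q : Matrix (Fin N × Fin N) (Fin N × Fin N) ℝ} {mbar : Fin N → ℝ} {m2 : Fin N → Fin N → ℝ}
  {m β σ c : ℝ} {F : ℕ → MeasurableSpace Ω} {A : ℕ → Ω → Matrix (Fin N) (Fin N) ℝ}
  {μ : ℕ → Ω → Fin N → ℝ} {x s : ℕ → Ω → Fin N → Vec M}
  {H : Fin N → Vec M →L[ℝ] Vec M} {ν δ e : ℝ}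

theorem mbar_le_sum (D : DiffusionProcess P g Abar Q mbar m2 m β σ c F A μ x s) (l : Fin N) :
    mbar l ≤ ∑ k, mbar k :=
  Finset.single_le_sum (f := mbar) (fun k _ => (D.mbar_pos k).le) (Finset.mem_univ l)

/-- A bound by `m²` would not suffice later: the factor `∑ mbar` is what cancels against the
contraction rate. -/
theorem abs_m2_le (D : DiffusionProcess P g Abar Q mbar m2 m β σ c F A μ x s) (k l : Fin N) :
    |m2 k l| ≤ (∑ k, mbar k) * m := by
  obtain ⟨S, C, H, hF, hs, O⟩ := D.oneStep 0
  have h1 := O.abs_m2_le k l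
  have h2 := mul_le_mul_of_nonneg_right (D.mbar_le_sum k) D.m_pos.le
  have h3 := mul_le_mul_of_nonneg_right (D.mbar_le_sum l) D.m_pos.le
  linarith [D.step_sq k, D.step_sq l]

/-- Second-order moments follow a linear recursion, up to terms of higher order. -/
theorem abs_second_moment_le (D : DiffusionProcess P g Abar Q mbar m2 m β σ c F A μ x s)
    (hg : CostBounds g H ν δ e) {i : ℕ} (hx4 : Integrable (fun ω => ‖x i ω‖ ^ 4) P)
    {Rs : Fin N → Matrix (Fin M) (Fin M) ℝ} {T κ : ℝ} (hT : ∫ ω, ‖x i ω‖ ^ 3 ∂P ≤ T)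
    (hκ : ∀ l a b, |∫ ω, s i ω l a * s i ω l b ∂P - Rs l a b| ≤ κ) (p : Idx N M) :
    |∫ ω, tens (x (i + 1) ω) (x (i + 1) ω) p ∂P
      - (momentMatrix Q mbar m2 H *ᵥ fun q => ∫ ω, tens (x i ω) (x i ω) q ∂P) p
      - drive Q m2 Rs p|
      ≤ absSum Q * ((∑ k, mbar k) * ((2 * e + 2 * δ * e * m) * T + m * κ)) := by
  obtain ⟨⟨k, a⟩, ⟨k', b⟩⟩ := p
  have mx := D.measurable_x i
  have ms := D.measurable_s i
  have hxF := D.measurable_state i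
  have hδ := hg.delta_pos
  have he := hg.e_nonneg
  set G : Ω → Fin N → Vec M := fun ω l => g l (x i ω l) with hG
  have mG : Measurable G := (measurable_drift hg).comp mx
  have mGF : Measurable[F i] G := (measurable_drift hg).comp hxF
  set W : Ω → Fin N → Vec M := fun ω l => H l (x i ω l) with hW
  have mW : Measurable W := by
    refine measurable_pi_lambda _ fun l => ?_
    exact (H l).continuous.measurable.comp ((measurable_pi_apply l).comp mx)
  set R : Ω → ℝ := fun ω => ‖x i ω‖ + ‖s i ω‖ with hRdef
  have hR : Integrable (fun ω => R ω ^ 4) P := by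
    refine ((hx4.add (D.noise_integrable i)).const_mul 8).mono'
      ((mx.norm.add ms.norm).pow_const 4).aestronglyMeasurable (Eventually.of_forall fun ω => ?_)
    rw [Real.norm_of_nonneg (by positivity)]
    exact add_pow_four_le
  have R0 : ∀ ω, 0 ≤ R ω := fun ω => by simp only [hRdef]; positivity
  have xR : ∀ ω, ‖x i ω‖ ≤ R ω := fun ω => by
    simp only [hRdef]; linarith [norm_nonneg (s i ω)]
  have bx : ∀ ω, ‖x i ω‖ ≤ (δ + 1) * R ω := fun ω => by
    nlinarith [xR ω, R0 ω]
  have bs : ∀ ω, ‖s i ω‖ ≤ (δ + 1) * R ω := fun ω => by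
    have : ‖s i ω‖ ≤ R ω := by simp only [hRdef]; linarith [norm_nonneg (x i ω)]
    nlinarith [R0 ω]
  have gx : ∀ ω, ‖G ω‖ ≤ δ * ‖x i ω‖ := fun ω => norm_drift_le hg _
  have bG : ∀ ω, ‖G ω‖ ≤ (δ + 1) * R ω := fun ω => by
    have := mul_le_mul_of_nonneg_left (xR ω) hδ.le
    nlinarith [R0 ω, gx ω]
  have wx : ∀ ω, ‖W ω‖ ≤ δ * ‖x i ω‖ := fun ω => by
    refine (pi_norm_le_iff_of_nonneg (by positivity)).2 fun l => (hg.norm_le l _).trans ?_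
    exact mul_le_mul_of_nonneg_left (norm_le_pi_norm (x i ω) l) hδ.le
  have bW : ∀ ω, ‖W ω‖ ≤ (δ + 1) * R ω := fun ω => by
    have := mul_le_mul_of_nonneg_left (xR ω) hδ.le
    nlinarith [R0 ω, wx ω]
  have bh : ∀ ω, ‖fun l => g l (x i ω l) + s i ω l‖ ≤ (δ + 1) * R ω := fun ω => by
    refine (norm_add_le (G ω) (s i ω)).trans ?_
    simp only [hRdef]
    nlinarith [gx ω, norm_nonneg (x i ω), norm_nonneg (s i ω)]
  have int : ∀ {f f' : Ω → Fin N → Vec M}, Measurable f → Measurable f' →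
      (∀ ω, ‖f ω‖ ≤ (δ + 1) * R ω) → (∀ ω, ‖f' ω‖ ≤ (δ + 1) * R ω) → ∀ l a l' b,
      Integrable (fun ω => f ω l a * f' ω l' b) P := by
    intro f f' hf hf' bf bf' l a l' b
    exact integrable_mul_of_le hR ((measurable_coord l a).comp hf)
      ((measurable_coord l' b).comp hf') (by positivity) (by positivity)
      (fun ω => (abs_coord_le _ _ _).trans (bf ω))
      (fun ω => (abs_coord_le _ _ _).trans (bf' ω))
  have hx3 : Integrable (fun ω => ‖x i ω‖ ^ 3) P := by
    refine (hx4.add (integrable_const 1)).mono' (mx.norm.pow_const 3).aestronglyMeasurable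
      (Eventually.of_forall fun ω => ?_)
    rw [Real.norm_of_nonneg (by positivity)]
    simp only [Pi.add_apply]
    have h0 := norm_nonneg (x i ω)
    generalize ‖x i ω‖ = t at h0
    nlinarith [sq_nonneg (t ^ 2 - 1), sq_nonneg (t - 1), mul_nonneg h0 (sq_nonneg (t - 1)),
      mul_nonneg h0 (sq_nonneg (t ^ 2 - 1)), sq_nonneg (t * (t - 1))]
  -- the noise is uncorrelated with the past
  have xs : ∀ l a l' b, HasInt P (fun ω => x i ω l a * s i ω l' b) 0 := fun l a l' b =>
    ⟨int mx ms bx bs l a l' b, D.unbiased i l' b _ ((measurable_coord l a).comp hxF)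
      (int mx ms bx bs l a l' b)⟩
  have gs : ∀ l a l' b, HasInt P (fun ω => G ω l a * s i ω l' b) 0 := fun l a l' b =>
    ⟨int mG ms bG bs l a l' b, D.unbiased i l' b _ ((measurable_coord l a).comp mGF)
      (int mG ms bG bs l a l' b)⟩
  have hx_ : ∀ l a l' b, ∫ ω, (g l (x i ω l) + s i ω l) a * x i ω l' b ∂P
      = ∫ ω, G ω l a * x i ω l' b ∂P := fun l a l' b => by
    have := ((HasInt.of_integrable (int mG mx bG bx l a l' b)).add (xs l' b l a)).congr
      (g := fun ω => (g l (x i ω l) + s i ω l) a * x i ω l' b) fun ω => by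
        simp only [hG, PiLp.add_apply]; ring
    rw [this.2, add_zero]
  have xh_ : ∀ l a l' b, ∫ ω, x i ω l a * (g l' (x i ω l') + s i ω l') b ∂P
      = ∫ ω, x i ω l a * G ω l' b ∂P := fun l a l' b => by
    have := ((HasInt.of_integrable (int mx mG bx bG l a l' b)).add (xs l a l' b)).congr
      (g := fun ω => x i ω l a * (g l' (x i ω l') + s i ω l') b) fun ω => by
        simp only [hG, PiLp.add_apply]; ring
    rw [this.2, add_zero]
  have hh_ : ∀ l a l' b, ∫ ω, (g l (x i ω l) + s i ω l) a * (g l' (x i ω l') + s i ω l') b ∂P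
      = ∫ ω, G ω l a * G ω l' b ∂P + ∫ ω, s i ω l a * s i ω l' b ∂P := fun l a l' b => by
    have := ((((HasInt.of_integrable (int mG mG bG bG l a l' b)).add (gs l a l' b)).add
      (gs l' b l a)).add (HasInt.of_integrable (int ms ms bs bs l a l' b))).congr
      (g := fun ω => (g l (x i ω l) + s i ω l) a * (g l' (x i ω l') + s i ω l') b) fun ω => by
        simp only [hG, PiLp.add_apply]; ring
    rw [this.2]; ring
  have ss_ : ∀ l l', ∫ ω, s i ω l a * s i ω l' b ∂P
      = if l = l' then ∫ ω, s i ω l a * s i ω l b ∂P else 0 := by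
    intro l l'
    split_ifs with h
    · rw [h]
    · exact D.uncorrelated i l l' h a b
  have step : ∫ ω, tens (x (i + 1) ω) (x (i + 1) ω) ((k, a), (k', b)) ∂P
      = ∑ l, ∑ l', Q (l, l') (k, k') * (∫ ω, x i ω l a * x i ω l' b ∂P
        + mbar l * ∫ ω, G ω l a * x i ω l' b ∂P + mbar l' * ∫ ω, x i ω l a * G ω l' b ∂P
        + m2 l l' * (∫ ω, G ω l a * G ω l' b ∂P + ∫ ω, s i ω l a * s i ω l' b ∂P)) := by
    have h1 : ∫ ω, tens (x (i + 1) ω) (x (i + 1) ω) ((k, a), (k', b)) ∂P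
        = ∫ ω, combine (A i ω) (x i ω + scale (μ i ω) (fun l => g l (x i ω l) + s i ω l)) k a *
          combine (A i ω) (x i ω + scale (μ i ω) (fun l => g l (x i ω l) + s i ω l)) k' b ∂P :=
      integral_congr_ae (by
        filter_upwards [D.recursion i] with ω h1
        simp only [tens, h1])
    obtain ⟨S, C, H', hF, hs, O⟩ := D.oneStep i
    have hxH : Measurable[H'] (x i) := hxF.mono hF le_rfl
    have hhH : Measurable[H'] fun ω l => g l (x i ω l) + s i ω l :=
      (mGF.mono hF le_rfl).add hs
    rw [h1, (O.second_moments_step hxH hhH hxH hhH hR (by positivity) bx bh bx bh k k' a b).2]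
    simp only [hx_, xh_, hh_]
  have lin : (momentMatrix Q mbar m2 H *ᵥ fun q => ∫ ω, tens (x i ω) (x i ω) q ∂P)
      ((k, a), (k', b)) = ∑ l, ∑ l', Q (l, l') (k, k') * (∫ ω, x i ω l a * x i ω l' b ∂P
        - mbar l * ∫ ω, W ω l a * x i ω l' b ∂P - mbar l' * ∫ ω, x i ω l a * W ω l' b ∂P
        + m2 l l' * ∫ ω, W ω l a * W ω l' b ∂P) := by
    rw [momentMatrix_mulVec]
    refine Finset.sum_congr rfl fun l _ => Finset.sum_congr rfl fun l' _ => ?_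
    simp only [tens]
    have ixx := fun l a l' b => HasInt.of_integrable (int mx mx bx bx l a l' b)
    have e1 : ∫ ω, W ω l a * x i ω l' b ∂P
        = ∑ c, opMatrix (H l) a c * ∫ ω, x i ω l c * x i ω l' b ∂P :=
      ((HasInt.sum fun c => (ixx l c l' b).const_mul (opMatrix (H l) a c)).congr fun ω => by
        simp only [hW, apply_coord (H l), Finset.sum_mul, mul_assoc]).2
    have e2 : ∫ ω, x i ω l a * W ω l' b ∂P
        = ∑ d, opMatrix (H l') b d * ∫ ω, x i ω l a * x i ω l' d ∂P :=
      ((HasInt.sum fun d => (ixx l a l' d).const_mul (opMatrix (H l') b d)).congr fun ω => by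
        simp only [hW, apply_coord (H l'), Finset.mul_sum]
        exact Finset.sum_congr rfl fun d _ => by ring).2
    have e3 : ∫ ω, W ω l a * W ω l' b ∂P
        = ∑ c, ∑ d, opMatrix (H l) a c * opMatrix (H l') b d * ∫ ω, x i ω l c * x i ω l' d ∂P :=
      ((HasInt.sum fun c => HasInt.sum fun d => (ixx l c l' d).const_mul
        (opMatrix (H l) a c * opMatrix (H l') b d)).congr fun ω => by
        simp only [hW, apply_coord (H l), apply_coord (H l'), Finset.sum_mul_sum]
        exact Finset.sum_congr rfl fun c _ => Finset.sum_congr rfl fun d _ => by ring).2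
    rw [e1, e2, e3]
  -- error terms
  have gw : ∀ ω l a, |G ω l a + W ω l a| ≤ e * ‖x i ω‖ ^ 2 := by
    intro ω l a
    have h1 := abs_coord_le_norm (g l (x i ω l) + H l (x i ω l)) a
    refine (le_trans h1 (hg.linearization l _)).trans (mul_le_mul_of_nonneg_left ?_ he)
    exact pow_le_pow_left₀ (norm_nonneg _) (norm_le_pi_norm (x i ω) l) 2
  have absint : ∀ {f f' : Ω → ℝ} {K : ℝ}, 0 ≤ K → Integrable f P → Integrable f' P →
      (∀ ω, |f ω + f' ω| ≤ K * ‖x i ω‖ ^ 3) → |∫ ω, f ω ∂P + ∫ ω, f' ω ∂P| ≤ K * T := by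
    intro f f' K hK hf hf' h
    rw [← integral_add hf hf']
    refine (abs_integral_le_integral_abs).trans ?_
    refine (integral_mono (hf.add hf').abs (hx3.const_mul K) h).trans ?_
    rw [integral_const_mul]
    exact mul_le_mul_of_nonneg_left hT hK
  have E1 : ∀ l l', |∫ ω, G ω l a * x i ω l' b ∂P + ∫ ω, W ω l a * x i ω l' b ∂P| ≤ e * T := by
    intro l l'
    refine absint he (int mG mx bG bx l a l' b) (int mW mx bW bx l a l' b) fun ω => ?_
    rw [← add_mul, abs_mul]
    calc _ ≤ (e * ‖x i ω‖ ^ 2) * ‖x i ω‖ := mul_le_mul (gw ω l a) (abs_coord_le _ _ _)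
          (abs_nonneg _) (by positivity)
      _ = _ := by ring
  have E2 : ∀ l l', |∫ ω, x i ω l a * G ω l' b ∂P + ∫ ω, x i ω l a * W ω l' b ∂P| ≤ e * T := by
    intro l l'
    refine absint he (int mx mG bx bG l a l' b) (int mx mW bx bW l a l' b) fun ω => ?_
    rw [← mul_add, abs_mul]
    calc _ ≤ ‖x i ω‖ * (e * ‖x i ω‖ ^ 2) := mul_le_mul (abs_coord_le _ _ _) (gw ω l' b)
          (abs_nonneg _) (by positivity)
      _ = _ := by ring
  -- The drift is close to `-W`, so sums `G + W` are the small quantities, and `G G' - W W' = G (G'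
  -- + W') - (G + W) W'`.
  have E3 : ∀ l l', |∫ ω, G ω l a * G ω l' b ∂P - ∫ ω, W ω l a * W ω l' b ∂P|
      ≤ 2 * δ * e * T := by
    intro l l'
    rw [sub_eq_add_neg, ← integral_neg]
    refine absint (by positivity) (int mG mG bG bG l a l' b) (int mW mW bW bW l a l' b).neg
      fun ω => ?_
    have e1 : G ω l a * G ω l' b + -(W ω l a * W ω l' b)
        = G ω l a * (G ω l' b + W ω l' b) - (G ω l a + W ω l a) * W ω l' b := by ring
    rw [e1]
    refine (abs_sub _ _).trans ?_
    rw [abs_mul, abs_mul]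
    have h1 : |G ω l a| * |G ω l' b + W ω l' b| ≤ (δ * ‖x i ω‖) * (e * ‖x i ω‖ ^ 2) :=
      mul_le_mul ((abs_coord_le _ _ _).trans (gx ω)) (gw ω l' b) (abs_nonneg _) (by positivity)
    have h2 : |G ω l a + W ω l a| * |W ω l' b| ≤ (e * ‖x i ω‖ ^ 2) * (δ * ‖x i ω‖) :=
      mul_le_mul (gw ω l a) ((abs_coord_le _ _ _).trans (wx ω)) (abs_nonneg _) (by positivity)
    calc _ ≤ _ := add_le_add h1 h2
      _ = _ := by ring
  have hT0 : 0 ≤ T := le_trans (integral_nonneg fun ω => by positivity) hT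
  have hκ0 : 0 ≤ κ := le_trans (abs_nonneg _) (hκ k a b)
  set η := ∑ k, mbar k with hη
  have hη0 : 0 ≤ η := Finset.sum_nonneg fun k _ => (D.mbar_pos k).le
  have hm0 := D.m_pos
  have drv : drive Q m2 Rs ((k, a), (k', b)) = ∑ l, ∑ l', Q (l, l') (k, k') *
      (m2 l l' * if l = l' then Rs l a b else 0) := by
    simp [drive]
  rw [step, lin, drv, ← Finset.sum_sub_distrib, ← Finset.sum_sub_distrib]
  simp only [← Finset.sum_sub_distrib, ← mul_sub]
  have term : ∀ l l', |(∫ ω, x i ω l a * x i ω l' b ∂P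
        + mbar l * ∫ ω, G ω l a * x i ω l' b ∂P + mbar l' * ∫ ω, x i ω l a * G ω l' b ∂P
        + m2 l l' * (∫ ω, G ω l a * G ω l' b ∂P + ∫ ω, s i ω l a * s i ω l' b ∂P))
      - (∫ ω, x i ω l a * x i ω l' b ∂P
        - mbar l * ∫ ω, W ω l a * x i ω l' b ∂P - mbar l' * ∫ ω, x i ω l a * W ω l' b ∂P
        + m2 l l' * ∫ ω, W ω l a * W ω l' b ∂P) - m2 l l' * (if l = l' then Rs l a b else 0)|
      ≤ η * ((2 * e + 2 * δ * e * m) * T + m * κ) := by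
    intro l l'
    have h4 : |∫ ω, s i ω l a * s i ω l' b ∂P - if l = l' then Rs l a b else 0| ≤ κ := by
      rw [ss_]
      split_ifs
      · exact hκ l a b
      · simpa using hκ0
    have h5 := D.abs_m2_le l l'
    have h6 := mul_le_mul h5 (E3 l l') (abs_nonneg _) (by positivity)
    have h7 := mul_le_mul h5 h4 (abs_nonneg _) (by positivity)
    have h8 := mul_le_mul (D.mbar_le_sum l) (E1 l l') (abs_nonneg _) hη0
    have h9 := mul_le_mul (D.mbar_le_sum l') (E2 l l') (abs_nonneg _) hη0
    rw [← abs_of_pos (D.mbar_pos l), ← abs_mul] at h8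
    rw [← abs_of_pos (D.mbar_pos l'), ← abs_mul] at h9
    rw [← abs_mul] at h6 h7
    have e1 : ∀ X Y1 Y2 Z1 Z2 U1 U2 V1 V2 c1 c2 c3 : ℝ,
        X + c1 * Y1 + c2 * Z1 + c3 * (U1 + V1) - (X - c1 * Y2 - c2 * Z2 + c3 * U2) - c3 * V2
        = (c1 * (Y1 + Y2) + c2 * (Z1 + Z2)) + (c3 * (U1 - U2) + c3 * (V1 - V2)) := by
      intros; ring
    rw [e1]
    refine (abs_add_le _ _).trans ((add_le_add (abs_add_le _ _) (abs_add_le _ _)).trans ?_)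
    calc _ ≤ _ := add_le_add (add_le_add h8 h9) (add_le_add h6 h7)
      _ = _ := by ring
  refine (Finset.abs_sum_le_sum_abs _ _).trans ?_
  refine (Finset.sum_le_sum fun l _ => Finset.abs_sum_le_sum_abs _ _).trans ?_
  simp only [abs_mul]
  refine (Finset.sum_le_sum fun l _ => Finset.sum_le_sum fun l' _ =>
    mul_le_mul_of_nonneg_left (term l l') (abs_nonneg _)).trans ?_
  rw [← Fintype.sum_prod_type' (f := fun l l' => |Q (l, l') (k, k')| *
    (η * ((2 * e + 2 * δ * e * m) * T + m * κ))), ← Finset.sum_mul]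
  exact mul_le_mul_of_nonneg_right (sum_abs_le_absSum Q (k, k')) (by positivity)

end DiffusionProcess

end SecondMoments

/-! ### The long-term model -/

section LongTerm

variable {N M : ℕ} {Ω : Type*}

/-- One step of the long-term model, in which the costs are replaced by quadratic ones. -/
noncomputable def longTerm (H : Fin N → Vec M →L[ℝ] Vec M) (A : Matrix (Fin N) (Fin N) ℝ)
    (μ : Fin N → ℝ) (x : Fin N → Vec M) : Fin N → Vec M :=
  combine A (x + scale μ fun l => -(H l (x l)))

/-- The mean Hessian, as an operator. -/
noncomputable def meanOp (mbar p : Fin N → ℝ) (H : Fin N → Vec M →L[ℝ] Vec M) : Vec M →L[ℝ] Vec M :=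
  ∑ l, (mbar l * p l) • H l

namespace OneStep

variable {S C H' : MeasurableSpace Ω} {mΩ : MeasurableSpace Ω} {P : Measure Ω}
  [IsProbabilityMeasure P]
  {A : Ω → Matrix (Fin N) (Fin N) ℝ} {μ : Ω → Fin N → ℝ} {Abar : Matrix (Fin N) (Fin N) ℝ}
  {Q : Matrix (Fin N × Fin N) (Fin N × Fin N) ℝ} {mbar : Fin N → ℝ} {m2 : Fin N → Fin N → ℝ}
  {g : Fin N → Vec M → Vec M} {H : Fin N → Vec M →L[ℝ] Vec M} {ν δ e m : ℝ} {p : Fin N → ℝ}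
  {v : Fin N × Fin N → ℝ} {cv : ℝ}

theorem measurable_longTerm (O : OneStep P S C H' A μ Abar Q mbar m2)
    (H : Fin N → Vec M →L[ℝ] Vec M) (x : Fin N → Vec M) :
    Measurable fun ω => longTerm H (A ω) (μ ω) x :=
  O.measurable_combine ((O.measurable_state (x := fun _ => x) (h := fun _ l => -(H l (x l)))
    measurable_const measurable_const).mono O.le_sup le_rfl)

/-- From a fixed starting point, bounded step-sizes and averaging keep the result in a fixed ball
almost surely, where continuous functions are bounded. -/
theorem integrable_longTerm (O : OneStep P S C H' A μ Abar Q mbar m2)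
    (H : Fin N → Vec M →L[ℝ] Vec M) (x : Fin N → Vec M) {f : (Fin N → Vec M) → ℝ}
    (hf : Continuous f) : Integrable (fun ω => f (longTerm H (A ω) (μ ω) x)) P := by
  obtain ⟨b, hb, hμ⟩ := O.step_bdd
  set r := ‖x‖ + b * ‖fun l => -(H l (x l))‖ with hr
  obtain ⟨L, hL⟩ := (isCompact_closedBall (0 : Fin N → Vec M) r).exists_bound_of_continuousOn
    hf.continuousOn
  refine (integrable_const L).mono' (hf.measurable.comp (O.measurable_longTerm H x)).aestronglyMeasurable ?_
  filter_upwards [hμ, O.stoch] with ω h1 h2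
  refine hL _ (mem_closedBall_zero_iff.2 ?_)
  refine (norm_combine_le h2 _).trans ((norm_add_le _ _).trans (add_le_add le_rfl ?_))
  exact norm_scale_le hb h1 _

/-- Second-order moments of the long-term model. -/
theorem integral_tens_longTerm (O : OneStep P S C H' A μ Abar Q mbar m2)
    (H : Fin N → Vec M →L[ℝ] Vec M) (x y : Fin N → Vec M) (q : Idx N M) :
    HasInt P (fun ω => tens (longTerm H (A ω) (μ ω) x) (longTerm H (A ω) (μ ω) y) q)
      ((momentMatrix Q mbar m2 H *ᵥ tens x y) q) := by
  obtain ⟨⟨k, a⟩, ⟨k', b⟩⟩ := q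
  set hx : Fin N → Vec M := fun l => -(H l (x l)) with hhx
  set hy : Fin N → Vec M := fun l => -(H l (y l)) with hhy
  set L := ‖x‖ + ‖hx‖ + ‖y‖ + ‖hy‖ with hL
  have n1 := norm_nonneg x
  have n2 := norm_nonneg y
  have n3 := norm_nonneg hx
  have n4 := norm_nonneg hy
  have h1 := O.second_moments_step (x := fun _ => x) (h := fun _ => hx) (y := fun _ => y)
    (g := fun _ => hy) measurable_const measurable_const measurable_const measurable_const
    (R := fun _ => 1) (integrable_const _) (L := L) (by positivity) (fun _ => by linarith)
    (fun _ => by linarith) (fun _ => by linarith) (fun _ => by linarith) k k' a b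
  refine ⟨h1.1, h1.2.trans ?_⟩
  rw [momentMatrix_mulVec]
  refine Finset.sum_congr rfl fun l _ => Finset.sum_congr rfl fun l' _ => ?_
  have e1 : (∑ c, opMatrix (H l) a c * x l c) * y l' b
      = ∑ c, opMatrix (H l) a c * (x l c * y l' b) := by
    rw [Finset.sum_mul]
    exact Finset.sum_congr rfl fun _ _ => by ring
  have e2 : x l a * (∑ c, opMatrix (H l') b c * y l' c)
      = ∑ c, opMatrix (H l') b c * (x l a * y l' c) := by
    rw [Finset.mul_sum]
    exact Finset.sum_congr rfl fun _ _ => by ring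
  have e3 : (∑ c, opMatrix (H l) a c * x l c) * (∑ d, opMatrix (H l') b d * y l' d)
      = ∑ c, ∑ d, opMatrix (H l) a c * opMatrix (H l') b d * (x l c * y l' d) := by
    rw [Finset.sum_mul_sum]
    exact Finset.sum_congr rfl fun _ _ => Finset.sum_congr rfl fun _ _ => by ring
  simp only [integral_const, probReal_univ, one_smul, tens, hhx, hhy, PiLp.neg_apply,
    apply_coord (H _), neg_mul, mul_neg, e1, e2, e3]
  ring

/-- By duality, `momentMatrix` acting on the right of a form is the expectation of that form after
one step of the long-term model. Powers of the matrix can thus be studied through pointwise one-step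
inequalities. -/
theorem integral_form_longTerm (O : OneStep P S C H' A μ Abar Q mbar m2)
    (H : Fin N → Vec M →L[ℝ] Vec M) (ζ : Idx N M → ℝ) (x y : Fin N → Vec M) :
    HasInt P (fun ω => ζ ⬝ᵥ tens (longTerm H (A ω) (μ ω) x) (longTerm H (A ω) (μ ω) y))
      ((ζ ᵥ* momentMatrix Q mbar m2 H) ⬝ᵥ tens x y) := by
  have h1 := HasInt.sum fun q => (O.integral_tens_longTerm H x y q).const_mul (ζ q)
  rw [← Matrix.dotProduct_mulVec]
  exact h1

/-- Forms are propagated by powers of the moment matrix. -/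
theorem abs_form_pow_le (O : OneStep P S C H' A μ Abar Q mbar m2)
    (H : Fin N → Vec M →L[ℝ] Vec M) {G : (Fin N → Vec M) → ℝ} (hG : Continuous G) {ρ : ℝ} (hρ : 0 ≤ ρ)
    (hstep : ∀ x, ∫ ω, G (longTerm H (A ω) (μ ω) x) ∂P ≤ ρ * G x) {ζ : Idx N M → ℝ}
    (hζ : ∀ x y, |ζ ⬝ᵥ tens x y| ≤ G x + G y) (n : ℕ) (x y : Fin N → Vec M) :
    |(ζ ᵥ* momentMatrix Q mbar m2 H ^ n) ⬝ᵥ tens x y| ≤ ρ ^ n * (G x + G y) := by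
  induction n generalizing x y with
  | zero => simpa using hζ x y
  | succ n ih =>
    have h1 := O.integral_form_longTerm H (ζ ᵥ* momentMatrix Q mbar m2 H ^ n) x y
    rw [Matrix.vecMul_vecMul, ← pow_succ] at h1
    rw [← h1.2]
    refine abs_integral_le_integral_abs.trans ?_
    -- The induction hypothesis is integrated over one step from `x` and `y`. Only the one-step law
    -- enters, so independent copies of the step at all times need not be constructed.
    have ix := HasInt.of_integrable (O.integrable_longTerm H x hG)
    have iy := HasInt.of_integrable (O.integrable_longTerm H y hG)
    refine ((HasInt.of_integrable h1.1.abs).mono_ae ((ix.add iy).const_mul (ρ ^ n))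
      (Eventually.of_forall fun ω => ih _ _)).trans ?_
    rw [pow_succ, mul_assoc]
    refine mul_le_mul_of_nonneg_left ?_ (by positivity)
    rw [mul_add]
    exact add_le_add (hstep x) (hstep y)

/-- The expectation is monotone, so a pointwise one-step expansion iterates. No sign of the form is
required, which permits the indefinite form of the lower bound on the spectral radius. -/
theorem le_form_pow (O : OneStep P S C H' A μ Abar Q mbar m2)
    (H : Fin N → Vec M →L[ℝ] Vec M) {ζ : Idx N M → ℝ} {ρ : ℝ} (hρ : 0 ≤ ρ)
    (hstep : ∀ x, ρ * (ζ ⬝ᵥ tens x x) ≤ (ζ ᵥ* momentMatrix Q mbar m2 H) ⬝ᵥ tens x x) (n : ℕ)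
    (x : Fin N → Vec M) :
    ρ ^ n * (ζ ⬝ᵥ tens x x) ≤ (ζ ᵥ* momentMatrix Q mbar m2 H ^ n) ⬝ᵥ tens x x := by
  induction n generalizing x with
  | zero => simp
  | succ n ih =>
    have h1 := O.integral_form_longTerm H (ζ ᵥ* momentMatrix Q mbar m2 H ^ n) x x
    rw [Matrix.vecMul_vecMul, ← pow_succ] at h1
    have h2 := (O.integral_form_longTerm H ζ x x).const_mul (ρ ^ n)
    have h3 := h2.mono_ae h1 (Eventually.of_forall fun ω => ih _)
    refine le_trans ?_ h3
    rw [pow_succ, mul_assoc]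
    exact mul_le_mul_of_nonneg_left (hstep x) (by positivity)

/-- The mean-square size of the increments of the long-term model. -/
theorem integral_norm_scale_sq_le (O : OneStep P S C H' A μ Abar Q mbar m2)
    (hg : CostBounds g H ν δ e) (hp : ProbVec p) (hm2 : ∀ k, m2 k k ≤ mbar k * m)
    (x : Fin N → Vec M) :
    Integrable (fun ω => ‖scale (μ ω) fun l => -(H l (x l))‖ ^ 2) P ∧
    ∫ ω, ‖scale (μ ω) fun l => -(H l (x l))‖ ^ 2 ∂P
      ≤ 2 * δ ^ 2 * ((∑ l, mbar l) * m) * (‖wavg p x‖ ^ 2 + disp x ^ 2) := by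
  have hsum : HasInt P (fun ω => ∑ l, μ ω l ^ 2 * ‖-(H l (x l))‖ ^ 2)
      (∑ l, m2 l l * ‖-(H l (x l))‖ ^ 2) := by
    refine HasInt.sum fun l => ?_
    have h1 : HasInt P (fun ω => μ ω l * μ ω l) (m2 l l) := by
      refine ⟨?_, O.mean_step_mul l l⟩
      have := O.integrable_step_mul (O.integrable_step_mul (integrable_const (1 : ℝ)) l) l
      simpa only [mul_one] using this
    have h2 := (h1.const_mul (‖-(H l (x l))‖ ^ 2)).congr
      (g := fun ω => μ ω l ^ 2 * ‖-(H l (x l))‖ ^ 2) fun ω => by ring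
    rwa [mul_comm] at h2
  have hms : Measurable fun ω => scale (μ ω) fun l => -(H l (x l)) :=
    measurable_scale O.measurable_step' measurable_const
  have hi : Integrable (fun ω => ‖scale (μ ω) fun l => -(H l (x l))‖ ^ 2) P :=
    hsum.1.mono' (hms.norm.pow_const 2).aestronglyMeasurable (Eventually.of_forall fun ω => by
      rw [Real.norm_of_nonneg (by positivity)]
      exact norm_scale_sq_le _ _)
  refine ⟨hi, ((HasInt.of_integrable hi).mono_ae hsum (Eventually.of_forall fun ω =>
    norm_scale_sq_le _ _)).trans ?_⟩
  have hx : ‖x‖ ^ 2 ≤ 2 * (‖wavg p x‖ ^ 2 + disp x ^ 2) := by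
    have h1 := norm_le_wavg_add_disp hp x
    have h2 := pow_le_pow_left₀ (norm_nonneg x) h1 2
    nlinarith [sq_nonneg (‖wavg p x‖ - disp x)]
  have hδ := hg.delta_pos
  have h1 : ∀ l, m2 l l * ‖-(H l (x l))‖ ^ 2
      ≤ mbar l * m * (δ ^ 2 * (2 * (‖wavg p x‖ ^ 2 + disp x ^ 2))) := by
    intro l
    have h0 : 0 ≤ m2 l l := by
      rw [← O.mean_step_mul l l]; exact integral_nonneg fun ω => mul_self_nonneg _
    refine mul_le_mul (hm2 l) ?_ (by positivity) (h0.trans (hm2 l))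
    rw [norm_neg]
    calc ‖H l (x l)‖ ^ 2 ≤ (δ * ‖x‖) ^ 2 := pow_le_pow_left₀ (norm_nonneg _) ((hg.norm_le l _).trans
          (mul_le_mul_of_nonneg_left (norm_le_pi_norm x l) hδ.le)) 2
      _ = δ ^ 2 * ‖x‖ ^ 2 := by ring
      _ ≤ _ := mul_le_mul_of_nonneg_left hx (by positivity)
  refine (Finset.sum_le_sum fun l _ => h1 l).trans (le_of_eq ?_)
  rw [← Finset.sum_mul, ← Finset.sum_mul]; ring

theorem integral_qf_longTerm_le (O : OneStep P S C H' A μ Abar Q mbar m2)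
    (hg : CostBounds g H ν δ e) (hp : ProbVec p) (hv : IsLyapunov M Q v cv)
    (hm2 : ∀ k, m2 k k ≤ mbar k * m) (x : Fin N → Vec M) :
    ∫ ω, qf v (longTerm H (A ω) (μ ω) x) ∂P ≤ (1 - 3 * IsLyapunov.rate cv) * qf v x
      + (1 + 1 / IsLyapunov.rate cv) * (4 * cv) * (2 * δ ^ 2 * ((∑ l, mbar l) * m)
        * (‖wavg p x‖ ^ 2 + disp x ^ 2)) := by
  obtain ⟨hi, hle⟩ := O.integral_norm_scale_sq_le hg hp hm2 x
  have hθ := hv.rate_pos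
  have hcv := hv.one_le
  obtain ⟨b, hb, hμ⟩ := O.step_bdd
  set hx : Fin N → Vec M := fun l => -(H l (x l)) with hhx
  have hz := O.measurable_state (x := fun _ => x) (h := fun _ => hx) measurable_const measurable_const
  have mz := hz.mono O.le_sup le_rfl
  have bdd : ∀ {f : (Fin N → Vec M) → ℝ}, Continuous f →
      Integrable (fun ω => f (x + scale (μ ω) hx)) P := by
    intro f hf
    obtain ⟨L, hL⟩ := (isCompact_closedBall (0 : Fin N → Vec M)
      (‖x‖ + b * ‖hx‖)).exists_bound_of_continuousOn hf.continuousOn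
    refine (integrable_const L).mono' (hf.measurable.comp mz).aestronglyMeasurable ?_
    filter_upwards [hμ] with ω h1
    exact hL _ (mem_closedBall_zero_iff.2 ((norm_add_le _ _).trans
      (add_le_add le_rfl (norm_scale_le hb h1 _))))
  have h1 := (O.integral_mul_qf_combine hz (φ := fun _ => 1) measurable_const (fun k l => by
    simp only [one_mul]
    exact bdd (f := fun y => inner ℝ (y k) (y l)) (by fun_prop)) v).2
  simp only [one_mul] at h1
  have h2 : ∫ ω, qf v (longTerm H (A ω) (μ ω) x) ∂P = ∫ ω, qf (Q *ᵥ v) (x + scale (μ ω) hx) ∂P := h1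
  rw [h2]
  have h3 := (HasInt.of_integrable (bdd (continuous_qf (Q *ᵥ v)))).mono_ae
    ((HasInt.of_integrable (integrable_const ((1 - 3 * IsLyapunov.rate cv) * qf v x))).add
      ((HasInt.of_integrable hi).const_mul ((1 + 1 / IsLyapunov.rate cv) * (4 * cv))))
    (Eventually.of_forall fun ω => hv.qf_step_le x (scale (μ ω) hx))
  refine h3.trans (add_le_add (by simp) (mul_le_mul_of_nonneg_left hle (by positivity)))

set_option maxHeartbeats 400000 in
-- Along an eigenvector `w` the average changes by an increment `ξ` with mean `-l ⟪w, u⟫ - q`, where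
-- `q` is due to disagreement only. Expanding the square gives the factor `1 - 2 l`; the second
-- moment of `ξ` contributes only squared disagreement and terms of order `η m`, so its part
-- quadratic in `l` is an error too.
theorem abs_integral_inner_sq_longTerm_le (O : OneStep P S C H' A μ Abar Q mbar m2)
    (hg : CostBounds g H ν δ e) (hp : ProbVec p) (hpA : Abar *ᵥ p = p)
    (hmbar : ∀ k, 0 < mbar k) (hmm : ∀ k, mbar k ≤ m) (hm1 : (∑ l, mbar l) * m ≤ 1)
    (hm2 : ∀ k, m2 k k ≤ mbar k * m) {w : Vec M} (hw : ‖w‖ = 1) {l : ℝ}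
    (hl : meanOp mbar p H w = l • w) (x : Fin N → Vec M) :
    |∫ ω, inner ℝ w (wavg p (longTerm H (A ω) (μ ω) x)) ^ 2 ∂P
      - (1 - 2 * l) * inner ℝ w (wavg p x) ^ 2|
      ≤ (3 + (N + 4) * δ ^ 2) * (disp x ^ 2 + (∑ l, mbar l) * m * ‖wavg p x‖ ^ 2) := by
  obtain ⟨hi, hle⟩ := O.integral_norm_scale_sq_le hg hp hm2 x
  have hδ := hg.delta_pos
  set hx : Fin N → Vec M := fun l => -(H l (x l)) with hhx
  set u := wavg p x with hu
  set d := disp x with hd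
  have hd0 : 0 ≤ d := disp_nonneg x
  set η := ∑ l, mbar l with hη
  have hη0 : 0 ≤ η := Finset.sum_nonneg fun k _ => (hmbar k).le
  have hηm : η ≤ N * m := by
    calc η ≤ ∑ _k : Fin N, m := Finset.sum_le_sum fun k _ => hmm k
      _ = N * m := by simp
  have hcont : Continuous fun y : Fin N → Vec M => inner ℝ w (wavg p y) :=
    (innerSL ℝ w).continuous.comp (continuous_wavg p)
  have i1 := HasInt.of_integrable (O.integrable_longTerm H x hcont)
  have i2 := HasInt.of_integrable (O.integrable_longTerm H x (hcont.pow 2))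
  have mean : ∫ ω, inner ℝ w (wavg p (longTerm H (A ω) (μ ω) x)) ∂P
      = inner ℝ w u + ∑ l, p l * mbar l * inner ℝ w (hx l) := by
    have := (O.integral_inner_wavg (x := fun _ => x) (h := fun _ => hx) (f := fun _ => w)
      measurable_const measurable_const measurable_const (fun l => integrable_const _)
      (fun l => integrable_const _) hpA).2
    simp only [integral_const, probReal_univ, one_smul] at this
    exact this
  have mean2 : ∑ l, p l * mbar l * inner ℝ w (hx l)
      = -(l * inner ℝ w u) - ∑ l, p l * mbar l * inner ℝ w (H l (x l - u)) := by
    have e1 : l * inner ℝ w u = ∑ l, p l * mbar l * inner ℝ w (H l u) := by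
      have e2 : inner ℝ (meanOp mbar p H w) u = l * inner ℝ w u := by
        rw [hl, real_inner_smul_left]
      rw [← e2]
      simp only [meanOp, FunLike.coe_sum, Finset.sum_apply,
        FunLike.coe_smul, Pi.smul_apply, sum_inner, real_inner_smul_left]
      refine Finset.sum_congr rfl fun k _ => ?_
      rw [hg.symm k u w]; ring
    rw [e1, ← sub_eq_zero]
    simp only [← Finset.sum_neg_distrib, ← Finset.sum_sub_distrib]
    refine Finset.sum_eq_zero fun k _ => ?_
    simp only [hhx, map_sub, inner_sub_right, inner_neg_right]; ring
  set ξ : Ω → ℝ := fun ω => inner ℝ w (wavg p (longTerm H (A ω) (μ ω) x)) - inner ℝ w u with hξ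
  have iξ : HasInt P ξ (-(l * inner ℝ w u) - ∑ l, p l * mbar l * inner ℝ w (H l (x l - u))) := by
    have := i1.sub (HasInt.of_integrable (integrable_const (inner ℝ w u)))
    rw [mean, mean2] at this
    simp only [integral_const, probReal_univ, one_smul, add_sub_cancel_left] at this
    exact this
  set q := ∑ l, p l * mbar l * inner ℝ w (H l (x l - u)) with hq
  have iξ2 : Integrable (fun ω => ξ ω ^ 2) P :=
    O.integrable_longTerm H x (f := fun y => (inner ℝ w (wavg p y) - inner ℝ w u) ^ 2)
      ((hcont.sub continuous_const).pow 2)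
  have e1 : ∫ ω, inner ℝ w (wavg p (longTerm H (A ω) (μ ω) x)) ^ 2 ∂P
      = inner ℝ w u ^ 2 + 2 * inner ℝ w u * (-(l * inner ℝ w u) - q) + ∫ ω, ξ ω ^ 2 ∂P := by
    have := (((HasInt.of_integrable (integrable_const (inner ℝ w u ^ 2))).add
      (iξ.const_mul (2 * inner ℝ w u))).add (HasInt.of_integrable iξ2)).congr
      (g := fun ω => inner ℝ w (wavg p (longTerm H (A ω) (μ ω) x)) ^ 2) fun ω => by
        simp only [hξ]; ring
    rw [this.2]; simp
  have hq1 : |q| ≤ η * (δ * d) := by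
    rw [hη, Finset.sum_mul]
    refine (Finset.abs_sum_le_sum_abs _ _).trans (Finset.sum_le_sum fun k _ => ?_)
    have hpk : p k ≤ 1 := by
      rw [← hp.sum]
      exact Finset.single_le_sum (f := p) (fun k _ => hp.nonneg k) (Finset.mem_univ k)
    rw [abs_mul, abs_of_nonneg (mul_nonneg (hp.nonneg k) (hmbar k).le)]
    refine mul_le_mul (by nlinarith [hmbar k]) ?_ (abs_nonneg _) (hmbar k).le
    refine (abs_real_inner_le_norm _ _).trans ?_
    rw [hw, one_mul]
    exact (hg.norm_le k _).trans (mul_le_mul_of_nonneg_left (norm_sub_wavg_le hp x k) hδ.le)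
  have hwu : |inner ℝ w u| ≤ ‖u‖ := by
    have := abs_real_inner_le_norm w u
    rwa [hw, one_mul] at this
  have hξ2 : ∫ ω, ξ ω ^ 2 ∂P ≤ 2 * d ^ 2 + 2 * (2 * δ ^ 2 * (η * m) * (‖u‖ ^ 2 + d ^ 2)) := by
    have h1 := (HasInt.of_integrable iξ2).mono_ae
      ((HasInt.of_integrable (integrable_const (2 * d ^ 2))).add
        ((HasInt.of_integrable hi).const_mul 2)) (by
        filter_upwards [O.stoch] with ω hω
        have h2 : |ξ ω| ≤ d + ‖scale (μ ω) hx‖ := by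
          have h3 := norm_wavg_combine_sub_le hp hω x (scale (μ ω) hx)
          simp only [hξ, ← inner_sub_right]
          refine (abs_real_inner_le_norm _ _).trans ?_
          rw [hw, one_mul]
          exact h3
        rw [← sq_abs]
        have h3 := pow_le_pow_left₀ (abs_nonneg _) h2 2
        nlinarith [sq_nonneg (d - ‖scale (μ ω) hx‖)])
    refine h1.trans ?_
    simp only [integral_const, probReal_univ, one_smul]
    linarith
  have hξ0 : 0 ≤ ∫ ω, ξ ω ^ 2 ∂P := integral_nonneg fun ω => sq_nonneg _
  have e2 : ∫ ω, inner ℝ w (wavg p (longTerm H (A ω) (μ ω) x)) ^ 2 ∂P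
      - (1 - 2 * l) * inner ℝ w u ^ 2 = -(2 * (inner ℝ w u * q)) + ∫ ω, ξ ω ^ 2 ∂P := by
    rw [e1]; ring
  rw [e2]
  have h4 : |inner ℝ w u * q| ≤ ‖u‖ * (η * (δ * d)) := by
    rw [abs_mul]; exact mul_le_mul hwu hq1 (abs_nonneg _) (norm_nonneg _)
  -- The cross term splits into `d²` and `η² δ² ‖u‖²`; then `η² ≤ N η m` puts the second part in the
  -- form of the other errors.
  have h5 : 2 * (‖u‖ * (η * (δ * d))) ≤ d ^ 2 + N * δ ^ 2 * (η * m * ‖u‖ ^ 2) := by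
    have h6 : η * η * (δ ^ 2 * ‖u‖ ^ 2) ≤ η * (N * m) * (δ ^ 2 * ‖u‖ ^ 2) :=
      mul_le_mul_of_nonneg_right (mul_le_mul_of_nonneg_left hηm hη0) (by positivity)
    have h7 := sq_nonneg (d - η * δ * ‖u‖)
    linarith only [h6, h7]
  have hm0 : 0 ≤ η * m := by
    have : 0 ≤ η * η := mul_nonneg hη0 hη0
    rcases Nat.eq_zero_or_pos N with h | h
    · subst h; simp [hη]
    · have : 0 < m := lt_of_lt_of_le (hmbar ⟨0, h⟩) (hmm ⟨0, h⟩)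
      positivity
  have h7 : η * m * (4 * δ ^ 2 * d ^ 2) ≤ 1 * (4 * δ ^ 2 * d ^ 2) :=
    mul_le_mul_of_nonneg_right hm1 (by positivity)
  have h8 : 0 ≤ (N : ℝ) * δ ^ 2 * d ^ 2 := by positivity
  have h9 : 0 ≤ η * m * ‖u‖ ^ 2 := by positivity
  have h10 := abs_le.1 h4
  rw [abs_le]
  have h11 : 0 ≤ η * m * (δ ^ 2 * ‖u‖ ^ 2) := by positivity
  have h12 : 0 ≤ δ ^ 2 * d ^ 2 := by positivity
  have h13 := sq_nonneg d
  constructor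
  · linarith only [h10.2, h5, hξ0, h8, h9, h11, h12, h13]
  · linarith only [h10.1, h5, hξ2, h7, h8, h9, h11, h12, h13]

end OneStep

end LongTerm

/-! ### The spectral radius of the long-term model -/

section SpectralRadius

variable {ι : Type*} [Fintype ι] [DecidableEq ι]

attribute [local instance] Matrix.linftyOpNormedRing Matrix.linftyOpNormedAlgebra

theorem norm_map_le_absSum (F : Matrix ι ι ℝ) : ‖F.map (fun x : ℝ => (x : ℂ))‖ ≤ absSum F := by
  rw [Matrix.linfty_opNorm_def]
  have h : ∀ s : Finset ι, ∀ f : ι → NNReal, ((s.sup f : NNReal) : ℝ) ≤ ∑ i ∈ s, (f i : ℝ) := by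
    intro s f
    rw [← NNReal.coe_sum, NNReal.coe_le_coe]
    exact Finset.sup_le fun i hi => Finset.single_le_sum (fun _ _ => zero_le) hi
  refine (h _ _).trans (le_of_eq ?_)
  simp [absSum]

theorem absSum_le_norm_map (F : Matrix ι ι ℝ) :
    absSum F ≤ Fintype.card ι * ‖F.map (fun x : ℝ => (x : ℂ))‖ := by
  rw [Matrix.linfty_opNorm_def]
  have h : ∀ p ∈ Finset.univ, ∑ q, |F p q| ≤ ((Finset.univ.sup fun i =>
      ∑ j, ‖(F.map (fun x : ℝ => (x : ℂ))) i j‖₊ : NNReal) : ℝ) := by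
    intro p hp
    have h1 := Finset.le_sup (f := fun i => ∑ j, ‖(F.map (fun x : ℝ => (x : ℂ))) i j‖₊) hp
    have h2 := NNReal.coe_le_coe.2 h1
    refine le_trans (le_of_eq ?_) h2
    simp
  refine (Finset.sum_le_sum h).trans (le_of_eq ?_)
  simp

theorem tendsto_const_rpow_one_div {c : ℝ} (hc : 0 < c) :
    Tendsto (fun n : ℕ => c ^ (1 / n : ℝ)) atTop (𝓝 1) := by
  have h := (tendsto_const_nhds (x := c)).rpow (tendsto_one_div_atTop_nhds_zero_nat (𝕜 := ℝ))
    (Or.inl hc.ne')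
  rwa [Real.rpow_zero] at h

/-- Geometric bounds on the powers of a matrix are bounds on its spectral radius. -/
theorem exists_spectralRadius_eq [Nonempty ι] {F : Matrix ι ι ℝ} {K κ ρ ρ₁ : ℝ} (hρ : 0 ≤ ρ)
    (hρ₁ : 0 ≤ ρ₁) (hκ : 0 < κ) (hup : ∀ n p q, |(F ^ n) p q| ≤ K * ρ₁ ^ n)
    (hlo : ∀ n, κ * ρ ^ n ≤ absSum (F ^ n)) :
    ∃ α, ρ ≤ α ∧ α ≤ ρ₁ ∧
      spectralRadius ℂ (F.map (fun x : ℝ => (x : ℂ))) = ENNReal.ofReal α := by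
  set a : Matrix ι ι ℂ := F.map (fun x : ℝ => (x : ℂ)) with ha
  have hpow : ∀ n, a ^ n = (F ^ n).map (fun x : ℝ => (x : ℂ)) := fun n =>
    (Matrix.map_pow F Complex.ofRealHom n).symm
  -- Gelfand's formula: the `n`-th roots remove the constants `K'` and `κ / card ι` in the limit.
  have ht := spectrum.pow_norm_pow_one_div_tendsto_nhds_spectralRadius a
  have hcard : (0 : ℝ) < Fintype.card ι := by exact_mod_cast Fintype.card_pos
  set K' := (Fintype.card ι : ℝ) * (Fintype.card ι * |K|) + 1 with hK'
  have hK'0 : 0 < K' := by positivity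
  have hn1 : ∀ n, ‖a ^ n‖ ≤ K' * ρ₁ ^ n := by
    intro n
    rw [hpow]
    refine (norm_map_le_absSum _).trans ?_
    have h1 : absSum (F ^ n) ≤ ∑ _p : ι, ∑ _q : ι, |K| * ρ₁ ^ n :=
      Finset.sum_le_sum fun p _ => Finset.sum_le_sum fun q _ => (hup n p q).trans
        (mul_le_mul_of_nonneg_right (le_abs_self K) (by positivity))
    refine h1.trans ?_
    simp only [Finset.sum_const, Finset.card_univ, nsmul_eq_mul, hK']
    have : 0 ≤ ρ₁ ^ n := by positivity
    linarith
  have hn2 : ∀ n, κ / Fintype.card ι * ρ ^ n ≤ ‖a ^ n‖ := by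
    intro n
    have h1 := (hlo n).trans (absSum_le_norm_map (F ^ n))
    rw [← hpow] at h1
    rw [div_mul_eq_mul_div, div_le_iff₀ hcard]
    linarith
  have root : ∀ {c r : ℝ}, 0 < c → 0 ≤ r → ∀ n : ℕ, n ≠ 0 →
      (c * r ^ n) ^ (1 / n : ℝ) = c ^ (1 / n : ℝ) * r := by
    intro c r hc hr n hn
    rw [Real.mul_rpow hc.le (by positivity), one_div, Real.pow_rpow_inv_natCast hr hn]
  have t1 : Tendsto (fun n : ℕ => ENNReal.ofReal (K' ^ (1 / n : ℝ) * ρ₁)) atTop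
      (𝓝 (ENNReal.ofReal ρ₁)) := by
    have := (tendsto_const_rpow_one_div hK'0).mul_const ρ₁
    rw [one_mul] at this
    exact ENNReal.tendsto_ofReal this
  have hκc : 0 < κ / Fintype.card ι := by positivity
  have t2 : Tendsto (fun n : ℕ => ENNReal.ofReal ((κ / Fintype.card ι) ^ (1 / n : ℝ) * ρ)) atTop
      (𝓝 (ENNReal.ofReal ρ)) := by
    have := (tendsto_const_rpow_one_div hκc).mul_const ρ
    rw [one_mul] at this
    exact ENNReal.tendsto_ofReal this
  have le1 : spectralRadius ℂ a ≤ ENNReal.ofReal ρ₁ := by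
    refine le_of_tendsto_of_tendsto ht t1 ?_
    filter_upwards [eventually_ne_atTop 0] with n hn
    rw [← root hK'0 hρ₁ n hn]
    exact ENNReal.ofReal_le_ofReal (Real.rpow_le_rpow (norm_nonneg _) (hn1 n) (by positivity))
  have le2 : ENNReal.ofReal ρ ≤ spectralRadius ℂ a := by
    refine le_of_tendsto_of_tendsto t2 ht ?_
    filter_upwards [eventually_ne_atTop 0] with n hn
    rw [← root hκc hρ n hn]
    exact ENNReal.ofReal_le_ofReal (Real.rpow_le_rpow (by positivity) (hn2 n) (by positivity))
  have hfin : spectralRadius ℂ a ≠ ⊤ := ne_top_of_le_ne_top ENNReal.ofReal_ne_top le1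
  refine ⟨(spectralRadius ℂ a).toReal, ?_, ?_, (ENNReal.ofReal_toReal hfin).symm⟩
  · exact (ENNReal.ofReal_le_iff_le_toReal hfin).1 le2
  · exact ENNReal.toReal_le_of_le_ofReal hρ₁ le1

end SpectralRadius

/-- Among `M + 1` consecutive intervals of length `2 g` above `L`, one contains no `x a`. -/
theorem exists_gap {M : ℕ} (x : Fin M → ℝ) (L : ℝ) {g : ℝ} (hg : 0 ≤ g) :
    ∃ j : ℕ, j ≤ M ∧ ∀ a, x a ≤ L + 2 * j * g ∨ L + (2 * j + 2) * g ≤ x a := by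
  by_contra! h
  -- Pigeonhole: if each of the `M + 1` disjoint open intervals contained some `x a`, distinct
  -- intervals would have distinct indices among only `M`.
  choose f hf1 hf2 using fun j : Fin (M + 1) => h j (Nat.lt_succ_iff.1 j.2)
  have inj : Function.Injective f := by
    have key : ∀ i j : Fin (M + 1), i < j → f i ≠ f j := by
      intro i j hij hfij
      have h1 := hf2 i
      have h2 := hf1 j
      rw [hfij] at h1
      have h3 : ((i : ℕ) : ℝ) + 1 ≤ (j : ℕ) := by exact_mod_cast hij
      nlinarith [mul_le_mul_of_nonneg_right h3 hg]
    intro i j hij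
    rcases lt_trichotomy i j with h1 | h1 | h1
    · exact absurd hij (key i j h1)
    · exact h1
    · exact absurd hij.symm (key j i h1)
  have := Fintype.card_le_of_injective f inj
  simp at this

/-! ### Bounds for the mean Hessian, and quadratic forms as vectors -/

section LongTermBounds

variable {N M : ℕ} {Ω : Type*}

theorem meanOp_inner_bounds {g : Fin N → Vec M → Vec M} {H : Fin N → Vec M →L[ℝ] Vec M}
    {ν δ e : ℝ} (hg : CostBounds g H ν δ e) {p mbar : Fin N → ℝ} (hp : ProbVec p)
    (hmbar : ∀ k, 0 < mbar k) {ε : ℝ} (hε : ∀ k, ε ≤ p k) (w : Vec M) :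
    ν * ε * (∑ k, mbar k) * ‖w‖ ^ 2 ≤ inner ℝ w (meanOp mbar p H w) ∧
    inner ℝ w (meanOp mbar p H w) ≤ δ * (∑ k, mbar k) * ‖w‖ ^ 2 := by
  have hν := hg.nu_pos
  have hδ := hg.delta_pos
  have e : inner ℝ w (meanOp mbar p H w) = ∑ k, mbar k * p k * inner ℝ w (H k w) := by
    simp only [meanOp, FunLike.coe_sum, Finset.sum_apply, FunLike.coe_smul, Pi.smul_apply,
      inner_sum, real_inner_smul_right]
  rw [e, Finset.mul_sum, Finset.mul_sum, Finset.sum_mul, Finset.sum_mul]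
  constructor
  · refine Finset.sum_le_sum fun k _ => ?_
    have h1 := hg.pos k w
    have h2 : ε * (ν * ‖w‖ ^ 2) ≤ p k * (ν * ‖w‖ ^ 2) :=
      mul_le_mul_of_nonneg_right (hε k) (by positivity)
    have h3 := mul_le_mul_of_nonneg_left h1 (hp.nonneg k)
    have h4 := mul_le_mul_of_nonneg_left (h2.trans h3) (hmbar k).le
    linarith
  · refine Finset.sum_le_sum fun k _ => ?_
    have hpk : p k ≤ 1 := by
      rw [← hp.sum]
      exact Finset.single_le_sum (f := p) (fun k _ => hp.nonneg k) (Finset.mem_univ k)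
    have h1 : inner ℝ w (H k w) ≤ δ * ‖w‖ ^ 2 := by
      refine (real_inner_le_norm _ _).trans ?_
      have := mul_le_mul_of_nonneg_left (hg.norm_le k w) (norm_nonneg w)
      linarith
    have h0 : 0 ≤ inner ℝ w (H k w) := le_trans (by positivity) (hg.pos k w)
    have h2 : p k * inner ℝ w (H k w) ≤ 1 * (δ * ‖w‖ ^ 2) :=
      mul_le_mul hpk h1 h0 zero_le_one
    have h4 := mul_le_mul_of_nonneg_left h2 (hmbar k).le
    linarith

/-- The vector of the tensor that represents `∑ c, ε c ⟪b c, wavg p x⟫² - Λ qf v x`. -/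
noncomputable def formVec (b : Fin M → Vec M) (s : Fin M → ℝ) (p : Fin N → ℝ) (Λ : ℝ)
    (v : Fin N × Fin N → ℝ) : Idx N M → ℝ :=
  fun q => ∑ c, s c * ((p q.1.1 * b c q.1.2) * (p q.2.1 * b c q.2.2))
    - Λ * (v (q.1.1, q.2.1) * (1 : Matrix (Fin M) (Fin M) ℝ) q.1.2 q.2.2)

theorem formVec_dotProduct (b : Fin M → Vec M) (s : Fin M → ℝ) (p : Fin N → ℝ) (Λ : ℝ)
    (v : Fin N × Fin N → ℝ) (x : Fin N → Vec M) :
    formVec b s p Λ v ⬝ᵥ tens x x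
      = ∑ c, s c * inner ℝ (b c) (wavg p x) ^ 2 - Λ * qf v x := by
  have e1 : ∀ c, inner ℝ (b c) (wavg p x) = ∑ q : Fin N × Fin M, p q.1 * b c q.2 * x q.1 q.2 := by
    intro c
    rw [Fintype.sum_prod_type]
    simp only [wavg, inner_sum, real_inner_smul_right]
    refine Finset.sum_congr rfl fun k _ => ?_
    rw [PiLp.inner_apply, Finset.mul_sum]
    refine Finset.sum_congr rfl fun a _ => ?_
    simp only [RCLike.inner_apply, conj_trivial]; ring
  have e2 : qf v x = ∑ q : Fin N × Fin M, ∑ q' : Fin N × Fin M,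
      v (q.1, q'.1) * (1 : Matrix (Fin M) (Fin M) ℝ) q.2 q'.2 * (x q.1 q.2 * x q'.1 q'.2) := by
    simp only [Fintype.sum_prod_type, qf]
    refine Finset.sum_congr rfl fun k _ => ?_
    rw [Finset.sum_comm]
    refine Finset.sum_congr rfl fun l _ => ?_
    rw [PiLp.inner_apply, Finset.mul_sum]
    refine Finset.sum_congr rfl fun a _ => ?_
    simp only [Matrix.one_apply, mul_ite, mul_one, mul_zero, ite_mul, zero_mul,
      Finset.sum_ite_eq, Finset.mem_univ, if_true, RCLike.inner_apply, conj_trivial]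
    ring
  rw [e2]
  simp only [e1, sq, Finset.sum_mul_sum]
  simp only [Finset.mul_sum]
  rw [Finset.sum_comm]
  simp only [dotProduct, formVec, tens, Fintype.sum_prod_type (γ := ℝ) (α₁ := Fin N × Fin M)]
  rw [← Finset.sum_sub_distrib]
  refine Finset.sum_congr rfl fun q _ => ?_
  rw [Finset.sum_comm, ← Finset.sum_sub_distrib]
  refine Finset.sum_congr rfl fun q' _ => ?_
  rw [sub_mul, Finset.sum_mul]
  congr 1
  · exact Finset.sum_congr rfl fun c _ => by ring
  · ring

end LongTermBounds

/-! ### Two-sided geometric bounds on the powers of the moment matrix -/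

section GeometricBounds

variable {N M : ℕ}

theorem abs_vecMul_dotProduct_le {ι : Type*} [Fintype ι] (ζ t : ι → ℝ) (B : Matrix ι ι ℝ) :
    |(ζ ᵥ* B) ⬝ᵥ t| ≤ (∑ p, |ζ p|) * (∑ q, |t q|) * absSum B := by
  have h1 : ∀ p, |ζ p| ≤ ∑ p, |ζ p| := fun p =>
    Finset.single_le_sum (f := fun p => |ζ p|) (fun _ _ => abs_nonneg _) (Finset.mem_univ p)
  have h2 : ∀ p, |t p| ≤ ∑ p, |t p| := fun p =>
    Finset.single_le_sum (f := fun p => |t p|) (fun _ _ => abs_nonneg _) (Finset.mem_univ p)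
  simp only [dotProduct, Matrix.vecMul, absSum]
  refine (Finset.abs_sum_le_sum_abs _ _).trans ?_
  rw [Finset.sum_comm (f := fun p q => |B p q|), Finset.mul_sum]
  refine Finset.sum_le_sum fun q _ => ?_
  rw [abs_mul]
  calc _ ≤ (∑ p, |ζ p * B p q|) * ∑ q, |t q| :=
        mul_le_mul (Finset.abs_sum_le_sum_abs _ _) (h2 q) (abs_nonneg _)
          (Finset.sum_nonneg fun _ _ => abs_nonneg _)
    _ ≤ ((∑ p, |ζ p|) * ∑ p, |B p q|) * ∑ q, |t q| := by
        refine mul_le_mul_of_nonneg_right ?_ (Finset.sum_nonneg fun _ _ => abs_nonneg _)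
        rw [Finset.mul_sum]
        refine Finset.sum_le_sum fun p _ => ?_
        rw [abs_mul]
        exact mul_le_mul_of_nonneg_right (h1 p) (abs_nonneg _)
    _ = _ := by ring

/-- The network vector with a single nonzero coordinate. -/
noncomputable def unitVec (q : Fin N × Fin M) : Fin N → Vec M :=
  Pi.single q.1 (EuclideanSpace.single q.2 1)

theorem unitVec_apply (q r : Fin N × Fin M) : (unitVec q : Fin N → Vec M) r.1 r.2
    = if r = q then 1 else 0 := by
  unfold unitVec
  by_cases h : r.1 = q.1
  · rw [h, Pi.single_eq_same]
    by_cases h2 : r.2 = q.2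
    · simp [h2, Prod.ext_iff, h]
    · simp [h2, Prod.ext_iff]
  · rw [Pi.single_eq_of_ne h]
    simp [h, Prod.ext_iff]

theorem norm_unitVec (q : Fin N × Fin M) : ‖(unitVec q : Fin N → Vec M)‖ ≤ 1 := by
  refine (pi_norm_le_iff_of_nonneg zero_le_one).2 fun k => ?_
  unfold unitVec
  by_cases h : k = q.1
  · rw [h, Pi.single_eq_same]; simp
  · rw [Pi.single_eq_of_ne h]; simp

/-- Rank-one tensors of unit vectors are the basis vectors, so bounds on forms evaluated at rank-one
tensors become bounds on matrix entries. -/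
theorem tens_unitVec (r : Idx N M) : tens (unitVec r.1) (unitVec r.2) = Pi.single r (1 : ℝ) := by
  funext q
  simp only [tens, unitVec_apply, Pi.single_apply, Prod.ext_iff (x := q) (y := r)]
  by_cases h1 : q.1 = r.1 <;> by_cases h2 : q.2 = r.2 <;> simp [h1, h2]

universe u

variable {g : Fin N → Vec M → Vec M} {H : Fin N → Vec M →L[ℝ] Vec M} {ν δ e : ℝ}
  {p : Fin N → ℝ} {v : Fin N × Fin N → ℝ} {cv ε : ℝ} {Abar : Matrix (Fin N) (Fin N) ℝ}
  {Q : Matrix (Fin N × Fin N) (Fin N × Fin N) ℝ}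

section OneNetwork

variable {Ω : Type u} {S C H' : MeasurableSpace Ω} {mΩ : MeasurableSpace Ω} {P : Measure Ω}
  [IsProbabilityMeasure P] {A : Ω → Matrix (Fin N) (Fin N) ℝ} {μ : Ω → Fin N → ℝ}
  {mbar : Fin N → ℝ} {m2 : Fin N → Fin N → ℝ} {m : ℝ}

/-- Two-sided bounds, in one step of the long-term model, of a signed combination of the squares of
the coordinates of the average. -/
theorem abs_integral_signed_sq_le (O : OneStep P S C H' A μ Abar Q mbar m2)
    (hg : CostBounds g H ν δ e) (hp : ProbVec p) (hpA : Abar *ᵥ p = p)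
    (hmbar : ∀ k, 0 < mbar k) (hmm : ∀ k, mbar k ≤ m) (hm1 : (∑ l, mbar l) * m ≤ 1)
    (hm2 : ∀ k, m2 k k ≤ mbar k * m) (b : OrthonormalBasis (Fin M) ℝ (Vec M)) {l : Fin M → ℝ}
    (hl : ∀ a, meanOp mbar p H (b a) = l a • b a) {s : Fin M → ℝ} (hs : ∀ a, |s a| = 1)
    (x : Fin N → Vec M) :
    |∫ ω, ∑ a, s a * inner ℝ (b a) (wavg p (longTerm H (A ω) (μ ω) x)) ^ 2 ∂P
      - ∑ a, s a * ((1 - 2 * l a) * inner ℝ (b a) (wavg p x) ^ 2)|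
      ≤ M * (3 + (N + 4) * δ ^ 2) * (disp x ^ 2 + (∑ l, mbar l) * m * ‖wavg p x‖ ^ 2) := by
  have hi : ∀ a, HasInt P (fun ω => inner ℝ (b a) (wavg p (longTerm H (A ω) (μ ω) x)) ^ 2) _ :=
    fun a => HasInt.of_integrable (O.integrable_longTerm H x
      (f := fun y => inner ℝ (b a) (wavg p y) ^ 2)
      (((innerSL ℝ (b a)).continuous.comp (continuous_wavg p)).pow 2))
  rw [(HasInt.sum fun a => (hi a).const_mul (s a)).2, ← Finset.sum_sub_distrib]
  refine (Finset.abs_sum_le_sum_abs _ _).trans ?_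
  refine (Finset.sum_le_sum (g := fun _ => (3 + (N + 4) * δ ^ 2) *
    (disp x ^ 2 + (∑ l, mbar l) * m * ‖wavg p x‖ ^ 2)) fun a _ => ?_).trans (le_of_eq ?_)
  · rw [← mul_sub, abs_mul, hs, one_mul]
    exact O.abs_integral_inner_sq_longTerm_le hg hp hpA hmbar hmm hm1 hm2
      (b.orthonormal.1 a) (hl a) x
  · simp only [Finset.sum_const, Finset.card_univ, Fintype.card_fin, nsmul_eq_mul]; ring

end OneNetwork

set_option maxHeartbeats 1000000 in
/-- The powers of the moment matrix grow like `(1 - 2 λ)ⁿ`, where `λ` is the smallest eigenvalue of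
the mean Hessian, up to terms of second order in the step-sizes. -/
theorem exists_geometric_bounds (hN : 0 < N) (hM : 0 < M) (hg : CostBounds g H ν δ e)
    (hp : ProbVec p) (hε : 0 < ε) (hεp : ∀ k, ε ≤ p k) (hpA : Abar *ᵥ p = p)
    (hv : IsLyapunov M Q v cv) :
    ∃ K c₀ μ₁ : ℝ, 0 < K ∧ 0 < c₀ ∧ 0 < μ₁ ∧ ∀ {Ω : Type u} {S C H' : MeasurableSpace Ω}
      {mΩ : MeasurableSpace Ω} {P : Measure Ω} [IsProbabilityMeasure P]
      {A : Ω → Matrix (Fin N) (Fin N) ℝ} {μ : Ω → Fin N → ℝ} {mbar : Fin N → ℝ}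
      {m2 : Fin N → Fin N → ℝ} {m : ℝ}, OneStep P S C H' A μ Abar Q mbar m2 →
      (∀ k, 0 < mbar k) → (∀ k, mbar k ≤ m) → (∀ k, m2 k k ≤ mbar k * m) → m < μ₁ →
      ∀ (b : OrthonormalBasis (Fin M) ℝ (Vec M)) (l : Fin M → ℝ),
      (∀ a, meanOp mbar p H (b a) = l a • b a) → ∀ a₀, (∀ a, l a₀ ≤ l a) →
      ∃ ρ ρ₁ κ : ℝ, 0 ≤ ρ ∧ 0 ≤ ρ₁ ∧ 0 < κ ∧
        1 - 2 * l a₀ - K * ((∑ k, mbar k) * m) ≤ ρ ∧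
        ρ₁ ≤ 1 - 2 * l a₀ + K * ((∑ k, mbar k) * m) ∧ ρ₁ ≤ 1 - c₀ * (∑ k, mbar k) ∧
        (∀ n q r, |(momentMatrix Q mbar m2 H ^ n) q r| ≤ K * ρ₁ ^ n) ∧
        ∀ n, κ * ρ ^ n ≤ absSum (momentMatrix Q mbar m2 H ^ n) := by
  have hNe : Nonempty (Fin N) := ⟨⟨0, hN⟩⟩
  have hθ := hv.rate_pos
  have hθ4 := hv.rate_le
  have hcv := hv.one_le
  have hν := hg.nu_pos
  have hδ := hg.delta_pos
  obtain ⟨θ, hθdef⟩ : ∃ θ, θ = IsLyapunov.rate cv := ⟨_, rfl⟩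
  rw [← hθdef] at hθ hθ4
  have hNR : (0 : ℝ) < N := by exact_mod_cast hN
  have hMR : (0 : ℝ) < M := by exact_mod_cast hM
  obtain ⟨MC, hMC⟩ : ∃ z, z = M * (3 + (N + 4) * δ ^ 2) := ⟨_, rfl⟩
  have hMC0 : 0 < MC := by rw [hMC]; positivity
  obtain ⟨K1, hK1⟩ : ∃ z, z = (1 + 1 / θ) * (4 * cv) * (2 * δ ^ 2) := ⟨_, rfl⟩
  have hK10 : 0 < K1 := by rw [hK1]; positivity
  -- `Λ θ = MC + 1` makes the decay of the disagreement form outweigh the error `MC * disp ^ 2` made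
  -- in the squares of the coordinates of the average.
  obtain ⟨Λ, hΛ⟩ : ∃ z, z = (MC + 1) / θ := ⟨_, rfl⟩
  have hΛθ : Λ * θ = MC + 1 := by rw [hΛ]; field_simp
  have hΛ1 : 1 ≤ Λ := by
    rw [hΛ, le_div_iff₀ hθ]; linarith
  -- `g0 τ`, with `τ = η m`, is the total one-step error proportional to `‖u‖²`: `MC` from the
  -- average, `Λ K1` from the weighted disagreement.
  obtain ⟨g0, hg0⟩ : ∃ z, z = MC + Λ * K1 := ⟨_, rfl⟩
  have hg00 : 0 < g0 := by rw [hg0]; positivity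
  obtain ⟨Z, hZ⟩ : ∃ z, z = 2 * δ * N + ((2 * M + 1) * g0 + K1) * N := ⟨_, rfl⟩
  have hZ0 : 0 < Z := by rw [hZ]; positivity
  obtain ⟨K, hK⟩ : ∃ z, z = (2 * M + 1) * g0 + 2 * (1 + 4 * Λ * cv) := ⟨_, rfl⟩
  have hK0 : 0 < K := by rw [hK]; positivity
  refine ⟨K, ν * ε, min (1 / N) (min (2 * θ / Z) (ν * ε / g0)), hK0, by positivity,
    by positivity, ?_⟩
  intro Ω S C H' mΩ P _ A μ mbar m2 m O hmbar hmm hm2 hm b l hl a₀ ha₀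
  obtain ⟨η, hη⟩ : ∃ z, z = ∑ k, mbar k := ⟨_, rfl⟩
  have hη0 : 0 < η := by
    rw [hη]; exact Finset.sum_pos (fun k _ => hmbar k) Finset.univ_nonempty
  have hm0 : 0 < m := (hmbar ⟨0, hN⟩).trans_le (hmm _)
  have hηN : η ≤ N * m := by
    rw [hη]
    calc ∑ k, mbar k ≤ ∑ _k : Fin N, m := Finset.sum_le_sum fun k _ => hmm k
      _ = N * m := by simp
  have s1 : m * N < 1 := by
    rw [← lt_div_iff₀ hNR]; exact hm.trans_le (min_le_left _ _)
  have s2 : m * Z < 2 * θ := by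
    rw [← lt_div_iff₀ hZ0]; exact hm.trans_le ((min_le_right _ _).trans (min_le_left _ _))
  have s3 : m * g0 < ν * ε := by
    rw [← lt_div_iff₀ hg00]; exact hm.trans_le ((min_le_right _ _).trans (min_le_right _ _))
  have hN1 : (1 : ℝ) ≤ N := by exact_mod_cast hN
  have hm_le : m ≤ 1 := by nlinarith
  obtain ⟨τ, hτ⟩ : ∃ z, z = η * m := ⟨_, rfl⟩
  have hτ0 : 0 < τ := by rw [hτ]; positivity
  have hητ : τ ≤ η := by rw [hτ]; nlinarith
  have hτN : τ ≤ N * m := hητ.trans hηN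
  have hτ1 : τ ≤ 1 := by linarith
  have hlu : l a₀ ≤ δ * η := by
    have h1 := (meanOp_inner_bounds hg hp hmbar hεp (b a₀)).2
    rw [hl, real_inner_smul_right, real_inner_self_eq_norm_sq, b.orthonormal.1, ← hη] at h1
    linarith
  have hll : ν * ε * η ≤ l a₀ := by
    have h1 := (meanOp_inner_bounds hg hp hmbar hεp (b a₀)).1
    rw [hl, real_inner_smul_right, real_inner_self_eq_norm_sq, b.orthonormal.1, ← hη] at h1
    linarith
  have hl0 : 0 ≤ l a₀ := le_trans (by positivity) hll
  -- All slow rates lie below `2 θ`, while the disagreement form decays with `3 θ`. The surplus `θ`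
  -- is what `Λ` amplifies.
  have small : 2 * l a₀ + (2 * M + 1) * g0 * τ + K1 * τ ≤ 2 * θ := by
    have h1 : ((2 * M + 1) * g0 + K1) * τ ≤ ((2 * M + 1) * g0 + K1) * (N * m) :=
      mul_le_mul_of_nonneg_left hτN (by positivity)
    have h2 : δ * η ≤ δ * (N * m) := mul_le_mul_of_nonneg_left hηN hδ.le
    have h3 : m * Z = 2 * (δ * (N * m)) + ((2 * M + 1) * g0 + K1) * (N * m) := by rw [hZ]; ring
    linarith
  have hg0τ : 0 ≤ g0 * τ := by positivity
  have hMg : 0 ≤ (M : ℝ) * (g0 * τ) := by positivity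
  have hK1τ : 0 ≤ K1 * τ := by positivity
  have Vub : ∀ x, ∫ ω, qf v (longTerm H (A ω) (μ ω) x) ∂P ≤ (1 - 3 * θ) * qf v x
      + K1 * τ * (‖wavg p x‖ ^ 2 + disp x ^ 2) := by
    intro x
    have h1 := O.integral_qf_longTerm_le hg hp hv hm2 x
    rw [← hθdef, ← hη, ← hτ] at h1
    refine h1.trans (le_of_eq ?_)
    rw [hK1]; ring
  have signed : ∀ s : Fin M → ℝ, (∀ a, |s a| = 1) → ∀ x : Fin N → Vec M,
      |∫ ω, ∑ a, s a * inner ℝ (b a) (wavg p (longTerm H (A ω) (μ ω) x)) ^ 2 ∂P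
      - ∑ a, s a * ((1 - 2 * l a) * inner ℝ (b a) (wavg p x) ^ 2)|
      ≤ MC * (disp x ^ 2 + τ * ‖wavg p x‖ ^ 2) := by
    intro s hs x
    have h1 := abs_integral_signed_sq_le O hg hp hpA hmbar hmm
      (by rw [← hη, ← hτ]; exact hτ1) hm2 b hl hs x
    rwa [← hη, ← hτ, ← hMC] at h1
  have normsq : ∀ u : Vec M, ‖u‖ ^ 2 = ∑ a, inner ℝ (b a) u ^ 2 := fun u =>
    (b.sum_sq_inner_right u).symm
  have hcont : ∀ s : Fin M → ℝ, Continuous fun y : Fin N → Vec M =>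
      ∑ a, s a * inner ℝ (b a) (wavg p y) ^ 2 := fun s =>
    continuous_finsetSum _ fun a _ => continuous_const.mul
      (((innerSL ℝ (b a)).continuous.comp (continuous_wavg p)).pow 2)
  have iV : ∀ x, HasInt P (fun ω => qf v (longTerm H (A ω) (μ ω) x)) _ := fun x =>
    HasInt.of_integrable (O.integrable_longTerm H x (continuous_qf v))
  have iS : ∀ (s : Fin M → ℝ) x, HasInt P (fun ω =>
      ∑ a, s a * inner ℝ (b a) (wavg p (longTerm H (A ω) (μ ω) x)) ^ 2) _ := fun s x =>
    HasInt.of_integrable (O.integrable_longTerm H x (hcont s))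
  -- Eigenvalues may cluster near the smallest one at distances comparable with the error. A gap of
  -- width `2 g0 τ` within `(2 M + 2) g0 τ` of it separates the coordinates to be treated as slow
  -- from the others.
  obtain ⟨j, hj, hgap⟩ := exists_gap (fun a => 2 * l a) (2 * l a₀) hg0τ
  have hjM : (j : ℝ) ≤ M := by exact_mod_cast hj
  have hjg : (j : ℝ) * (g0 * τ) ≤ M * (g0 * τ) := mul_le_mul_of_nonneg_right hjM hg0τ
  have hj0 : 0 ≤ (j : ℝ) * (g0 * τ) := by positivity
  -- One minus the midpoint of the gap, so every factor `1 - 2 l a` is at distance at least `g0 τ`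
  -- from `ρ`.
  obtain ⟨ρ, hρ⟩ : ∃ z, z = 1 - 2 * l a₀ - (2 * j + 1) * (g0 * τ) := ⟨_, rfl⟩
  have hρ0 : 0 ≤ ρ := by rw [hρ]; linarith
  obtain ⟨ρ₁, hρ₁⟩ : ∃ z, z = 1 - 2 * l a₀ + g0 * τ := ⟨_, rfl⟩
  have hρ₁0 : 0 ≤ ρ₁ := by rw [hρ₁]; linarith
  -- upper bound
  set G : (Fin N → Vec M) → ℝ := fun x => ‖wavg p x‖ ^ 2 + Λ * qf v x with hG
  have Gcont : Continuous G :=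
    ((continuous_wavg p).norm.pow 2).add (continuous_const.mul (continuous_qf v))
  -- The average contracts at worst by `1 - 2 l a₀`; the extra `g0 τ` in `ρ₁` pays for the terms in
  -- `‖u‖²`, and the surplus decay of the weighted disagreement pays for the terms in `disp ^ 2`.
  have Gstep : ∀ x, ∫ ω, G (longTerm H (A ω) (μ ω) x) ∂P ≤ ρ₁ * G x := by
    intro x
    have h1 := (abs_le.1 (signed (fun _ => 1) (fun _ => abs_one) x)).2
    have e1 := ((iS (fun _ => 1) x).add ((iV x).const_mul Λ)).congr
      (g := fun ω => G (longTerm H (A ω) (μ ω) x)) fun ω => by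
        simp only [hG, normsq, one_mul]
    rw [e1.2]
    have h2 := mul_le_mul_of_nonneg_left (Vub x) (by linarith : 0 ≤ Λ)
    have h3 : ∑ a, (1 : ℝ) * ((1 - 2 * l a) * inner ℝ (b a) (wavg p x) ^ 2)
        ≤ (1 - 2 * l a₀) * ‖wavg p x‖ ^ 2 := by
      rw [normsq, Finset.mul_sum]
      refine Finset.sum_le_sum fun a _ => ?_
      rw [one_mul]
      exact mul_le_mul_of_nonneg_right (by linarith [ha₀ a]) (sq_nonneg _)
    simp only [one_mul, hG] at h1 h3 ⊢
    have hdV := hv.lower x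
    have hV0 := hv.qf_nonneg x
    have hu0 := sq_nonneg ‖wavg p x‖
    generalize ‖wavg p x‖ ^ 2 = U at *
    generalize disp x ^ 2 = d at *
    generalize qf v x = V at *
    have h4 : (MC + Λ * (K1 * τ)) * d ≤ (MC + Λ * (K1 * τ)) * V :=
      mul_le_mul_of_nonneg_left hdV (by positivity)
    have h5 : (Λ * (2 * l a₀ + (2 * M + 1) * g0 * τ + K1 * τ)) * V ≤ (Λ * (2 * θ)) * V :=
      mul_le_mul_of_nonneg_right (mul_le_mul_of_nonneg_left small (by linarith)) hV0
    have h6 : Λ * θ * V = (MC + 1) * V := by rw [hΛθ]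
    have h7 : 0 ≤ Λ * ((M : ℝ) * (g0 * τ)) * V := by positivity
    have h8 : 0 ≤ Λ * (g0 * τ) * V := by positivity
    have h9 : g0 * τ * U = MC * τ * U + Λ * K1 * τ * U := by rw [hg0]; ring
    rw [hρ₁]
    linarith only [h1, h2, h3, h4, h5, h6, h7, h8, h9, hV0]
  have Gnorm : ∀ x, ‖x‖ ^ 2 ≤ 2 * G x := by
    intro x
    have h1 := norm_le_wavg_add_disp hp x
    have h2 := pow_le_pow_left₀ (norm_nonneg x) h1 2
    have h3 := hv.lower x
    have h4 : qf v x ≤ Λ * qf v x := le_mul_of_one_le_left (hv.qf_nonneg x) hΛ1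
    simp only [hG]
    nlinarith [sq_nonneg (‖wavg p x‖ - disp x)]
  have Gunit : ∀ q : Fin N × Fin M, G (unitVec q) ≤ 1 + 4 * Λ * cv := by
    intro q
    have h0 := norm_unitVec (N := N) (M := M) q
    have h1 : ‖wavg p (unitVec q : Fin N → Vec M)‖ ^ 2 ≤ 1 ^ 2 :=
      pow_le_pow_left₀ (norm_nonneg _) ((norm_wavg_le hp _).trans h0) 2
    have h2 : disp (unitVec q : Fin N → Vec M) ^ 2 ≤ 2 ^ 2 :=
      pow_le_pow_left₀ (disp_nonneg _) ((disp_le_two_mul_norm _).trans (by linarith)) 2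
    have h3 := hv.upper (unitVec q)
    have h4 := mul_le_mul_of_nonneg_left h3 (by linarith : 0 ≤ Λ)
    have h5 : Λ * (cv * disp (unitVec q : Fin N → Vec M) ^ 2) ≤ Λ * (cv * 2 ^ 2) :=
      mul_le_mul_of_nonneg_left (mul_le_mul_of_nonneg_left h2 (by linarith)) (by linarith)
    simp only [hG]
    linarith
  have upper : ∀ n q r, |(momentMatrix Q mbar m2 H ^ n) q r| ≤ K * ρ₁ ^ n := by
    intro n q r
    have h1 := O.abs_form_pow_le H Gcont hρ₁0 Gstep (ζ := Pi.single q 1) (fun x y => by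
      rw [single_dotProduct, one_mul, tens, abs_mul]
      have h2 := mul_le_mul (abs_coord_le x q.1.1 q.1.2) (abs_coord_le y q.2.1 q.2.2)
        (abs_nonneg _) (norm_nonneg _)
      refine h2.trans ?_
      nlinarith [Gnorm x, Gnorm y, sq_nonneg (‖x‖ - ‖y‖)]) n (unitVec r.1) (unitVec r.2)
    rw [tens_unitVec, dotProduct_single, mul_one, Matrix.single_one_vecMul] at h1
    refine h1.trans ?_
    rw [mul_comm]
    refine mul_le_mul_of_nonneg_right ?_ (by positivity)
    have h2 := Gunit r.1
    have h3 := Gunit r.2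
    rw [hK]
    have : 0 ≤ (2 * (M : ℝ) + 1) * g0 := by positivity
    linarith
  -- lower bound
  set s : Fin M → ℝ := fun a => if 2 * l a ≤ 2 * l a₀ + 2 * j * (g0 * τ) then 1 else -1 with hs
  have hs1 : ∀ a, |s a| = 1 := fun a => by simp only [hs]; split_ifs <;> simp
  set ζ := formVec (fun a => b a) s p Λ v with hζ
  -- The form counts slow coordinates of the average positively, and fast ones and the disagreement
  -- negatively. A negative part that shrinks faster than `ρ` helps, so the whole form is expanded
  -- by at least `ρ`.
  have lower : ∀ x : Fin N → Vec M,
      ρ * (ζ ⬝ᵥ tens x x) ≤ (ζ ᵥ* momentMatrix Q mbar m2 H) ⬝ᵥ tens x x := by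
    intro x
    have h1 := (abs_le.1 (signed s hs1 x)).1
    have e1 := ((iS s x).sub ((iV x).const_mul Λ)).congr
      (g := fun ω => ζ ⬝ᵥ tens (longTerm H (A ω) (μ ω) x) (longTerm H (A ω) (μ ω) x)) fun ω => by
        rw [hζ, formVec_dotProduct]
    rw [← (O.integral_form_longTerm H ζ x x).2, e1.2, hζ, formVec_dotProduct]
    have h2 := mul_le_mul_of_nonneg_left (Vub x) (by linarith : 0 ≤ Λ)
    have h3 : ρ * ∑ a, s a * inner ℝ (b a) (wavg p x) ^ 2 + g0 * τ * ‖wavg p x‖ ^ 2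
        ≤ ∑ a, s a * ((1 - 2 * l a) * inner ℝ (b a) (wavg p x) ^ 2) := by
      rw [normsq, Finset.mul_sum, Finset.mul_sum, ← Finset.sum_add_distrib]
      refine Finset.sum_le_sum fun a _ => ?_
      -- With the sign chosen according to the side of the gap, each coordinate leaves a margin `g0
      -- τ`. Their sum is the multiple of `‖u‖²` needed to absorb the errors.
      have h4 : ρ * s a + g0 * τ ≤ s a * (1 - 2 * l a) := by
        rcases hgap a with h | h
        · have : s a = 1 := by simp only [hs]; exact if_pos h
          rw [this, hρ]; linarith
        · by_cases h5 : 2 * l a ≤ 2 * l a₀ + 2 * j * (g0 * τ)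
          · have : s a = 1 := by simp only [hs]; exact if_pos h5
            rw [this, hρ]; linarith
          · have : s a = -1 := by simp only [hs]; exact if_neg h5
            rw [this, hρ]; linarith
      have h5 := mul_le_mul_of_nonneg_right h4 (sq_nonneg (inner ℝ (b a) (wavg p x)))
      linarith
    have hdV := hv.lower x
    have hV0 := hv.qf_nonneg x
    have hu0 := sq_nonneg ‖wavg p x‖
    generalize ‖wavg p x‖ ^ 2 = U at *
    generalize disp x ^ 2 = d at *
    generalize qf v x = V at *
    have h4 : (MC + Λ * (K1 * τ)) * d ≤ (MC + Λ * (K1 * τ)) * V :=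
      mul_le_mul_of_nonneg_left hdV (by positivity)
    have h5 : (Λ * (2 * l a₀ + (2 * M + 1) * g0 * τ + K1 * τ)) * V ≤ (Λ * (2 * θ)) * V :=
      mul_le_mul_of_nonneg_right (mul_le_mul_of_nonneg_left small (by linarith)) hV0
    have h6 : Λ * θ * V = (MC + 1) * V := by rw [hΛθ]
    have h7 : Λ * ((j : ℝ) * (g0 * τ)) * V ≤ Λ * ((M : ℝ) * (g0 * τ)) * V :=
      mul_le_mul_of_nonneg_right (mul_le_mul_of_nonneg_left hjg (by linarith)) hV0
    have h9 : g0 * τ * U = MC * τ * U + Λ * K1 * τ * U := by rw [hg0]; ring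
    have h10 : ρ * (Λ * V) = Λ * V - 2 * l a₀ * Λ * V - (2 * j + 1) * (g0 * τ) * Λ * V := by
      rw [hρ]; ring
    linarith only [h1, h2, h3, h4, h5, h6, h7, h9, h10, hV0]
  -- Full consensus on the lowest eigenvector: no disagreement, and the form equals one. Its growth
  -- `ρⁿ` is then a lower bound for the powers of the matrix.
  set x₀ : Fin N → Vec M := fun _ => b a₀ with hx₀
  have Ψ1 : ζ ⬝ᵥ tens x₀ x₀ = 1 := by
    rw [hζ, formVec_dotProduct]
    have h1 : wavg p x₀ = b a₀ := by
      simp only [wavg, hx₀, ← Finset.sum_smul, hp.sum, one_smul]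
    have h2 : disp x₀ = 0 := by simp [disp, hx₀]
    have h3 : qf v x₀ = 0 := le_antisymm (by simpa [h2] using hv.upper x₀) (hv.qf_nonneg x₀)
    rw [h1, h3, mul_zero, sub_zero, Finset.sum_eq_single a₀]
    · have : s a₀ = 1 := by
        simp only [hs]
        exact if_pos (by linarith)
      rw [this, real_inner_self_eq_norm_sq, b.orthonormal.1]; norm_num
    · intro c _ hc
      rw [b.orthonormal.2 hc]; simp
    · simp
  set κ' := (∑ q, |ζ q|) * (∑ q, |tens x₀ x₀ q|) with hκ'
  have hκ'0 : 0 < κ' := by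
    have h1 := abs_vecMul_dotProduct_le ζ (tens x₀ x₀) 1
    rw [Matrix.vecMul_one, Ψ1, abs_one] at h1
    have h2 : 0 ≤ κ' := mul_nonneg (Finset.sum_nonneg fun _ _ => abs_nonneg _)
      (Finset.sum_nonneg fun _ _ => abs_nonneg _)
    rcases h2.lt_or_eq with h3 | h3
    · exact h3
    · rw [← hκ', ← h3, zero_mul] at h1
      exact absurd h1 (by norm_num)
  refine ⟨ρ, ρ₁, 1 / κ', hρ0, hρ₁0, by positivity, ?_, ?_, ?_, upper, ?_⟩
  · rw [hρ, ← hη, ← hτ, hK]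
    have : 0 ≤ 2 * (1 + 4 * Λ * cv) * τ := by positivity
    linarith
  · rw [hρ₁, ← hη, ← hτ, hK]
    have : 0 ≤ 2 * (1 + 4 * Λ * cv) * τ := by positivity
    linarith
  · rw [hρ₁, ← hη]
    have h1 : m * g0 * η ≤ ν * ε * η := mul_le_mul_of_nonneg_right s3.le hη0.le
    have h2 : g0 * τ = m * g0 * η := by rw [hτ]; ring
    linarith
  · intro n
    have h1 := O.le_form_pow H hρ0 lower n x₀
    rw [Ψ1, mul_one] at h1
    have h2 := h1.trans ((le_abs_self _).trans (abs_vecMul_dotProduct_le ζ (tens x₀ x₀) _))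
    rw [one_div, inv_mul_le_iff₀ hκ'0]
    exact h2

end GeometricBounds

/-! ### The steady state -/

section Lyapunov

variable {M : ℕ}

/-- Coercivity of `Hh` is used on every column of `S` for `Hh * S` and on every row for `S * Hh`;
the two halves add up to `2 r`. -/
theorem le_sum_mul_lyapunov {Hh : Matrix (Fin M) (Fin M) ℝ} {r : ℝ}
    (hH : ∀ x : Fin M → ℝ, r * (x ⬝ᵥ x) ≤ x ⬝ᵥ Hh *ᵥ x) (S : Matrix (Fin M) (Fin M) ℝ) :
    2 * r * ∑ a, ∑ b, S a b ^ 2 ≤ ∑ a, ∑ b, S a b * (Hh * S + S * Hh) a b := by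
  have h1 : r * ∑ a, ∑ b, S a b ^ 2 ≤ ∑ a, ∑ b, S a b * (Hh * S) a b := by
    rw [Finset.sum_comm, Finset.sum_comm (f := fun a b => S a b * (Hh * S) a b), Finset.mul_sum]
    refine Finset.sum_le_sum fun b _ => ?_
    have := hH fun a => S a b
    simpa only [dotProduct, Matrix.mulVec, Matrix.mul_apply, sq] using this
  have h2 : r * ∑ a, ∑ b, S a b ^ 2 ≤ ∑ a, ∑ b, S a b * (S * Hh) a b := by
    rw [Finset.mul_sum]
    refine Finset.sum_le_sum fun a _ => ?_
    have := hH fun b => S a b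
    rw [Matrix.dotProduct_mulVec, dotProduct_comm (_ ᵥ* _)] at this
    simpa only [dotProduct, Matrix.vecMul, Matrix.mul_apply, sq] using this
  simp only [Matrix.add_apply, mul_add, Finset.sum_add_distrib]
  linarith

theorem sq_le_sum_sq (S : Matrix (Fin M) (Fin M) ℝ) (a b : Fin M) :
    S a b ^ 2 ≤ ∑ a, ∑ b, S a b ^ 2 :=
  (Finset.single_le_sum (f := fun b => S a b ^ 2) (fun _ _ => sq_nonneg _)
    (Finset.mem_univ b)).trans (Finset.single_le_sum (f := fun a => ∑ b, S a b ^ 2)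
    (fun _ _ => Finset.sum_nonneg fun _ _ => sq_nonneg _) (Finset.mem_univ a))

/-- The Lyapunov equation `Hh S + S Hh = R`, with a bound on the solution and its trace. -/
theorem exists_lyapunov_solution {Hh : Matrix (Fin M) (Fin M) ℝ} {r : ℝ} (hr : 0 < r)
    (hH : ∀ x : Fin M → ℝ, r * (x ⬝ᵥ x) ≤ x ⬝ᵥ Hh *ᵥ x) (R : Matrix (Fin M) (Fin M) ℝ) :
    ∃ S, Hh * S + S * Hh = R ∧ S.trace = 1 / 2 * (Hh⁻¹ * R).trace ∧
      ∀ B, (∀ a b, |R a b| ≤ B) → ∀ a b, |S a b| ≤ M * B / (2 * r) := by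
  let L : Matrix (Fin M) (Fin M) ℝ →ₗ[ℝ] Matrix (Fin M) (Fin M) ℝ :=
    LinearMap.mulLeft ℝ Hh + LinearMap.mulRight ℝ Hh
  have hL : ∀ S, L S = Hh * S + S * Hh := fun S => rfl
  have inj : Function.Injective L := by
    rw [injective_iff_map_eq_zero]
    -- The left-hand side is a linear endomorphism of a finite-dimensional space: coercivity makes
    -- it injective, hence surjective.
    intro S hS
    rw [hL] at hS
    have h1 := le_sum_mul_lyapunov hH S
    rw [hS] at h1
    simp only [Matrix.zero_apply, mul_zero, Finset.sum_const_zero] at h1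
    have h2 : ∑ a, ∑ b, S a b ^ 2 = 0 := by
      refine le_antisymm ?_ (Finset.sum_nonneg fun a _ => Finset.sum_nonneg fun b _ => sq_nonneg _)
      by_contra h
      push Not at h
      have : 0 < 2 * r * ∑ a, ∑ b, S a b ^ 2 := by positivity
      linarith
    ext a b
    have h3 := sq_le_sum_sq S a b
    rw [h2] at h3
    exact pow_eq_zero_iff (two_ne_zero) |>.1 (le_antisymm h3 (sq_nonneg _))
  obtain ⟨S, hS⟩ := LinearMap.injective_iff_surjective.1 inj R
  rw [hL] at hS
  refine ⟨S, hS, ?_, ?_⟩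
  · have hdet : IsUnit Hh.det := by
      rw [isUnit_iff_ne_zero]
      intro h0
      obtain ⟨x, hx, hx0⟩ := Matrix.exists_mulVec_eq_zero_iff.2 h0
      have h1 := hH x
      rw [hx0, dotProduct_zero] at h1
      have h2 : 0 < x ⬝ᵥ x := by
        refine lt_of_le_of_ne (by
          simp only [dotProduct]; exact Finset.sum_nonneg fun _ _ => mul_self_nonneg _) ?_
        intro h; exact hx (dotProduct_self_eq_zero.1 h.symm)
      have : 0 < r * (x ⬝ᵥ x) := by positivity
      linarith
    -- By cyclicity of the trace, `tr (Hh⁻¹ (Hh S + S Hh)) = 2 tr S`. This is the origin of the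
    -- factor `1 / 2` in the mean-square deviation.
    rw [← hS, mul_add, Matrix.trace_add, Matrix.nonsing_inv_mul_cancel_left _ _ hdet,
      Matrix.trace_mul_comm, mul_assoc, Matrix.mul_nonsing_inv _ hdet, mul_one]
    ring
  · intro B hB a b
    have h1 := le_sum_mul_lyapunov hH S
    rw [hS] at h1
    have hB0 : 0 ≤ B := (abs_nonneg _).trans (hB a b)
    have h2 : ∑ a, ∑ b, S a b * R a b ≤ r * ∑ a, ∑ b, S a b ^ 2 + (M * B) ^ 2 / (4 * r) := by
      have h3 : ∀ a b, S a b * R a b ≤ r * S a b ^ 2 + B ^ 2 / (4 * r) := by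
        intro a b
        have h4 : R a b ^ 2 ≤ B ^ 2 := sq_le_sq' (by linarith [(abs_le.1 (hB a b)).1])
          (abs_le.1 (hB a b)).2
        have h5 : S a b * R a b ≤ r * S a b ^ 2 + R a b ^ 2 / (4 * r) := by
          rw [← sub_nonneg]
          have : r * S a b ^ 2 + R a b ^ 2 / (4 * r) - S a b * R a b
              = (2 * r * S a b - R a b) ^ 2 / (4 * r) := by field_simp; ring
          rw [this]; positivity
        have h6 : R a b ^ 2 / (4 * r) ≤ B ^ 2 / (4 * r) :=
          div_le_div_of_nonneg_right h4 (by positivity)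
        linarith
      refine (Finset.sum_le_sum fun a _ => Finset.sum_le_sum fun b _ => h3 a b).trans (le_of_eq ?_)
      simp only [Finset.sum_add_distrib, Finset.mul_sum, Finset.sum_const, Finset.card_univ,
        Fintype.card_fin, nsmul_eq_mul]
      ring
    have h3 := sq_le_sum_sq S a b
    have h4 : S a b ^ 2 ≤ (M * B / (2 * r)) ^ 2 := by
      have h5 : r * S a b ^ 2 ≤ (M * B) ^ 2 / (4 * r) := by
        have := mul_le_mul_of_nonneg_left h3 hr.le
        linarith
      have h6 : (M * B / (2 * r)) ^ 2 = (M * B) ^ 2 / (4 * r) / r := by field_simp; ring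
      rw [h6, le_div_iff₀ hr]
      linarith
    exact abs_le_of_sq_le_sq h4 (by positivity)

end Lyapunov

/-! ### The approximate fixed point of the second-moment recursion -/

section SteadyState

variable {N M : ℕ} {g : Fin N → Vec M → Vec M} {H : Fin N → Vec M →L[ℝ] Vec M} {ν δ e : ℝ}
  {Abar : Matrix (Fin N) (Fin N) ℝ} {Q : Matrix (Fin N × Fin N) (Fin N × Fin N) ℝ}
  {p : Fin N → ℝ} {pc : Fin N × Fin N → ℝ} {ε : ℝ}

theorem abs_opMatrix_le (hg : CostBounds g H ν δ e) (l : Fin N) (a b : Fin M) :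
    |opMatrix (H l) a b| ≤ δ := by
  refine (abs_coord_le_norm _ _).trans ((hg.norm_le l _).trans ?_)
  simp

theorem opMatrix_symm (hg : CostBounds g H ν δ e) (l : Fin N) (a b : Fin M) :
    opMatrix (H l) a b = opMatrix (H l) b a := by
  have h := hg.symm l (EuclideanSpace.single b (1 : ℝ)) (EuclideanSpace.single a (1 : ℝ))
  rw [EuclideanSpace.inner_single_left, real_inner_comm, EuclideanSpace.inner_single_left] at h
  simpa [opMatrix] using h

theorem meanHessian_mulVec (mbar p : Fin N → ℝ) (H : Fin N → Vec M →L[ℝ] Vec M) (x : Vec M)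
    (a : Fin M) :
    (meanHessian mbar p (fun l => opMatrix (H l)) *ᵥ x.ofLp) a = meanOp mbar p H x a := by
  simp only [meanHessian, meanOp, FunLike.coe_sum, Finset.sum_apply, FunLike.coe_smul,
    Pi.smul_apply, Matrix.sum_mulVec, Matrix.smul_mulVec, WithLp.ofLp_sum, WithLp.ofLp_smul,
    smul_eq_mul]
  refine Finset.sum_congr rfl fun l _ => ?_
  rw [apply_coord (H l)]
  rfl

theorem meanHessian_pos (hg : CostBounds g H ν δ e) {mbar : Fin N → ℝ} (hp : ProbVec p)
    (hmbar : ∀ k, 0 < mbar k) (hε : ∀ k, ε ≤ p k) (x : Fin M → ℝ) :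
    ν * ε * (∑ k, mbar k) * (x ⬝ᵥ x)
      ≤ x ⬝ᵥ meanHessian mbar p (fun l => opMatrix (H l)) *ᵥ x := by
  have h := (meanOp_inner_bounds hg hp hmbar hε (WithLp.toLp 2 x)).1
  have e1 : x ⬝ᵥ x = ‖(WithLp.toLp 2 x : Vec M)‖ ^ 2 := by
    rw [EuclideanSpace.real_norm_sq_eq]; simp [dotProduct, sq]
  have e2 : x ⬝ᵥ meanHessian mbar p (fun l => opMatrix (H l)) *ᵥ x
      = inner ℝ (WithLp.toLp 2 x : Vec M) (meanOp mbar p H (WithLp.toLp 2 x)) := by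
    rw [PiLp.inner_apply]
    simp only [dotProduct, ← meanHessian_mulVec, RCLike.inner_apply, conj_trivial]
    exact Finset.sum_congr rfl fun a _ => mul_comm _ _
  rw [e1, e2]; exact h

set_option maxHeartbeats 1000000 in
/-- The steady state of the recursion of second-order moments, up to terms of higher order. -/
theorem exists_steady_state (hN : 0 < N) (hg : CostBounds g H ν δ e) (hp : ProbVec p) (hε : 0 < ε)
    (hεp : ∀ k, ε ≤ p k) {n : ℕ} (hpos : ∀ q r, 0 < (Q ^ n) q r) (hQ : ∀ q, ∑ r, Q r q = 1)
    (hpc : Q *ᵥ pc = pc) (hpc1 : ∑ q, pc q = 1) (hfst : ∀ k, ∑ l, pc (k, l) = p k)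
    (hsnd : ∀ l, ∑ k, pc (k, l) = p l) {Kn : ℝ} (hKn : 0 ≤ Kn) :
    ∃ K : ℝ, 0 ≤ K ∧ ∀ (mbar : Fin N → ℝ) (m2 : Fin N → Fin N → ℝ) (m : ℝ)
      (Rs : Fin N → Matrix (Fin M) (Fin M) ℝ), (∀ k, 0 < mbar k) → (∀ k, mbar k ≤ m) →
      (∀ k l, |m2 k l| ≤ (∑ k, mbar k) * m) → m ≤ 1 → (∀ l a b, |Rs l a b| ≤ Kn) →
      ∃ z : Idx N M → ℝ,
        (∀ k, |∑ a, z ((k, a), (k, a)) - 1 / 2 * ((meanHessian mbar p fun l => opMatrix (H l))⁻¹ *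
          ∑ l, (m2 l l * pc (l, l)) • Rs l).trace| ≤ K * m ^ 2) ∧
        ∀ q, |z q - (momentMatrix Q mbar m2 H *ᵥ z) q - drive Q m2 Rs q|
          ≤ K * ((∑ k, mbar k) * m ^ 2) := by
  have hν := hg.nu_pos
  have hδ := hg.delta_pos
  obtain ⟨C, hC, hT⟩ := exists_bound_sub_vecMul_eq hpos hQ hpc1 hpc
  obtain ⟨Pc, hPc⟩ : ∃ z, z = ∑ q, |pc q| := ⟨_, rfl⟩
  have hPc0 : 0 ≤ Pc := by rw [hPc]; exact Finset.sum_nonneg fun _ _ => abs_nonneg _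
  have hPcq : ∀ q, |pc q| ≤ Pc := fun q => by
    rw [hPc]
    exact Finset.single_le_sum (f := fun q => |pc q|) (fun _ _ => abs_nonneg _) (Finset.mem_univ q)
  obtain ⟨aQ, haQ⟩ : ∃ z, z = absSum Q := ⟨_, rfl⟩
  have haQ0 : 0 ≤ aQ := by rw [haQ]; exact absSum_nonneg Q
  obtain ⟨Ks, hKs⟩ : ∃ z, z = M * (N * (Pc * Kn)) / (2 * (ν * ε)) := ⟨_, rfl⟩
  have hKs0 : 0 ≤ Ks := by rw [hKs]; positivity
  obtain ⟨Kt, hKt⟩ : ∃ z, z = C * (aQ * (2 * M * δ * Ks + Kn)) := ⟨_, rfl⟩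
  have hKt0 : 0 ≤ Kt := by rw [hKt]; positivity
  obtain ⟨K, hK⟩ : ∃ z, z = M * Kt * N + aQ * (2 * (M * (δ * (Kt * N)))
    + M * (M * (δ * δ * (Ks + Kt * N)))) := ⟨_, rfl⟩
  refine ⟨K, by rw [hK]; positivity, ?_⟩
  intro mbar m2 m Rs hmbar hmm hm2 hm1 hRs
  obtain ⟨η, hη⟩ : ∃ z, z = ∑ k, mbar k := ⟨_, rfl⟩
  rw [← hη] at hm2 ⊢
  have hNe : Nonempty (Fin N) := ⟨⟨0, hN⟩⟩
  have hη0 : 0 < η := by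
    rw [hη]; exact Finset.sum_pos (fun k _ => hmbar k) Finset.univ_nonempty
  have hm0 : 0 < m := (hmbar ⟨0, hN⟩).trans_le (hmm _)
  have hmη : ∀ k, mbar k ≤ η := fun k => by
    rw [hη]
    exact Finset.single_le_sum (f := mbar) (fun k _ => (hmbar k).le) (Finset.mem_univ k)
  have hηN : η ≤ N * m := by
    rw [hη]
    calc ∑ k, mbar k ≤ ∑ _k : Fin N, m := Finset.sum_le_sum fun k _ => hmm k
      _ = N * m := by simp
  -- The right-hand side is of order `η m` and the mean Hessian is at least `ν ε η`, so `η` cancels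
  -- and `S` is of order `m`.
  obtain ⟨S, hS, htr, hSb⟩ := exists_lyapunov_solution (r := ν * ε * η) (by positivity)
    (by rw [hη]; exact meanHessian_pos hg hp hmbar hεp) (∑ l, (m2 l l * pc (l, l)) • Rs l)
  have hSm : ∀ a b, |S a b| ≤ Ks * m := by
    intro a b
    refine (hSb (N * (η * m * Pc * Kn)) (fun a b => ?_) a b).trans (le_of_eq ?_)
    · rw [Matrix.sum_apply]
      refine (Finset.abs_sum_le_sum_abs _ _).trans ?_
      refine (Finset.sum_le_sum (g := fun _ => η * m * Pc * Kn) fun l _ => ?_).trans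
        (le_of_eq (by simp))
      rw [Matrix.smul_apply, smul_eq_mul, abs_mul, abs_mul]
      exact mul_le_mul (mul_le_mul (hm2 l l) (hPcq _) (abs_nonneg _) (by positivity)) (hRs l a b)
        (abs_nonneg _) (by positivity)
    · rw [hKs]; field_simp
  -- the right-hand side of the equation for the correction
  set G0 : Fin M → Fin M → Fin N × Fin N → ℝ := fun a b q =>
    -(mbar q.1 * ∑ c, opMatrix (H q.1) a c * S c b) - mbar q.2 * ∑ d, opMatrix (H q.2) b d * S a d
      + (if q.1 = q.2 then m2 q.1 q.1 * Rs q.1 a b else 0) with hG0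
  have hHS : ∀ l a b, |∑ c, opMatrix (H l) a c * S c b| ≤ M * (δ * (Ks * m)) := by
    intro l a b
    refine (Finset.abs_sum_le_sum_abs _ _).trans ?_
    refine (Finset.sum_le_sum (g := fun _ => δ * (Ks * m)) fun c _ => ?_).trans
        (le_of_eq (by simp))
    rw [abs_mul]
    exact mul_le_mul (abs_opMatrix_le hg l a c) (hSm c b) (abs_nonneg _) hδ.le
  have hSH : ∀ l a b, |∑ d, opMatrix (H l) b d * S a d| ≤ M * (δ * (Ks * m)) := by
    intro l a b
    refine (Finset.abs_sum_le_sum_abs _ _).trans ?_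
    refine (Finset.sum_le_sum (g := fun _ => δ * (Ks * m)) fun c _ => ?_).trans
        (le_of_eq (by simp))
    rw [abs_mul]
    exact mul_le_mul (abs_opMatrix_le hg l b c) (hSm a c) (abs_nonneg _) hδ.le
  have hG0b : ∀ a b q, |G0 a b q| ≤ (2 * M * δ * Ks + Kn) * (η * m) := by
    intro a b q
    simp only [hG0]
    have t1 : |mbar q.1 * ∑ c, opMatrix (H q.1) a c * S c b| ≤ η * (M * (δ * (Ks * m))) := by
      rw [abs_mul, abs_of_pos (hmbar _)]
      exact mul_le_mul (hmη _) (hHS _ _ _) (abs_nonneg _) hη0.le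
    have t2 : |mbar q.2 * ∑ d, opMatrix (H q.2) b d * S a d| ≤ η * (M * (δ * (Ks * m))) := by
      rw [abs_mul, abs_of_pos (hmbar _)]
      exact mul_le_mul (hmη _) (hSH _ _ _) (abs_nonneg _) hη0.le
    have t3 : |if q.1 = q.2 then m2 q.1 q.1 * Rs q.1 a b else 0| ≤ η * m * Kn := by
      split_ifs
      · rw [abs_mul]
        exact mul_le_mul (hm2 _ _) (hRs _ _ _) (abs_nonneg _) (by positivity)
      · rw [abs_zero]; positivity
    have t1' := abs_le.1 t1
    have t2' := abs_le.1 t2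
    have t3' := abs_le.1 t3
    rw [abs_le]
    constructor <;> linarith [t1'.1, t1'.2, t2'.1, t2'.2, t3'.1, t3'.2]
  -- Solvability condition for the correction. As the marginals of `pc` are `p`, averaging `G0`
  -- against `pc` gives `R - Hh S - S Hh`, which the choice of `S` makes zero.
  have hort : ∀ a b, ∑ q, pc q * G0 a b q = 0 := by
    intro a b
    have h1 : ∑ q : Fin N × Fin N, pc q * (mbar q.1 * ∑ c, opMatrix (H q.1) a c * S c b)
        = ((meanHessian mbar p fun l => opMatrix (H l)) * S) a b := by
      rw [Fintype.sum_prod_type, meanHessian, Matrix.sum_mul, Matrix.sum_apply]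
      refine Finset.sum_congr rfl fun l _ => ?_
      change ∑ y, pc (l, y) * (mbar l * ∑ c, opMatrix (H l) a c * S c b) = _
      rw [← Finset.sum_mul, hfst, Matrix.smul_mul, Matrix.smul_apply, Matrix.mul_apply, smul_eq_mul]
      ring
    have h2 : ∑ q : Fin N × Fin N, pc q * (mbar q.2 * ∑ d, opMatrix (H q.2) b d * S a d)
        = (S * (meanHessian mbar p fun l => opMatrix (H l))) a b := by
      rw [Fintype.sum_prod_type, Finset.sum_comm, meanHessian, Matrix.mul_sum, Matrix.sum_apply]
      refine Finset.sum_congr rfl fun l _ => ?_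
      change ∑ y, pc (y, l) * (mbar l * ∑ d, opMatrix (H l) b d * S a d) = _
      rw [← Finset.sum_mul, hsnd, Matrix.mul_smul, Matrix.smul_apply, Matrix.mul_apply, smul_eq_mul]
      have : ∑ d, opMatrix (H l) b d * S a d = ∑ d, S a d * opMatrix (H l) d b :=
        Finset.sum_congr rfl fun d _ => by rw [opMatrix_symm hg l b d]; ring
      rw [this]; ring
    have h3 : ∑ q : Fin N × Fin N, pc q * (if q.1 = q.2 then m2 q.1 q.1 * Rs q.1 a b else 0)
        = (∑ l, (m2 l l * pc (l, l)) • Rs l) a b := by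
      rw [Fintype.sum_prod_type, Matrix.sum_apply]
      refine Finset.sum_congr rfl fun l _ => ?_
      change ∑ y, pc (l, y) * (if l = y then m2 l l * Rs l a b else 0) = _
      simp only [mul_ite, mul_zero, Finset.sum_ite_eq, Finset.mem_univ, if_true, Matrix.smul_apply,
        smul_eq_mul]
      ring
    have h4 := congrFun (congrFun hS a) b
    rw [Matrix.add_apply, ← h1, ← h2, ← h3] at h4
    simp only [hG0, mul_add, mul_sub, mul_neg, Finset.sum_add_distrib, Finset.sum_sub_distrib,
      Finset.sum_neg_distrib]
    linarith
  -- On the pairs of agents the moment recursion acts through the transpose of `Q`, whose range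
  -- without the identity is orthogonal to `pc`. The equation is solved separately for each pair of
  -- coordinates, and `T` inherits the order `η m` of `G0`.
  have hvec : ∀ a b, ∃ T : Fin N × Fin N → ℝ, T - T ᵥ* Q = G0 a b ᵥ* Q ∧
      ∀ q, |T q| ≤ Kt * (η * m) := by
    intro a b
    have h1 : ∑ q, pc q * (G0 a b ᵥ* Q) q = 0 := by
      have h2 : (G0 a b ᵥ* Q) ⬝ᵥ pc = 0 := by
        rw [← Matrix.dotProduct_mulVec, hpc, dotProduct_comm]
        exact hort a b
      rw [dotProduct_comm] at h2
      exact h2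
    obtain ⟨T, hT1, hT2⟩ := hT _ h1 (aQ * ((2 * M * δ * Ks + Kn) * (η * m))) (fun q => by
      simp only [Matrix.vecMul, dotProduct]
      refine (Finset.abs_sum_le_sum_abs _ _).trans ?_
      refine (Finset.sum_le_sum (g := fun r => |Q r q| * ((2 * M * δ * Ks + Kn) * (η * m)))
        fun r _ => ?_).trans ?_
      · rw [abs_mul, mul_comm]
        exact mul_le_mul_of_nonneg_left (hG0b a b r) (abs_nonneg _)
      · rw [← Finset.sum_mul]
        refine mul_le_mul_of_nonneg_right ?_ (by positivity)
        rw [haQ]; exact sum_abs_le_absSum Q q)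
    refine ⟨T, hT1, fun q => (hT2 q).trans (le_of_eq ?_)⟩
    rw [hKt]; ring
  choose T hT1 hT2 using hvec
  have hTm : ∀ a b q, |T a b q| ≤ Kt * N * m ^ 2 := by
    intro a b q
    refine (hT2 a b q).trans ?_
    have := mul_le_mul_of_nonneg_left (mul_le_mul_of_nonneg_right hηN hm0.le) hKt0
    linarith
  have hTm1 : ∀ a b q, |T a b q| ≤ Kt * N * m := by
    intro a b q
    refine (hTm a b q).trans ?_
    have h1 : m ^ 2 ≤ m := by nlinarith
    exact mul_le_mul_of_nonneg_left h1 (by positivity)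
  have hcard : (0:ℝ) ≤ N := by positivity
  -- All agents share the covariance `S`; only the correction depends on the pair of agents.
  refine ⟨fun q => S q.1.2 q.2.2 + T q.1.2 q.2.2 (q.1.1, q.2.1), ?_, ?_⟩
  · intro k
    have e1 : ∑ a, (S a a + T a a (k, k)) - 1 / 2 *
        ((meanHessian mbar p fun l => opMatrix (H l))⁻¹ *
          ∑ l, (m2 l l * pc (l, l)) • Rs l).trace = ∑ a, T a a (k, k) := by
      rw [← htr, Finset.sum_add_distrib]
      simp only [Matrix.trace, Matrix.diag_apply]
      ring
    rw [e1]
    refine (Finset.abs_sum_le_sum_abs _ _).trans ?_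
    refine (Finset.sum_le_sum fun a _ => hTm a a (k, k)).trans ?_
    simp only [Finset.sum_const, Finset.card_univ, Fintype.card_fin, nsmul_eq_mul]
    rw [hK]
    have : 0 ≤ aQ * (2 * (M * (δ * (Kt * N))) + M * (M * (δ * δ * (Ks + Kt * N)))) * m ^ 2 := by
      positivity
    linarith
  · rintro ⟨⟨k, a⟩, ⟨k', b⟩⟩
    rw [momentMatrix_mulVec]
    simp only
    -- What is left uncancelled: first-order terms applied to `T`, and second-order terms applied to
    -- `S + T`. Both are of order `η m²`.
    set E : Fin N → Fin N → ℝ := fun l l' =>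
      mbar l * ∑ c, opMatrix (H l) a c * T c b (l, l')
        + mbar l' * ∑ d, opMatrix (H l') b d * T a d (l, l')
        - m2 l l' * ∑ c, ∑ d, opMatrix (H l) a c * opMatrix (H l') b d * (S c d + T c d (l, l'))
      with hE
    have drv : drive Q m2 Rs ((k, a), (k', b)) = ∑ l, ∑ l', Q (l, l') (k, k') *
        (if l = l' then m2 l l * Rs l a b else 0) := by
      simp [drive]
    have hT3 : T a b (k, k') - ∑ l, ∑ l', Q (l, l') (k, k') * T a b (l, l')
        = ∑ l, ∑ l', Q (l, l') (k, k') * G0 a b (l, l') := by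
      have h1 := congrFun (hT1 a b) (k, k')
      simp only [Pi.sub_apply, Matrix.vecMul, dotProduct, Fintype.sum_prod_type] at h1
      simpa only [mul_comm] using h1
    have hS3 : S a b = ∑ l, ∑ l', Q (l, l') (k, k') * S a b := by
      have h1 := hQ (k, k')
      rw [Fintype.sum_prod_type] at h1
      simp only [← Finset.sum_mul, h1, one_mul]
    have e1 : S a b + T a b (k, k') - ∑ l, ∑ l', Q (l, l') (k, k') *
        (S a b + T a b (l, l') - mbar l * ∑ c, opMatrix (H l) a c * (S c b + T c b (l, l'))
          - mbar l' * ∑ d, opMatrix (H l') b d * (S a d + T a d (l, l'))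
          + m2 l l' * ∑ c, ∑ d, opMatrix (H l) a c * opMatrix (H l') b d
            * (S c d + T c d (l, l')))
        - drive Q m2 Rs ((k, a), (k', b)) = ∑ l, ∑ l', Q (l, l') (k, k') * E l l' := by
      have e2 : S a b + T a b (k, k') = ∑ l, ∑ l', Q (l, l') (k, k') * S a b
          + (∑ l, ∑ l', Q (l, l') (k, k') * T a b (l, l')
            + ∑ l, ∑ l', Q (l, l') (k, k') * G0 a b (l, l')) := by
        rw [← hS3]; linarith
      rw [e2, drv]
      simp only [← Finset.sum_add_distrib, ← Finset.sum_sub_distrib]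
      refine Finset.sum_congr rfl fun l _ => Finset.sum_congr rfl fun l' _ => ?_
      simp only [hE, hG0, mul_add, Finset.sum_add_distrib]
      ring
    rw [e1]
    have hHT : ∀ l l', |∑ c, opMatrix (H l) a c * T c b (l, l')| ≤ M * (δ * (Kt * N * m ^ 2)) := by
      intro l l'
      refine (Finset.abs_sum_le_sum_abs _ _).trans ?_
      refine (Finset.sum_le_sum (g := fun _ => δ * (Kt * N * m ^ 2)) fun c _ => ?_).trans
          (le_of_eq (by simp))
      rw [abs_mul]
      exact mul_le_mul (abs_opMatrix_le hg l a c) (hTm c b _) (abs_nonneg _) hδ.le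
    have hTH : ∀ l l', |∑ d, opMatrix (H l') b d * T a d (l, l')| ≤ M * (δ * (Kt * N * m ^ 2)) := by
      intro l l'
      refine (Finset.abs_sum_le_sum_abs _ _).trans ?_
      refine (Finset.sum_le_sum (g := fun _ => δ * (Kt * N * m ^ 2)) fun c _ => ?_).trans
          (le_of_eq (by simp))
      rw [abs_mul]
      exact mul_le_mul (abs_opMatrix_le hg l' b c) (hTm a c _) (abs_nonneg _) hδ.le
    have hHH : ∀ l l', |∑ c, ∑ d, opMatrix (H l) a c * opMatrix (H l') b d
        * (S c d + T c d (l, l'))| ≤ M * (M * (δ * δ * (Ks * m + Kt * N * m))) := by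
      intro l l'
      refine (Finset.abs_sum_le_sum_abs _ _).trans ?_
      refine (Finset.sum_le_sum (g := fun _ => M * (δ * δ * (Ks * m + Kt * N * m)))
        fun c _ => ?_).trans (le_of_eq (by simp))
      refine (Finset.abs_sum_le_sum_abs _ _).trans ?_
      refine (Finset.sum_le_sum (g := fun _ => δ * δ * (Ks * m + Kt * N * m))
        fun d _ => ?_).trans (le_of_eq (by simp))
      rw [abs_mul, abs_mul]
      exact mul_le_mul (mul_le_mul (abs_opMatrix_le hg l a c) (abs_opMatrix_le hg l' b d)
        (abs_nonneg _) hδ.le) ((abs_add_le _ _).trans (add_le_add (hSm c d) (hTm1 c d _)))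
        (abs_nonneg _) (by positivity)
    have hEb : ∀ l l', |E l l'| ≤ (2 * (M * (δ * (Kt * N))) + M * (M * (δ * δ * (Ks + Kt * N))))
        * (η * m ^ 2) := by
      intro l l'
      have t1 : |mbar l * ∑ c, opMatrix (H l) a c * T c b (l, l')|
          ≤ η * (M * (δ * (Kt * N * m ^ 2))) := by
        rw [abs_mul, abs_of_pos (hmbar _)]
        exact mul_le_mul (hmη _) (hHT _ _) (abs_nonneg _) hη0.le
      have t2 : |mbar l' * ∑ d, opMatrix (H l') b d * T a d (l, l')|
          ≤ η * (M * (δ * (Kt * N * m ^ 2))) := by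
        rw [abs_mul, abs_of_pos (hmbar _)]
        exact mul_le_mul (hmη _) (hTH _ _) (abs_nonneg _) hη0.le
      have t3 : |m2 l l' * ∑ c, ∑ d, opMatrix (H l) a c * opMatrix (H l') b d
          * (S c d + T c d (l, l'))| ≤ η * m * (M * (M * (δ * δ * (Ks * m + Kt * N * m)))) := by
        rw [abs_mul]
        exact mul_le_mul (hm2 _ _) (hHH _ _) (abs_nonneg _) (by positivity)
      have t1' := abs_le.1 t1
      have t2' := abs_le.1 t2
      have t3' := abs_le.1 t3
      simp only [hE]
      rw [abs_le]
      constructor <;> linarith [t1'.1, t1'.2, t2'.1, t2'.2, t3'.1, t3'.2]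
    refine (Finset.abs_sum_le_sum_abs _ _).trans ?_
    refine (Finset.sum_le_sum fun l _ => Finset.abs_sum_le_sum_abs _ _).trans ?_
    simp only [abs_mul]
    refine (Finset.sum_le_sum fun l _ => Finset.sum_le_sum fun l' _ =>
      mul_le_mul_of_nonneg_left (hEb l l') (abs_nonneg _)).trans ?_
    rw [← Fintype.sum_prod_type' (f := fun l l' => |Q (l, l') (k, k')| *
      ((2 * (M * (δ * (Kt * N))) + M * (M * (δ * δ * (Ks + Kt * N)))) * (η * m ^ 2))),
      ← Finset.sum_mul]
    have h1 : ∑ q, |Q q (k, k')| ≤ aQ := by rw [haQ]; exact sum_abs_le_absSum Q (k, k')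
    refine (mul_le_mul_of_nonneg_right h1 (by positivity)).trans ?_
    rw [hK]
    have : 0 ≤ M * Kt * N * (η * m ^ 2) := by positivity
    linarith

end SteadyState

/-! ### Convergence of the second-order moments -/

section Convergence

theorem abs_mulVec_le {ι : Type*} [Fintype ι] {B : Matrix ι ι ℝ} {c : ℝ} (hB : ∀ p q, |B p q| ≤ c)
    (y : ι → ℝ) (p : ι) : |(B *ᵥ y) p| ≤ c * ∑ q, |y q| := by
  simp only [Matrix.mulVec, dotProduct]
  rw [Finset.mul_sum]
  refine (Finset.abs_sum_le_sum_abs _ _).trans (Finset.sum_le_sum fun q _ => ?_)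
  rw [abs_mul]
  exact mul_le_mul_of_nonneg_right (hB p q) (abs_nonneg _)

/-- A perturbed linear recursion whose matrix has geometrically decreasing powers. -/
theorem eventually_abs_le_of_recursion {ι : Type*} [Fintype ι] [DecidableEq ι] {F : Matrix ι ι ℝ}
    {K ρ B : ℝ} (hK : 0 ≤ K) (hρ : 0 ≤ ρ) (hρ1 : ρ < 1) (hF : ∀ n p q, |(F ^ n) p q| ≤ K * ρ ^ n)
    (hB : 0 ≤ B) {d : ℕ → ι → ℝ} (hd : ∀ᶠ i in atTop, ∀ q, |d (i + 1) q - (F *ᵥ d i) q| ≤ B)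
    {t : ℝ} (ht : 0 < t) :
    ∀ᶠ i in atTop, ∀ q, |d i q| ≤ t + K * Fintype.card ι * B / (1 - ρ) := by
  obtain ⟨i₀, hi₀⟩ := eventually_atTop.1 hd
  have h1ρ : 0 < 1 - ρ := by linarith
  obtain ⟨s, hs⟩ : ∃ s, s = 1 / (1 - ρ) := ⟨_, rfl⟩
  have hs0 : 0 < s := by rw [hs]; positivity
  have hs1 : ρ * s + 1 = s := by rw [hs]; field_simp; ring
  obtain ⟨D, hD⟩ : ∃ D, D = ∑ q, |d i₀ q| := ⟨_, rfl⟩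
  have hD0 : 0 ≤ D := by rw [hD]; exact Finset.sum_nonneg fun _ _ => abs_nonneg _
  obtain ⟨c, hc⟩ : ∃ c : ℝ, c = Fintype.card ι := ⟨_, rfl⟩
  have hc0 : 0 ≤ c := by rw [hc]; positivity
  -- Only powers of `F` are controlled, not a norm of `F` itself, so the induction on `n` is run for
  -- `F ^ k *ᵥ d` with all `k` at once. The relation `ρ s + 1 = s` sums the geometric series.
  have key : ∀ n k q, |(F ^ k *ᵥ d (i₀ + n)) q|
      ≤ K * ρ ^ (n + k) * D + K * c * B * (ρ ^ k * s) := by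
    intro n
    induction n with
    | zero =>
      intro k q
      refine (abs_mulVec_le (hF k) _ q).trans ?_
      rw [add_zero, zero_add, ← hD]
      have : 0 ≤ K * c * B * (ρ ^ k * s) := by positivity
      linarith
    | succ n ih =>
      intro k q
      have e1 : (F ^ k *ᵥ d (i₀ + (n + 1))) q = (F ^ (k + 1) *ᵥ d (i₀ + n)) q
          + (F ^ k *ᵥ (d (i₀ + n + 1) - F *ᵥ d (i₀ + n))) q := by
        rw [Matrix.mulVec_sub, Pi.sub_apply, Matrix.mulVec_mulVec, ← pow_succ, ← add_assoc]
        ring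
      rw [e1]
      refine (abs_add_le _ _).trans ?_
      have h2 : |(F ^ k *ᵥ (d (i₀ + n + 1) - F *ᵥ d (i₀ + n))) q| ≤ K * ρ ^ k * (c * B) := by
        refine (abs_mulVec_le (hF k) _ q).trans (mul_le_mul_of_nonneg_left ?_ (by positivity))
        refine (Finset.sum_le_sum fun q _ => hi₀ (i₀ + n) (by omega) q).trans ?_
        simp [hc]
      refine (add_le_add (ih (k + 1) q) h2).trans (le_of_eq ?_)
      have e2 : n + 1 + k = n + (k + 1) := by ring
      rw [e2]
      have e3 : ρ ^ k * s = ρ ^ (k + 1) * s + ρ ^ k := by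
        conv_lhs => rw [← hs1]
        ring
      rw [e3]; ring
  have ht0 : Tendsto (fun n : ℕ => K * ρ ^ n * D) atTop (𝓝 0) := by
    have := ((tendsto_pow_atTop_nhds_zero_of_lt_one hρ hρ1).const_mul K).mul_const D
    simpa using this
  obtain ⟨n₀, hn₀⟩ := eventually_atTop.1 (ht0.eventually_lt_const ht)
  refine eventually_atTop.2 ⟨i₀ + n₀, fun i hi q => ?_⟩
  obtain ⟨n, rfl⟩ := Nat.exists_eq_add_of_le hi
  have h3 := key (n₀ + n) 0 q
  have h4 := hn₀ (n₀ + n) (by omega)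
  rw [pow_zero, Matrix.one_mulVec, pow_zero, add_zero, ← add_assoc, one_mul] at h3
  have h5 : K * (Fintype.card ι : ℝ) * B / (1 - ρ) = K * c * B * s := by
    rw [hs, hc]; field_simp
  rw [h5]
  linarith

variable {N M : ℕ} {g : Fin N → Vec M → Vec M} {H : Fin N → Vec M →L[ℝ] Vec M} {ν δ e : ℝ}
  {Abar : Matrix (Fin N) (Fin N) ℝ} {Q : Matrix (Fin N × Fin N) (Fin N × Fin N) ℝ}
  {p : Fin N → ℝ} {pc : Fin N × Fin N → ℝ} {ε : ℝ} {v : Fin N × Fin N → ℝ} {cv : ℝ}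

/-- An orthonormal basis of eigenvectors of the mean Hessian. -/
theorem exists_eigenbasis (hM : 0 < M) (hg : CostBounds g H ν δ e) (mbar p : Fin N → ℝ) :
    ∃ (b : OrthonormalBasis (Fin M) ℝ (Vec M)) (l : Fin M → ℝ) (a₀ : Fin M),
      (∀ a, meanOp mbar p H (b a) = l a • b a) ∧ (∀ a, l a₀ ≤ l a) ∧
      lambdaMin (meanHessian mbar p fun l => opMatrix (H l)) = l a₀ := by
  have hNe : Nonempty (Fin M) := ⟨⟨0, hM⟩⟩
  have hh : (meanHessian mbar p fun l => opMatrix (H l)).IsHermitian := by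
    ext a b
    simp only [Matrix.conjTranspose_apply, star_trivial, meanHessian, Matrix.sum_apply,
      Matrix.smul_apply]
    exact Finset.sum_congr rfl fun l _ => by rw [opMatrix_symm hg l b a]
  obtain ⟨a₀, ha₀⟩ := Finite.exists_min hh.eigenvalues
  refine ⟨hh.eigenvectorBasis, hh.eigenvalues, a₀, fun a => ?_, ha₀, ?_⟩
  · ext i
    rw [← meanHessian_mulVec, hh.mulVec_eigenvectorBasis a]
    rfl
  · rw [lambdaMin, hh.spectrum_real_eq_range_eigenvalues]
    refine le_antisymm (csInf_le (Set.finite_range _).bddBelow ⟨a₀, rfl⟩) ?_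
    refine le_csInf (Set.range_nonempty _) ?_
    rintro _ ⟨a, rfl⟩
    exact ha₀ a

universe u

set_option maxHeartbeats 1000000 in
/-- Steady state and convergence rate of the second-order moments. -/
theorem exists_moment_convergence (hN : 0 < N) (hM : 0 < M) (hg : CostBounds g H ν δ e)
    (hp : ProbVec p) (hε : 0 < ε) (hεp : ∀ k, ε ≤ p k) (hpA : Abar *ᵥ p = p)
    (hv : IsLyapunov M Q v cv) {n : ℕ} (hpos : ∀ q r, 0 < (Q ^ n) q r)
    (hQ : ∀ q, ∑ r, Q r q = 1) (hpc : Q *ᵥ pc = pc) (hpc1 : ∑ q, pc q = 1)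
    (hfst : ∀ k, ∑ l, pc (k, l) = p k) (hsnd : ∀ l, ∑ k, pc (k, l) = p l) {Kn K₄ : ℝ}
    (hKn : 0 ≤ Kn) (hK₄ : 0 ≤ K₄) (β σ c : ℝ) :
    ∃ K μ₁ : ℝ, 0 ≤ K ∧ 0 < μ₁ ∧ ∀ {Ω : Type u} {mΩ : MeasurableSpace Ω} {P : Measure Ω}
      [IsProbabilityMeasure P] {mbar : Fin N → ℝ} {m2 : Fin N → Fin N → ℝ} {m : ℝ}
      {F : ℕ → MeasurableSpace Ω} {A : ℕ → Ω → Matrix (Fin N) (Fin N) ℝ}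
      {μ : ℕ → Ω → Fin N → ℝ} {x s : ℕ → Ω → Fin N → Vec M}
      {Rs : Fin N → Matrix (Fin M) (Fin M) ℝ},
      DiffusionProcess P g Abar Q mbar m2 m β σ c F A μ x s → m < μ₁ →
      (∀ i, Integrable (fun ω => ‖x i ω‖ ^ 4) P) →
      (∀ᶠ i in atTop, ∫ ω, ‖x i ω‖ ^ 4 ∂P ≤ K₄ * m ^ 2) →
      (∀ l a b, |Rs l a b| ≤ Kn) →
      (∀ᶠ i in atTop, ∀ l a b, |∫ ω, s i ω l a * s i ω l b ∂P - Rs l a b| ≤ Kn * √m) →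
      (∃ z : Idx N M → ℝ,
        (∀ k, |∑ a, z ((k, a), (k, a)) - 1 / 2 * ((meanHessian mbar p fun l => opMatrix (H l))⁻¹ *
          ∑ l, (m2 l l * pc (l, l)) • Rs l).trace| ≤ K * √m ^ 3) ∧
        (∀ᶠ i in atTop, ∀ q, |∫ ω, tens (x (i + 1) ω) (x (i + 1) ω) q ∂P - z q
          - (momentMatrix Q mbar m2 H *ᵥ
              ((fun q => ∫ ω, tens (x i ω) (x i ω) q ∂P) - z)) q| ≤ K * √m ^ 5) ∧
        ∀ᶠ i in atTop, ∀ q, |∫ ω, tens (x i ω) (x i ω) q ∂P - z q| ≤ K * √m ^ 3) ∧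
      ∃ α, 0 ≤ α ∧ α < 1 ∧
        spectralRadius ℂ ((momentMatrix Q mbar m2 H).map (fun x : ℝ => (x : ℂ)))
          = ENNReal.ofReal α ∧
        |α - (1 - 2 * lambdaMin (meanHessian mbar p fun l => opMatrix (H l)))| ≤ K * m ^ 2 := by
  have hNe : Nonempty (Fin N) := ⟨⟨0, hN⟩⟩
  have hMe : Nonempty (Fin M) := ⟨⟨0, hM⟩⟩
  have hδ := hg.delta_pos
  have he := hg.e_nonneg
  obtain ⟨Kg, c₀, μg, hKg, hc₀, hμg, geom⟩ := exists_geometric_bounds.{u} hN hM hg hp hε hεp hpA hv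
  obtain ⟨Kz, hKz, steady⟩ := exists_steady_state hN hg hp hε hεp hpos hQ hpc hpc1 hfst hsnd hKn
  -- Forcing per unit of `η m^{3/2}`: linearization and noise-covariance errors in the recursion,
  -- plus the defect `Kz` of the approximate fixed point.
  obtain ⟨K₁, hK₁⟩ : ∃ z, z = absSum Q * ((2 * e + 2 * δ * e) * (1 + K₄) + Kn) + Kz := ⟨_, rfl⟩
  have hK₁0 : 0 ≤ K₁ := by
    have := absSum_nonneg Q
    rw [hK₁]; positivity
  obtain ⟨cd, hcd⟩ : ∃ z : ℝ, z = Fintype.card (Idx N M) := ⟨_, rfl⟩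
  have hcd0 : 0 ≤ cd := by rw [hcd]; positivity
  obtain ⟨K, hK⟩ : ∃ z, z = Kz + N * K₁ + (1 + Kg * cd * K₁ / c₀) + Kg * N := ⟨_, rfl⟩
  have i1 : 0 ≤ Kz := hKz
  have i2 : 0 ≤ N * K₁ := by positivity
  have i3 : 0 ≤ 1 + Kg * cd * K₁ / c₀ := by positivity
  have i4 : 0 ≤ Kg * N := by positivity
  refine ⟨K, min 1 μg, by rw [hK]; positivity, by positivity, ?_⟩
  intro Ω mΩ P _ mbar m2 m F A μ x s Rs D hm hx4 h4 hRs hcov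
  have hm1 : m < 1 := hm.trans_le (min_le_left _ _)
  have hmg : m < μg := hm.trans_le (min_le_right _ _)
  have hm0 := D.m_pos
  obtain ⟨r, hr⟩ : ∃ r, r = √m := ⟨_, rfl⟩
  have hr0 : 0 < r := by rw [hr]; exact Real.sqrt_pos.2 hm0
  have hrm : r ^ 2 = m := by rw [hr]; exact Real.sq_sqrt hm0.le
  have hr1 : r ≤ 1 := by rw [hr]; exact Real.sqrt_le_one.2 hm1.le
  rw [← hr] at hcov ⊢
  obtain ⟨η, hη⟩ : ∃ z, z = ∑ k, mbar k := ⟨_, rfl⟩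
  have hη0 : 0 < η := by
    rw [hη]; exact Finset.sum_pos (fun k _ => D.mbar_pos k) Finset.univ_nonempty
  have hηN : η ≤ N * m := by
    rw [hη]
    calc ∑ k, mbar k ≤ ∑ _k : Fin N, m := Finset.sum_le_sum fun k _ => D.mbar_le k
      _ = N * m := by simp
  have hr43 : m ^ 2 ≤ r ^ 3 := by
    rw [← hrm]
    calc (r ^ 2) ^ 2 = r ^ 3 * r := by ring
      _ ≤ r ^ 3 * 1 := mul_le_mul_of_nonneg_left hr1 (by positivity)
      _ = r ^ 3 := mul_one _
  obtain ⟨z, hz1, hz2⟩ := steady mbar m2 m Rs D.mbar_pos D.mbar_le D.abs_m2_le hm1.le hRs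
  obtain ⟨b, l, a₀, hl, ha₀, hlmin⟩ := exists_eigenbasis hM hg mbar p
  -- `momentMatrix` depends only on moments that do not change in time, so its powers may be
  -- estimated with the random quantities of time zero.
  obtain ⟨S, C, H', hF, hs, O⟩ := D.oneStep 0
  obtain ⟨ρ, ρ₁, κ, hρ, hρ₁, hκ, hρl, hρ₁l, hρ₁c, hup, hlo⟩ := geom O D.mbar_pos D.mbar_le D.step_sq
    hmg b l hl a₀ ha₀
  clear hs hF O
  clear S C H'
  rw [← hη] at hρl hρ₁l hρ₁c hz2
  have hρ₁1 : ρ₁ < 1 := by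
    have : 0 < c₀ * η := by positivity
    linarith
  have hrec : ∀ᶠ i in atTop, ∀ q, |∫ ω, tens (x (i + 1) ω) (x (i + 1) ω) q ∂P - z q
      - (momentMatrix Q mbar m2 H *ᵥ ((fun q => ∫ ω, tens (x i ω) (x i ω) q ∂P) - z)) q|
      ≤ K₁ * (η * r ^ 3) := by
    filter_upwards [h4, hcov] with i h4 hcov q
    have hT : ∫ ω, ‖x i ω‖ ^ 3 ∂P ≤ (1 + K₄) * r ^ 3 := by
      have hmx : Measurable fun ω => ‖x i ω‖ := (D.measurable_x i).norm
      -- Interpolation at the typical size `r = √m` of the error: a fourth moment of order `m²`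
      -- yields a third moment of order `m^{3/2}`.
      have pt : ∀ ω, ‖x i ω‖ ^ 3 ≤ r ^ 3 + 1 / r * ‖x i ω‖ ^ 4 := by
        intro ω
        have h0 := norm_nonneg (x i ω)
        generalize ‖x i ω‖ = t at h0
        rcases le_total t r with h | h
        · have h1 := pow_le_pow_left₀ h0 h 3
          have h2 : 0 ≤ 1 / r * t ^ 4 := by positivity
          linarith
        · have h1 : t ^ 3 ≤ 1 / r * t ^ 4 := by
            rw [one_div, ← div_eq_inv_mul, le_div_iff₀ hr0]
            have := mul_le_mul_of_nonneg_left h (by positivity : 0 ≤ t ^ 3)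
            linarith
          have h2 : 0 ≤ r ^ 3 := by positivity
          linarith
      have i2 := (HasInt.of_integrable (integrable_const (r ^ 3) (μ := P))).add
        ((HasInt.of_integrable (hx4 i)).const_mul (1 / r))
      have i1 : Integrable (fun ω => ‖x i ω‖ ^ 3) P :=
        i2.1.mono' (hmx.pow_const 3).aestronglyMeasurable (Eventually.of_forall fun ω => by
          rw [Real.norm_of_nonneg (by positivity)]; exact pt ω)
      refine ((HasInt.of_integrable i1).mono_ae i2 (Eventually.of_forall pt)).trans ?_
      simp only [integral_const, probReal_univ, one_smul]
      have h5 : 1 / r * ∫ ω, ‖x i ω‖ ^ 4 ∂P ≤ 1 / r * (K₄ * m ^ 2) :=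
        mul_le_mul_of_nonneg_left h4 (by positivity)
      have h6 : 1 / r * (K₄ * m ^ 2) = K₄ * r ^ 3 := by rw [← hrm]; field_simp
      linarith
    have h1 := D.abs_second_moment_le hg (hx4 i) hT hcov q
    have h2 := hz2 q
    rw [Matrix.mulVec_sub, Pi.sub_apply]
    rw [← hη] at h1
    have e1 : ∀ X Y z w d : ℝ, X - z - (Y - w) = (X - Y - d) - (z - w - d) := by intros; ring
    rw [e1 _ _ _ _ (drive Q m2 Rs q)]
    refine (abs_sub _ _).trans ((add_le_add h1 h2).trans ?_)
    have h7 : (2 * e + 2 * δ * e * m) * ((1 + K₄) * r ^ 3) + m * (Kn * r)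
        ≤ ((2 * e + 2 * δ * e) * (1 + K₄) + Kn) * r ^ 3 := by
      have h8 : 2 * δ * e * m ≤ 2 * δ * e * 1 :=
        mul_le_mul_of_nonneg_left hm1.le (by positivity)
      have h9 : 2 * δ * e * m * ((1 + K₄) * r ^ 3) ≤ 2 * δ * e * 1 * ((1 + K₄) * r ^ 3) :=
        mul_le_mul_of_nonneg_right h8 (by positivity)
      have h10 : m * (Kn * r) = Kn * r ^ 3 := by rw [← hrm]; ring
      linarith
    have h8 := mul_le_mul_of_nonneg_left (mul_le_mul_of_nonneg_left h7 hη0.le) (absSum_nonneg Q)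
    have h9 := mul_le_mul_of_nonneg_left (mul_le_mul_of_nonneg_left hr43 hη0.le) hKz
    rw [hK₁]
    linarith
  refine ⟨⟨z, fun k => ?_, ?_, ?_⟩, ?_⟩
  · refine (hz1 k).trans ?_
    have h1 : Kz * m ^ 2 ≤ Kz * r ^ 3 := mul_le_mul_of_nonneg_left hr43 hKz
    have h2 : Kz * r ^ 3 ≤ K * r ^ 3 :=
      mul_le_mul_of_nonneg_right (by rw [hK]; linarith) (by positivity)
    linarith
  · filter_upwards [hrec] with i h q
    refine (h q).trans ?_
    have h1 : K₁ * (η * r ^ 3) ≤ K₁ * (N * m * r ^ 3) :=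
      mul_le_mul_of_nonneg_left (mul_le_mul_of_nonneg_right hηN (by positivity)) hK₁0
    have h2 : K₁ * (N * m * r ^ 3) = N * K₁ * r ^ 5 := by rw [← hrm]; ring
    have h3 : N * K₁ * r ^ 5 ≤ K * r ^ 5 :=
      mul_le_mul_of_nonneg_right (by rw [hK]; linarith) (by positivity)
    linarith
  · have h1 := eventually_abs_le_of_recursion hKg.le hρ₁ hρ₁1 hup (B := K₁ * (η * r ^ 3))
      (by positivity) (d := fun i q => ∫ ω, tens (x i ω) (x i ω) q ∂P - z q) hrec
      (t := r ^ 3) (by positivity)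
    filter_upwards [h1] with i h q
    refine (h q).trans ?_
    rw [← hcd]
    -- The sum of the forcing over time: the factor `η` cancels because `1 - ρ₁ ≥ c₀ η`.
    have h2 : Kg * cd * (K₁ * (η * r ^ 3)) / (1 - ρ₁) ≤ Kg * cd * K₁ / c₀ * r ^ 3 := by
      rw [div_le_iff₀ (by linarith)]
      have h3 : c₀ * η ≤ 1 - ρ₁ := by linarith
      have h4 := mul_le_mul_of_nonneg_left h3 (by positivity : 0 ≤ Kg * cd * K₁ / c₀ * r ^ 3)
      refine le_trans (le_of_eq ?_) h4
      field_simp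
    have h3 : (1 + Kg * cd * K₁ / c₀) * r ^ 3 ≤ K * r ^ 3 :=
      mul_le_mul_of_nonneg_right (by rw [hK]; linarith) (by positivity)
    linarith
  · obtain ⟨α, hα1, hα2, hα3⟩ := exists_spectralRadius_eq hρ hρ₁ hκ hup hlo
    refine ⟨α, hρ.trans hα1, hα2.trans_lt hρ₁1, hα3, ?_⟩
    rw [hlmin]
    have h1 : Kg * (η * m) ≤ K * m ^ 2 := by
      have h2 : Kg * (η * m) ≤ Kg * (N * m * m) :=
        mul_le_mul_of_nonneg_left (mul_le_mul_of_nonneg_right hηN hm0.le) hKg.le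
      have h3 : Kg * N * m ^ 2 ≤ K * m ^ 2 :=
        mul_le_mul_of_nonneg_right (by rw [hK]; linarith) (by positivity)
      linarith
    rw [abs_le]
    constructor <;> linarith

end Convergence

/-! ### Steady-state noise covariances -/

section NoiseCovariance

variable {M : ℕ} {Ω : Type*} {mΩ : MeasurableSpace Ω} {P : Measure Ω} [IsProbabilityMeasure P]

/-- Used with `ρ = √m`: a fourth moment of order `m²` makes the first and second moments together of
order `√m`. -/
theorem add_sq_le_of_pow_four {ρ t : ℝ} (hρ : 0 < ρ) (hρ1 : ρ ≤ 1) (ht : 0 ≤ t) :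
    t + t ^ 2 ≤ 2 * ρ + 2 / ρ ^ 3 * t ^ 4 := by
  rcases le_total t ρ with h | h
  · have h1 : t ^ 2 ≤ ρ := by
      calc t ^ 2 = t * t := sq t
        _ ≤ ρ * 1 := mul_le_mul h (h.trans hρ1) ht hρ.le
        _ = ρ := mul_one ρ
    have h2 : 0 ≤ 2 / ρ ^ 3 * t ^ 4 := by positivity
    linarith
  · have h1 : t * ρ ^ 3 ≤ t ^ 4 := by
      calc t * ρ ^ 3 ≤ t * t ^ 3 :=
            mul_le_mul_of_nonneg_left (pow_le_pow_left₀ hρ.le h 3) ht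
        _ = t ^ 4 := by ring
    have h2 : t ^ 2 * ρ ^ 3 ≤ t ^ 4 := by
      calc t ^ 2 * ρ ^ 3 = t ^ 2 * ρ ^ 2 * ρ := by ring
        _ ≤ t ^ 2 * ρ ^ 2 * 1 := mul_le_mul_of_nonneg_left hρ1 (by positivity)
        _ = t ^ 2 * ρ ^ 2 := mul_one _
        _ ≤ t ^ 2 * t ^ 2 :=
            mul_le_mul_of_nonneg_left (pow_le_pow_left₀ hρ.le h 2) (by positivity)
        _ = t ^ 4 := by ring
    have h3 : t + t ^ 2 ≤ 2 / ρ ^ 3 * t ^ 4 := by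
      rw [div_mul_eq_mul_div, le_div_iff₀ (by positivity)]
      linarith
    linarith

theorem one_le_div_pow_four {r t : ℝ} (hr : 0 < r) (h : r < t) : 1 ≤ t ^ 4 / r ^ 4 := by
  rw [le_div_iff₀ (by positivity), one_mul]
  exact pow_le_pow_left₀ hr.le h.le 4

/-- If `c i` converges to `R` and `D i` is close to `c i` where `x i` is small, then the mean of
`D i` is eventually close to `R`. -/
theorem eventually_abs_integral_sub_le {x D c : ℕ → Ω → ℝ} {R β σ τ r m K₄ : ℝ}
    (hx : ∀ i, Measurable (x i)) (hx0 : ∀ i ω, 0 ≤ x i ω)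
    (hx4 : ∀ i, Integrable (fun ω => x i ω ^ 4) P) (hD : ∀ i, Integrable (D i) P)
    (hc : ∀ i, Measurable (c i)) (hβ : 0 ≤ β) (hσ : 0 ≤ σ) (hτ : 0 ≤ τ) (hr : 0 < r)
    (hK₄ : 0 ≤ K₄) (hDle : ∀ i, ∀ᵐ ω ∂P, |D i ω| ≤ β * x i ω ^ 2 + σ)
    (hDc : ∀ i, ∀ᵐ ω ∂P, x i ω ≤ r → |D i ω - c i ω| ≤ τ * (x i ω + x i ω ^ 2))
    (hlim : ∀ᵐ ω ∂P, Tendsto (fun i => c i ω) atTop (𝓝 R)) (hm : 0 < m) (hm1 : m ≤ 1)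
    (hmr : K₄ * m ^ 2 ≤ r ^ 4 / 2) (h4 : ∀ᶠ i in atTop, ∫ ω, x i ω ^ 4 ∂P ≤ K₄ * m ^ 2) :
    |R| ≤ 2 * (β * r ^ 2 + σ + τ * (r + r ^ 2) + 1) ∧
    ∀ᶠ i in atTop, |∫ ω, D i ω ∂P - R| ≤ (1 + 2 * τ * (1 + K₄) + (β / r ^ 2
      + (σ + 2 * (β * r ^ 2 + σ + τ * (r + r ^ 2) + 1)) / r ^ 4) * K₄) * √m := by
  classical
  obtain ⟨C₀, hC₀⟩ : ∃ z, z = β * r ^ 2 + σ + τ * (r + r ^ 2) := ⟨_, rfl⟩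
  have hC₀0 : 0 ≤ C₀ := by rw [hC₀]; positivity
  rw [← hC₀]
  -- The conditional covariances `c i` at `wo` have no direct bound; the variance condition holds at
  -- the iterates only. On `{x i ≤ r}` they are close to `D i`, hence bounded, so dominated
  -- convergence applies to this truncation.
  obtain ⟨g, hg⟩ : ∃ g : ℕ → Ω → ℝ, g = fun i ω => if x i ω ≤ r then c i ω - R else 0 := ⟨_, rfl⟩
  have hgm : ∀ i, Measurable (g i) := by
    intro i
    rw [hg]
    exact Measurable.ite (measurableSet_le (hx i) measurable_const) ((hc i).sub_const R)
      measurable_const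
  have hcle : ∀ i, ∀ᵐ ω ∂P, x i ω ≤ r → |c i ω| ≤ C₀ := by
    intro i
    filter_upwards [hDle i, hDc i] with ω h1 h2 h
    have h3 := pow_le_pow_left₀ (hx0 i ω) h 2
    have h4 := mul_le_mul_of_nonneg_left h3 hβ
    have h5 := mul_le_mul_of_nonneg_left (add_le_add h h3) hτ
    have h6 : |c i ω| ≤ |D i ω| + |D i ω - c i ω| := by
      calc |c i ω| = |D i ω - (D i ω - c i ω)| := by rw [sub_sub_cancel]
        _ ≤ _ := abs_sub _ _
    have h7 := h2 h
    rw [hC₀]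
    linarith
  have hgle : ∀ i, ∀ᵐ ω ∂P, ‖g i ω‖ ≤ C₀ + |R| := by
    intro i
    filter_upwards [hcle i] with ω h
    rw [hg, Real.norm_eq_abs]
    by_cases hx : x i ω ≤ r
    · simp only [hx, if_true]
      exact (abs_sub _ _).trans (add_le_add_left (h hx) _)
    · simp only [hx, if_false, abs_zero]
      positivity
  have hgi : ∀ i, Integrable (g i) P := fun i =>
    (integrable_const (C₀ + |R|)).mono' (hgm i).aestronglyMeasurable (hgle i)
  have hg0 : Tendsto (fun i => ∫ ω, g i ω ∂P) atTop (𝓝 0) := by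
    have := tendsto_integral_of_dominated_convergence (μ := P) (F := g) (f := fun _ => (0 : ℝ))
      (bound := fun _ => C₀ + |R|) (fun i => (hgm i).aestronglyMeasurable) (integrable_const _) hgle (by
        filter_upwards [hlim] with ω h
        have h1 : Tendsto (fun i => |c i ω - R|) atTop (𝓝 0) := by
          have := (h.sub_const R).abs
          simpa using this
        refine squeeze_zero_norm (fun i => ?_) h1
        rw [hg, Real.norm_eq_abs]
        by_cases hx : x i ω ≤ r
        · simp only [hx, if_true]; exact le_rfl
        · simp only [hx, if_false, abs_zero]
          positivity)
    simpa using this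
  have hgev : ∀ t > 0, ∀ᶠ i in atTop, |∫ ω, g i ω ∂P| ≤ t := fun t ht => by
    filter_upwards [(Metric.tendsto_nhds.1 hg0) t ht] with i h
    rw [Real.dist_eq, sub_zero] at h
    exact h.le
  -- `R + g i` is bounded by `C₀` where `x i ≤ r`, and equals `R` elsewhere, where `1 ≤ x⁴ / r⁴`. By
  -- the smallness of the fourth moment the second part contributes at most `|R| / 2`, which is
  -- moved to the left.
  have hR : |R| ≤ 2 * (C₀ + 1) := by
    obtain ⟨i, h1, h2⟩ := ((hgev 1 one_pos).and h4).exists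
    have h3 : ‖∫ ω, (R + g i ω) ∂P‖ ≤ ∫ ω, (C₀ + |R| / r ^ 4 * x i ω ^ 4) ∂P := by
      refine norm_integral_le_of_norm_le (g := fun ω => C₀ + |R| / r ^ 4 * x i ω ^ 4)
        ((integrable_const _).add ((hx4 i).const_mul _)) ?_
      filter_upwards [hcle i] with ω h
      rw [hg, Real.norm_eq_abs]
      by_cases hxr : x i ω ≤ r
      · simp only [hxr, if_true, add_sub_cancel]
        have : 0 ≤ |R| / r ^ 4 * x i ω ^ 4 := by positivity
        linarith [h hxr]
      · simp only [hxr, if_false, add_zero]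
        have := mul_le_mul_of_nonneg_left (one_le_div_pow_four hr (not_le.1 hxr)) (abs_nonneg R)
        rw [div_mul_eq_mul_div]
        rw [← mul_div_assoc] at this
        linarith
    rw [Real.norm_eq_abs, integral_add (integrable_const _) (hgi i),
      integral_add (integrable_const _) ((hx4 i).const_mul _), integral_const_mul] at h3
    simp only [integral_const, probReal_univ, one_smul] at h3
    have h5 : |R| / r ^ 4 * ∫ ω, x i ω ^ 4 ∂P ≤ |R| / r ^ 4 * (r ^ 4 / 2) :=
      mul_le_mul_of_nonneg_left (h2.trans hmr) (by positivity)
    have h6 : |R| / r ^ 4 * (r ^ 4 / 2) = |R| / 2 := by field_simp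
    have h7 : |R| ≤ |R + ∫ ω, g i ω ∂P| + |∫ ω, g i ω ∂P| := by
      calc |R| = |(R + ∫ ω, g i ω ∂P) - ∫ ω, g i ω ∂P| := by rw [add_sub_cancel_right]
        _ ≤ _ := abs_sub _ _
    linarith
  refine ⟨hR, ?_⟩
  obtain ⟨C₁, hC₁⟩ : ∃ z, z = 2 * (C₀ + 1) := ⟨_, rfl⟩
  rw [← hC₁] at hR ⊢
  have hC₁0 : 0 ≤ C₁ := (abs_nonneg R).trans hR
  obtain ⟨ρ, hρ⟩ : ∃ ρ, ρ = √m := ⟨_, rfl⟩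
  rw [← hρ]
  have hρ0 : 0 < ρ := by rw [hρ]; exact Real.sqrt_pos.2 hm
  have hρm : ρ ^ 2 = m := by rw [hρ]; exact Real.sq_sqrt hm.le
  have hρ1 : ρ ≤ 1 := by rw [hρ]; exact Real.sqrt_le_one.2 hm1
  filter_upwards [hgev ρ hρ0, h4] with i h1 h2
  -- The first term serves the region `x i ≤ r` through smoothness and interpolation. The others
  -- serve its complement, where lower powers of `x i` are dominated by `x⁴` divided by powers of
  -- `r`.
  obtain ⟨b, hb⟩ : ∃ z, z = τ * (2 / ρ ^ 3) + (β / r ^ 2 + (σ + C₁) / r ^ 4) := ⟨_, rfl⟩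
  have hb0 : 0 ≤ b := by rw [hb]; positivity
  have h3 : ‖∫ ω, (D i ω - R - g i ω) ∂P‖ ≤ ∫ ω, (τ * (2 * ρ) + b * x i ω ^ 4) ∂P := by
    refine norm_integral_le_of_norm_le (g := fun ω => τ * (2 * ρ) + b * x i ω ^ 4)
      ((integrable_const _).add ((hx4 i).const_mul _)) ?_
    filter_upwards [hDle i, hDc i] with ω h5 h6
    rw [hg, Real.norm_eq_abs]
    have h7 : 0 ≤ τ * (2 / ρ ^ 3) * x i ω ^ 4 := by positivity
    have h8 : 0 ≤ (β / r ^ 2 + (σ + C₁) / r ^ 4) * x i ω ^ 4 := by positivity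
    have h9 : b * x i ω ^ 4 = τ * (2 / ρ ^ 3) * x i ω ^ 4
        + (β / r ^ 2 + (σ + C₁) / r ^ 4) * x i ω ^ 4 := by rw [hb]; ring
    by_cases hxr : x i ω ≤ r
    · simp only [hxr, if_true]
      rw [sub_sub_sub_cancel_right]
      have h10 := mul_le_mul_of_nonneg_left (add_sq_le_of_pow_four hρ0 hρ1 (hx0 i ω)) hτ
      have h11 := h6 hxr
      linarith
    · simp only [hxr, if_false, sub_zero]
      have h10 : |D i ω - R| ≤ β * x i ω ^ 2 + σ + C₁ :=
        (abs_sub _ _).trans (add_le_add h5 hR)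
      have h11 := one_le_div_pow_four hr (not_le.1 hxr)
      have h12 : x i ω ^ 2 ≤ x i ω ^ 4 / r ^ 2 := by
        rw [le_div_iff₀ (by positivity)]
        calc x i ω ^ 2 * r ^ 2 ≤ x i ω ^ 2 * x i ω ^ 2 :=
              mul_le_mul_of_nonneg_left (pow_le_pow_left₀ hr.le (not_le.1 hxr).le 2) (by positivity)
          _ = x i ω ^ 4 := by ring
      have h13 := mul_le_mul_of_nonneg_left h12 hβ
      have h14 := mul_le_mul_of_nonneg_left h11 (add_nonneg hσ hC₁0)
      have h15 : (β / r ^ 2 + (σ + C₁) / r ^ 4) * x i ω ^ 4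
          = β * (x i ω ^ 4 / r ^ 2) + (σ + C₁) * (x i ω ^ 4 / r ^ 4) := by ring
      have h16 : 0 ≤ τ * (2 * ρ) := by positivity
      linarith
  rw [Real.norm_eq_abs, integral_sub (f := fun ω => D i ω - R)
    ((hD i).sub (integrable_const _)) (hgi i), integral_sub (hD i)
    (integrable_const _), integral_add (integrable_const _) ((hx4 i).const_mul _)] at h3
  simp only [integral_const_mul, integral_const, probReal_univ, one_smul] at h3
  have h5 : |∫ ω, D i ω ∂P - R| ≤ |∫ ω, D i ω ∂P - R - ∫ ω, g i ω ∂P| + |∫ ω, g i ω ∂P| := by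
    calc |∫ ω, D i ω ∂P - R|
        = |(∫ ω, D i ω ∂P - R - ∫ ω, g i ω ∂P) + ∫ ω, g i ω ∂P| := by rw [sub_add_cancel]
      _ ≤ _ := abs_add_le _ _
  have h6 : b * ∫ ω, x i ω ^ 4 ∂P ≤ b * (K₄ * m ^ 2) := mul_le_mul_of_nonneg_left h2 hb0
  have h7 : b * (K₄ * m ^ 2) = 2 * τ * K₄ * ρ + (β / r ^ 2 + (σ + C₁) / r ^ 4) * K₄ * m ^ 2 := by
    rw [hb, ← hρm]; field_simp
  have h8 : m ^ 2 ≤ ρ := by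
    rw [← hρm]
    calc (ρ ^ 2) ^ 2 = ρ * ρ ^ 3 := by ring
      _ ≤ ρ * 1 := mul_le_mul_of_nonneg_left (pow_le_one₀ hρ0.le hρ1) hρ0.le
      _ = ρ := mul_one ρ
  have h9 := mul_le_mul_of_nonneg_left h8
    (by positivity : 0 ≤ (β / r ^ 2 + (σ + C₁) / r ^ 4) * K₄)
  linarith

/-- The two endpoint powers dominate every exponent between them, so `κ` does not appear in the
estimates that follow. -/
theorem rpow_le_add_sq {t κ : ℝ} (ht : 0 ≤ t) (hκ : κ ∈ Set.Icc (1 : ℝ) 2) :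
    t ^ κ ≤ t + t ^ 2 := by
  rcases le_total t 1 with h | h
  · rcases ht.eq_or_lt with rfl | h0
    · rw [Real.zero_rpow (by linarith [hκ.1])]; simp
    have := Real.rpow_le_rpow_of_exponent_ge h0 h hκ.1
    rw [Real.rpow_one] at this
    have := sq_nonneg t
    linarith
  · have := Real.rpow_le_rpow_of_exponent_le h hκ.2
    rw [Real.rpow_two] at this
    linarith

theorem memLp_coord {s : Ω → Vec M} {p : ENNReal} (hs : MemLp s p P) (a : Fin M) :
    MemLp (fun ω => s ω a) p P :=
  hs.mono ((EuclideanSpace.proj (𝕜 := ℝ) a).continuous.comp_aestronglyMeasurable hs.1)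
    (Eventually.of_forall fun ω => by
      rw [Real.norm_eq_abs]; exact abs_coord_le_norm _ a)

theorem integrable_coord_mul {s t : Ω → Vec M} (hs : MemLp s 2 P) (ht : MemLp t 2 P)
    (a b : Fin M) : Integrable (fun ω => s ω a * t ω b) P :=
  (memLp_coord hs a).integrable_mul (memLp_coord ht b)

theorem abs_condExp_coord_mul_le {𝓕 : MeasurableSpace Ω} {s : Ω → Vec M}
    (hs : MemLp s 2 P) {B : Ω → ℝ} (hB : ∀ᵐ ω ∂P, (P[fun ω => ‖s ω‖ ^ 2 | 𝓕]) ω ≤ B ω)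
    (a b : Fin M) : ∀ᵐ ω ∂P, |(P[fun ω => s ω a * s ω b | 𝓕]) ω| ≤ B ω := by
  have hi := integrable_coord_mul hs hs a b
  have h2 : Integrable (fun ω => ‖s ω‖ ^ 2) P := hs.integrable_norm_pow (by norm_num)
  have pt : ∀ ω, |s ω a * s ω b| ≤ ‖s ω‖ ^ 2 := fun ω => by
    rw [abs_mul, sq]
    exact mul_le_mul (abs_coord_le_norm _ a) (abs_coord_le_norm _ b) (abs_nonneg _) (norm_nonneg _)
  have u1 : (P[fun ω => s ω a * s ω b | 𝓕]) ≤ᵐ[P] P[fun ω => ‖s ω‖ ^ 2 | 𝓕] :=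
    condExp_mono hi h2 (Eventually.of_forall fun ω => (abs_le.1 (pt ω)).2)
  have u2 : (P[-(fun ω => ‖s ω‖ ^ 2) | 𝓕]) ≤ᵐ[P] P[fun ω => s ω a * s ω b | 𝓕] :=
    condExp_mono h2.neg hi (Eventually.of_forall fun ω => (abs_le.1 (pt ω)).1)
  have u3 := condExp_neg (μ := P) (fun ω => ‖s ω‖ ^ 2) 𝓕
  filter_upwards [u1, u2, u3, hB] with ω h1 h2 h3 h4
  rw [h3, Pi.neg_apply] at h2
  rw [abs_le]
  constructor <;> linarith

/-- Conditional expectations agree on a set of the conditioning σ-algebra where the functions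
do. -/
theorem condExp_eq_of_eqOn {𝓕 : MeasurableSpace Ω} {f g : Ω → ℝ} {E : Set Ω}
    (hf : Integrable f P) (hg : Integrable g P) (hE : MeasurableSet[𝓕] E)
    (h : ∀ ω ∈ E, f ω = g ω) : ∀ᵐ ω ∂P, ω ∈ E → (P[f | 𝓕]) ω = (P[g | 𝓕]) ω := by
  have e : E.indicator f = E.indicator g := Set.indicator_congr h
  have h1 := condExp_indicator hf hE
  have h2 := condExp_indicator hg hE
  rw [e] at h1
  filter_upwards [h1, h2] with ω h1 h2 hω
  rw [h1, Set.indicator_of_mem hω, Set.indicator_of_mem hω] at h2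
  exact h2

end NoiseCovariance

/-! ### The network as a diffusion process -/

section NetworkModel

variable {N M : ℕ} {Ω : Type*} {mΩ : MeasurableSpace Ω} {P : Measure Ω} [IsProbabilityMeasure P]

theorem integrable_of_abs_le {f : Ω → ℝ} (hf : Measurable f) {B : ℝ} (h : ∀ᵐ ω ∂P, |f ω| ≤ B) :
    Integrable f P :=
  (integrable_const B).mono' hf.aestronglyMeasurable h

theorem integral_mul_of_cov {f g : Ω → ℝ} (hf : Measurable f) (hg : Measurable g) {B a b c : ℝ}
    (hfB : ∀ᵐ ω ∂P, |f ω| ≤ B) (hgB : ∀ᵐ ω ∂P, |g ω| ≤ B) (ha : ∫ ω, f ω ∂P = a)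
    (hb : ∫ ω, g ω ∂P = b) (hc : ∫ ω, (f ω - a) * (g ω - b) ∂P = c) :
    ∫ ω, f ω * g ω ∂P = c + a * b := by
  have i1 := HasInt.of_integrable (integrable_of_abs_le hf hfB)
  have i2 := HasInt.of_integrable (integrable_of_abs_le hg hgB)
  have i3 : Integrable (fun ω => f ω * g ω) P := by
    refine integrable_of_abs_le (hf.mul hg) (B := B * B) ?_
    filter_upwards [hfB, hgB] with ω h1 h2
    rw [abs_mul]
    exact mul_le_mul h1 h2 (abs_nonneg _) ((abs_nonneg _).trans h1)
  have i4 := (((HasInt.of_integrable i3).sub (i1.const_mul b)).sub (i2.const_mul a)).add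
    (HasInt.of_integrable (integrable_const (a * b) (μ := P)))
  have i5 := i4.congr (g := fun ω => (f ω - a) * (g ω - b)) (fun ω => by ring)
  have h := i5.2
  rw [hc, ha, hb] at h
  simp only [integral_const, probReal_univ, one_smul] at h
  linarith

namespace Network

variable {X : Network N M Ω} {J : Fin N → Vec M → ℝ} {wo : Vec M}
  {Abar : Matrix (Fin N) (Fin N) ℝ} {CA : Matrix (Fin N × Fin N) (Fin N × Fin N) ℝ}
  {mbar : Fin N → ℝ} {cmu : Fin N → Fin N → ℝ}

theorem IsATCDiffusion.measurable_w (hX : X.IsATCDiffusion) (i : ℕ) :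
    ∀ k, Measurable (X.w i k) := by
  induction i with
  | zero => exact hX.measurable_init
  | succ i ih =>
    intro k
    have e : X.w (i + 1) k = fun ω => ∑ l, X.comb i ω l k •
        (X.w i l ω - X.step i l ω • X.gradHat i l (X.w i l ω) ω) :=
      funext fun ω => hX.recursion i k ω
    rw [e]
    refine Finset.measurable_fun_sum _ fun l _ => (hX.measurable_comb i l k).smul
      ((ih l).sub ((hX.measurable_step i l).smul ?_))
    exact (hX.measurable_gradHat i l).comp ((ih l).prodMk measurable_id)

theorem IsATCDiffusion.measurable_gradHat_w (hX : X.IsATCDiffusion) (i : ℕ) (k : Fin N) :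
    Measurable fun ω => X.gradHat i k (X.w i k ω) ω :=
  (hX.measurable_gradHat i k).comp ((hX.measurable_w i k).prodMk measurable_id)

theorem IsATCDiffusion.past_le (hX : X.IsATCDiffusion) (i : ℕ) : X.past i ≤ mΩ :=
  iSup₂_le fun j _ => iSup_le fun k => (hX.measurable_w j k).comap_le

theorem IsATCDiffusion.stepAlg_le (hX : X.IsATCDiffusion) (i : ℕ) : X.stepAlg i ≤ mΩ :=
  iSup_le fun k => (hX.measurable_step i k).comap_le

theorem IsATCDiffusion.combAlg_le (hX : X.IsATCDiffusion) (i : ℕ) : X.combAlg i ≤ mΩ :=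
  iSup_le fun l => iSup_le fun k => (hX.measurable_comb i l k).comap_le

theorem IsATCDiffusion.history_le (hX : X.IsATCDiffusion) (i : ℕ) : X.history i ≤ mΩ :=
  sup_le (sup_le (hX.past_le i)
    (iSup₂_le fun j _ => iSup_le fun k => (hX.measurable_gradHat_w j k).comap_le))
    (iSup₂_le fun j _ => sup_le (hX.stepAlg_le j) (hX.combAlg_le j))

theorem measurable_past (X : Network N M Ω) (i : ℕ) (k : Fin N) : Measurable[X.past i] (X.w i k) :=
  Measurable.of_comap_le
    ((le_iSup (fun k => MeasurableSpace.comap (X.w i k) inferInstance) k).trans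
      (le_iSup₂ (f := fun j (_ : j ≤ i) => ⨆ k, MeasurableSpace.comap (X.w j k) inferInstance)
        i le_rfl))

theorem measurable_history (X : Network N M Ω) (i : ℕ) (k : Fin N) :
    Measurable[X.history i] fun ω => X.gradHat i k (X.w i k ω) ω :=
  Measurable.of_comap_le
    (((le_iSup (fun k => MeasurableSpace.comap (fun ω => X.gradHat i k (X.w i k ω) ω)
        inferInstance) k).trans
      (le_iSup₂ (f := fun j (_ : j ≤ i) => ⨆ k,
        MeasurableSpace.comap (fun ω => X.gradHat j k (X.w j k ω) ω) inferInstance)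
        i le_rfl)).trans (le_sup_right.trans le_sup_left))

theorem IsAsyncModel.leftStochastic (hA : X.IsAsyncModel P Abar CA mbar cmu) (i : ℕ) :
    ∀ᵐ ω ∂P, LeftStochastic (X.comb i ω) := by
  filter_upwards [ae_all_iff.2 fun l => ae_all_iff.2 fun k => hA.comb_nonneg i l k,
    ae_all_iff.2 fun k => hA.comb_sum i k] with ω h1 h2
  exact ⟨h1, h2⟩

theorem IsAsyncModel.abs_comb_le (hA : X.IsAsyncModel P Abar CA mbar cmu) (i : ℕ) (l k : Fin N) :
    ∀ᵐ ω ∂P, |X.comb i ω l k| ≤ 1 := by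
  filter_upwards [hA.leftStochastic i] with ω h
  rw [abs_of_nonneg (h.nonneg l k), ← h.sum k]
  exact Finset.single_le_sum (f := fun l => X.comb i ω l k) (fun l _ => h.nonneg l k)
    (Finset.mem_univ l)

theorem IsAsyncModel.oneStep (hX : X.IsATCDiffusion) (hA : X.IsAsyncModel P Abar CA mbar cmu)
    (i : ℕ) : OneStep P (X.stepAlg i) (X.combAlg i) (X.history i) (X.comb i)
      (fun ω k => X.step i k ω) Abar (Abar ⊗ₖ Abar + CA) mbar
      (fun k l => cmu k l + mbar k * mbar l) := by
  have hle : ∀ j : Fin 3, ![X.stepAlg i, X.combAlg i, X.history i] j ≤ mΩ := by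
    intro j
    fin_cases j
    · exact hX.stepAlg_le i
    · exact hX.combAlg_le i
    · exact hX.history_le i
  obtain ⟨b, hb⟩ := hA.step_bounded
  have hb' : ∀ i k, ∀ᵐ ω ∂P, |X.step i k ω| ≤ b := fun i k => by
    filter_upwards [hb i k] with ω h
    rw [abs_of_nonneg h.1]; exact h.2
  refine ⟨hX.stepAlg_le i, hX.combAlg_le i, hX.history_le i, fun l k => ?_, fun k => ?_, ?_, ?_,
    hA.leftStochastic i, hA.comb_mean i, fun l k l' k' => ?_, ⟨|b|, abs_nonneg b, ?_⟩, hA.step_mean i,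
    fun k l => ?_⟩
  · exact Measurable.of_comap_le ((le_iSup (fun k => MeasurableSpace.comap
      (fun ω => X.comb i ω l k) inferInstance) k).trans (le_iSup (fun l => ⨆ k,
        MeasurableSpace.comap (fun ω => X.comb i ω l k) inferInstance) l))
  · exact Measurable.of_comap_le
      (le_iSup (fun k => MeasurableSpace.comap (X.step i k) inferInstance) k)
  -- Mutual independence makes the combination coefficients independent of step-sizes and history
  -- jointly; pairwise independence would not suffice.
  · have h := indep_iSup_of_disjoint hle (hA.indep i) (S := {1}) (T := {0, 2})
      (by rw [Set.disjoint_singleton_left]; simp)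
    rw [iSup_singleton, iSup_pair] at h
    exact h
  · exact (hA.indep i).indep (i := 0) (j := 2) (by decide)
  · rw [integral_mul_of_cov (hX.measurable_comb i l k) (hX.measurable_comb i l' k')
      (hA.abs_comb_le i l k) (hA.abs_comb_le i l' k') (hA.comb_mean i l k) (hA.comb_mean i l' k')
      (hA.comb_cov i (l, l') (k, k'))]
    exact add_comm _ _
  · filter_upwards [ae_all_iff.2 fun k => hb i k] with ω h k
    exact ⟨(h k).1, (h k).2.trans (le_abs_self b)⟩
  · exact integral_mul_of_cov (hX.measurable_step i k) (hX.measurable_step i l) (hb' i k) (hb' i l)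
      (hA.step_mean i k) (hA.step_mean i l) (hA.step_cov i k l)

/-- Each property holds for the random matrix and survives expectation. For `psd`, the form of `Q *ᵥ
G` at `t` is the expected form of `G` at the vector with entries `∑ k, A k p * t k`. -/
theorem IsAsyncModel.combMoments (hX : X.IsATCDiffusion)
    (hA : X.IsAsyncModel P Abar CA mbar cmu) : CombMoments Abar (Abar ⊗ₖ Abar + CA) := by
  have O := hA.oneStep hX 0
  generalize Abar ⊗ₖ Abar + CA = Q at O
  have i1 : ∀ l k, HasInt P (fun ω => X.comb 0 ω l k) (Abar l k) := fun l k =>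
    ⟨integrable_of_abs_le (hX.measurable_comb 0 l k) (hA.abs_comb_le 0 l k), O.mean_comb l k⟩
  have i2 : ∀ l k l' k', HasInt P (fun ω => X.comb 0 ω l k * X.comb 0 ω l' k')
      (Q (l, l') (k, k')) := by
    intro l k l' k'
    refine ⟨integrable_of_abs_le (B := 1) ((hX.measurable_comb 0 l k).mul
      (hX.measurable_comb 0 l' k')) ?_, O.mean_comb_mul l k l' k'⟩
    filter_upwards [hA.abs_comb_le 0 l k, hA.abs_comb_le 0 l' k'] with ω h1 h2
    rw [abs_mul]
    exact mul_le_one₀ h1 (abs_nonneg _) h2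
  refine ⟨fun k => ?_, fun l' k k' => ?_, fun l k k' => ?_, fun G hG t => ?_⟩
  · rw [← (HasInt.sum fun l => i1 l k).2]
    rw [integral_congr_ae (g := fun _ => (1 : ℝ))]
    · simp
    · filter_upwards [hA.leftStochastic 0] with ω h
      exact h.sum k
  · rw [← (HasInt.sum fun l => i2 l k l' k').2, ← (i1 l' k').2]
    refine integral_congr_ae ?_
    filter_upwards [hA.leftStochastic 0] with ω h
    change ∑ l, X.comb 0 ω l k * X.comb 0 ω l' k' = X.comb 0 ω l' k'
    rw [← Finset.sum_mul, h.sum k, one_mul]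
  · rw [← (HasInt.sum fun l' => i2 l k l' k').2, ← (i1 l k).2]
    refine integral_congr_ae ?_
    filter_upwards [hA.leftStochastic 0] with ω h
    change ∑ l', X.comb 0 ω l k * X.comb 0 ω l' k' = X.comb 0 ω l k
    rw [← Finset.mul_sum, h.sum k', mul_one]
  · have h := HasInt.sum fun k => HasInt.sum fun l => HasInt.sum fun q : Fin N × Fin N =>
      (i2 k q.1 l q.2).const_mul (G q * (t k * t l))
    have e : ∑ k, ∑ l, (Q *ᵥ G) (k, l) * (t k * t l)
        = ∑ k, ∑ l, ∑ q : Fin N × Fin N, G q * (t k * t l) * Q (k, l) (q.1, q.2) := by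
      refine Finset.sum_congr rfl fun k _ => Finset.sum_congr rfl fun l _ => ?_
      rw [Matrix.mulVec, dotProduct, Finset.sum_mul]
      exact Finset.sum_congr rfl fun q _ => by ring
    rw [e, ← h.2]
    refine integral_nonneg fun ω => ?_
    refine (hG fun p => ∑ k, X.comb 0 ω k p * t k).trans (le_of_eq ?_)
    have e2 : ∀ q : Fin N × Fin N, G q * ((∑ k, X.comb 0 ω k q.1 * t k)
        * ∑ k, X.comb 0 ω k q.2 * t k) = ∑ k, ∑ l, G q * (t k * t l) *
          (X.comb 0 ω k q.1 * X.comb 0 ω l q.2) := by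
      intro q
      rw [Finset.sum_mul_sum, Finset.mul_sum]
      refine Finset.sum_congr rfl fun k _ => ?_
      rw [Finset.mul_sum]
      exact Finset.sum_congr rfl fun l _ => by ring
    have e3 : ∑ k, ∑ l, G (k, l) * ((∑ j, X.comb 0 ω j k * t j) * ∑ j, X.comb 0 ω j l * t j)
        = ∑ q : Fin N × Fin N, G q * ((∑ k, X.comb 0 ω k q.1 * t k)
        * ∑ k, X.comb 0 ω k q.2 * t k) := by rw [Fintype.sum_prod_type]
    refine e3.trans ?_
    simp only [e2]
    rw [Finset.sum_comm]
    exact Finset.sum_congr rfl fun k _ => Finset.sum_comm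

theorem IsAsyncModel.cmu_nonneg (hA : X.IsAsyncModel P Abar CA mbar cmu) (k : Fin N) :
    0 ≤ cmu k k := by
  rw [← hA.step_cov 0 k k]
  exact integral_nonneg fun ω => mul_self_nonneg _

theorem IsAsyncModel.add_le_muMax (k : Fin N) : mbar k + cmu k k / mbar k ≤ muMax mbar cmu :=
  le_ciSup (f := fun k => mbar k + cmu k k / mbar k) (Set.finite_range _).bddAbove k

theorem IsAsyncModel.mbar_le_muMax (hA : X.IsAsyncModel P Abar CA mbar cmu) (k : Fin N) :
    mbar k ≤ muMax mbar cmu := by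
  have h := add_le_muMax (mbar := mbar) (cmu := cmu) k
  have := div_nonneg (hA.cmu_nonneg k) (hA.mbar_pos k).le
  linarith

/-- This motivates `muMax`: the second moment of a step-size equals `mbar k` times its term in the
maximum, so it keeps a factor `mbar k`. -/
theorem IsAsyncModel.step_sq_le (hA : X.IsAsyncModel P Abar CA mbar cmu) (k : Fin N) :
    cmu k k + mbar k * mbar k ≤ mbar k * muMax mbar cmu := by
  have h := mul_le_mul_of_nonneg_left (add_le_muMax (mbar := mbar) (cmu := cmu) k)
    (hA.mbar_pos k).le
  have := hA.mbar_pos k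
  rw [mul_add, mul_div_cancel₀ _ this.ne'] at h
  linarith

end Network

end NetworkModel

/-! ### The network satisfies the abstract recursion -/

section NetworkProcess

variable {N M : ℕ} {Ω : Type*} {mΩ : MeasurableSpace Ω} {P : Measure Ω} [IsProbabilityMeasure P]

theorem integrable_norm_pow_four_pi {y : Ω → Fin N → Vec M}
    (h : ∀ k, MemLp (fun ω => y ω k) 4 P) : Integrable (fun ω => ‖y ω‖ ^ 4) P :=
  (MemLp.of_eval h).integrable_norm_pow (p := 4) (by norm_num)

namespace Network

/-- The error vectors of all agents. -/
noncomputable def errVec (X : Network N M Ω) (wo : Vec M) (i : ℕ) (ω : Ω) : Fin N → Vec M :=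
  fun k => X.err wo i k ω

/-- The gradient noises of all agents, at their iterates. -/
noncomputable def noiseVec (X : Network N M Ω) (J : Fin N → Vec M → ℝ) (i : ℕ) (ω : Ω) : Fin N → Vec M :=
  fun k => X.noise J i k (X.w i k ω) ω

variable {X : Network N M Ω} {J : Fin N → Vec M → ℝ} {wo : Vec M}
  {Abar : Matrix (Fin N) (Fin N) ℝ} {CA : Matrix (Fin N × Fin N) (Fin N × Fin N) ℝ}
  {mbar : Fin N → ℝ} {cmu : Fin N → Fin N → ℝ} {β2 σ2 β4 σ4 τ : Fin N → ℝ} {c r κ : ℝ}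
  {Rs : Fin N → Matrix (Fin M) (Fin M) ℝ} {H : Fin N → Vec M →L[ℝ] Vec M} {ν δ e : ℝ}

theorem measurable_errVec (X : Network N M Ω) (wo : Vec M) (i : ℕ) :
    Measurable[X.past i] (X.errVec wo i) := by
  let _ := X.past i
  refine measurable_pi_lambda _ fun k => ?_
  have h1 : Measurable fun v : Vec M => wo - v := by fun_prop
  exact h1.comp (X.measurable_past i k)

theorem measurable_noiseVec (X : Network N M Ω) (hJ : ∀ k, Continuous (gradient (J k))) (i : ℕ) :
    Measurable[X.history i] (X.noiseVec J i) := by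
  let _ := X.history i
  refine measurable_pi_lambda _ fun k => ?_
  have h1 : Measurable[X.history i] fun ω => gradient (J k) (X.w i k ω) :=
    (hJ k).measurable.comp ((X.measurable_past i k).mono (le_sup_left.trans le_sup_left) le_rfl)
  exact (X.measurable_history i k).sub h1

theorem memLp_w (hX : X.IsATCDiffusion) (hA : X.IsAsyncModel P Abar CA mbar cmu)
    (hg : CostBounds (fun l x => gradient (J l) (wo - x)) H ν δ e)
    (hJ : ∀ k, Continuous (gradient (J k)))
    (h4 : X.FourthMomentConditions P J wo β4 σ4 c mbar cmu) (i : ℕ) :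
    ∀ k, MemLp (X.w i k) 4 P := by
  induction i with
  | zero => exact h4.init
  | succ i ih =>
    intro k
    obtain ⟨b, hb⟩ := hA.step_bounded
    have e : X.w (i + 1) k = fun ω => ∑ l, X.comb i ω l k •
        (X.w i l ω - X.step i l ω • X.gradHat i l (X.w i l ω) ω) :=
      funext fun ω => hX.recursion i k ω
    rw [e]
    refine memLp_finsetSum _ fun l _ => ?_
    have g1 : MemLp (fun ω => gradient (J l) (X.w i l ω)) 4 P := by
      refine MemLp.of_le_mul (c := δ) ((memLp_const wo).sub (ih l))
        ((hJ l).measurable.comp (hX.measurable_w i l)).aestronglyMeasurable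
        (Eventually.of_forall fun ω => ?_)
      have h1 := hg.lipschitz l (wo - X.w i l ω) 0
      rw [hg.zero, sub_sub_cancel, sub_zero, sub_zero] at h1
      exact h1
    have g2 : MemLp (fun ω => X.gradHat i l (X.w i l ω) ω) 4 P := by
      refine (g1.add (h4.memLp i l)).congr_norm
        (hX.measurable_gradHat_w i l).aestronglyMeasurable (Eventually.of_forall fun ω => ?_)
      simp [noise]
    have g3 : MemLp (fun ω => X.step i l ω • X.gradHat i l (X.w i l ω) ω) 4 P := by
      refine MemLp.of_le_mul (c := b) g2
        ((hX.measurable_step i l).smul (hX.measurable_gradHat_w i l)).aestronglyMeasurable ?_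
      filter_upwards [hb i l] with ω h
      rw [norm_smul, Real.norm_of_nonneg h.1]
      exact mul_le_mul_of_nonneg_right h.2 (norm_nonneg _)
    have g4 := (ih l).sub g3
    refine g4.mono ((hX.measurable_comb i l k).smul ((hX.measurable_w i l).sub
      ((hX.measurable_step i l).smul (hX.measurable_gradHat_w i l)))).aestronglyMeasurable ?_
    filter_upwards [hA.abs_comb_le i l k] with ω h
    rw [norm_smul, Real.norm_eq_abs]
    exact mul_le_of_le_one_left (norm_nonneg _) h

theorem memLp_err (hX : X.IsATCDiffusion) (hA : X.IsAsyncModel P Abar CA mbar cmu)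
    (hg : CostBounds (fun l x => gradient (J l) (wo - x)) H ν δ e)
    (hJ : ∀ k, Continuous (gradient (J k)))
    (h4 : X.FourthMomentConditions P J wo β4 σ4 c mbar cmu) (i : ℕ) (k : Fin N) :
    MemLp (X.err wo i k) 4 P :=
  (memLp_const wo).sub (memLp_w hX hA hg hJ h4 i k)

/-- The abstract estimates use one set of noise constants for all agents, and these must be
nonnegative, hence the sums of absolute values. -/
theorem diffusionProcess (hX : X.IsATCDiffusion) (hA : X.IsAsyncModel P Abar CA mbar cmu)
    (hg : CostBounds (fun l x => gradient (J l) (wo - x)) H ν δ e) (hN : 0 < N)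
    (hJ : ∀ k, Continuous (gradient (J k))) (hns : X.NoiseConditions P J wo β2 σ2 Rs)
    (h4 : X.FourthMomentConditions P J wo β4 σ4 c mbar cmu) :
    DiffusionProcess P (fun l x => gradient (J l) (wo - x)) Abar (Abar ⊗ₖ Abar + CA) mbar
      (fun k l => cmu k l + mbar k * mbar l) (muMax mbar cmu) (∑ k, |β4 k|) (∑ k, |σ4 k|) |c|
      X.past X.comb (fun i ω k => X.step i k ω) (X.errVec wo) (X.noiseVec J) where
  oneStep i := ⟨X.stepAlg i, X.combAlg i, X.history i, le_sup_left.trans le_sup_left,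
    X.measurable_noiseVec hJ i, hA.oneStep hX i⟩
  measurable_state i := X.measurable_errVec wo i
  recursion i := by
    filter_upwards [hA.leftStochastic i] with ω h
    funext k
    simp only [errVec, noiseVec, combine, err, noise, scale, Pi.add_apply]
    rw [hX.recursion]
    -- As the columns of the combination matrix sum to one, `wo` can be distributed over the
    -- neighbours. The minus sign of the gradient step becomes a plus in the error variable.
    have e1 : wo = ∑ l, X.comb i ω l k • wo := by rw [← Finset.sum_smul, h.sum k, one_smul]
    conv_lhs => rw [e1]
    rw [← Finset.sum_sub_distrib]
    refine Finset.sum_congr rfl fun l _ => ?_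
    rw [← smul_sub, sub_sub_cancel, add_sub_cancel]
    congr 1
    abel
  init := integrable_norm_pow_four_pi fun k => memLp_err hX hA hg hJ h4 0 k
  noise_integrable i := integrable_norm_pow_four_pi fun k => h4.memLp i k
  unbiased i l a f hf hfs := by
    have hs : Integrable (fun ω => X.noise J i l (X.w i l ω) ω) P :=
      (hns.memLp i l).integrable one_le_two
    have hsa : Integrable (fun ω => X.noiseVec J i ω l a) P :=
      (EuclideanSpace.proj (𝕜 := ℝ) a).integrable_comp hs
    have h1 := ContinuousLinearMap.comp_condExp_comm (m := X.past i) hs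
      (EuclideanSpace.proj (𝕜 := ℝ) a)
    have h2 := condExp_mul_of_stronglyMeasurable_left hf.stronglyMeasurable hfs hsa
    rw [← integral_condExp (hX.past_le i)]
    rw [integral_congr_ae (g := fun _ => (0 : ℝ))]
    · simp
    · filter_upwards [h1, h2, hns.unbiased i l] with ω h1 h2 h3
      refine h2.trans ?_
      have h4 : (P[fun ω => X.noiseVec J i ω l a | X.past i]) ω = 0 := by
        refine h1.symm.trans ?_
        rw [Function.comp_apply, h3]
        simp
      rw [Pi.mul_apply, h4, mul_zero]
  uncorrelated i k l hkl a b := by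
    rw [← integral_condExp (hX.past_le i)]
    refine Eq.trans (integral_congr_ae (hns.uncorrelated i k l hkl a b)) ?_
    simp
  noise_fourth i l := by
    have e1 : ∫ ω, ‖X.noiseVec J i ω l‖ ^ 4 ∂P = ∫ ω, ‖X.noise J i l (X.w i l ω) ω‖ ^ 4 ∂P := rfl
    have hx := (memLp_err hX hA hg hJ h4 i l).integrable_norm_pow (p := 4) (by norm_num)
    rw [e1, ← integral_condExp (hX.past_le i)]
    have h1 := HasInt.of_integrable (integrable_condExp (μ := P) (m := X.past i)
      (f := fun ω => ‖X.noise J i l (X.w i l ω) ω‖ ^ 4))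
    have h2 := ((HasInt.of_integrable hx).const_mul (∑ k, |β4 k|)).add
      (HasInt.of_integrable (integrable_const (∑ k, |σ4 k|) (μ := P)))
    refine (h1.mono_ae h2 ?_).trans (le_of_eq ?_)
    · filter_upwards [h4.noise_bound i l] with ω h
      refine h.trans (add_le_add (mul_le_mul_of_nonneg_right ?_ (by positivity)) ?_)
      · exact (le_abs_self _).trans (Finset.single_le_sum (f := fun k => |β4 k|)
          (fun _ _ => abs_nonneg _) (Finset.mem_univ l))
      · exact (le_abs_self _).trans (Finset.single_le_sum (f := fun k => |σ4 k|)
          (fun _ _ => abs_nonneg _) (Finset.mem_univ l))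
    · simp only [integral_const, probReal_univ, one_smul]
      rfl
  m_pos := (hA.mbar_pos ⟨0, hN⟩).trans_le (hA.mbar_le_muMax _)
  mbar_pos := hA.mbar_pos
  mbar_le := hA.mbar_le_muMax
  step_sq := hA.step_sq_le
  step_fourth i k := by
    refine (h4.step_bound i k).trans ?_
    have := (hA.mbar_pos k).le
    gcongr
    exact le_abs_self c

/-- Applies the truncation argument to each agent and pair of coordinates, with `D i` the
conditional covariance at the iterates and `c i` the one at `wo`. -/
theorem exists_noise_covariance_bound (β2 σ2 τ : Fin N → ℝ) (hr : 0 < r)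
    (hκ : κ ∈ Set.Icc (1 : ℝ) 2) {K₄ : ℝ} (hK₄ : 0 ≤ K₄) : ∃ K μ₁ : ℝ, 0 ≤ K ∧ 0 < μ₁ ∧
    ∀ {Ω : Type*} {mΩ : MeasurableSpace Ω} {P : Measure Ω} [IsProbabilityMeasure P]
      {X : Network N M Ω} {J : Fin N → Vec M → ℝ} {wo : Vec M}
      {Rs : Fin N → Matrix (Fin M) (Fin M) ℝ} {m : ℝ}, X.IsATCDiffusion →
      X.NoiseConditions P J wo β2 σ2 Rs → X.NoiseSmoothness P J wo r κ τ →
      0 < m → m < μ₁ → (∀ i, Integrable (fun ω => ‖X.errVec wo i ω‖ ^ 4) P) →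
      (∀ᶠ i in atTop, ∫ ω, ‖X.errVec wo i ω‖ ^ 4 ∂P ≤ K₄ * m ^ 2) →
      (∀ l a b, |Rs l a b| ≤ K) ∧ ∀ᶠ i in atTop, ∀ l a b,
        |∫ ω, X.noiseVec J i ω l a * X.noiseVec J i ω l b ∂P - Rs l a b| ≤ K * √m := by
  obtain ⟨C, hC⟩ : ∃ C : Fin N → ℝ, C = fun l =>
    2 * (|β2 l| * r ^ 2 + |σ2 l| + |τ l| * (r + r ^ 2) + 1) := ⟨_, rfl⟩
  obtain ⟨D, hD⟩ : ∃ D : Fin N → ℝ, D = fun l => 1 + 2 * |τ l| * (1 + K₄) + (|β2 l| / r ^ 2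
      + (|σ2 l| + C l) / r ^ 4) * K₄ := ⟨_, rfl⟩
  have hC0 : ∀ l, 0 ≤ C l := fun l => by rw [hC]; positivity
  have hD0 : ∀ l, 0 ≤ D l := fun l => by have := hC0 l; rw [hD]; positivity
  refine ⟨∑ l, (C l + D l), min 1 (r ^ 4 / (2 * (K₄ + 1))),
    Finset.sum_nonneg fun l _ => add_nonneg (hC0 l) (hD0 l), by positivity, ?_⟩
  intro Ω mΩ P _ X J wo Rs m hX hns hsm hm hm1 hx4 h4
  have hm' : m ≤ 1 := hm1.le.trans (min_le_left _ _)
  have hmr : K₄ * m ^ 2 ≤ r ^ 4 / 2 := by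
    have h1 : m ≤ r ^ 4 / (2 * (K₄ + 1)) := hm1.le.trans (min_le_right _ _)
    rw [le_div_iff₀ (by positivity)] at h1
    have h2 : m ^ 2 ≤ m := by
      rw [sq]; exact mul_le_of_le_one_right hm.le hm'
    have h3 := mul_le_mul_of_nonneg_left h2 hK₄
    linarith
  have key : ∀ l a b, |Rs l a b| ≤ C l ∧ ∀ᶠ i in atTop,
      |∫ ω, X.noiseVec J i ω l a * X.noiseVec J i ω l b ∂P - Rs l a b| ≤ D l * √m := by
    intro l a b
    have hle : ∀ i ω, ‖X.err wo i l ω‖ ≤ ‖X.errVec wo i ω‖ := fun i ω =>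
      norm_le_pi_norm (X.errVec wo i ω) l
    have herrF : ∀ i, Measurable[X.past i] (X.err wo i l) := fun i =>
      (measurable_pi_apply l).comp (X.measurable_errVec wo i)
    have herr : ∀ i, Measurable (X.err wo i l) := fun i => (herrF i).mono (hX.past_le i) le_rfl
    have hl4 : ∀ i, Integrable (fun ω => ‖X.err wo i l ω‖ ^ 4) P := fun i =>
      (hx4 i).mono' ((herr i).norm.pow_const 4).aestronglyMeasurable
        (Eventually.of_forall fun ω => by
          rw [Real.norm_of_nonneg (by positivity)]
          exact pow_le_pow_left₀ (norm_nonneg _) (hle i ω) 4)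
    have main := eventually_abs_integral_sub_le (P := P) (x := fun i ω => ‖X.err wo i l ω‖)
      (D := fun i => P[fun ω => X.noiseVec J i ω l a * X.noiseVec J i ω l b | X.past i])
      (c := fun i => X.condCov P J i l (fun _ => wo) a b) (R := Rs l a b)
      (β := |β2 l|) (σ := |σ2 l|) (τ := |τ l|) (r := r) (m := m) (K₄ := K₄)
      (fun i => (herr i).norm) (fun i ω => norm_nonneg _) hl4 (fun i => integrable_condExp)
      (fun i => (stronglyMeasurable_condExp.mono (hX.past_le i)).measurable)
      (abs_nonneg _) (abs_nonneg _) (abs_nonneg _) hr hK₄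
      (fun i => abs_condExp_coord_mul_le (hns.memLp i l) (by
        filter_upwards [hns.variance i l] with ω h
        refine h.trans (add_le_add (mul_le_mul_of_nonneg_right (le_abs_self _) (by positivity))
          (le_abs_self _))) a b)
      (fun i => ?_) (hns.limit_cov l a b) hm hm' hmr ?_
    · refine ⟨by rw [hC]; exact main.1, ?_⟩
      filter_upwards [main.2] with i h
      rw [integral_condExp (hX.past_le i)] at h
      rw [hD, hC]
      exact h
    · obtain ⟨E, hE⟩ : ∃ E, E = {ω | ‖X.err wo i l ω‖ ≤ r} := ⟨_, rfl⟩
      have hEm : MeasurableSet[X.past i] E := by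
        rw [hE]
        have h1 : Measurable[X.past i] fun ω => ‖X.err wo i l ω‖ :=
          measurable_norm.comp (herrF i)
        exact h1 measurableSet_Iic
      classical
      -- Smoothness is assumed only for perturbations bounded by `r`, so the true one is cut to zero
      -- off `E`. As `E` belongs to the past, the conditional expectations with the cut and the true
      -- perturbation agree on it.
      obtain ⟨d, hd⟩ : ∃ d, d = fun ω => if ω ∈ E then -X.err wo i l ω else 0 := ⟨_, rfl⟩
      have hdm : Measurable[X.past i] d := by
        have h1 : Measurable[X.past i] fun ω => -X.err wo i l ω := measurable_neg.comp (herrF i)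
        rw [hd]
        exact Measurable.ite hEm h1 measurable_const
      have hdE : ∀ ω ∈ E, d ω = -X.err wo i l ω := fun ω h => by rw [hd]; simp [h]
      have hdr : ∀ ω, ‖d ω‖ ≤ r := by
        intro ω
        by_cases h : ω ∈ E
        · rw [hdE ω h, norm_neg]
          rw [hE] at h; exact h
        · rw [hd]; simp [h, hr.le]
      obtain ⟨h1, h2⟩ := hsm i l d hdm hdr
      have h3 := condExp_eq_of_eqOn (𝓕 := X.past i)
        (integrable_coord_mul (hns.memLp i l) (hns.memLp i l) a b)
        (integrable_coord_mul h1 h1 a b) hEm (fun ω h => by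
          have : wo + d ω = X.w i l ω := by rw [hdE ω h, err]; abel
          rw [this])
      filter_upwards [h2 a b, h3] with ω h2 h3 hω
      have hωE : ω ∈ E := by rw [hE]; exact hω
      rw [condCov, ← h3 hωE, hdE ω hωE, norm_neg] at h2
      refine h2.trans ?_
      have h5 := rpow_le_add_sq (norm_nonneg (X.err wo i l ω)) hκ
      calc _ ≤ |τ l| * ‖X.err wo i l ω‖ ^ κ :=
            mul_le_mul_of_nonneg_right (le_abs_self _) (by positivity)
        _ ≤ _ := mul_le_mul_of_nonneg_left h5 (abs_nonneg _)
    · filter_upwards [h4] with i h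
      refine le_trans (integral_mono (hl4 i) (hx4 i) fun ω => ?_) h
      exact pow_le_pow_left₀ (norm_nonneg _) (hle i ω) 4
  have hsum : ∀ l, C l + D l ≤ ∑ l, (C l + D l) := fun l =>
    Finset.single_le_sum (f := fun l => C l + D l) (fun l _ => add_nonneg (hC0 l) (hD0 l))
      (Finset.mem_univ l)
  constructor
  · intro l a b
    linarith [(key l a b).1, hsum l, hD0 l]
  · filter_upwards [eventually_all.2 fun l => eventually_all.2 fun a => eventually_all.2 fun b =>
      (key l a b).2] with i h l a b
    exact (h l a b).trans
      (mul_le_mul_of_nonneg_right (by linarith [hsum l, hC0 l]) (Real.sqrt_nonneg _))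

/-- The columns of the transition matrix are the images of unit vectors under one long-term step.
Evaluating the second-moment identity at basis tensors gives the entries of `F`, with no dependence
on time. -/
theorem msTransition_eq (hX : X.IsATCDiffusion) (hA : X.IsAsyncModel P Abar CA mbar cmu)
    (H : Fin N → Vec M →L[ℝ] Vec M) (i : ℕ) :
    X.msTransition P (fun l => opMatrix (H l)) i
      = momentMatrix (Abar ⊗ₖ Abar + CA) mbar (fun k l => cmu k l + mbar k * mbar l) H := by
  have entry : ∀ ω (p q : Fin N × Fin M), X.transition (fun l => opMatrix (H l)) i ω p q
      = longTerm H (X.comb i ω) (fun k => X.step i k ω) (unitVec q) p.1 p.2 := by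
    intro ω p q
    have h1 : ∀ l, (unitVec q : Fin N → Vec M) l p.2 = if (l, p.2) = q then 1 else 0 :=
      fun l => unitVec_apply q (l, p.2)
    have h2 : ∀ l, H l ((unitVec q : Fin N → Vec M) l) p.2
        = if l = q.1 then opMatrix (H l) p.2 q.2 else 0 := by
      intro l
      unfold unitVec
      by_cases h : l = q.1
      · rw [h, Pi.single_eq_same, if_pos rfl]; rfl
      · rw [Pi.single_eq_of_ne h, if_neg h, map_zero]; rfl
    have h3 : longTerm H (X.comb i ω) (fun k => X.step i k ω) (unitVec q) p.1 p.2
        = ∑ l, X.comb i ω l p.1 * ((unitVec q : Fin N → Vec M) l p.2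
          - X.step i l ω * H l ((unitVec q : Fin N → Vec M) l) p.2) := by
      simp [longTerm, combine, scale, Finset.sum_apply, sub_eq_add_neg, mul_add]
    rw [h3, transition, Matrix.mul_apply, Fintype.sum_prod_type]
    refine Finset.sum_congr rfl fun l _ => ?_
    rw [Finset.sum_eq_single p.2]
    · rw [h1, h2]
      simp only [Matrix.transpose_apply, Matrix.sub_apply, Matrix.of_apply, Matrix.one_apply]
      change X.comb i ω l p.1 * (1 : Matrix (Fin M) (Fin M) ℝ) p.2 p.2 * _ = _
      rw [Matrix.one_apply_eq, mul_one]
      congr 2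
      rw [mul_ite, mul_zero]
    · intro b _ hb
      change X.comb i ω l p.1 * (1 : Matrix (Fin M) (Fin M) ℝ) b p.2 * _ = _
      rw [Matrix.one_apply_ne hb, mul_zero, zero_mul]
    · simp
  ext p q
  have O := hA.oneStep hX i
  have h := (O.integral_tens_longTerm H (unitVec q.1) (unitVec q.2) p).2
  rw [tens_unitVec, Matrix.mulVec_single_one] at h
  refine Eq.trans ?_ h
  refine integral_congr_ae (Eventually.of_forall fun ω => ?_)
  exact congrArg₂ (· * ·) (entry ω p.1 q.1) (entry ω p.2 q.2)

end Network

end NetworkProcess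

theorem abs_limsup_sub_le {f : ℕ → ℝ} {L B : ℝ} (h : ∀ᶠ i in atTop, |f i - L| ≤ B) :
    |limsup f atTop - L| ≤ B := by
  have h1 : ∀ᶠ i in atTop, f i ≤ L + B := h.mono fun i hi => by linarith [(abs_le.1 hi).2]
  have h2 : ∀ᶠ i in atTop, L - B ≤ f i := h.mono fun i hi => by linarith [(abs_le.1 hi).1]
  have b1 : IsBoundedUnder (· ≤ ·) atTop f := ⟨_, h1⟩
  have b2 : IsBoundedUnder (· ≥ ·) atTop f := ⟨_, h2⟩
  have u1 : limsup f atTop ≤ L + B := limsup_le_of_le b2.isCoboundedUnder_le h1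
  have u2 : L - B ≤ limsup f atTop := le_limsup_of_frequently_le h2.frequently b1
  rw [abs_le]
  constructor <;> linarith

end AsyncDiffusion

/-! ### The theorem on mean-square performance and convergence rate -/

theorem lemma5 {N M : ℕ} (hN : 0 < N) (hM : 0 < M)
    (J : Fin N → AsyncDiffusion.Vec M → ℝ) (wo : AsyncDiffusion.Vec M)
    (hJ : AsyncDiffusion.CostConditions J wo)
    (Abar : Matrix (Fin N) (Fin N) ℝ) (CA : Matrix (Fin N × Fin N) (Fin N × Fin N) ℝ)
    (hprim : (Abar ⊗ₖ Abar + CA).IsPrimitive)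
    (pbar : Fin N → ℝ) (hpbar : AsyncDiffusion.IsPerronVector Abar pbar)
    (pc : Fin N × Fin N → ℝ) (hpc : AsyncDiffusion.IsPerronVector (Abar ⊗ₖ Abar + CA) pc)
    (r κ : ℝ) (hr : 0 < r) (hκ : κ ∈ Set.Icc (1 : ℝ) 2)
    (τd τs β2 σ2 β4 σ4 : Fin N → ℝ) (c : ℝ)
    (hHess : AsyncDiffusion.HessianSmoothness J wo r τd) :
    ∃ K μo : ℝ, 0 < μo ∧
      ∀ (Ω : Type*) [MeasurableSpace Ω] (P : Measure Ω) [IsProbabilityMeasure P]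
        (X : AsyncDiffusion.Network N M Ω)
        (mbar : Fin N → ℝ) (cmu : Fin N → Fin N → ℝ) (Rs : Fin N → Matrix (Fin M) (Fin M) ℝ),
        X.IsATCDiffusion →
        X.IsAsyncModel P Abar CA mbar cmu →
        X.NoiseConditions P J wo β2 σ2 Rs →
        X.NoiseSmoothness P J wo r κ τs →
        X.FourthMomentConditions P J wo β4 σ4 c mbar cmu →
        AsyncDiffusion.Network.muMax mbar cmu < μo →
        -- the mean-square errors are finite
        (∀ i k, MemLp (X.err wo i k) 2 P) ∧
        -- MSD of every agent and of the network
        (∀ k, ∀ᶠ i in atTop,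
          |X.mse P wo k i
            - AsyncDiffusion.msdExpr mbar cmu pbar pc
                (fun l => AsyncDiffusion.hessMatrix (J l) wo) Rs|
            ≤ K * AsyncDiffusion.Network.muMax mbar cmu ^ (3 / 2 : ℝ)) ∧
        (∀ k, |X.msd P wo k
            - AsyncDiffusion.msdExpr mbar cmu pbar pc
                (fun l => AsyncDiffusion.hessMatrix (J l) wo) Rs|
            ≤ K * AsyncDiffusion.Network.muMax mbar cmu ^ (3 / 2 : ℝ)) ∧
        |X.msdAv P wo
            - AsyncDiffusion.msdExpr mbar cmu pbar pc
                (fun l => AsyncDiffusion.hessMatrix (J l) wo) Rs|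
            ≤ K * AsyncDiffusion.Network.muMax mbar cmu ^ (3 / 2 : ℝ) ∧
        (∀ k, |X.msd P wo k - X.msdAv P wo|
            ≤ K * AsyncDiffusion.Network.muMax mbar cmu ^ (3 / 2 : ℝ)) ∧
        -- convergence rate
        ∃ α : ℝ,
          AsyncDiffusion.HasConvergenceRate X P wo
            (fun l => AsyncDiffusion.hessMatrix (J l) wo)
            (AsyncDiffusion.msdExpr mbar cmu pbar pc
              (fun l => AsyncDiffusion.hessMatrix (J l) wo) Rs)
            (AsyncDiffusion.Network.muMax mbar cmu) K α ∧
          |α - (1 - 2 * AsyncDiffusion.lambdaMin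
              (AsyncDiffusion.meanHessian mbar pbar
                (fun l => AsyncDiffusion.hessMatrix (J l) wo)))|
            ≤ K * AsyncDiffusion.Network.muMax mbar cmu ^ (1 + 1 / (N : ℝ) ^ 2) := by
  have hNe : Nonempty (Fin N) := ⟨⟨0, hN⟩⟩
  obtain ⟨ν, δ, e, hg⟩ := AsyncDiffusion.exists_costBounds hN hJ hr hHess
  have hJc : ∀ k, Continuous (gradient (J k)) := fun k => (hJ.twiceDiff k).2.continuous
  -- The constants must be fixed before any network is given, but these moment properties follow
  -- from the existence of one. If they fail, no network satisfies the model and the claim is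
  -- vacuous.
  by_cases hQ : AsyncDiffusion.CombMoments Abar (Abar ⊗ₖ Abar + CA)
  swap
  · exact ⟨0, 1, one_pos, fun Ω _ P _ X mbar cmu Rs hX hA _ _ _ _ =>
      absurd (hA.combMoments hX) hQ⟩
  obtain ⟨hsnd, hfst, hpos⟩ := hQ.perron_marginals hN hprim hpbar hpc
  obtain ⟨v, cv, hcv, hv⟩ := hQ.exists_lyapunov (M := M) hN hprim hpc
  have hL : AsyncDiffusion.IsLyapunov M (Abar ⊗ₖ Abar + CA) v cv :=
    ⟨hcv, fun x => (hv x).1, fun x => (hv x).2.1, fun x => (hv x).2.2⟩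
  have hp : AsyncDiffusion.ProbVec pbar := ⟨fun k => (hpos k).le, hpbar.2⟩
  obtain ⟨K₄, μ₁, hK₄, hμ₁, fourth⟩ := AsyncDiffusion.DiffusionProcess.exists_fourth_moment_bound hN
    hg hp hpos hpbar.1 hL (Finset.sum_nonneg fun k _ => abs_nonneg (β4 k))
    (Finset.sum_nonneg fun k _ => abs_nonneg (σ4 k)) (abs_nonneg c)
  obtain ⟨Kn, μ₂, hKn, hμ₂, cov⟩ :=
    AsyncDiffusion.Network.exists_noise_covariance_bound (M := M) β2 σ2 τs hr hκ hK₄.le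
  obtain ⟨k₀, hk₀⟩ := Finite.exists_min pbar
  obtain ⟨n, -, hn⟩ := hprim.exists_pos_pow
  obtain ⟨K, μ₃, hK, hμ₃, conv⟩ := AsyncDiffusion.exists_moment_convergence hN hM hg hp (hpos k₀) hk₀
    hpbar.1 hL hn hQ.colSum_pair hpc.1 hpc.2 hfst hsnd hKn hK₄.le (∑ k, |β4 k|) (∑ k, |σ4 k|) |c|
  -- `M` diagonal entries of the moment error plus the trace error of the steady state give `M + 1`;
  -- the factor `2` serves the comparison of an agent with the network average.
  refine ⟨2 * ((M + 1) * K), min (min 1 μ₁) (min μ₂ μ₃), by positivity, ?_⟩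
  intro Ω _ P _ X mbar cmu Rs hX hA hns hsm h4 hm
  have D := AsyncDiffusion.Network.diffusionProcess hX hA hg hN hJc hns h4
  have hF := AsyncDiffusion.Network.msTransition_eq hX hA (fun l => AsyncDiffusion.hess (J l) wo)
  have hm0 := D.m_pos
  have hlevel : AsyncDiffusion.msdExpr mbar cmu pbar pc
        (fun l => AsyncDiffusion.hessMatrix (J l) wo) Rs
      = 1 / 2 * ((AsyncDiffusion.meanHessian mbar pbar fun l =>
          AsyncDiffusion.opMatrix (AsyncDiffusion.hess (J l) wo))⁻¹ *
            ∑ l, ((cmu l l + mbar l * mbar l) * pc (l, l)) • Rs l).trace := by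
    have h1 : ∀ l, cmu l l + mbar l * mbar l = mbar l ^ 2 + cmu l l := fun l => by ring
    simp only [h1]
    rfl
  generalize AsyncDiffusion.msdExpr mbar cmu pbar pc
    (fun l => AsyncDiffusion.hessMatrix (J l) wo) Rs = L at hlevel ⊢
  generalize AsyncDiffusion.Network.muMax mbar cmu = m at D hm hm0 ⊢
  obtain ⟨⟨hm1, hmμ₁⟩, hmμ₂, hmμ₃⟩ : (m < 1 ∧ m < μ₁) ∧ m < μ₂ ∧ m < μ₃ := by
    simpa only [lt_min_iff] using hm
  obtain ⟨hx4, hev4⟩ := fourth D hmμ₁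
  obtain ⟨hRs, hcov⟩ := cov hX hns hsm hm0 hmμ₂ hx4 hev4
  obtain ⟨⟨z, hz1, hz2, hz3⟩, α, hα0, hα1, hα2, hα3⟩ := conv D hmμ₃ hx4 hev4 hRs hcov
  rw [← hlevel] at hz1
  have e3 : √m ^ 3 = m ^ (3 / 2 : ℝ) := by
    rw [Real.sqrt_eq_rpow, ← Real.rpow_natCast, ← Real.rpow_mul hm0.le]; norm_num
  have e5 : √m ^ 5 = m ^ (5 / 2 : ℝ) := by
    rw [Real.sqrt_eq_rpow, ← Real.rpow_natCast, ← Real.rpow_mul hm0.le]; norm_num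
  rw [e3] at hz1 hz3
  rw [e5] at hz2
  have hp3 : 0 ≤ m ^ (3 / 2 : ℝ) := by positivity
  have hp5 : 0 ≤ m ^ (5 / 2 : ℝ) := by positivity
  obtain ⟨B, hB⟩ : ∃ B, B = (M + 1) * K * m ^ (3 / 2 : ℝ) := ⟨_, rfl⟩
  have hB0 : 0 ≤ B := by rw [hB]; positivity
  have hB2 : 2 * ((M + 1) * K) * m ^ (3 / 2 : ℝ) = 2 * B := by rw [hB]; ring
  have hKK : K ≤ 2 * ((M + 1) * K) := by
    have : 0 ≤ (M : ℝ) * K := by positivity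
    linarith
  have hmem : ∀ i k, MemLp (X.err wo i k) 2 P := fun i k =>
    (AsyncDiffusion.Network.memLp_err hX hA hg hJc h4 i k).mono_exponent (by norm_num)
  have hmse : ∀ k, ∀ᶠ i in atTop, |X.mse P wo k i - L| ≤ B := by
    intro k
    filter_upwards [hz3] with i h
    have e1 : X.mse P wo k i = ∑ a, X.errMoment P wo i ((k, a), (k, a)) := by
      unfold AsyncDiffusion.Network.mse AsyncDiffusion.Network.errMoment
      rw [← integral_finsetSum _ fun a _ =>
        AsyncDiffusion.integrable_coord_mul (hmem i k) (hmem i k) a a]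
      refine integral_congr_ae (Eventually.of_forall fun ω => ?_)
      change ‖X.err wo i k ω‖ ^ 2 = _
      rw [EuclideanSpace.norm_sq_eq]
      exact Finset.sum_congr rfl fun a _ => by rw [Real.norm_eq_abs, sq_abs, sq]
    have e2 : X.mse P wo k i - L = ∑ a, (X.errMoment P wo i ((k, a), (k, a)) - z ((k, a), (k, a)))
        + (∑ a, z ((k, a), (k, a)) - L) := by
      rw [e1, Finset.sum_sub_distrib]; ring
    rw [e2]
    refine (abs_add_le _ _).trans ((add_le_add (Finset.abs_sum_le_sum_abs _ _) (hz1 k)).trans ?_)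
    have h2 : ∑ a, |X.errMoment P wo i ((k, a), (k, a)) - z ((k, a), (k, a))|
        ≤ ∑ _a : Fin M, K * m ^ (3 / 2 : ℝ) :=
      Finset.sum_le_sum fun a _ => h ((k, a), (k, a))
    rw [Finset.sum_const, Finset.card_univ, Fintype.card_fin, nsmul_eq_mul] at h2
    rw [hB]
    linarith
  have hmsd : ∀ k, |X.msd P wo k - L| ≤ B := fun k =>
    AsyncDiffusion.abs_limsup_sub_le (hmse k)
  have hav : |X.msdAv P wo - L| ≤ B := by
    have hN' : (0 : ℝ) < N := by exact_mod_cast hN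
    have e1 : X.msdAv P wo - L = 1 / (N : ℝ) * ∑ k, (X.msd P wo k - L) := by
      unfold AsyncDiffusion.Network.msdAv
      rw [Finset.sum_sub_distrib, Finset.sum_const, Finset.card_univ, Fintype.card_fin,
        nsmul_eq_mul, mul_sub, ← mul_assoc (1 / (N : ℝ)), one_div_mul_cancel hN'.ne', one_mul]
    rw [e1, abs_mul, abs_of_pos (by positivity), one_div, inv_mul_le_iff₀ hN']
    refine (Finset.abs_sum_le_sum_abs _ _).trans ((Finset.sum_le_sum fun k _ => hmsd k).trans ?_)
    simp
  rw [hB2]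
  refine ⟨hmem, fun k => ?_, fun k => (hmsd k).trans (by linarith), hav.trans (by linarith),
    fun k => ?_, α, ⟨_, z, hF, hα0, hα1, hα2, fun k => ?_, ?_⟩, ?_⟩
  · filter_upwards [hmse k] with i h
    linarith
  · have e1 : X.msd P wo k - X.msdAv P wo = (X.msd P wo k - L) - (X.msdAv P wo - L) := by ring
    rw [e1]
    refine (abs_sub _ _).trans ((add_le_add (hmsd k) hav).trans ?_)
    linarith
  · exact (hz1 k).trans (mul_le_mul_of_nonneg_right hKK hp3)
  · filter_upwards [hz2] with i h p
    exact (h p).trans (mul_le_mul_of_nonneg_right hKK hp5)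
  · refine hα3.trans ?_
    -- The spectral radius is known within `O(m²)`; as `m < 1` and the exponent is at most two, the
    -- stated bound is weaker.
    have h1 : m ^ 2 ≤ m ^ (1 + 1 / (N : ℝ) ^ 2) := by
      rw [← Real.rpow_two]
      refine Real.rpow_le_rpow_of_exponent_ge hm0 hm1.le ?_
      have h2 : (1 : ℝ) ≤ (N : ℝ) ^ 2 := one_le_pow₀ (by exact_mod_cast hN)
      have h3 : 1 / (N : ℝ) ^ 2 ≤ 1 := by
        rw [div_le_one (by positivity)]; exact h2
      linarith
    exact mul_le_mul hKK h1 (by positivity) (by positivity)
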